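/- Let $\mathbb K=\mathbb R$ or $\mathbb C$ and let $G$ be a Lie supergroup over $\mathbb K$ (a real Lie supergroup, respectively a cs Lie supergroup) with supergroup pair $(\mathfrak g,G_0)$: $G_0$ is a $\sigma$-compact real Lie group with Lie algebra $\mathfrak g_0$, $\mathfrak g=\mathfrak g_{\bar 0}\oplus\mathfrak g_{\bar 1}$ is a finite-dimensional Lie superalgebra over $\mathbb K$ with $\mathfrak g_{\bar 0}=\mathfrak g_0\otimes_{\mathbb R}\mathbb K$, and $G_0$ acts smoothly on $\mathfrak g$ by Lie superalgebra automorphisms $\mathrm{Ad}(g)$ which extend the adjoint action on $\mathfrak g_0$ and whose differential is the restriction of the bracket. The superfunctions on an open set $U\subseteq G_0$ are $\mathcal O_G(U)=\underline{\mathrm{Hom}}_{\mathfrak g_{\bar 0}}(\mathfrak U(\mathfrak g),C^\infty(U,\mathbb K))$, where $\mathfrak g_{\bar 0}$ acts on $C^\infty(U,\mathbb K)$ by left-invariant differential operators, with the product dual to the coproduct of the enveloping superalgebra $\mathfrak U(\mathfrak g)$. The group $G_0$ and the superalgebra $\mathfrak U(\mathfrak g)$ act by left translations, denoted $L$, on compactly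 supported superfunctions and, dually, on superdistributions (functionals on compactly supported superfunctions). A Berezinian density on $G$ is regarded as the superdistribution $\varphi\mapsto\int_G\omega\varphi$; in local coordinates $(u,\xi)$ it is of the form $\varphi\mapsto\int D(u,\xi)\,f\varphi$ with a superfunction $f$, and it is nowhere vanishing if $f$ is invertible. A superdistribution is $G$-invariant if it is fixed by $L_g$, $g\in G_0$, and annihilated by $L_x$, $x\in\mathfrak g$. A density on $G_0$ is regarded as a superdistribution on $G$ by restricting superfunctions to $G_0$. Define the character $\delta(x)=-\mathrm{tr}_{\mathfrak g_{\bar 1}}(\mathrm{ad}\,x)$ of $\mathfrak g_{\bar 0}$, the left ideal $I_\delta\subseteq\mathfrak U(\mathfrak g)$ generated by all $x-\delta(x)$, $x\in\mathfrak g_{\bar 0}$, and the odd modular character $$\Delta_{\rm odd}(g)=\mathrm{Ber}_{(\mathfrak g/\mathfrak g_{\bar 0})^*}(\mathrm{Ad}(g))=\det\nolimits_{\mathfrak g_{\bar 1}}\mathrm{Ad}(g),\qquad g\in G_0 .$$ Then the space of $\mathfrak g$-invariants in $\mathfrak U(\mathfrak g)/I_\delta$ is one-dimensional. Let $\gamma\in\mathfrak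 U(\mathfrak g)$ be any representative of a generator of it, and let $|dg|$ be a left Haar density on $G_0$. Then $L_\gamma(|dg|\,\Delta_{\rm odd})$ is a nowhere vanishing $G$-invariant Berezinian density on $G$, and for every nowhere vanishing $G$-invariant Berezinian density $|Dg|$ on $G$ there is a non-zero constant $c\in\mathbb K$ with $$c\,|Dg|=L_\gamma(|dg|\,\Delta_{\rm odd}).$$ That is, $|Dg|=L_\gamma(|dg|\,\Delta_{\rm odd})$ for suitable normalisations. -/

import Mathlib

open scoped Manifold ContDiff TensorProduct
open MeasureTheory

noncomputable section

set_option linter.unusedSectionVars false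

/-- The Koszul sign `(-1)^(i j)` of two parities. -/
def koszulSign (K : Type*) [Field K] (i j : ZMod 2) : K := if i = 1 ∧ j = 1 then -1 else 1

/-- A Lie superalgebra over the field `K` (of characteristic zero) on the vector space `𝔤`:
a `ZMod 2`-grading and an even bracket which is super skew-symmetric and satisfies
the super Jacobi identity. -/
structure LieSuperalgebra (K 𝔤 : Type*) [Field K] [AddCommGroup 𝔤] [Module K 𝔤] where
  gr : ZMod 2 → Submodule K 𝔤
  isCompl : IsCompl (gr 0) (gr 1)
  bracket : 𝔤 →ₗ[K] 𝔤 →ₗ[K] 𝔤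
  bracket_mem : ∀ (i j : ZMod 2), ∀ x ∈ gr i, ∀ y ∈ gr j, bracket x y ∈ gr (i + j)
  bracket_skew : ∀ (i j : ZMod 2), ∀ x ∈ gr i, ∀ y ∈ gr j,
    bracket x y = -(koszulSign K i j • bracket y x)
  jacobi : ∀ (i j : ZMod 2), ∀ x ∈ gr i, ∀ y ∈ gr j, ∀ z,
    bracket x (bracket y z) =
      bracket (bracket x y) z + koszulSign K i j • bracket y (bracket x z)

namespace LieSuperalgebra

section Algebra

variable {K 𝔤 : Type*} [Field K] [AddCommGroup 𝔤] [Module K 𝔤] (L : LieSuperalgebra K 𝔤)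

/-- The projection of `𝔤` onto its even part. -/
def evenPart : 𝔤 →ₗ[K] 𝔤 := (L.gr 0).projection (L.gr 1) L.isCompl

/-- The projection of `𝔤` onto its odd part. -/
def oddPart : 𝔤 →ₗ[K] 𝔤 := (L.gr 1).projection (L.gr 0) L.isCompl.symm

lemma evenPart_even {x : 𝔤} (hx : x ∈ L.gr 0) : L.evenPart x = x :=
  Submodule.projection_apply_of_mem_left _ hx

lemma oddPart_odd {x : 𝔤} (hx : x ∈ L.gr 1) : L.oddPart x = x :=
  Submodule.projection_apply_of_mem_left _ hx

lemma evenPart_odd {x : 𝔤} (hx : x ∈ L.gr 1) : L.evenPart x = 0 :=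
  (Submodule.projection_apply_eq_zero_iff _).2 hx

lemma oddPart_even {x : 𝔤} (hx : x ∈ L.gr 0) : L.oddPart x = 0 :=
  (Submodule.projection_apply_eq_zero_iff _).2 hx

lemma evenPart_mem (x : 𝔤) : L.evenPart x ∈ L.gr 0 := Submodule.projection_apply_mem _ _

lemma oddPart_mem (x : 𝔤) : L.oddPart x ∈ L.gr 1 := Submodule.projection_apply_mem _ _

lemma even_add_odd (x : 𝔤) : L.evenPart x + L.oddPart x = x :=
  Submodule.projection_add_projection_eq_self L.isCompl x

/-- The relations `x y = (-1)^(|x| |y|) y x + [x, y]` of the universal enveloping algebra. -/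
inductive EnvRel : TensorAlgebra K 𝔤 → TensorAlgebra K 𝔤 → Prop
  | bracket (i j : ZMod 2) (x y : 𝔤) (hx : x ∈ L.gr i) (hy : y ∈ L.gr j) :
      EnvRel (TensorAlgebra.ι K x * TensorAlgebra.ι K y)
        (koszulSign K i j • (TensorAlgebra.ι K y * TensorAlgebra.ι K x)
          + TensorAlgebra.ι K (L.bracket x y))

/-- The universal enveloping algebra `U(𝔤)` of a Lie superalgebra. -/
def Env : Type _ := RingQuot L.EnvRel

instance : Ring L.Env := inferInstanceAs (Ring (RingQuot L.EnvRel))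

instance : Algebra K L.Env := inferInstanceAs (Algebra K (RingQuot L.EnvRel))

/-- The canonical map `𝔤 → U(𝔤)`. -/
def ι : 𝔤 →ₗ[K] L.Env :=
  (RingQuot.mkAlgHom K L.EnvRel).toLinearMap ∘ₗ TensorAlgebra.ι K

lemma ι_mul_ι {i j : ZMod 2} {x y : 𝔤} (hx : x ∈ L.gr i) (hy : y ∈ L.gr j) :
    L.ι x * L.ι y = koszulSign K i j • (L.ι y * L.ι x) + L.ι (L.bracket x y) := by
  have := RingQuot.mkAlgHom_rel K (EnvRel.bracket (L := L) i j x y hx hy)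
  rw [map_mul, map_add, map_smul, map_mul] at this
  exact this

/-- The universal property of `U(𝔤)`. -/
def lift {A : Type*} [Ring A] [Algebra K A] (f : 𝔤 →ₗ[K] A)
    (hf : ∀ (i j : ZMod 2), ∀ x ∈ L.gr i, ∀ y ∈ L.gr j,
      f x * f y = koszulSign K i j • (f y * f x) + f (L.bracket x y)) : L.Env →ₐ[K] A :=
  RingQuot.liftAlgHom K ⟨TensorAlgebra.lift K f, by
    rintro _ _ ⟨i, j, x, y, hx, hy⟩
    simpa using hf i j x hx y hy⟩

lemma lift_ι {A : Type*} [Ring A] [Algebra K A] (f : 𝔤 →ₗ[K] A)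
    (hf : ∀ (i j : ZMod 2), ∀ x ∈ L.gr i, ∀ y ∈ L.gr j,
      f x * f y = koszulSign K i j • (f y * f x) + f (L.bracket x y)) (x : 𝔤) :
    L.lift f hf (L.ι x) = f x :=
  (RingQuot.liftAlgHom_mkAlgHom_apply K _ _ _).trans (TensorAlgebra.lift_ι_apply f x)

/-- To check the relations of `U(𝔤)` it suffices to consider the pairs even-even, even-odd
and odd-odd. -/
lemma rel_of_cases {A : Type*} [Ring A] [Algebra K A] (f : 𝔤 →ₗ[K] A)
    (h00 : ∀ x ∈ L.gr 0, ∀ y ∈ L.gr 0, f x * f y = f y * f x + f (L.bracket x y))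
    (h01 : ∀ x ∈ L.gr 0, ∀ y ∈ L.gr 1, f x * f y = f y * f x + f (L.bracket x y))
    (h11 : ∀ x ∈ L.gr 1, ∀ y ∈ L.gr 1, f x * f y = -(f y * f x) + f (L.bracket x y))
    (i j : ZMod 2) (x : 𝔤) (hx : x ∈ L.gr i) (y : 𝔤) (hy : y ∈ L.gr j) :
      f x * f y = koszulSign K i j • (f y * f x) + f (L.bracket x y) := by
  have hc : ∀ k : ZMod 2, k = 0 ∨ k = 1 := by decide
  rcases hc i with rfl | rfl <;> rcases hc j with rfl | rfl
  · simpa [koszulSign] using h00 x hx y hy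
  · simpa [koszulSign] using h01 x hx y hy
  · have := h01 y hy x hx
    rw [L.bracket_skew 1 0 x hx y hy]
    simp [koszulSign, this]
  · simpa [koszulSign] using h11 x hx y hy

/-- The parity automorphism of `U(𝔤)`, equal to `(-1)^|u|` on homogeneous elements `u`. -/
def parity : L.Env →ₐ[K] L.Env :=
  L.lift (L.ι ∘ₗ (L.evenPart - L.oddPart)) (L.rel_of_cases _
    (by
      intro x hx y hy
      have hb := L.bracket_mem 0 0 x hx y hy
      simp only [zero_add] at hb
      simpa [L.evenPart_even, L.oddPart_even, hx, hy, hb, koszulSign] using L.ι_mul_ι hx hy)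
    (by
      intro x hx y hy
      have hb := L.bracket_mem 0 1 x hx y hy
      simp only [zero_add] at hb
      have := L.ι_mul_ι hx hy
      simp [koszulSign] at this
      simp [L.evenPart_even, L.oddPart_even, L.evenPart_odd, L.oddPart_odd, hx, hy, hb, this]
      abel)
    (by
      intro x hx y hy
      have hb := L.bracket_mem 1 1 x hx y hy
      rw [show (1 + 1 : ZMod 2) = 0 from rfl] at hb
      simpa [L.evenPart_odd, L.oddPart_odd, L.evenPart_even, L.oddPart_even, hx, hy, hb,
        koszulSign] using L.ι_mul_ι hx hy))

lemma parity_even {x : 𝔤} (hx : x ∈ L.gr 0) : L.parity (L.ι x) = L.ι x := by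
  simp [parity, lift_ι, L.evenPart_even hx, L.oddPart_even hx]

lemma parity_odd {x : 𝔤} (hx : x ∈ L.gr 1) : L.parity (L.ι x) = -L.ι x := by
  simp [parity, lift_ι, L.evenPart_odd hx, L.oddPart_odd hx]

lemma algHom_ext {A : Type*} [Ring A] [Algebra K A] {f g : L.Env →ₐ[K] A}
    (h : ∀ x, f (L.ι x) = g (L.ι x)) : f = g := by
  apply RingQuot.ringQuot_ext'
  apply TensorAlgebra.hom_ext
  ext x
  exact h x

lemma parity_parity (a : L.Env) : L.parity (L.parity a) = a := by
  have : L.parity.comp L.parity = AlgHom.id K L.Env := by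
    apply L.algHom_ext
    intro x
    rw [← L.even_add_odd x]
    simp [L.parity_even (L.evenPart_mem x), L.parity_odd (L.oddPart_mem x)]
  exact DFunLike.congr_fun this a

/-- The counit `ε : U(𝔤) → K`. -/
def counit : L.Env →ₐ[K] K := L.lift 0 (by simp)

/-- The action of `x ∈ 𝔤` on `U(𝔤) ⊗ U(𝔤)`, given for homogeneous `x` and `a` by
`x (a ⊗ b) = x a ⊗ b + (-1)^(|x| |a|) a ⊗ x b`. -/
def tensorLie : 𝔤 →ₗ[K] Module.End K (L.Env ⊗[K] L.Env) :=
  LinearMap.rTensorHom L.Env ∘ₗ LinearMap.mul K L.Env ∘ₗ L.ι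
  + LinearMap.lTensorHom L.Env ∘ₗ LinearMap.mul K L.Env ∘ₗ L.ι ∘ₗ L.evenPart
  + LinearMap.mulLeft K (A := Module.End K (L.Env ⊗[K] L.Env))
      (L.parity.toLinearMap.rTensor L.Env) ∘ₗ
      LinearMap.lTensorHom L.Env ∘ₗ LinearMap.mul K L.Env ∘ₗ L.ι ∘ₗ L.oddPart

lemma tensorLie_tmul (x : 𝔤) (a b : L.Env) :
    L.tensorLie x (a ⊗ₜ b) = (L.ι x * a) ⊗ₜ b + a ⊗ₜ (L.ι (L.evenPart x) * b)
      + L.parity a ⊗ₜ (L.ι (L.oddPart x) * b) := by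
  simp [tensorLie]

/-- The action of `U(𝔤)` on `U(𝔤) ⊗ U(𝔤)` extending the action of `𝔤`. -/
def tensorAct : L.Env →ₐ[K] Module.End K (L.Env ⊗[K] L.Env) :=
  L.lift L.tensorLie (L.rel_of_cases _
    (by
      intro x hx y hy
      have hb := L.bracket_mem 0 0 x hx y hy
      simp only [zero_add] at hb
      have h := L.ι_mul_ι hx hy
      simp only [koszulSign] at h
      ext a b
      simp [tensorLie_tmul, L.evenPart_even, L.oddPart_even, hx, hy, hb,
        ← mul_assoc, h, add_mul, TensorProduct.add_tmul, TensorProduct.tmul_add]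
      abel)
    (by
      intro x hx y hy
      have hb := L.bracket_mem 0 1 x hx y hy
      simp only [zero_add] at hb
      have h := L.ι_mul_ι hx hy
      simp only [koszulSign] at h
      ext a b
      simp [tensorLie_tmul, L.evenPart_even, L.oddPart_even, L.evenPart_odd, L.oddPart_odd,
        hx, hy, hb, parity_even, ← mul_assoc, h, add_mul, TensorProduct.add_tmul,
        TensorProduct.tmul_add]
      abel)
    (by
      intro x hx y hy
      have hb := L.bracket_mem 1 1 x hx y hy
      rw [show (1 + 1 : ZMod 2) = 0 from rfl] at hb
      have h := L.ι_mul_ι hx hy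
      simp only [koszulSign] at h
      have hp : ∀ a, L.parity (L.parity a) = a := L.parity_parity
      ext a b
      simp [tensorLie_tmul, L.evenPart_even, L.oddPart_even, L.evenPart_odd, L.oddPart_odd,
        hx, hy, hb, parity_odd, hp, ← mul_assoc, h, add_mul, TensorProduct.add_tmul,
        TensorProduct.tmul_add, TensorProduct.neg_tmul, TensorProduct.tmul_neg]
      abel))

lemma tensorAct_ι (x : 𝔤) : L.tensorAct (L.ι x) = L.tensorLie x := L.lift_ι _ _ _

/-- The coproduct `Δ : U(𝔤) → U(𝔤) ⊗ U(𝔤)`, i.e. the morphism of superalgebras with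
`Δ(x) = x ⊗ 1 + 1 ⊗ x` for `x ∈ 𝔤`. -/
def comul : L.Env →ₗ[K] L.Env ⊗[K] L.Env :=
  LinearMap.applyₗ (1 ⊗ₜ[K] 1) ∘ₗ L.tensorAct.toLinearMap

lemma comul_apply (u : L.Env) : L.comul u = L.tensorAct u (1 ⊗ₜ 1) := rfl

lemma comul_ι_mul (x : 𝔤) (u : L.Env) :
    L.comul (L.ι x * u) = L.tensorLie x (L.comul u) := by
  simp [comul_apply, tensorAct_ι]

/-- The sign operator on `U(𝔤) ⊗ U(𝔤)` with `a ⊗ b ↦ (-1)^(|a| |b|) a ⊗ b` for homogeneous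
`a` and `b`. -/
def signOp : Module.End K (L.Env ⊗[K] L.Env) :=
  (2⁻¹ : K) • (LinearMap.id + L.parity.toLinearMap.rTensor L.Env
    + L.parity.toLinearMap.lTensor L.Env
    - TensorProduct.map L.parity.toLinearMap L.parity.toLinearMap)

lemma bracket_even_odd (x : L.gr 0) : ∀ y ∈ L.gr 1, L.bracket x y ∈ L.gr 1 := fun y hy => by
  simpa using L.bracket_mem 0 1 x x.2 y hy

/-- The character `δ(x) = -tr(ad x | 𝔤₁)` by which the even part of `𝔤` acts on the Berezinian of
the quotient of `𝔤` by its even part. -/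
def deltaOdd (x : L.gr 0) : K :=
  -LinearMap.trace K (L.gr 1) ((L.bracket x).restrict (L.bracket_even_odd x))

/-- The left ideal of `U(𝔤)` generated by the elements `x - δ(x)` with `x` even. -/
def idealDelta : Ideal L.Env :=
  Ideal.span (Set.range fun x : L.gr 0 => L.ι x - algebraMap K L.Env (L.deltaOdd x))

/-- The space of `𝔤`-invariants of the left `U(𝔤)`-module `U(𝔤) / I`, where `I` is the left ideal
generated by the elements `x - δ(x)` with `x` even. -/
def invariants : Submodule K (L.Env ⧸ L.idealDelta) where
  carrier := {m | ∀ x : 𝔤, L.ι x • m = 0}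
  add_mem' ha hb x := by rw [smul_add, ha x, hb x, add_zero]
  zero_mem' x := smul_zero _
  smul_mem' c m hm x := by
    rw [← algebraMap_smul L.Env c m, smul_smul, ← Algebra.commutes, ← smul_smul, hm x, smul_zero]

end Algebra

end LieSuperalgebra

/-- A supergroup pair `(𝔤, G)` over `K = ℝ` or `K = ℂ`: a Lie superalgebra `𝔤` over `K` whose even
part is the scalar extension of the Lie algebra of the real Lie group `G`, together with a smooth
action `Ad` of `G` on `𝔤` by automorphisms of Lie superalgebras which extends the adjoint action
of `G` and whose differential is the restriction of the bracket. -/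
structure SupergroupPair (K : Type*) [RCLike K] (p : ℕ)
    (G : Type*) [TopologicalSpace G] [ChartedSpace (EuclideanSpace ℝ (Fin p)) G] [Group G]
    (𝔤 : Type*) [AddCommGroup 𝔤] [Module K 𝔤] where
  L : LieSuperalgebra K 𝔤
  evenEquiv : (K ⊗[ℝ] GroupLieAlgebra (𝓡 p) G) ≃ₗ[K] L.gr 0
  evenEquiv_bracket : ∀ x y : GroupLieAlgebra (𝓡 p) G,
    (evenEquiv (1 ⊗ₜ ⁅x, y⁆) : 𝔤) = L.bracket (evenEquiv (1 ⊗ₜ x)) (evenEquiv (1 ⊗ₜ y))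
  Ad : G →* (𝔤 ≃ₗ[K] 𝔤)
  Ad_mem : ∀ (g : G) (i : ZMod 2), ∀ x ∈ L.gr i, Ad g x ∈ L.gr i
  Ad_bracket : ∀ (g : G) (x y : 𝔤), Ad g (L.bracket x y) = L.bracket (Ad g x) (Ad g y)
  Ad_smooth : ∀ (l : Module.Dual K 𝔤) (x : 𝔤),
    ContMDiff (𝓡 p) 𝓘(ℝ, K) ∞ (fun g : G => l (Ad g x))
  Ad_even : ∀ (g : G) (x : GroupLieAlgebra (𝓡 p) G),
    Ad g (evenEquiv (1 ⊗ₜ x)) =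
      evenEquiv (1 ⊗ₜ (mfderiv (𝓡 p) (𝓡 p) (fun h : G => g * h * g⁻¹) 1 x :
        EuclideanSpace ℝ (Fin p)))
  Ad_deriv : ∀ (x : GroupLieAlgebra (𝓡 p) G) (y : 𝔤) (l : Module.Dual K 𝔤),
    mfderiv (𝓡 p) 𝓘(ℝ, K) (fun g : G => l (Ad g y)) 1 x = l (L.bracket (evenEquiv (1 ⊗ₜ x)) y)

section Functions

variable {K : Type*} [RCLike K] {p : ℕ}
  {G : Type*} [TopologicalSpace G] [ChartedSpace (EuclideanSpace ℝ (Fin p)) G] [Group G]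

/-- The left-invariant differential operator (infinitesimal right translation) attached to
`x ∈ Lie(G)`: the value at `g` is the derivative of `h ↦ f (g h)` at `h = 1` in direction `x`. -/
def rightDeriv (x : GroupLieAlgebra (𝓡 p) G) (f : G → K) (g : G) : K :=
  mfderiv (𝓡 p) 𝓘(ℝ, K) (fun h : G => f (g * h)) 1 x

lemma rightDeriv_congr {f f' : G → K} {g g' : G} (h : ∀ a, f (g * a) = f' (g' * a))
    (x : GroupLieAlgebra (𝓡 p) G) : rightDeriv x f g = rightDeriv x f' g' :=
  congrArg (fun F : G → K => (mfderiv (𝓡 p) 𝓘(ℝ, K) F 1 x : K)) (funext h)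

lemma rightDeriv_const (c : K) (g : G) (x : GroupLieAlgebra (𝓡 p) G) :
    rightDeriv x (fun _ => c) g = 0 := by
  simp only [rightDeriv, mfderiv_const]
  rfl

lemma contMDiffOn_mul {G : Type*} [TopologicalSpace G]
    [ChartedSpace (EuclideanSpace ℝ (Fin p)) G] {s : Set G} {f₁ f₂ : G → K} (h₁ : ContMDiffOn (𝓡 p) 𝓘(ℝ, K) ∞ f₁ s)
    (h₂ : ContMDiffOn (𝓡 p) 𝓘(ℝ, K) ∞ f₂ s) : ContMDiffOn (𝓡 p) 𝓘(ℝ, K) ∞ (f₁ * f₂) s :=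
  (contDiff_mul (𝕜 := ℝ) (𝔸 := K) (n := ∞)).contMDiff.comp_contMDiffOn (h₁.prodMk_space h₂)

variable [LieGroup (𝓡 p) ∞ G]

lemma mdifferentiableAt_translate {U : TopologicalSpace.Opens G} {f : G → K}
    (hf : ContMDiffOn (𝓡 p) 𝓘(ℝ, K) ∞ f U) {g : G} (hg : g ∈ U) :
    MDifferentiableAt (𝓡 p) 𝓘(ℝ, K) (fun h : G => f (g * h)) 1 := by
  have h1 : ContMDiffAt (𝓡 p) 𝓘(ℝ, K) ∞ f (g * 1) := by
    rw [mul_one]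
    exact hf.contMDiffAt (U.isOpen.mem_nhds hg)
  have h2 : ContMDiffAt (𝓡 p) (𝓡 p) ∞ (fun h : G => g * h) 1 :=
    (contMDiff_mul_left (I := 𝓡 p) (n := ∞) (a := g)).contMDiffAt
  exact (ContMDiffAt.comp (1 : G) h1 h2).mdifferentiableAt (by simp)

lemma rightDeriv_add {U : TopologicalSpace.Opens G} {f₁ f₂ : G → K}
    (h₁ : ContMDiffOn (𝓡 p) 𝓘(ℝ, K) ∞ f₁ U) (h₂ : ContMDiffOn (𝓡 p) 𝓘(ℝ, K) ∞ f₂ U)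
    {g : G} (hg : g ∈ U) (x : GroupLieAlgebra (𝓡 p) G) :
    rightDeriv x (f₁ + f₂) g = rightDeriv x f₁ g + rightDeriv x f₂ g := by
  have := ((mdifferentiableAt_translate h₁ hg).hasMFDerivAt.add
    (mdifferentiableAt_translate h₂ hg).hasMFDerivAt).mfderiv
  exact DFunLike.congr_fun this x

lemma rightDeriv_mul {U : TopologicalSpace.Opens G} {f₁ f₂ : G → K}
    (h₁ : ContMDiffOn (𝓡 p) 𝓘(ℝ, K) ∞ f₁ U) (h₂ : ContMDiffOn (𝓡 p) 𝓘(ℝ, K) ∞ f₂ U)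
    {g : G} (hg : g ∈ U) (x : GroupLieAlgebra (𝓡 p) G) :
    rightDeriv x (f₁ * f₂) g = rightDeriv x f₁ g * f₂ g + f₁ g * rightDeriv x f₂ g := by
  have := ((mdifferentiableAt_translate h₁ hg).hasMFDerivAt.mul
    (mdifferentiableAt_translate h₂ hg).hasMFDerivAt).mfderiv
  refine (DFunLike.congr_fun this x).trans ?_
  simp only [mul_one]
  change f₁ g * rightDeriv x f₂ g + f₂ g * rightDeriv x f₁ g = _
  ring

/-- The space `C^∞(U, K)` of smooth functions on the open set `U`; as functions on `G` they are
extended by zero outside `U`. -/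
def smoothFun (K : Type*) [RCLike K] (p : ℕ)
    {G : Type*} [TopologicalSpace G] [ChartedSpace (EuclideanSpace ℝ (Fin p)) G] (U : TopologicalSpace.Opens G) : Submodule K (G → K) where
  carrier := {f | ContMDiffOn (𝓡 p) 𝓘(ℝ, K) ∞ f U ∧ ∀ g ∉ U, f g = 0}
  add_mem' := fun ha hb => ⟨ha.1.add hb.1, fun g hg => by simp [ha.2 g hg, hb.2 g hg]⟩
  zero_mem' := ⟨contMDiffOn_const, fun _ _ => rfl⟩
  smul_mem' := fun c f hf => ⟨contMDiffOn_mul contMDiffOn_const hf.1, fun g hg => by simp [hf.2 g hg]⟩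

lemma smoothFun_mul_mem {G : Type*} [TopologicalSpace G]
    [ChartedSpace (EuclideanSpace ℝ (Fin p)) G] {U : TopologicalSpace.Opens G} {f₁ f₂ : G → K}
    (h₁ : f₁ ∈ smoothFun K p U) (h₂ : f₂ ∈ smoothFun K p U) : f₁ * f₂ ∈ smoothFun K p U :=
  ⟨contMDiffOn_mul h₁.1 h₂.1, fun g hg => by simp [h₁.2 g hg]⟩

lemma smoothFun_one_mem (p : ℕ) {G : Type*} [TopologicalSpace G]
    [ChartedSpace (EuclideanSpace ℝ (Fin p)) G] (U : TopologicalSpace.Opens G) :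
    Set.indicator (U : Set G) (fun _ => (1 : K)) ∈ smoothFun K p U :=
  ⟨(contMDiffOn_const (c := (1 : K))).congr fun g hg => by simp [hg],
    fun g hg => Set.indicator_of_notMem hg _⟩

lemma rightDeriv_smul {U : TopologicalSpace.Opens G} (c : K) {f : G → K}
    (h : ContMDiffOn (𝓡 p) 𝓘(ℝ, K) ∞ f U)
    {g : G} (hg : g ∈ U) (x : GroupLieAlgebra (𝓡 p) G) :
    rightDeriv x (c • f) g = c * rightDeriv x f g := by
  have := rightDeriv_mul (contMDiffOn_const (c := c)) h hg x
  rw [rightDeriv_const, zero_mul, zero_add] at this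
  exact this

lemma rightDeriv_sum {ι : Type*} (s : Finset ι) {U : TopologicalSpace.Opens G} {f : ι → G → K}
    (h : ∀ i, ContMDiffOn (𝓡 p) 𝓘(ℝ, K) ∞ (f i) U)
    {g : G} (hg : g ∈ U) (x : GroupLieAlgebra (𝓡 p) G) :
    ContMDiffOn (𝓡 p) 𝓘(ℝ, K) ∞ (∑ i ∈ s, f i) U ∧
      rightDeriv x (∑ i ∈ s, f i) g = ∑ i ∈ s, rightDeriv x (f i) g := by
  classical
  induction s using Finset.induction_on with
  | empty => exact ⟨contMDiffOn_const, rightDeriv_const (0 : K) g x⟩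
  | insert a s ha ih =>
    rw [Finset.sum_insert ha, Finset.sum_insert ha, ← ih.2, rightDeriv_add (h a) ih.1 hg]
    exact ⟨(h a).add ih.1, rfl⟩

end Functions

namespace SupergroupPair

variable {K : Type*} [RCLike K] {p : ℕ}
  {G : Type*} [TopologicalSpace G] [ChartedSpace (EuclideanSpace ℝ (Fin p)) G] [Group G]
  {𝔤 : Type*} [AddCommGroup 𝔤] [Module K 𝔤] (P : SupergroupPair K p G 𝔤)

/-- The inclusion of the Lie algebra of `G` into `𝔤`. -/
def incl (x : GroupLieAlgebra (𝓡 p) G) : 𝔤 := P.evenEquiv (1 ⊗ₜ x)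

lemma incl_mem (x : GroupLieAlgebra (𝓡 p) G) : P.incl x ∈ P.L.gr 0 := SetLike.coe_mem _

section Product

/-- The convolution product of linear maps `U(𝔤) → (G → K)`:
`(φ ψ)(u) = ∑ (-1)^(|ψ| |u'|) φ(u') ψ(u'')` where `Δ(u) = ∑ u' ⊗ u''`.
As functions on `G` are even, only `u''` of the parity of `ψ` contribute, whence the sign is
`(-1)^(|u''| |u'|)`. -/
def mul (φ ψ : P.L.Env →ₗ[K] (G → K)) : P.L.Env →ₗ[K] (G → K) :=
  LinearMap.mul' K (G → K) ∘ₗ TensorProduct.map φ ψ ∘ₗ P.L.signOp ∘ₗ P.L.comul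

/-- The constant superfunction `1` on the open set `U`. -/
def one (U : Set G) : P.L.Env →ₗ[K] (G → K) :=
  P.L.counit.toLinearMap.smulRight (U.indicator fun _ => 1)

end Product

variable [LieGroup (𝓡 p) ∞ G]

/-- The space `𝒪(U)` of superfunctions on the open set `U` of the Lie supergroup attached to the
supergroup pair: the `𝔤₀`-linear maps `φ : U(𝔤) → C^∞(U, K)`, where the even part of `𝔤` acts on
`C^∞(U, K)` by left-invariant differential operators. (It suffices to require linearity under the
real form `Lie(G)`.) We write `φ u g` for the value at `g ∈ U` of `φ(u)`. -/
def superFun (U : TopologicalSpace.Opens G) : Submodule K (P.L.Env →ₗ[K] (G → K)) where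
  carrier := {φ | (∀ u, φ u ∈ smoothFun K p U) ∧
    ∀ (x : GroupLieAlgebra (𝓡 p) G) (u : P.L.Env), ∀ g ∈ U,
      φ (P.L.ι (P.incl x) * u) g = rightDeriv x (φ u) g}
  add_mem' := fun ha hb => ⟨fun u => add_mem (ha.1 u) (hb.1 u), fun x u g hg => by
    refine (congrArg₂ (· + ·) (ha.2 x u g hg) (hb.2 x u g hg)).trans ?_
    exact (rightDeriv_add (ha.1 u).1 (hb.1 u).1 hg x).symm⟩
  zero_mem' := ⟨fun u => zero_mem _, fun x u g hg => (rightDeriv_const 0 g x).symm⟩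
  smul_mem' := fun c φ h => ⟨fun u => Submodule.smul_mem _ c (h.1 u), fun x u g hg => by
    refine (congrArg (c * ·) (h.2 x u g hg)).trans ?_
    exact (rightDeriv_smul c (h.1 u).1 hg x).symm⟩

lemma one_mem (U : TopologicalSpace.Opens G) : P.one (U : Set G) ∈ P.superFun U := by
  have h1 := smoothFun_one_mem (K := K) p U
  refine ⟨fun u => Submodule.smul_mem _ _ h1, fun x u g hg => ?_⟩
  have : P.L.counit (P.L.ι (P.incl x)) = 0 := by
    simp [LieSuperalgebra.counit, LieSuperalgebra.lift_ι]
  have hd : rightDeriv x (Set.indicator (U : Set G) (fun _ => (1 : K))) g = 0 := by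
    have : (fun h : G => Set.indicator (U : Set G) (fun _ => (1 : K)) (g * h)) =ᶠ[nhds 1]
        fun _ => (1 : K) := by
      have hc : ContinuousAt (fun h : G => g * h) (1 : G) :=
        (contMDiff_mul_left (I := 𝓡 p) (n := ∞) (a := g)).continuous.continuousAt
      have hU : (U : Set G) ∈ nhds (g * 1) := U.isOpen.mem_nhds (by simpa using hg)
      filter_upwards [hc hU] with h hh
      exact Set.indicator_of_mem (show g * h ∈ (U : Set G) from hh) (fun _ => (1 : K))
    rw [rightDeriv, this.mfderiv_eq]
    exact rightDeriv_const (1 : K) g x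
  refine Eq.trans ?_ (rightDeriv_smul (P.L.counit u) h1.1 hg x).symm
  simp [one, this, hd]

/-- Superfunctions on `U` form an algebra. -/
lemma mul_mem {U : TopologicalSpace.Opens G} {φ ψ : P.L.Env →ₗ[K] (G → K)}
    (hφ : φ ∈ P.superFun U) (hψ : ψ ∈ P.superFun U) : P.mul φ ψ ∈ P.superFun U := by
  have key : ∀ w : P.L.Env ⊗[K] P.L.Env,
      LinearMap.mul' K (G → K) (TensorProduct.map φ ψ w) ∈ smoothFun K p U ∧
      ∀ (x : GroupLieAlgebra (𝓡 p) G), ∀ g ∈ U,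
        LinearMap.mul' K (G → K) (TensorProduct.map φ ψ (P.L.tensorLie (P.incl x) w)) g =
          rightDeriv x (LinearMap.mul' K (G → K) (TensorProduct.map φ ψ w)) g := by
    intro w
    induction w using TensorProduct.induction_on with
    | zero =>
      simp only [map_zero]
      exact ⟨zero_mem _, fun x g hg => (rightDeriv_const (0 : K) g x).symm⟩
    | tmul a b =>
      refine ⟨smoothFun_mul_mem (hφ.1 a) (hψ.1 b), fun x g hg => ?_⟩
      simp [LieSuperalgebra.tensorLie_tmul, P.L.evenPart_even (P.incl_mem x),
        P.L.oddPart_even (P.incl_mem x), hφ.2 x a g hg, hψ.2 x b g hg,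
        rightDeriv_mul (hφ.1 a).1 (hψ.1 b).1 hg]
    | add v w hv hw =>
      simp only [map_add]
      refine ⟨add_mem hv.1 hw.1, fun x g hg => ?_⟩
      rw [rightDeriv_add hv.1.1 hw.1.1 hg, Pi.add_apply, hv.2 x g hg, hw.2 x g hg]
  have comm : ∀ (x : GroupLieAlgebra (𝓡 p) G) (w : P.L.Env ⊗[K] P.L.Env),
      P.L.signOp (P.L.tensorLie (P.incl x) w) = P.L.tensorLie (P.incl x) (P.L.signOp w) := by
    intro x w
    induction w using TensorProduct.induction_on with
    | zero => simp
    | tmul a b =>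
      simp [LieSuperalgebra.signOp, LieSuperalgebra.tensorLie_tmul,
        P.L.evenPart_even (P.incl_mem x), P.L.oddPart_even (P.incl_mem x),
        P.L.parity_even (P.incl_mem x)]
    | add v w hv hw => simp only [map_add, hv, hw]
  refine ⟨fun u => (key _).1, fun x u g hg => ?_⟩
  have := (key (P.L.signOp (P.L.comul u))).2 x g hg
  rw [← comm, ← LieSuperalgebra.comul_ι_mul] at this
  exact this

/-- A superfunction on `G` which vanishes outside a compact subset of the open set `U`, and hence
has compact support contained in `U`. -/
def SuppIn (φ : P.L.Env →ₗ[K] (G → K)) (U : Set G) : Prop :=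
  ∃ C : Set G, IsCompact C ∧ C ⊆ U ∧ ∀ u, ∀ g ∉ C, φ u g = 0

/-- The subspace of superfunctions on `G` with compact support. -/
def testSubmodule : Submodule K (P.L.Env →ₗ[K] (G → K)) where
  carrier := {φ | φ ∈ P.superFun ⊤ ∧ P.SuppIn φ Set.univ}
  add_mem' := by
    rintro φ ψ ⟨hφ, C, hC, -, h⟩ ⟨hψ, D, hD, -, h'⟩
    refine ⟨add_mem hφ hψ, C ∪ D, hC.union hD, Set.subset_univ _, fun u g hg => ?_⟩
    rw [Set.mem_union, not_or] at hg
    simp [h u g hg.1, h' u g hg.2]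
  zero_mem' := ⟨zero_mem _, ∅, isCompact_empty, Set.subset_univ _, fun _ _ _ => rfl⟩
  smul_mem' := by
    rintro c φ ⟨hφ, C, hC, -, h⟩
    exact ⟨Submodule.smul_mem _ c hφ, C, hC, Set.subset_univ _, fun u g hg => by simp [h u g hg]⟩

/-- The space of superfunctions on `G` with compact support. -/
def TestFun : Type _ := P.testSubmodule

instance : AddCommGroup P.TestFun := inferInstanceAs (AddCommGroup P.testSubmodule)

instance : Module K P.TestFun := inferInstanceAs (Module K P.testSubmodule)

namespace TestFun

variable {P}

/-- The value `φ(u; g)` of a superfunction. -/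
def val (φ : P.TestFun) : P.L.Env →ₗ[K] (G → K) := Subtype.val (p := (· ∈ P.testSubmodule)) φ

/-- Constructor for compactly supported superfunctions. -/
def mk (φ : P.L.Env →ₗ[K] (G → K)) (h : φ ∈ P.testSubmodule) : P.TestFun :=
  Subtype.mk (p := (· ∈ P.testSubmodule)) φ h

lemma mem (φ : P.TestFun) : φ.val ∈ P.testSubmodule := Subtype.prop (p := (· ∈ P.testSubmodule)) φ

lemma val_mk (φ : P.L.Env →ₗ[K] (G → K)) (h : φ ∈ P.testSubmodule) : (mk φ h).val = φ := rfl

lemma ext {φ ψ : P.TestFun} (h : ∀ u g, φ.val u g = ψ.val u g) : φ = ψ :=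
  Subtype.ext (LinearMap.ext fun u => funext fun g => h u g)

lemma val_add (φ ψ : P.TestFun) (u : P.L.Env) (g : G) :
    (φ + ψ).val u g = φ.val u g + ψ.val u g := rfl

lemma val_neg (φ : P.TestFun) (u : P.L.Env) (g : G) : (-φ).val u g = -φ.val u g := rfl

lemma val_smul (c : K) (φ : P.TestFun) (u : P.L.Env) (g : G) :
    (c • φ).val u g = c * φ.val u g := rfl

end TestFun

/-- The linear functionals on the compactly supported superfunctions on `G`. -/
abbrev Functional : Type _ := Module.Dual K P.TestFun

lemma translate_mem (a : G) {φ : P.L.Env →ₗ[K] (G → K)} (hφ : φ ∈ P.testSubmodule) :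
    LinearMap.funLeft K K (fun h : G => a⁻¹ * h) ∘ₗ φ ∈ P.testSubmodule := by
  obtain ⟨hφ, C, hC, -, h⟩ := hφ
  have hcont : Continuous fun h : G => a * h :=
    (contMDiff_mul_left (I := 𝓡 p) (n := ∞) (a := a)).continuous
  refine ⟨⟨fun u => ⟨?_, fun g hg => (hg trivial).elim⟩, fun x u g _ => ?_⟩,
    (fun h => a * h) '' C, hC.image hcont, Set.subset_univ _, fun u g hg => ?_⟩
  · have := (hφ.1 u).1
    rw [TopologicalSpace.Opens.coe_top, contMDiffOn_univ] at this ⊢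
    exact this.comp contMDiff_mul_left
  · refine (hφ.2 x u (a⁻¹ * g) trivial).trans (rightDeriv_congr (fun h => ?_) x)
    exact congrArg (φ u) (mul_assoc _ _ _)
  · exact h u _ fun hC' => hg ⟨_, hC', by simp⟩

/-- Left translation of superfunctions, `(L_a φ)(u; h) = φ(u; a⁻¹ h)`. -/
def translate (a : G) : P.TestFun →ₗ[K] P.TestFun where
  toFun φ := TestFun.mk (LinearMap.funLeft K K (fun h : G => a⁻¹ * h) ∘ₗ φ.val)
    (P.translate_mem a φ.mem)
  map_add' _ _ := rfl
  map_smul' _ _ := rfl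

lemma translate_apply (a : G) (φ : P.TestFun) (u : P.L.Env) (h : G) :
    (P.translate a φ).val u h = φ.val u (a⁻¹ * h) := rfl

lemma parityFun_mem {φ : P.L.Env →ₗ[K] (G → K)} (hφ : φ ∈ P.testSubmodule) :
    φ ∘ₗ P.L.parity.toLinearMap ∈ P.testSubmodule := by
  obtain ⟨hφ, C, hC, hU, h⟩ := hφ
  refine ⟨⟨fun u => hφ.1 _, fun x u g hg => ?_⟩, C, hC, hU, fun u g hg => h _ g hg⟩
  have := hφ.2 x (P.L.parity u) g hg
  rw [← P.L.parity_even (P.incl_mem x), ← map_mul] at this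
  exact this

/-- The parity involution on superfunctions, `φ ↦ (-1)^|φ| φ`. -/
def parityFun : P.TestFun →ₗ[K] P.TestFun where
  toFun φ := TestFun.mk (φ.val ∘ₗ P.L.parity.toLinearMap) (P.parityFun_mem φ.mem)
  map_add' _ _ := rfl
  map_smul' _ _ := rfl

lemma parityFun_apply (φ : P.TestFun) (u : P.L.Env) (h : G) :
    (P.parityFun φ).val u h = φ.val (P.L.parity u) h := rfl

lemma Ad_inv_smooth (l : Module.Dual K 𝔤) (x : 𝔤) :
    ContMDiff (𝓡 p) 𝓘(ℝ, K) ∞ (fun g : G => l (P.Ad g⁻¹ x)) :=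
  (P.Ad_smooth l x).comp (contMDiff_inv (𝓡 p) ∞)

section Frozen

variable [FiniteDimensional K 𝔤]

lemma map_expand {V : Type*} [AddCommGroup V] [Module K V] (T : 𝔤 →ₗ[K] V) (z : 𝔤) :
    T z = ∑ i, (Module.finBasis K 𝔤).coord i z • T (Module.finBasis K 𝔤 i) := by
  conv_lhs => rw [← (Module.finBasis K 𝔤).sum_repr z]
  simp only [map_sum, map_smul, Module.Basis.coord_apply]

lemma Ad_inv_expand (T : 𝔤 →ₗ[K] (G → K)) (x : 𝔤) :
    (fun h : G => T (P.Ad h⁻¹ x) h) =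
      ∑ i, (fun h : G => (Module.finBasis K 𝔤).coord i (P.Ad h⁻¹ x)) * T (Module.finBasis K 𝔤 i)
    := by
  ext h
  rw [map_expand T (P.Ad h⁻¹ x)]
  simp only [Finset.sum_apply, Pi.smul_apply, Pi.mul_apply, smul_eq_mul]

lemma rightDeriv_Ad (l : Module.Dual K 𝔤) (y : GroupLieAlgebra (𝓡 p) G) (z : 𝔤) :
    rightDeriv y (fun g : G => l (P.Ad g z)) 1 = l (P.L.bracket (P.incl y) z) :=
  (congrArg (fun F : G → K => (mfderiv (𝓡 p) 𝓘(ℝ, K) F 1 y : K))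
    (funext fun h => by rw [one_mul])).trans (P.Ad_deriv y z l)

lemma rightDeriv_Ad_inv_one (l : Module.Dual K 𝔤) (y : GroupLieAlgebra (𝓡 p) G) (z : 𝔤) :
    rightDeriv y (fun g : G => l (P.Ad g⁻¹ z)) 1 = -l (P.L.bracket (P.incl y) z) := by
  set b := Module.finBasis K 𝔤 with hb
  have e : (fun _ : G => l z) = ∑ i, (fun g : G => b.coord i (P.Ad g⁻¹ z)) *
      (fun g : G => l (P.Ad g (b i))) := by
    ext g
    have hz : P.Ad g (P.Ad g⁻¹ z) = z := by
      rw [← LinearEquiv.mul_apply, ← map_mul]; simp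
    have := map_expand (l ∘ₗ (P.Ad g).toLinearMap) (P.Ad g⁻¹ z)
    simp only [LinearMap.comp_apply, LinearEquiv.coe_coe, hz] at this
    rw [this]
    simp only [Finset.sum_apply, Pi.mul_apply, smul_eq_mul, hb]
  have e' : (fun g : G => l (P.Ad g⁻¹ z)) = ∑ i, (fun g : G => b.coord i (P.Ad g⁻¹ z)) *
      (fun _ : G => l (b i)) := by
    ext g
    rw [map_expand l (P.Ad g⁻¹ z)]
    simp only [Finset.sum_apply, Pi.mul_apply, smul_eq_mul, hb]
  have sm : ∀ i, ContMDiffOn (𝓡 p) 𝓘(ℝ, K) ∞ (fun g : G => b.coord i (P.Ad g⁻¹ z))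
      (⊤ : TopologicalSpace.Opens G) := fun i => (P.Ad_inv_smooth _ _).contMDiffOn
  have sm' : ∀ i, ContMDiffOn (𝓡 p) 𝓘(ℝ, K) ∞ (fun g : G => l (P.Ad g (b i)))
      (⊤ : TopologicalSpace.Opens G) := fun i => (P.Ad_smooth _ _).contMDiffOn
  have sm0 : ∀ i, ContMDiffOn (𝓡 p) 𝓘(ℝ, K) ∞ (fun _ : G => l (b i))
      (⊤ : TopologicalSpace.Opens G) := fun i => contMDiffOn_const
  have h1g : (1 : G) ∈ (⊤ : TopologicalSpace.Opens G) := trivial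
  have h0 := rightDeriv_const (l z) (1 : G) y
  rw [e, (rightDeriv_sum _ (fun i => contMDiffOn_mul (sm i) (sm' i)) h1g y).2] at h0
  rw [e', (rightDeriv_sum _ (fun i => contMDiffOn_mul (sm i) (sm0 i)) h1g y).2]
  have a1 : ∀ i, rightDeriv y ((fun g : G => b.coord i (P.Ad g⁻¹ z)) *
      (fun g : G => l (P.Ad g (b i)))) 1 =
      rightDeriv y (fun g : G => b.coord i (P.Ad g⁻¹ z)) 1 * l (b i) +
        b.coord i z * l (P.L.bracket (P.incl y) (b i)) := fun i => by
    rw [rightDeriv_mul (sm i) (sm' i) h1g, rightDeriv_Ad]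
    simp
  have a2 : ∀ i, rightDeriv y ((fun g : G => b.coord i (P.Ad g⁻¹ z)) *
      (fun _ : G => l (b i))) 1 =
      rightDeriv y (fun g : G => b.coord i (P.Ad g⁻¹ z)) 1 * l (b i) := fun i => by
    rw [rightDeriv_mul (sm i) (sm0 i) h1g, rightDeriv_const, mul_zero, add_zero]
  simp only [a1, Finset.sum_add_distrib] at h0
  simp only [a2]
  have h1 := map_expand (l ∘ₗ P.L.bracket (P.incl y)) z
  simp only [LinearMap.comp_apply, smul_eq_mul] at h1
  rw [h1]
  linear_combination h0

lemma rightDeriv_Ad_inv (l : Module.Dual K 𝔤) (y : GroupLieAlgebra (𝓡 p) G) (z : 𝔤) (g : G) :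
    rightDeriv y (fun h : G => l (P.Ad h⁻¹ z)) g = -l (P.L.bracket (P.incl y) (P.Ad g⁻¹ z)) := by
  rw [← rightDeriv_Ad_inv_one]
  refine rightDeriv_congr (fun h => ?_) y
  rw [one_mul, mul_inv_rev, map_mul, LinearEquiv.mul_apply]

lemma frozen (T : 𝔤 →ₗ[K] (G → K)) {U : TopologicalSpace.Opens G}
    (hT : ∀ z, ContMDiffOn (𝓡 p) 𝓘(ℝ, K) ∞ (T z) U) (x : 𝔤) :
    ContMDiffOn (𝓡 p) 𝓘(ℝ, K) ∞ (fun h : G => T (P.Ad h⁻¹ x) h) U ∧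
    ∀ (y : GroupLieAlgebra (𝓡 p) G), ∀ g ∈ U, rightDeriv y (fun h : G => T (P.Ad h⁻¹ x) h) g =
      -T (P.L.bracket (P.incl y) (P.Ad g⁻¹ x)) g + rightDeriv y (T (P.Ad g⁻¹ x)) g := by
  rw [Ad_inv_expand]
  have sm : ∀ i, ContMDiffOn (𝓡 p) 𝓘(ℝ, K) ∞
      (fun g : G => (Module.finBasis K 𝔤).coord i (P.Ad g⁻¹ x)) U :=
    fun i => (P.Ad_inv_smooth _ _).contMDiffOn
  refine ⟨?_, fun y g hg => ?_⟩
  · rcases isEmpty_or_nonempty U with hU | ⟨⟨g, hg⟩⟩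
    · intro g hg
      exact (hU.false ⟨g, hg⟩).elim
    · exact (rightDeriv_sum Finset.univ (fun i => contMDiffOn_mul (sm i) (hT _)) hg 0).1
  rw [(rightDeriv_sum Finset.univ (fun i => contMDiffOn_mul (sm i) (hT _)) hg y).2]
  have h2 : rightDeriv y (T (P.Ad g⁻¹ x)) g = ∑ i, (Module.finBasis K 𝔤).coord i (P.Ad g⁻¹ x) *
      rightDeriv y (T (Module.finBasis K 𝔤 i)) g := by
    rw [map_expand T (P.Ad g⁻¹ x), (rightDeriv_sum Finset.univ
      (f := fun i => (Module.finBasis K 𝔤).coord i (P.Ad g⁻¹ x) • T (Module.finBasis K 𝔤 i))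
      (fun i => contMDiffOn_mul contMDiffOn_const (hT _)) hg y).2]
    exact Finset.sum_congr rfl fun i _ => rightDeriv_smul _ (hT _) hg _
  rw [h2, map_expand T (P.L.bracket _ _), Finset.sum_apply, ← Finset.sum_neg_distrib,
    ← Finset.sum_add_distrib]
  refine Finset.sum_congr rfl fun i _ => ?_
  rw [rightDeriv_mul (sm i) (hT _) hg, rightDeriv_Ad_inv, Pi.smul_apply, smul_eq_mul, neg_mul]

end Frozen

section LeftAction

lemma ι_commute (x : GroupLieAlgebra (𝓡 p) G) (z : 𝔤) :
    P.L.ι z * P.L.ι (P.incl x) =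
      P.L.ι (P.incl x) * P.L.ι z - P.L.ι (P.L.bracket (P.incl x) z) := by
  have h0 := P.L.ι_mul_ι (P.incl_mem x) (P.L.evenPart_mem z)
  have h1 := P.L.ι_mul_ι (P.incl_mem x) (P.L.oddPart_mem z)
  simp only [koszulSign, zero_ne_one, false_and, if_false, one_smul] at h0 h1
  conv_lhs => rw [← P.L.even_add_odd z]
  conv_rhs => rw [← P.L.even_add_odd z]
  simp only [map_add, mul_add, add_mul, h0, h1]
  abel

/-- For an algebra endomorphism `θ` of `U(𝔤)`, the map sending the superfunction `φ` to
`(u; h) ↦ -φ(θ(Ad(h⁻¹)(x) u); h)`. -/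
def leftRaw (θ : P.L.Env →ₐ[K] P.L.Env) :
    𝔤 →ₗ[K] (P.L.Env →ₗ[K] (G → K)) →ₗ[K] (P.L.Env →ₗ[K] (G → K)) :=
  LinearMap.mk₂ K (fun x φ =>
    { toFun := fun u h => -φ (θ (P.L.ι (P.Ad h⁻¹ x) * u)) h
      map_add' := fun u v => by ext h; simp only [mul_add, map_add, Pi.add_apply]; ring
      map_smul' := fun c u => by
        ext h
        simp only [Algebra.mul_smul_comm, map_smul, Pi.smul_apply, smul_eq_mul, RingHom.id_apply]
        ring })
    (fun x y φ => by
      ext u h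
      simp only [map_add, add_mul, LinearMap.coe_mk, AddHom.coe_mk, LinearMap.add_apply,
        Pi.add_apply]
      ring)
    (fun c x φ => by
      ext u h
      simp only [map_smul, Algebra.smul_mul_assoc, LinearMap.coe_mk, AddHom.coe_mk,
        LinearMap.smul_apply, Pi.smul_apply, smul_eq_mul]
      ring)
    (fun x φ ψ => by
      ext u h
      simp only [LinearMap.coe_mk, AddHom.coe_mk, LinearMap.add_apply, Pi.add_apply]
      ring)
    (fun c x φ => by
      ext u h
      simp only [LinearMap.coe_mk, AddHom.coe_mk, LinearMap.smul_apply, Pi.smul_apply,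
        smul_eq_mul]
      ring)

lemma leftRaw_apply (θ : P.L.Env →ₐ[K] P.L.Env) (x : 𝔤) (φ : P.L.Env →ₗ[K] (G → K))
    (u : P.L.Env) (h : G) :
    P.leftRaw θ x φ u h = -φ (θ (P.L.ι (P.Ad h⁻¹ x) * u)) h := rfl

lemma leftRaw_mem [FiniteDimensional K 𝔤] (θ : P.L.Env →ₐ[K] P.L.Env)
    (hθ : ∀ x, θ (P.L.ι (P.incl x)) = P.L.ι (P.incl x)) (x : 𝔤)
    {φ : P.L.Env →ₗ[K] (G → K)} (hφ : φ ∈ P.testSubmodule) :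
    P.leftRaw θ x φ ∈ P.testSubmodule := by
  obtain ⟨hφ, C, hC, hU, h⟩ := hφ
  have key := fun u : P.L.Env => P.frozen (U := ⊤)
    (-(φ ∘ₗ θ.toLinearMap ∘ₗ (LinearMap.mulRight K u) ∘ₗ P.L.ι))
    (fun z => (neg_mem (hφ.1 (θ (P.L.ι z * u)))).1) x
  refine ⟨⟨fun u => ⟨(key u).1, fun g hg => (hg trivial).elim⟩, fun y u g hg => ?_⟩,
    C, hC, hU, fun u g hg => by rw [leftRaw_apply, h _ g hg, neg_zero]⟩
  refine Eq.trans ?_ ((key u).2 y g hg).symm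
  have e : rightDeriv y (-φ (θ (P.L.ι (P.Ad g⁻¹ x) * u))) g =
      -φ (P.L.ι (P.incl y) * θ (P.L.ι (P.Ad g⁻¹ x) * u)) g := by
    rw [hφ.2 y _ g hg, ← neg_one_smul K (φ _), rightDeriv_smul _ (hφ.1 _).1 hg, neg_one_mul]
  rw [leftRaw_apply, ← mul_assoc, ι_commute]
  refine Eq.trans ?_ (congrArg _ e.symm)
  simp only [LinearMap.neg_apply, LinearMap.comp_apply, AlgHom.toLinearMap_apply,
    LinearMap.mulRight_apply, Pi.neg_apply, neg_neg]
  rw [← hθ y, ← map_mul, sub_mul, mul_assoc, hθ y]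
  simp only [map_sub, Pi.sub_apply]
  ring

variable [FiniteDimensional K 𝔤]

/-- The action of `x ∈ 𝔤` on compactly supported superfunctions induced by left translations,
`(L_x φ)(u; h) = -(-1)^(|x| |φ|) φ(Ad(h⁻¹)(x) u; h)` for homogeneous `x` and `φ`.
As `φ(v; h)` only depends on the component of `v` of the parity of `φ`, the sign can be
replaced for odd `x` by the parity automorphism of `U(𝔤)`. -/
def leftLie (x : 𝔤) : P.TestFun →ₗ[K] P.TestFun where
  toFun φ :=
    TestFun.mk (P.leftRaw (AlgHom.id K _) (P.L.evenPart x) φ.val)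
      (P.leftRaw_mem _ (fun _ => rfl) _ φ.mem) +
    TestFun.mk (P.leftRaw P.L.parity (P.L.oddPart x) φ.val)
      (P.leftRaw_mem _ (fun y => P.L.parity_even (P.incl_mem y)) _ φ.mem)
  map_add' φ ψ := TestFun.ext fun u h => by
    simp only [TestFun.val_add, TestFun.val_mk, leftRaw_apply]
    ring
  map_smul' c φ := TestFun.ext fun u h => by
    simp only [TestFun.val_add, TestFun.val_smul, TestFun.val_mk, leftRaw_apply, RingHom.id_apply]
    ring

lemma leftLie_apply (x : 𝔤) (φ : P.TestFun) (u : P.L.Env) (h : G) :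
    (P.leftLie x φ).val u h = -φ.val (P.L.ι (P.Ad h⁻¹ (P.L.evenPart x)) * u) h
      - φ.val (P.L.parity (P.L.ι (P.Ad h⁻¹ (P.L.oddPart x)) * u)) h :=
  (sub_eq_add_neg _ _).symm

/-- The action of `a ∈ G` on functionals, `⟨L_a μ, φ⟩ = ⟨μ, L_{a⁻¹} φ⟩`. -/
def dualTranslate (a : G) (μ : P.Functional) : P.Functional := μ ∘ₗ P.translate a⁻¹

/-- The map `φ ↦ -(-1)^(|x| |L_x φ|) L_x φ`. -/
def signedLie : 𝔤 →ₗ[K] Module.End K P.TestFun :=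
  LinearMap.mk₂ K
    (fun x φ => -(P.leftLie (P.L.evenPart x) φ + P.parityFun (P.leftLie (P.L.oddPart x) φ)))
    (fun x y φ => TestFun.ext fun u h => by
      simp only [TestFun.val_neg, TestFun.val_add, parityFun_apply, leftLie_apply, map_add,
        add_mul, Pi.add_apply]
      ring)
    (fun c x φ => TestFun.ext fun u h => by
      simp only [TestFun.val_neg, TestFun.val_add, TestFun.val_smul, parityFun_apply,
        leftLie_apply, map_smul, Algebra.smul_mul_assoc, Pi.smul_apply, smul_eq_mul]
      ring)
    (fun x φ ψ => by rw [map_add, map_add, map_add]; abel)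
    (fun c x φ => by rw [map_smul, map_smul, map_smul, ← smul_add, smul_neg])

lemma signedLie_apply (x : 𝔤) (φ : P.TestFun) (u : P.L.Env) (h : G) :
    (P.signedLie x φ).val u h =
      φ.val (P.L.ι (P.Ad h⁻¹ (P.L.evenPart x - P.L.oddPart x)) * u) h := by
  have hp := P.L.parity_odd (P.Ad_mem h⁻¹ 1 _ (P.L.oddPart_mem x))
  simp only [signedLie, LinearMap.mk₂_apply, TestFun.val_neg, TestFun.val_add, parityFun_apply,
    leftLie_apply, P.L.evenPart_even (P.L.evenPart_mem x),
    P.L.oddPart_odd (P.L.oddPart_mem x), P.L.oddPart_even (P.L.evenPart_mem x),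
    P.L.evenPart_odd (P.L.oddPart_mem x), map_zero, zero_mul, Pi.zero_apply, map_mul, hp,
    P.L.parity_parity, map_sub, sub_mul, Pi.sub_apply, neg_mul, map_neg, Pi.neg_apply]
  ring

/-- The action of `x ∈ 𝔤` on functionals, `⟨L_x μ, φ⟩ = -(-1)^(|x| |μ|) ⟨μ, L_x φ⟩` for
homogeneous `x` and `μ`. (As `⟨μ, ψ⟩ = 0` unless `|ψ| = |μ|`, the sign is `(-1)^(|x| |L_x φ|)`.) -/
def dualLie : 𝔤 →ₗ[K] Module.End K P.Functional :=
  Module.Dual.transpose (R := K) (M := P.TestFun) (M' := P.TestFun) ∘ₗ P.signedLie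

lemma dualLie_apply (x : 𝔤) (μ : P.Functional) (φ : P.TestFun) :
    P.dualLie x μ φ = μ (P.signedLie x φ) := rfl

/-- The action `u ↦ L_u` of `U(𝔤)` on functionals extending the action of `𝔤`. -/
def dualAct : P.L.Env →ₐ[K] Module.End K P.Functional :=
  P.L.lift (A := Module.End K P.Functional) P.dualLie
    (P.L.rel_of_cases (A := Module.End K P.Functional) P.dualLie
    (by
      intro x hx y hy
      have hb := P.L.bracket_mem 0 0 x hx y hy
      simp only [zero_add] at hb
      refine LinearMap.ext fun (μ : P.Functional) => LinearMap.ext fun (φ : P.TestFun) => ?_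
      change μ (P.signedLie y (P.signedLie x φ)) =
        μ (P.signedLie x (P.signedLie y φ)) + μ (P.signedLie _ φ)
      rw [← map_add]
      congr 1
      refine TestFun.ext fun u h => ?_
      have hr := P.L.ι_mul_ι (P.Ad_mem h⁻¹ _ x hx) (P.Ad_mem h⁻¹ _ y hy)
      simp only [koszulSign, zero_ne_one, false_and, if_false, one_smul] at hr
      change (P.signedLie y _).val u h = (P.signedLie x _).val u h + (P.signedLie _ φ).val u h
      simp only [signedLie_apply, P.L.evenPart_even, P.L.oddPart_even, hx, hy, hb, sub_zero,
        ← mul_assoc, hr, add_mul, map_add, Pi.add_apply, P.Ad_bracket])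
    (by
      intro x hx y hy
      have hb := P.L.bracket_mem 0 1 x hx y hy
      simp only [zero_add] at hb
      refine LinearMap.ext fun (μ : P.Functional) => LinearMap.ext fun (φ : P.TestFun) => ?_
      change μ (P.signedLie y (P.signedLie x φ)) =
        μ (P.signedLie x (P.signedLie y φ)) + μ (P.signedLie _ φ)
      rw [← map_add]
      congr 1
      refine TestFun.ext fun u h => ?_
      have hr := P.L.ι_mul_ι (P.Ad_mem h⁻¹ _ x hx) (P.Ad_mem h⁻¹ _ y hy)
      simp only [koszulSign, zero_ne_one, false_and, if_false, one_smul] at hr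
      change (P.signedLie y _).val u h = (P.signedLie x _).val u h + (P.signedLie _ φ).val u h
      simp only [signedLie_apply, P.L.evenPart_even, P.L.oddPart_even, P.L.evenPart_odd,
        P.L.oddPart_odd, hx, hy, hb, sub_zero, zero_sub, map_neg, neg_mul, mul_neg,
        ← mul_assoc, hr, add_mul, map_add, Pi.add_apply, Pi.neg_apply, P.Ad_bracket]
      ring)
    (by
      intro x hx y hy
      have hb := P.L.bracket_mem 1 1 x hx y hy
      rw [show (1 + 1 : ZMod 2) = 0 from rfl] at hb
      refine LinearMap.ext fun (μ : P.Functional) => LinearMap.ext fun (φ : P.TestFun) => ?_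
      change μ (P.signedLie y (P.signedLie x φ)) =
        -μ (P.signedLie x (P.signedLie y φ)) + μ (P.signedLie _ φ)
      rw [← map_neg, ← map_add]
      congr 1
      refine TestFun.ext fun u h => ?_
      have hr := P.L.ι_mul_ι (P.Ad_mem h⁻¹ _ x hx) (P.Ad_mem h⁻¹ _ y hy)
      simp only [koszulSign, and_self, if_true, neg_smul, one_smul] at hr
      change (P.signedLie y _).val u h = -(P.signedLie x _).val u h + (P.signedLie _ φ).val u h
      simp only [signedLie_apply, P.L.evenPart_even, P.L.oddPart_even, P.L.evenPart_odd,
        P.L.oddPart_odd, hx, hy, hb, sub_zero, zero_sub, map_neg, neg_mul, mul_neg, neg_neg,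
        ← mul_assoc, hr, add_mul, map_add, Pi.add_apply, Pi.neg_apply, P.Ad_bracket]))

end LeftAction

end SupergroupPair

namespace SupergroupPair

variable {K : Type*} [RCLike K] {p : ℕ}
  {G : Type*} [TopologicalSpace G] [ChartedSpace (EuclideanSpace ℝ (Fin p)) G] [Group G]
  {𝔤 : Type*} [AddCommGroup 𝔤] [Module K 𝔤] (P : SupergroupPair K p G 𝔤)

/-- The odd modular character of `G`: the Berezinian of `Ad(g)` on the dual of the purely odd space
`𝔤 / 𝔤₀`, i.e. the determinant of `Ad(g)` on the odd part of `𝔤`. -/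
def DeltaOdd (g : G) : K :=
  LinearMap.det ((P.Ad g).toLinearMap.restrict (P.Ad_mem g 1))

variable [LieGroup (𝓡 p) ∞ G]

lemma continuous_DeltaOdd [FiniteDimensional K 𝔤] : Continuous P.DeltaOdd := by
  let b := Module.finBasis K (P.L.gr 1)
  have : P.DeltaOdd = fun g => (LinearMap.toMatrix b b
      ((P.Ad g).toLinearMap.restrict (P.Ad_mem g 1))).det := by
    ext g
    rw [LinearMap.det_toMatrix]
    rfl
  rw [this]
  refine Continuous.matrix_det (continuous_matrix fun i j => ?_)
  have h := (P.Ad_smooth (b.coord i ∘ₗ (P.L.gr 1).projectionOnto (P.L.gr 0) P.L.isCompl.symm)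
    (b j)).continuous
  refine h.congr fun g => ?_
  have hm := P.Ad_mem g 1 (b j) (b j).2
  rw [LinearMap.toMatrix_apply, LinearMap.comp_apply,
    Submodule.projectionOnto_apply_of_mem_left _ hm]
  rfl

/-- The superdistribution `|dg| Δ` on `G`, for `|dg| = ν` a Haar measure and `Δ` the odd modular
character: the measure `Δ(g) dν(g)`, evaluated on the restrictions `φ(1; ·)` of superfunctions to
the underlying Lie group. -/
def haarDelta [FiniteDimensional K 𝔤] [MeasurableSpace G] [BorelSpace G] (ν : Measure G)
    [ν.IsHaarMeasure] : P.Functional :=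
  have hint : ∀ φ : P.TestFun, Integrable (fun g => P.DeltaOdd g * φ.val 1 g) ν := fun φ => by
    obtain ⟨hφ, C, hC, -, h⟩ := φ.mem
    have hc : Continuous (φ.val 1) := continuousOn_univ.1 (hφ.1 1).1.continuousOn
    have hs : HasCompactSupport (φ.val 1) := by
      have : IsTopologicalGroup G := topologicalGroup_of_lieGroup (𝓡 p) ∞
      exact HasCompactSupport.intro hC fun g hg => h 1 g hg
    exact (P.continuous_DeltaOdd.mul hc).integrable_of_hasCompactSupport hs.mul_left
  { toFun := fun φ => ∫ g, P.DeltaOdd g * φ.val 1 g ∂ν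
    map_add' := fun φ ψ => by
      rw [← integral_add (hint φ) (hint ψ)]
      exact integral_congr_ae (.of_forall fun g => mul_add _ _ _)
    map_smul' := fun c φ => by
      rw [RingHom.id_apply, smul_eq_mul, ← integral_const_mul]
      exact integral_congr_ae (.of_forall fun g => mul_left_comm _ _ _) }

/-- The ordered product `ξ^I = ∏_{i ∈ I} ξ_i` of superfunctions on `U`. -/
def monomial (U : TopologicalSpace.Opens G) {q : ℕ} (ξ : Fin q → P.superFun U)
    (I : Finset (Fin q)) : P.L.Env →ₗ[K] (G → K) :=
  ((I.sort (· ≤ ·)).map fun i => (ξ i).1).foldr P.mul (P.one U)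

/-- A system of local coordinates `(u, ξ)` of the supermanifold `G` on the open set `U`.
The even coordinates are given by a chart of `G` with domain `U`, whose coordinate functions are
lifted to even superfunctions by an algebra morphism `pull : C^∞(U) → 𝒪(U)` which is a section of
the restriction to the underlying manifold; the odd coordinates are odd superfunctions `ξ_i`,
and it is required that any superfunction on `U` can be written uniquely as
`∑_I pull(a_I) ξ^I` with smooth functions `a_I`. -/
structure Coordinates (U : TopologicalSpace.Opens G) where
  chart : OpenPartialHomeomorph G (EuclideanSpace ℝ (Fin p))
  chart_mem : chart ∈ IsManifold.maximalAtlas (𝓡 p) ∞ G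
  chart_source : chart.source = U
  pull : smoothFun K p U →ₗ[K] P.superFun U
  pull_one : (pull ⟨_, smoothFun_one_mem p U⟩).1 = P.one U
  pull_mul : ∀ f g : smoothFun K p U,
    (pull ⟨f.1 * g.1, smoothFun_mul_mem f.2 g.2⟩).1 = P.mul (pull f).1 (pull g).1
  pull_even : ∀ (f : smoothFun K p U) (u : P.L.Env), (pull f).1 (P.L.parity u) = (pull f).1 u
  pull_body : ∀ f : smoothFun K p U, (pull f).1 1 = f.1
  ξ : Fin (Module.finrank K (P.L.gr 1)) → P.superFun U
  ξ_odd : ∀ i u, (ξ i).1 (P.L.parity u) = -(ξ i).1 u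
  expand : ∀ φ : P.superFun U,
    ∃! a : Finset (Fin (Module.finrank K (P.L.gr 1))) → smoothFun K p U,
      φ.1 = ∑ I, P.mul (pull (a I)).1 (P.monomial U ξ I)

variable {P} in
/-- The Berezin integral `∫ D(u, ξ) φ` in local coordinates: the Lebesgue integral of the
coefficient of `ξ_1 ⋯ ξ_q` of `φ`. -/
def Coordinates.berezinIntegral {U : TopologicalSpace.Opens G} (c : P.Coordinates U)
    (φ : P.superFun U) : K :=
  ∫ t in c.chart.target, ((c.expand φ).choose Finset.univ).1 (c.chart.symm t)

lemma mem_superFun_of_suppIn {U : TopologicalSpace.Opens G} (φ : P.TestFun)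
    (h : P.SuppIn φ.val U) : φ.val ∈ P.superFun U := by
  obtain ⟨C, -, hCU, h⟩ := h
  refine ⟨fun u => ⟨(φ.mem.1.1 u).1.mono fun _ _ => trivial, fun g hg => ?_⟩,
    fun x u g _ => φ.mem.1.2 x u g trivial⟩
  exact h u g fun hC => hg (hCU hC)

/-- The functional `μ` is given on `U` by the Berezinian density `D(u, ξ) f`, i.e.
`⟨μ, φ⟩ = ∫ D(u, ξ) f φ` for all superfunctions `φ` with compact support in `U`. -/
def Represents (μ : P.Functional) {U : TopologicalSpace.Opens G} (c : P.Coordinates U)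
    (f : P.superFun U) : Prop :=
  ∀ (φ : P.TestFun) (h : P.SuppIn φ.val U),
    μ φ = c.berezinIntegral ⟨P.mul f.1 φ.val, P.mul_mem f.2 (P.mem_superFun_of_suppIn φ h)⟩

/-- Berezinian densities on `G`, considered as superdistributions `φ ↦ ∫ ω φ`: the functionals
which in suitable local coordinates around any point are of the form `D(u, ξ) f` with a
superfunction `f`. -/
def IsBerezinDensity (μ : P.Functional) : Prop :=
  ∀ g : G, ∃ (U : TopologicalSpace.Opens G) (c : P.Coordinates U) (f : P.superFun U),
    g ∈ U ∧ P.Represents μ c f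

/-- Nowhere vanishing Berezinian densities: those for which the local coefficients `f` can be taken
invertible, i.e. with non-zero value at the given point. -/
def IsNowhereVanishing (μ : P.Functional) : Prop :=
  ∀ g : G, ∃ (U : TopologicalSpace.Opens G) (c : P.Coordinates U) (f : P.superFun U),
    g ∈ U ∧ P.Represents μ c f ∧ f.1 1 g ≠ 0

/-- Nowhere vanishing Berezinian densities `|Dg|` which are invariant under left translations by
the Lie supergroup, i.e. invariant under `G` and annihilated by `𝔤`. -/
structure IsInvariantBerezinDensity [FiniteDimensional K 𝔤] (μ : P.Functional) : Prop where
  isBerezinDensity : P.IsBerezinDensity μ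
  isNowhereVanishing : P.IsNowhereVanishing μ
  translate_eq : ∀ a : G, P.dualTranslate a μ = μ
  lie_eq_zero : ∀ x : 𝔤, P.dualLie x μ = 0

end SupergroupPair

end

set_option linter.unusedSectionVars false

noncomputable section

/-! The proof is algebra in `U(𝔤)/I_δ` followed by analysis on the underlying Lie group. Let `e_1,
…, e_q` be a basis of the odd part and `e_I` the ordered products.

Algebra. By a relative Poincaré–Birkhoff–Witt theorem, a map on `U(𝔤)` that is linear under the even
part is determined by its values on the `e_I`, and these values are arbitrary. Uniqueness comes from
the filtration by the number of odd factors (`filt_le_of_mono_mem`), existence from an explicit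
coinduced module (`exists_coind`). With trivial coefficients this gives the functional `top`, which
kills left multiples of even elements and reads off the coefficient of `e_1 ⋯ e_q`. Moving an even
`x` across `e_1 ⋯ e_q` costs the trace of `ad x`, so `top(u x) = δ(x) top(u)`, and the pairing
`top(v u)` descends in `u` to `U(𝔤)/I_δ`. On the products `e_I` the pairing is triangular with
non-zero diagonal, so its kernel in `u` is exactly `I_δ` (`mem_idealDelta_iff`). The class of `γ` is
invariant iff `top(u γ) = ε(u) top(γ)` with `ε` the counit; by nondegeneracy there is exactly one
such class up to scalars, and `top(γ) ≠ 0` on it. Since `Ad(g)` scales `top` by `Δ_odd(g)`, it acts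
on the invariant class by `Δ_odd(g)`.

Invariance. Integration by parts gives `L_x(|dg| Δ_odd) = δ(x) |dg| Δ_odd` for even `x`, hence `I_δ`
annihilates `|dg| Δ_odd`, and `L_γ(|dg| Δ_odd)` is killed by `𝔤` because `𝔤 γ ⊆ I_δ`. Translation by
`a` multiplies `|dg| Δ_odd` by `Δ_odd(a)⁻¹` and the class of `γ` by `Δ_odd(a)`; the two factors
cancel.

Non-vanishing. Integrating by parts until only the products `e_I` remain puts `L_γ(|dg| Δ_odd)` in
the form `φ ↦ ∑_I ∫ l_I φ(e_I)` with smooth `l_I`. Testing on superfunctions with only a top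
component shows that the top coefficient is the constant `± top(γ)`. In coordinates given by a chart
and the dual odd coordinates, where Haar measure has a smooth density (`exists_haar_density`), the
functional is `D(u, ξ) f` with `f` invertible because this constant is non-zero.

Uniqueness. A functional killed by `𝔤` is determined by its values on superfunctions with only a top
component, since lower components can be removed by infinitesimal translates
(`eq_zero_of_dualLie_eq_zero`). On those, a nowhere vanishing Berezinian density is locally
integration against a continuous density with respect to Haar measure, and left invariance makes it
one non-zero constant (`exists_topDensity_const`). Two invariant densities are therefore
proportional. -/

namespace LieSuperalgebra

/-! ### Recursive construction of the coinduced module. -/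

section Coinduced

variable {K 𝔤 : Type*} [Field K] [AddCommGroup 𝔤] [Module K 𝔤] (L : LieSuperalgebra K 𝔤)
  {ι : Type*} [LinearOrder ι] [Fintype ι] (b : Module.Basis ι K (L.gr 1))
  {V : Type*} [AddCommGroup V] [Module K V] (ρ : L.gr 0 →ₗ[K] Module.End K V)

lemma bracket_even_even {x y : 𝔤} (hx : x ∈ L.gr 0) (hy : y ∈ L.gr 0) :
    L.bracket x y ∈ L.gr 0 := by simpa using L.bracket_mem 0 0 x hx y hy

lemma bracket_even_odd' {x y : 𝔤} (hx : x ∈ L.gr 0) (hy : y ∈ L.gr 1) :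
    L.bracket x y ∈ L.gr 1 := by simpa using L.bracket_mem 0 1 x hx y hy

lemma bracket_odd_even {x y : 𝔤} (hx : x ∈ L.gr 1) (hy : y ∈ L.gr 0) :
    L.bracket x y ∈ L.gr 1 := by simpa using L.bracket_mem 1 0 x hx y hy

lemma bracket_odd_odd {x y : 𝔤} (hx : x ∈ L.gr 1) (hy : y ∈ L.gr 1) :
    L.bracket x y ∈ L.gr 0 := L.bracket_mem 1 1 x hx y hy

lemma bracket_skew_odd_even {x y : 𝔤} (hx : x ∈ L.gr 1) (hy : y ∈ L.gr 0) :
    L.bracket x y = -L.bracket y x := by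
  simpa [koszulSign] using L.bracket_skew 1 0 x hx y hy

lemma bracket_symm_odd {x y : 𝔤} (hx : x ∈ L.gr 1) (hy : y ∈ L.gr 1) :
    L.bracket x y = L.bracket y x := by
  simpa [koszulSign] using L.bracket_skew 1 1 x hx y hy

lemma jacobi_even {x : 𝔤} (hx : x ∈ L.gr 0) {y : 𝔤} {j : ZMod 2} (hy : y ∈ L.gr j) (z : 𝔤) :
    L.bracket x (L.bracket y z) = L.bracket (L.bracket x y) z + L.bracket y (L.bracket x z) := by
  simpa [koszulSign] using L.jacobi 0 j x hx y hy z

lemma jacobi_odd {x y : 𝔤} (hx : x ∈ L.gr 1) (hy : y ∈ L.gr 1) (z : 𝔤) :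
    L.bracket x (L.bracket y z) = L.bracket (L.bracket x y) z - L.bracket y (L.bracket x z) := by
  simpa [koszulSign, sub_eq_add_neg] using L.jacobi 1 1 x hx y hy z

/-- The even part as a map into the even subspace. -/
def toEven : 𝔤 →ₗ[K] L.gr 0 := (L.gr 0).projectionOnto (L.gr 1) L.isCompl

/-- The odd part as a map into the odd subspace. -/
def toOdd : 𝔤 →ₗ[K] L.gr 1 := (L.gr 1).projectionOnto (L.gr 0) L.isCompl.symm

lemma toOdd_even {x : 𝔤} (hx : x ∈ L.gr 0) : L.toOdd x = 0 :=
  Subtype.ext (L.oddPart_even hx)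

lemma toEven_even {x : 𝔤} (hx : x ∈ L.gr 0) : L.toEven x = ⟨x, hx⟩ :=
  Subtype.ext (L.evenPart_even hx)

lemma toOdd_odd {x : 𝔤} (hx : x ∈ L.gr 1) : L.toOdd x = ⟨x, hx⟩ :=
  Subtype.ext (L.oddPart_odd hx)

lemma toEven_odd {x : 𝔤} (hx : x ∈ L.gr 1) : L.toEven x = 0 :=
  Subtype.ext (L.evenPart_odd hx)

/-- The coefficient of `e_i` in one step of the recursive construction of the coinduced module. -/
def coindOddRow (S : 𝔤 →ₗ[K] (List ι → V) →ₗ[K] (List ι → V)) (j : ι) (J : List ι) (i : ι) :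
    (List ι → V) →ₗ[K] V :=
  -- A component `f I` stands for `φ(e_{I reversed})` with `φ` linear under the even part, and `x`
  -- acts by `φ ↦ φ(· x)`. The row at `j :: J` is thus `φ(⋯ e_j e_i)`: already ordered for `j < i`,
  -- rewritten by `e_j e_j = ½ [e_j, e_j]` for `i = j`, and by `e_j e_i = [e_j, e_i] - e_i e_j` for
  -- `i < j`.
  if j < i then LinearMap.proj (i :: j :: J) else
    if i = j then (2⁻¹ : K) • LinearMap.proj J ∘ₗ S (L.bracket (b j) (b j)) else
      LinearMap.proj J ∘ₗ S (L.bracket (b j) (b i)) - LinearMap.proj J ∘ₗ S (b i) ∘ₗ S (b j)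

open Classical in
/-- The components of one step in the recursive construction of the coinduced module. -/
def coindRow (S : 𝔤 →ₗ[K] (List ι → V) →ₗ[K] (List ι → V)) :
    List ι → 𝔤 → (List ι → V) → V
  | [], x, f => ρ (L.toEven x) (f []) + ∑ i, b.coord i (L.toOdd x) • f [i]
  | j :: J, x, f => if (j :: J).Pairwise (· > ·) then
      S (L.toEven x) (S (b j) f) J + S (L.bracket (b j) (L.toEven x)) f J
        + ∑ i, b.coord i (L.toOdd x) • L.coindOddRow b S j J i f
      else 0

/-- One step in the recursive construction of the coinduced module: an operator family `S`, which is
correct on the components of small length, is improved by moving the letter `x` to its place. -/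
def coindStep (S : 𝔤 →ₗ[K] (List ι → V) →ₗ[K] (List ι → V)) :
    𝔤 →ₗ[K] (List ι → V) →ₗ[K] (List ι → V) :=
  LinearMap.mk₂ K (fun x f I => L.coindRow b ρ S I x f)
    (fun x y f => by
      ext I
      change L.coindRow b ρ S I (x + y) f = L.coindRow b ρ S I x f + L.coindRow b ρ S I y f
      rcases I with _ | ⟨j, J⟩ <;> simp only [coindRow]
      · simp only [map_add, add_smul, Finset.sum_add_distrib, LinearMap.add_apply]; abel
      · split_ifs
        · simp only [map_add, Submodule.coe_add, add_smul, Finset.sum_add_distrib,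
            LinearMap.add_apply, Pi.add_apply]; abel
        · rw [add_zero])
    (fun c x f => by
      ext I
      change L.coindRow b ρ S I (c • x) f = c • L.coindRow b ρ S I x f
      rcases I with _ | ⟨j, J⟩ <;> simp only [coindRow]
      · simp only [map_smul, smul_add, Finset.smul_sum, LinearMap.smul_apply, smul_assoc]
      · split_ifs
        · simp only [map_smul, Submodule.coe_smul, smul_add, Finset.smul_sum,
            LinearMap.smul_apply, smul_assoc, Pi.smul_apply]
        · rw [smul_zero])
    (fun x f g => by
      ext I
      change L.coindRow b ρ S I x (f + g) = L.coindRow b ρ S I x f + L.coindRow b ρ S I x g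
      rcases I with _ | ⟨j, J⟩ <;> simp only [coindRow]
      · simp only [map_add, Pi.add_apply, smul_add, Finset.sum_add_distrib]; abel
      · split_ifs
        · simp only [map_add, Pi.add_apply, smul_add, Finset.sum_add_distrib]; abel
        · rw [add_zero])
    (fun c x f => by
      ext I
      change L.coindRow b ρ S I x (c • f) = c • L.coindRow b ρ S I x f
      rcases I with _ | ⟨j, J⟩ <;> simp only [coindRow]
      · simp only [map_smul, Pi.smul_apply, smul_add, Finset.smul_sum, smul_comm c]
      · split_ifs
        · simp only [map_smul, Pi.smul_apply, smul_add, Finset.smul_sum, smul_comm c]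
        · rw [smul_zero])

variable (S : 𝔤 →ₗ[K] (List ι → V) →ₗ[K] (List ι → V))

lemma coindStep_apply (x : 𝔤) (f : List ι → V) (I : List ι) :
    L.coindStep b ρ S x f I = L.coindRow b ρ S I x f := rfl

lemma coindStep_not_sorted (x : 𝔤) (f : List ι → V) {I : List ι} (hI : ¬ I.Pairwise (· > ·)) :
    L.coindStep b ρ S x f I = 0 := by
  rcases I with _ | ⟨j, J⟩
  · exact (hI List.Pairwise.nil).elim
  · rw [coindStep_apply, coindRow, if_neg hI]

lemma coindStep_nil_even (x : L.gr 0) (f : List ι → V) :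
    L.coindStep b ρ S x f [] = ρ x (f []) := by
  simp [coindStep_apply, coindRow, L.toEven_even x.2, L.toOdd_even x.2]

lemma sum_coord_odd (i : ι) (F : ι → V) :
    ∑ k, b.coord k (L.toOdd (b i)) • F k = F i := by
  classical
  rw [L.toOdd_odd (b i).2, Finset.sum_eq_single i]
  · simp
  · intro k _ h
    simp [h.symm]
  · simp

lemma coindStep_cons_odd {j : ι} {J : List ι} (h : (j :: J).Pairwise (· > ·)) (i : ι)
    (f : List ι → V) :
    L.coindStep b ρ S (b i) f (j :: J) = L.coindOddRow b S j J i f := by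
  rw [coindStep_apply, coindRow, if_pos h]
  simp only [L.sum_coord_odd, L.toEven_odd (b i).2, map_zero, LinearMap.zero_apply, zero_add,
      Submodule.coe_zero, Pi.zero_apply]

lemma coindStep_create {j : ι} {J : List ι} (h : (j :: J).Pairwise (· > ·)) (f : List ι → V) :
    L.coindStep b ρ S (b j) f J = f (j :: J) := by
  rcases J with _ | ⟨k, J⟩
  · simp only [coindStep_apply, coindRow, L.sum_coord_odd, L.toEven_odd (b j).2, map_zero,
      LinearMap.zero_apply, zero_add]
  · have hk : k < j := (List.pairwise_cons.1 h).1 k (by simp)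
    rw [coindStep_cons_odd _ _ _ _ (List.Pairwise.of_cons h), coindOddRow, if_pos hk]
    rfl

lemma coindStep_cons_even {j : ι} {J : List ι} (h : (j :: J).Pairwise (· > ·)) (x : L.gr 0)
    (f : List ι → V) :
    L.coindStep b ρ S x f (j :: J) = S x (S (b j) f) J + S (L.bracket (b j) x) f J := by
  rw [coindStep_apply, coindRow, if_pos h]
  simp [L.toEven_even x.2, L.toOdd_even x.2]

lemma coindStep_cons_lt {i j : ι} {J : List ι} (h : (j :: J).Pairwise (· > ·)) (hij : i < j)
    (f : List ι → V) :
    L.coindStep b ρ S (b i) f (j :: J) =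
      S (L.bracket (b j) (b i)) f J - S (b i) (S (b j) f) J := by
  rw [coindStep_cons_odd _ _ _ _ h, coindOddRow, if_neg hij.not_gt, if_neg hij.ne]
  rfl

lemma coindStep_cons_self {j : ι} {J : List ι} (h : (j :: J).Pairwise (· > ·))
    (f : List ι → V) :
    L.coindStep b ρ S (b j) f (j :: J) = (2⁻¹ : K) • S (L.bracket (b j) (b j)) f J := by
  rw [coindStep_cons_odd _ _ _ _ h, coindOddRow, if_neg (lt_irrefl j), if_pos rfl]
  rfl

/-- The statement that the `I`-components of `S x f` and `S' x f'` agree whenever `f` and `f'` agree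
on those components on which they should depend. -/
def CoindAgree (S S' : 𝔤 →ₗ[K] (List ι → V) →ₗ[K] (List ι → V)) (I : List ι) : Prop :=
  (∀ (x : L.gr 0) (f f' : List ι → V),
    (∀ J : List ι, J.Pairwise (· > ·) → J.length ≤ I.length → f J = f' J) →
      S x f I = S' x f' I) ∧
  -- For an odd letter the components one longer than `I` also matter, but only those with entries
  -- below `j`, if `i` and the entries of `I` are below `j`. The value `⊤` imposes no bound.
  (∀ (j : WithTop ι) (i : ι) (f f' : List ι → V), (i : WithTop ι) < j →
    (∀ k ∈ I, (k : WithTop ι) < j) →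
    (∀ J : List ι, J.Pairwise (· > ·) → J.length ≤ I.length → f J = f' J) →
    (∀ J : List ι, J.Pairwise (· > ·) → J.length = I.length + 1 →
      (∀ k ∈ J, (k : WithTop ι) < j) → f J = f' J) →
      S (b i) f I = S' (b i) f' I)

lemma CoindAgree.odd {S S' : 𝔤 →ₗ[K] (List ι → V) →ₗ[K] (List ι → V)} {I : List ι}
    (h : L.CoindAgree b S S' I) (x : L.gr 1) {f f' : List ι → V}
    (hf : ∀ J : List ι, J.Pairwise (· > ·) → J.length ≤ I.length + 1 → f J = f' J) :
    S x f I = S' x f' I := by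
  have e : (x : 𝔤) = ∑ i, b.repr x i • (b i : 𝔤) := by
    conv_lhs => rw [← b.sum_repr x]
    simp only [Submodule.coe_sum, Submodule.coe_smul]
  rw [e]
  simp only [map_sum, map_smul, LinearMap.sum_apply, LinearMap.smul_apply, Finset.sum_apply,
    Pi.smul_apply]
  refine Finset.sum_congr rfl fun i _ => congrArg _ ?_
  exact h.2 ⊤ i f f' (WithTop.coe_lt_top _) (fun k _ => WithTop.coe_lt_top _)
    (fun J hJ h1 => hf J hJ (h1.trans (Nat.le_succ _))) (fun J hJ h1 _ => hf J hJ h1.le)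

/-- The iterated improvement, starting from `0`. -/
def coindIter (n : ℕ) : 𝔤 →ₗ[K] (List ι → V) →ₗ[K] (List ι → V) :=
  (L.coindStep b ρ)^[n] 0

lemma coindIter_succ (n : ℕ) :
    L.coindIter b ρ (n + 1) = L.coindStep b ρ (L.coindIter b ρ n) :=
  Function.iterate_succ_apply' _ _ _

/-- Induction on the length of `I`. A row at `j₀ :: I` evaluates the previous operator at `I`, but
on the argument `S (b j₀) f`, and an odd letter `e_i` with `i < j₀` reads this argument also on
lists longer than `I`. Those lists have all entries below `j₀`, and there `e_{j₀}` merely prepends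
itself, so the recursion does not have to be settled at the longer length. -/
lemma coindIter_agree : ∀ (I : List ι), I.Pairwise (· > ·) → ∀ m n : ℕ, I.length < m →
    I.length < n → L.CoindAgree b (L.coindIter b ρ m) (L.coindIter b ρ n) I := by
  intro I
  induction hl : I.length using Nat.strong_induction_on generalizing I with
  | _ l ih =>
  intro hI m n hm hn
  obtain ⟨m, rfl⟩ := Nat.exists_eq_succ_of_ne_zero (Nat.ne_of_gt (Nat.zero_lt_of_lt hm))
  obtain ⟨n, rfl⟩ := Nat.exists_eq_succ_of_ne_zero (Nat.ne_of_gt (Nat.zero_lt_of_lt hn))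
  simp only [Nat.succ_eq_add_one, coindIter_succ]
  rcases I with _ | ⟨j₀, I⟩
  · refine ⟨fun x f f' h => ?_, fun j i f f' hij hI h1 h2 => ?_⟩
    · rw [coindStep_nil_even, coindStep_nil_even, h [] List.Pairwise.nil le_rfl]
    · rw [coindStep_create _ _ _ _ (List.pairwise_singleton _ _),
        coindStep_create _ _ _ _ (List.pairwise_singleton _ _)]
      exact h2 [i] (List.pairwise_singleton _ _) rfl (by simpa using hij)
  · have hI' := List.Pairwise.of_cons hI
    have hlt := (List.pairwise_cons.1 hI).1
    simp only [List.length_cons] at hl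
    have key : ∀ J : List ι, J.Pairwise (· > ·) → J.length ≤ I.length →
        L.CoindAgree b (L.coindIter b ρ m) (L.coindIter b ρ n) J := fun J hJ hJl =>
      ih J.length (by omega) J rfl hJ m n (by omega) (by omega)
    have cr : ∀ f f' : List ι → V, (∀ J : List ι, J.Pairwise (· > ·) → J.length ≤ I.length + 1 →
        f J = f' J) → ∀ J : List ι, J.Pairwise (· > ·) → J.length ≤ I.length →
        L.coindIter b ρ m (b j₀) f J = L.coindIter b ρ n (b j₀) f' J := fun f f' h J hJ hJl =>
      (key J hJ hJl).odd _ _ _ fun J' hJ' hl' => h J' hJ' (by omega)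
    refine ⟨fun x f f' h => ?_, fun j i f f' hij hIj h1 h2 => ?_⟩
    · rw [coindStep_cons_even _ _ _ _ hI, coindStep_cons_even _ _ _ _ hI]
      congr 1
      · exact (key I hI' le_rfl).1 x _ _ (cr f f' fun J hJ hJl => h J hJ hJl)
      · exact (key I hI' le_rfl).odd _ _ ⟨_, L.bracket_odd_even (b j₀).2 x.2⟩
          fun J hJ hJl => h J hJ hJl
    · rcases lt_trichotomy i j₀ with hi | rfl | hi
      · rw [coindStep_cons_lt _ _ _ _ hI hi, coindStep_cons_lt _ _ _ _ hI hi]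
        congr 1
        · exact (key I hI' le_rfl).1 ⟨_, L.bracket_odd_odd (b j₀).2 (b i).2⟩ _ _
            fun J hJ hJl => h1 J hJ (by simp; omega)
        · refine (key I hI' le_rfl).2 j₀ i _ _ (WithTop.coe_lt_coe.2 hi)
            (fun k hk => WithTop.coe_lt_coe.2 (hlt k hk))
            (cr f f' fun J hJ hJl => h1 J hJ hJl) fun J hJ hJl hJj => ?_
          have hs : (j₀ :: J).Pairwise (· > ·) :=
            List.pairwise_cons.2 ⟨fun k hk => WithTop.coe_lt_coe.1 (hJj k hk), hJ⟩
          obtain ⟨m, rfl⟩ := Nat.exists_eq_succ_of_ne_zero (show m ≠ 0 by omega)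
          obtain ⟨n, rfl⟩ := Nat.exists_eq_succ_of_ne_zero (show n ≠ 0 by omega)
          simp only [Nat.succ_eq_add_one, coindIter_succ]
          rw [coindStep_create _ _ _ _ hs, coindStep_create _ _ _ _ hs]
          refine h2 _ hs (by simp [hJl]) fun k hk => ?_
          rcases List.mem_cons.1 hk with rfl | hk
          · exact hIj _ (by simp)
          · exact (hJj k hk).trans (hIj _ (by simp))
      · rw [coindStep_cons_self _ _ _ _ hI, coindStep_cons_self _ _ _ _ hI]
        congr 1
        exact (key I hI' le_rfl).1 ⟨_, L.bracket_odd_odd (b i).2 (b i).2⟩ _ _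
            fun J hJ hJl => h1 J hJ (by simp; omega)
      · have hs : (i :: j₀ :: I).Pairwise (· > ·) := by
          refine List.pairwise_cons.2 ⟨fun k hk => ?_, hI⟩
          rcases List.mem_cons.1 hk with rfl | hk
          · exact hi
          · exact lt_trans (hlt k hk) hi
        rw [coindStep_create _ _ _ _ hs, coindStep_create _ _ _ _ hs]
        refine h2 _ hs rfl fun k hk => ?_
        rcases List.mem_cons.1 hk with rfl | hk
        · exact hij
        · exact hIj _ hk

/-- The action of `𝔤` on the coinduced module. -/
def coindOp : 𝔤 →ₗ[K] (List ι → V) →ₗ[K] (List ι → V) := L.coindIter b ρ (Fintype.card ι + 1)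

lemma length_le_of_sorted {I : List ι} (hI : I.Pairwise (· > ·)) :
    I.length ≤ Fintype.card ι := List.Nodup.length_le_card (hI.imp fun h => ne_of_gt h)

lemma coindOp_agree {I : List ι} (hI : I.Pairwise (· > ·)) :
    L.CoindAgree b (L.coindOp b ρ) (L.coindOp b ρ) I :=
  L.coindIter_agree b ρ I hI _ _ (Nat.lt_succ_of_le (length_le_of_sorted hI))
    (Nat.lt_succ_of_le (length_le_of_sorted hI))

/-- The iteration has become stationary: a strictly decreasing list has at most `card ι` entries,
and its row is settled once the number of iterations exceeds its length. All other rows are zero on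
both sides. -/
lemma coindOp_eq_step (x : 𝔤) (f : List ι → V) (I : List ι) :
    L.coindOp b ρ x f I = L.coindStep b ρ (L.coindOp b ρ) x f I := by
  by_cases hI : I.Pairwise (· > ·)
  · have hl := length_le_of_sorted hI
    have h : L.CoindAgree b (L.coindOp b ρ) (L.coindStep b ρ (L.coindOp b ρ)) I := by
      rw [coindOp, ← coindIter_succ]
      exact L.coindIter_agree b ρ I hI _ _ (by omega) (by omega)
    rw [← L.even_add_odd x]
    simp only [map_add, LinearMap.add_apply, Pi.add_apply]
    congr 1
    · exact h.1 ⟨_, L.evenPart_mem x⟩ f f fun _ _ _ => rfl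
    · exact h.odd _ _ ⟨_, L.oddPart_mem x⟩ fun _ _ _ => rfl
  · rw [coindStep_not_sorted _ _ _ _ _ _ hI, coindOp, coindIter_succ,
      coindStep_not_sorted _ _ _ _ _ _ hI]

end Coinduced

end LieSuperalgebra

namespace LieSuperalgebra

/-! ### Commutation relations and the relative Poincaré–Birkhoff–Witt theorem. -/

section CoinducedRelations

variable {K 𝔤 : Type*} [Field K] [AddCommGroup 𝔤] [Module K 𝔤] (L : LieSuperalgebra K 𝔤)
  {ι : Type*} [LinearOrder ι] [Fintype ι] (b : Module.Basis ι K (L.gr 1))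
  {V : Type*} [AddCommGroup V] [Module K V] (ρ : L.gr 0 →ₗ[K] Module.End K V)

lemma coindOp_nil (x : L.gr 0) (f : List ι → V) : L.coindOp b ρ x f [] = ρ x (f []) := by
  rw [coindOp_eq_step, coindStep_nil_even]

lemma coindOp_create {j : ι} {J : List ι} (h : (j :: J).Pairwise (· > ·)) (f : List ι → V) :
    L.coindOp b ρ (b j) f J = f (j :: J) := by
  rw [coindOp_eq_step, coindStep_create _ _ _ _ h]

lemma coindOp_even {j : ι} {J : List ι} (h : (j :: J).Pairwise (· > ·)) (x : L.gr 0)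
    (f : List ι → V) :
    L.coindOp b ρ x f (j :: J) =
      L.coindOp b ρ x (L.coindOp b ρ (b j) f) J + L.coindOp b ρ (L.bracket (b j) x) f J := by
  rw [coindOp_eq_step, coindStep_cons_even _ _ _ _ h]

lemma coindOp_lt {i j : ι} {J : List ι} (h : (j :: J).Pairwise (· > ·)) (hij : i < j)
    (f : List ι → V) :
    L.coindOp b ρ (b i) f (j :: J) =
      L.coindOp b ρ (L.bracket (b j) (b i)) f J
        - L.coindOp b ρ (b i) (L.coindOp b ρ (b j) f) J := by
  rw [coindOp_eq_step, coindStep_cons_lt _ _ _ _ h hij]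

lemma coindOp_self {j : ι} {J : List ι} (h : (j :: J).Pairwise (· > ·)) (f : List ι → V) :
    L.coindOp b ρ (b j) f (j :: J) = (2⁻¹ : K) • L.coindOp b ρ (L.bracket (b j) (b j)) f J := by
  rw [coindOp_eq_step, coindStep_cons_self _ _ _ _ h]

lemma coindOp_not_sorted (x : 𝔤) (f : List ι → V) {I : List ι} (hI : ¬ I.Pairwise (· > ·)) :
    L.coindOp b ρ x f I = 0 := by
  rw [coindOp_eq_step, coindStep_not_sorted _ _ _ _ _ _ hI]

/-- The commutation relations of the operators `coindOp` on the `I`-components. -/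
structure CoindRel (I : List ι) : Prop where
  even_even : ∀ (x y : L.gr 0) (f : List ι → V), L.coindOp b ρ x (L.coindOp b ρ y f) I =
    L.coindOp b ρ y (L.coindOp b ρ x f) I + L.coindOp b ρ (L.bracket x y) f I
  even_odd : ∀ (x : L.gr 0) (y : L.gr 1) (f : List ι → V),
    L.coindOp b ρ x (L.coindOp b ρ y f) I =
      L.coindOp b ρ y (L.coindOp b ρ x f) I + L.coindOp b ρ (L.bracket x y) f I
  odd_odd : ∀ (x y : L.gr 1) (f : List ι → V), L.coindOp b ρ x (L.coindOp b ρ y f) I =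
    -L.coindOp b ρ y (L.coindOp b ρ x f) I + L.coindOp b ρ (L.bracket x y) f I

lemma coe_eq_sum_basis (y : L.gr 1) : (y : 𝔤) = ∑ i, b.repr y i • (b i : 𝔤) := by
  conv_lhs => rw [← b.sum_repr y]
  simp only [Submodule.coe_sum, Submodule.coe_smul]

lemma even_odd_of_basis {I : List ι}
    (h : ∀ (x : L.gr 0) (i : ι) (f : List ι → V), L.coindOp b ρ x (L.coindOp b ρ (b i) f) I =
      L.coindOp b ρ (b i) (L.coindOp b ρ x f) I + L.coindOp b ρ (L.bracket x (b i)) f I)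
    (x : L.gr 0) (y : L.gr 1) (f : List ι → V) :
    L.coindOp b ρ x (L.coindOp b ρ y f) I =
      L.coindOp b ρ y (L.coindOp b ρ x f) I + L.coindOp b ρ (L.bracket x y) f I := by
  rw [L.coe_eq_sum_basis b y]
  simp only [map_sum, map_smul, LinearMap.sum_apply, LinearMap.smul_apply, Finset.sum_apply,
    Pi.smul_apply, h, smul_add, Finset.sum_add_distrib]

lemma odd_odd_of_basis {I : List ι}
    (h : ∀ (i k : ι) (f : List ι → V), i ≤ k →
      L.coindOp b ρ (b i) (L.coindOp b ρ (b k) f) I =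
      -L.coindOp b ρ (b k) (L.coindOp b ρ (b i) f) I + L.coindOp b ρ (L.bracket (b i) (b k)) f I)
    (x y : L.gr 1) (f : List ι → V) :
    L.coindOp b ρ x (L.coindOp b ρ y f) I =
      -L.coindOp b ρ y (L.coindOp b ρ x f) I + L.coindOp b ρ (L.bracket x y) f I := by
  have h' : ∀ (i k : ι) (f : List ι → V), L.coindOp b ρ (b i) (L.coindOp b ρ (b k) f) I =
      -L.coindOp b ρ (b k) (L.coindOp b ρ (b i) f) I
        + L.coindOp b ρ (L.bracket (b i) (b k)) f I := fun i k f => by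
    rcases le_total i k with hik | hik
    · exact h i k f hik
    · rw [h k i f hik, L.bracket_symm_odd (b k).2 (b i).2]; abel
  obtain ⟨C, hC⟩ : ∃ C : ι → ι → V, ∀ i k, C i k = -L.coindOp b ρ (b k) (L.coindOp b ρ (b i) f) I
      + L.coindOp b ρ (L.bracket (b i) (b k)) f I := ⟨_, fun _ _ => rfl⟩
  rw [L.coe_eq_sum_basis b y, L.coe_eq_sum_basis b x]
  simp only [map_sum, map_smul, LinearMap.sum_apply, LinearMap.smul_apply, Finset.sum_apply,
    Pi.smul_apply]
  have hC' : ∀ i k, L.coindOp b ρ (b i) (L.coindOp b ρ (b k) f) I = C i k := fun i k =>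
    (h' i k f).trans (hC i k).symm
  conv_lhs => simp only [hC']
  simp only [hC, smul_add, Finset.sum_add_distrib, Finset.smul_sum, smul_neg,
    Finset.sum_neg_distrib]
  congr 2
  rw [Finset.sum_comm]
  exact Finset.sum_congr rfl fun i _ => Finset.sum_congr rfl fun k _ => smul_comm _ _ _

variable [CharZero K] (hρ : ∀ (x y : L.gr 0) (v : V),
  ρ ⟨L.bracket x y, L.bracket_even_even x.2 y.2⟩ v = ρ x (ρ y v) - ρ y (ρ x v))

/-- Commuting an even letter past the basis vector `e_j` on components below `j`. -/
lemma coindOp_move {j : ι} {J : List ι} (h : (j :: J).Pairwise (· > ·)) (x : L.gr 0)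
    (f : List ι → V) :
    L.coindOp b ρ (b j) (L.coindOp b ρ x f) J =
      L.coindOp b ρ x (L.coindOp b ρ (b j) f) J + L.coindOp b ρ (L.bracket (b j) x) f J := by
  rw [coindOp_create _ _ _ h, coindOp_even _ _ _ h]

/-- Anticommuting basis vectors `e_i`, `e_j` with `i ≤ j` on components below `j`. -/
lemma coindOp_move_odd {i j : ι} {J : List ι} (h : (j :: J).Pairwise (· > ·)) (hij : i ≤ j)
    (f : List ι → V) :
    L.coindOp b ρ (b j) (L.coindOp b ρ (b i) f) J =
      -L.coindOp b ρ (b i) (L.coindOp b ρ (b j) f) J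
        + L.coindOp b ρ (L.bracket (b j) (b i)) f J := by
  rcases hij.lt_or_eq with hij | rfl
  · rw [coindOp_create _ _ _ h, coindOp_lt _ _ _ h hij]; abel
  · rw [coindOp_create _ _ _ h, coindOp_self _ _ _ h]
    module

lemma cons_sorted {j : ι} {J : List ι} (hJ : J.Pairwise (· > ·))
    (hj : ∀ k ∈ J, (k : WithTop ι) < j) : (j :: J).Pairwise (· > ·) :=
  List.pairwise_cons.2 ⟨fun k hk => WithTop.coe_lt_coe.1 (hj k hk), hJ⟩

section Step

variable {j : ι} {J : List ι} (h : (j :: J).Pairwise (· > ·))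
  (ih : ∀ I : List ι, I.Pairwise (· > ·) → I.length ≤ J.length → L.CoindRel b ρ I)

include h

lemma coindOp_even_congr (x : L.gr 0) {f f' : List ι → V}
    (hf : ∀ I : List ι, I.Pairwise (· > ·) → I.length ≤ J.length → f I = f' I) :
    L.coindOp b ρ x f J = L.coindOp b ρ x f' J :=
  (L.coindOp_agree b ρ (List.Pairwise.of_cons h)).1 x f f' hf

/-- This closes the induction over the length: the argument of an odd operator may be changed on
lists longer than `J` as well, since there only lists `I` with `j :: I` decreasing occur, on which
relations involving `e_j` hold by construction. -/
lemma coindOp_odd_congr {i : ι} (hi : i < j) {f f' : List ι → V}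
    (hf : ∀ I : List ι, I.Pairwise (· > ·) → I.length ≤ J.length → f I = f' I)
    (hf' : ∀ I : List ι, (j :: I).Pairwise (· > ·) → f I = f' I) :
    L.coindOp b ρ (b i) f J = L.coindOp b ρ (b i) f' J :=
  (L.coindOp_agree b ρ (List.Pairwise.of_cons h)).2 j i f f' (WithTop.coe_lt_coe.2 hi)
    (fun k hk => WithTop.coe_lt_coe.2 ((List.pairwise_cons.1 h).1 k hk)) hf
    fun _ hI _ hj => hf' _ (cons_sorted hI hj)

include ih

/-- For `i > j` this is the creation rule at `i :: j :: J`. For `i ≤ j` both sides are pushed past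
`e_j`, which leaves relations on components of length at most `J.length`; what remains is the Jacobi
identity for `x`, `e_j`, `e_i`. -/
lemma even_odd_step (x : L.gr 0) (i : ι) (f : List ι → V) :
    L.coindOp b ρ x (L.coindOp b ρ (b i) f) (j :: J) =
      L.coindOp b ρ (b i) (L.coindOp b ρ x f) (j :: J)
        + L.coindOp b ρ (L.bracket x (b i)) f (j :: J) := by
  have hJ := ih J (List.Pairwise.of_cons h) le_rfl
  have sk : L.bracket (b j) x = -L.bracket x (b j) := L.bracket_skew_odd_even (b j).2 x.2
  set T := L.coindOp b ρ with hT
  rcases lt_trichotomy i j with hij | rfl | hij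
  · have e1 := L.coindOp_even b ρ h x (T (b i) f)
    have e2 : T x (T (b j) (T (b i) f)) J =
        T x (-T (b i) (T (b j) f) + T (L.bracket (b j) (b i)) f) J :=
      L.coindOp_even_congr b ρ h x fun I hI hl => (ih I hI hl).odd_odd _ _ _
    have e3 := L.coindOp_lt b ρ h hij (T x f)
    have e4 : T (b i) (T (b j) (T x f)) J =
        T (b i) (T x (T (b j) f) + T (L.bracket (b j) x) f) J :=
      L.coindOp_odd_congr b ρ h hij
        (fun I hI hl => by
          have := (ih I hI hl).even_odd x (b j) f
          simp only [← hT] at this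
          rw [Pi.add_apply, this, sk]; simp)
        fun I hI => L.coindOp_move b ρ hI x f
    have e5 := L.coindOp_create b ρ h (T (L.bracket x (b i)) f)
    have e5' := L.coindOp_create b ρ h f
    have h1 := hJ.even_even x ⟨_, L.bracket_odd_odd (b j).2 (b i).2⟩ f
    have h2 := hJ.even_odd x (b i) (T (b j) f)
    have h3 := hJ.odd_odd ⟨_, L.bracket_odd_even (b j).2 x.2⟩ (b i) f
    have h4 := hJ.odd_odd (b j) ⟨_, L.bracket_even_odd' x.2 (b i).2⟩ f
    have jac := L.jacobi_even x.2 (b j).2 (b i)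
    simp only [← hT] at *
    simp only [map_add, map_neg, Pi.add_apply, Pi.neg_apply, sk, LinearMap.neg_apply, jac,
      LinearMap.add_apply] at *
    rw [e1, e2, e3, e4, ← e5, h1, h2, h4, h3]
    abel
  · have e1 := L.coindOp_even b ρ h x (T (b i) f)
    have e2 : T x (T (b i) (T (b i) f)) J =
        T x ((2⁻¹ : K) • T (L.bracket (b i) (b i)) f) J :=
      L.coindOp_even_congr b ρ h x fun I hI hl => by
        have := (ih I hI hl).odd_odd (b i) (b i) f
        simp only [Pi.smul_apply, ← hT] at *
        linear_combination (norm := module) (2⁻¹ : K) • this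
    have e3 := L.coindOp_self b ρ h (T x f)
    have e5 := L.coindOp_create b ρ h (T (L.bracket x (b i)) f)
    have h1 := hJ.even_even x ⟨_, L.bracket_odd_odd (b i).2 (b i).2⟩ f
    have h3 := hJ.odd_odd ⟨_, L.bracket_even_odd' x.2 (b i).2⟩ (b i) f
    have jac := L.jacobi_even x.2 (b i).2 (b i)
    have s2 : L.bracket (b i) (L.bracket x (b i)) = L.bracket (L.bracket x (b i)) (b i) :=
      L.bracket_symm_odd (b i).2 (L.bracket_even_odd' x.2 (b i).2)
    simp only [← hT] at *
    simp only [map_smul, Pi.smul_apply, map_add, map_neg, Pi.add_apply, Pi.neg_apply, sk,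
      LinearMap.neg_apply, jac, s2, LinearMap.add_apply] at *
    rw [e1, e2, e3, ← e5, h1, h3]
    module
  · have hs : (i :: j :: J).Pairwise (· > ·) := by
      refine List.pairwise_cons.2 ⟨fun k hk => ?_, h⟩
      rcases List.mem_cons.1 hk with rfl | hk
      · exact hij
      · exact lt_trans ((List.pairwise_cons.1 h).1 k hk) hij
    have := L.coindOp_move b ρ hs x f
    rw [L.bracket_skew_odd_even (b i).2 x.2] at this
    simp only [← hT] at *
    rw [this]
    simp

/-- Both orders are pushed past `e_j`; the mixed terms are matched by the relations at `J`, and the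
double brackets by the Jacobi identity for `x`, `y`, `e_j`. -/
lemma even_even_step (x y : L.gr 0) (f : List ι → V) :
    L.coindOp b ρ x (L.coindOp b ρ y f) (j :: J) =
      L.coindOp b ρ y (L.coindOp b ρ x f) (j :: J)
        + L.coindOp b ρ (L.bracket x y) f (j :: J) := by
  have hJ := ih J (List.Pairwise.of_cons h) le_rfl
  have sk : ∀ x : L.gr 0, L.bracket (b j) x = -L.bracket x (b j) := fun x =>
    L.bracket_skew_odd_even (b j).2 x.2
  set T := L.coindOp b ρ with hT
  have key : ∀ x y : L.gr 0, T x (T y f) (j :: J) = T x (T y (T (b j) f)) J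
      - T x (T (L.bracket y (b j)) f) J - T (L.bracket x (b j)) (T y f) J := fun x y => by
    have e1 := L.coindOp_even b ρ h x (T y f)
    have e2 : T x (T (b j) (T y f)) J =
        T x (T y (T (b j) f) - T (L.bracket y (b j)) f) J :=
      L.coindOp_even_congr b ρ h x fun I hI hl => by
        have := (ih I hI hl).even_odd y (b j) f
        rw [Pi.sub_apply]
        simp only [← hT] at *
        rw [this]; abel
    simp only [← hT] at *
    rw [e1, e2, sk]
    simp only [map_sub, map_neg, LinearMap.neg_apply, Pi.sub_apply, Pi.neg_apply]
    abel
  have e3 : T (L.bracket x y) f (j :: J) = _ :=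
    L.coindOp_even b ρ h ⟨_, L.bracket_even_even x.2 y.2⟩ f
  have h1 := hJ.even_even x y (T (b j) f)
  have h2 := hJ.even_odd x ⟨_, L.bracket_even_odd' y.2 (b j).2⟩ f
  have h3 := hJ.even_odd y ⟨_, L.bracket_even_odd' x.2 (b j).2⟩ f
  have jac := L.jacobi_even x.2 y.2 (b j)
  rw [sk ⟨_, L.bracket_even_even x.2 y.2⟩] at e3
  simp only [← hT] at *
  simp only [map_neg, LinearMap.neg_apply, Pi.neg_apply, jac, map_add, LinearMap.add_apply,
    Pi.add_apply] at *
  rw [key, key, e3, h1, h2, h3]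
  abel

/-- If `k > j`, creation at `k` gives the relation. If `i` and `k` are below `j`, the letter `e_j`
is pulled out and the Jacobi identity is used. If `k = j`, or `i = k = j`, the rule `e_j e_j = ½
[e_j, e_j]` enters. -/
lemma odd_odd_step {i k : ι} (hik : i ≤ k) (f : List ι → V) :
    L.coindOp b ρ (b i) (L.coindOp b ρ (b k) f) (j :: J) =
      -L.coindOp b ρ (b k) (L.coindOp b ρ (b i) f) (j :: J)
        + L.coindOp b ρ (L.bracket (b i) (b k)) f (j :: J) := by
  have hJ := ih J (List.Pairwise.of_cons h) le_rfl
  have sym : ∀ i k, L.bracket (b i) (b k) = L.bracket (b k) (b i) := fun i k =>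
    L.bracket_symm_odd (b i).2 (b k).2
  have sk : ∀ x : L.gr 0, L.bracket (b j) x = -L.bracket x (b j) := fun x =>
    L.bracket_skew_odd_even (b j).2 x.2
  set T := L.coindOp b ρ with hT
  have key : ∀ i k : ι, i < j → k ≤ j → T (b i) (T (b k) f) (j :: J) =
      T (L.bracket (b j) (b i)) (T (b k) f) J + T (b i) (T (b k) (T (b j) f)) J
        - T (b i) (T (L.bracket (b j) (b k)) f) J := fun i k hi hk => by
    have e1 := L.coindOp_lt b ρ h hi (T (b k) f)
    have e2 : T (b i) (T (b j) (T (b k) f)) J =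
        T (b i) (-T (b k) (T (b j) f) + T (L.bracket (b j) (b k)) f) J :=
      L.coindOp_odd_congr b ρ h hi (fun I hI hl => (ih I hI hl).odd_odd _ _ _)
        fun I hI => L.coindOp_move_odd b ρ hI hk f
    simp only [← hT] at *
    rw [e1, e2]
    simp only [map_add, map_neg, Pi.add_apply, Pi.neg_apply]
    abel
  have e3 : T (L.bracket (b i) (b k)) f (j :: J) = _ :=
    L.coindOp_even b ρ h ⟨_, L.bracket_odd_odd (b i).2 (b k).2⟩ f
  have jac := L.jacobi_odd (b j).2 (b i).2 (b k)
  have h1 : ∀ i k : ι, T (L.bracket (b j) (b i)) (T (b k) f) J = T (b k) (T (L.bracket (b j) (b i)) f) J +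
      T (L.bracket (L.bracket (b j) (b i)) (b k)) f J := fun i k =>
    hJ.even_odd ⟨_, L.bracket_odd_odd (b j).2 (b i).2⟩ (b k) f
  have h2 := hJ.odd_odd (b i) (b k) (T (b j) f)
  have s3 : ∀ i k : ι, L.bracket (b i) (L.bracket (b j) (b k)) =
    -L.bracket (L.bracket (b j) (b k)) (b i) := fun i k =>
      L.bracket_skew_odd_even (b i).2 (L.bracket_odd_odd (b j).2 (b k).2)
  rcases hik.lt_or_eq.symm.imp_right id with rfl | hik'
  · rcases lt_trichotomy i j with hi | rfl | hi
    · simp only [← hT] at *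
      simp only [jac, s3, map_add, sub_neg_eq_add, LinearMap.add_apply, Pi.add_apply] at *
      rw [key i i hi hi.le, e3, h1]
      linear_combination (norm := module) h2
    · have e4 := L.coindOp_self b ρ h (T (b i) f)
      -- The Jacobi identity for three copies of an odd element only yields three times the claim;
      -- characteristic zero allows the division.
      have z : L.bracket (b i) (L.bracket (b i) (b i)) = 0 := by
        have hz : (3 : K) • L.bracket (b i) (L.bracket (b i) (b i)) = 0 := by
          linear_combination (norm := module) jac + s3 i i
        exact (smul_eq_zero.1 hz).resolve_left (by norm_num)
      simp only [← hT] at *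
      simp only [z, map_zero, LinearMap.zero_apply, Pi.zero_apply, add_zero] at e3
      rw [e4, e3]
      module
    · have hs : (i :: j :: J).Pairwise (· > ·) := by
        refine List.pairwise_cons.2 ⟨fun k hk => ?_, h⟩
        rcases List.mem_cons.1 hk with rfl | hk
        · exact hi
        · exact lt_trans ((List.pairwise_cons.1 h).1 k hk) hi
      exact L.coindOp_move_odd b ρ hs le_rfl f
  rcases lt_trichotomy k j with hk | rfl | hk
  · simp only [← hT] at *
    simp only [jac, s3, map_add, sub_neg_eq_add, LinearMap.add_apply, Pi.add_apply] at *
    rw [key i k (hik'.trans hk) hk.le, key k i hk (hik'.trans hk).le, e3, h1, h1]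
    linear_combination (norm := module) h2
  · have e4 := L.coindOp_self b ρ h (T (b i) f)
    have e1 := L.coindOp_lt b ρ h hik' (T (b k) f)
    have e2 : T (b i) (T (b k) (T (b k) f)) J =
        T (b i) ((2⁻¹ : K) • T (L.bracket (b k) (b k)) f) J :=
      L.coindOp_odd_congr b ρ h hik'
        (fun I hI hl => by
          have := (ih I hI hl).odd_odd (b k) (b k) f
          simp only [Pi.smul_apply, ← hT] at *
          linear_combination (norm := module) (2⁻¹ : K) • this)
        fun I hI => by
          have := L.coindOp_move_odd b ρ hI le_rfl f
          simp only [Pi.smul_apply, ← hT] at *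
          linear_combination (norm := module) (2⁻¹ : K) • this
    have h5 := h1 k i
    have jac' := L.jacobi_odd (b k).2 (b k).2 (b i)
    simp only [← hT] at *
    rw [sym i k] at e3 ⊢
    have j2 : L.bracket (b k) (L.bracket (b k) (b i)) =
        (2⁻¹ : K) • L.bracket (L.bracket (b k) (b k)) (b i) := by
      linear_combination (norm := module) (2⁻¹ : K) • jac'
    simp only [j2, map_smul, LinearMap.smul_apply, Pi.smul_apply] at *
    rw [e1, e4, e3, h5, e2]
    module
  · have hs : (k :: j :: J).Pairwise (· > ·) := by
      refine List.pairwise_cons.2 ⟨fun l hl => ?_, h⟩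
      rcases List.mem_cons.1 hl with rfl | hl
      · exact hk
      · exact lt_trans ((List.pairwise_cons.1 h).1 l hl) hk
    have := L.coindOp_move_odd b ρ hs hik f
    simp only [← hT] at *
    rw [this, sym i k]
    abel

end Step

include hρ in
-- Induction on the length. At the empty list the even-even relation is the hypothesis that `ρ` is a
-- representation, and the relations with an odd letter follow from the creation rule on lists with
-- one entry.
lemma coindRel_of_sorted (I : List ι) (hI : I.Pairwise (· > ·)) : L.CoindRel b ρ I := by
  induction hl : I.length using Nat.strong_induction_on generalizing I with
  | _ l ih =>
  rcases I with _ | ⟨j, J⟩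
  · refine ⟨fun x y f => ?_, even_odd_of_basis L b ρ fun x i f => ?_,
      odd_odd_of_basis L b ρ fun i k f hik => ?_⟩
    · have := L.coindOp_nil b ρ ⟨_, L.bracket_even_even x.2 y.2⟩ f
      rw [hρ] at this
      refine Eq.trans ?_ (congrArg _ this.symm)
      simp only [coindOp_nil]
      abel
    · have := L.coindOp_move b ρ (List.pairwise_singleton (· > ·) i) x f
      rw [this, L.bracket_skew_odd_even (b i).2 x.2]
      simp
    · have := L.coindOp_move_odd b ρ (List.pairwise_singleton (· > ·) k) hik f
      rw [this, L.bracket_symm_odd (b i).2 (b k).2]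
      abel
  · simp only [List.length_cons] at hl
    have ih' : ∀ I : List ι, I.Pairwise (· > ·) → I.length ≤ J.length → L.CoindRel b ρ I :=
      fun I hI' hIl => ih I.length (by omega) I hI' rfl
    exact ⟨L.even_even_step b ρ hI ih', even_odd_of_basis L b ρ (L.even_odd_step b ρ hI ih'),
      odd_odd_of_basis L b ρ fun i k f hik => L.odd_odd_step b ρ hI ih' hik f⟩

include hρ in
lemma coindRel (I : List ι) : L.CoindRel b ρ I := by
  by_cases hI : I.Pairwise (· > ·)
  · exact L.coindRel_of_sorted b ρ hρ I hI
  · constructor <;> intros <;> simp [coindOp_not_sorted _ _ _ _ _ hI]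

/-- The module over `U(𝔤)` coinduced from a module over the even part of `𝔤`. -/
def coindAct : L.Env →ₐ[K] Module.End K (List ι → V) :=
  L.lift (A := Module.End K (List ι → V)) (L.coindOp b ρ) (L.rel_of_cases _
    (fun x hx y hy => LinearMap.ext fun f => funext fun I =>
      (L.coindRel b ρ hρ I).even_even ⟨x, hx⟩ ⟨y, hy⟩ f)
    (fun x hx y hy => LinearMap.ext fun f => funext fun I =>
      (L.coindRel b ρ hρ I).even_odd ⟨x, hx⟩ ⟨y, hy⟩ f)
    (fun x hx y hy => LinearMap.ext fun f => funext fun I =>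
      (L.coindRel b ρ hρ I).odd_odd ⟨x, hx⟩ ⟨y, hy⟩ f))

lemma coindAct_ι (x : 𝔤) : L.coindAct b ρ hρ (L.ι x) = L.coindOp b ρ x := L.lift_ι _ _ _

/-- The product of the odd basis vectors with indices in the list `I`. -/
def basisWord (I : List ι) : L.Env := (I.map fun i => L.ι (b i)).prod

/-- The letters act from the last to the first in reading components, and each one only prepends
itself because the resulting list stays strictly decreasing. -/
lemma coindAct_basisWord (I J : List ι) (h : (I.reverse ++ J).Pairwise (· > ·))
    (f : List ι → V) :
    L.coindAct b ρ hρ (L.basisWord b I) f J = f (I.reverse ++ J) := by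
  induction I generalizing J with
  | nil => simp [basisWord]
  | cons i I ih =>
    have e : L.basisWord b (i :: I) = L.ι (b i) * L.basisWord b I := by simp [basisWord]
    rw [e, map_mul, Module.End.mul_apply, coindAct_ι, coindOp_create, ih]
    · simp
    · simpa using h
    · have : (I.reverse ++ (i :: J)).Pairwise (· > ·) := by simpa using h
      exact (List.pairwise_append.1 this).2.1

include hρ in
/-- Relative Poincaré–Birkhoff–Witt theorem: there is a map on `U(𝔤)`, linear under the even part of
`𝔤`, with prescribed values on the ordered products of odd basis vectors. -/
theorem exists_coind (a : Finset ι → V) : ∃ φ : L.Env →ₗ[K] V,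
    (∀ (x : L.gr 0) (u : L.Env), φ (L.ι x * u) = ρ x (φ u)) ∧
      ∀ I : Finset ι, φ (L.basisWord b (I.sort (· ≤ ·))) = a I := by
  -- The value at `u` is the empty component of `u` applied to the family `a`: even letters act on
  -- this component through `ρ`, and ordered words carry the component `a I` to it.
  refine ⟨LinearMap.proj [] ∘ₗ LinearMap.applyₗ (fun I : List ι => a I.toFinset) ∘ₗ
    (L.coindAct b ρ hρ).toLinearMap, fun x u => ?_, fun I => ?_⟩
  · simp [coindAct_ι, coindOp_nil]
  · have := L.coindAct_basisWord b ρ hρ (I.sort (· ≤ ·)) []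
      (by
        rw [List.append_nil, List.pairwise_reverse]
        exact I.sortedLT_sort.pairwise) (fun I : List ι => a I.toFinset)
    simpa using this

end CoinducedRelations

end LieSuperalgebra

namespace LieSuperalgebra

/-! ### Filtration of `U(𝔤)` by the number of odd factors. -/

section Filtration

variable {K 𝔤 : Type*} [Field K] [AddCommGroup 𝔤] [Module K 𝔤] (L : LieSuperalgebra K 𝔤)

/-- Induction principle for `U(𝔤)`: it is spanned by the products of elements of `𝔤`. -/
lemma env_induction {p : L.Env → Prop} (one : p 1) (add : ∀ u v, p u → p v → p (u + v))
    (smul : ∀ (c : K) u, p u → p (c • u)) (mul : ∀ x u, p u → p (L.ι x * u)) (u : L.Env) : p u := by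
  let M : Submodule K L.Env :=
    { carrier := {u | p u}
      add_mem' := fun {a b} ha hb => add a b ha hb
      zero_mem' := by simpa using smul 0 1 one
      smul_mem' := fun c a ha => smul c a ha }
  -- The elements stabilizing `M` form a subalgebra containing `𝔤`. The universal property then
  -- factors the identity of `U(𝔤)` through it, so every `u` stabilizes `M`, and `M` contains `1`.
  let A : Subalgebra K L.Env :=
    { carrier := {a | ∀ u ∈ M, a * u ∈ M}
      mul_mem' := fun {a b} ha hb u hu => by rw [mul_assoc]; exact ha _ (hb _ hu)
      add_mem' := fun {a b} ha hb u hu => by rw [add_mul]; exact M.add_mem (ha _ hu) (hb _ hu)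
      algebraMap_mem' := fun c u hu => by rw [← Algebra.smul_def]; exact M.smul_mem c hu }
  let f : L.Env →ₐ[K] A := L.lift ((L.ι).codRestrict A.toSubmodule fun x u hu => mul x u hu)
    (fun i j x hx y hy => Subtype.ext (L.ι_mul_ι hx hy))
  have hf : A.val.comp f = AlgHom.id K _ := by
    apply L.algHom_ext
    intro x
    simp only [AlgHom.comp_apply, f, lift_ι]
    rfl
  have : (f u : L.Env) = u := DFunLike.congr_fun hf u
  have hu : u * 1 ∈ M := this ▸ (f u).2 1 one
  rwa [mul_one] at hu

lemma ι_mul_ι_even_odd {x y : 𝔤} (hx : x ∈ L.gr 0) (hy : y ∈ L.gr 1) :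
    L.ι x * L.ι y = L.ι y * L.ι x + L.ι (L.bracket x y) := by
  simpa [koszulSign] using L.ι_mul_ι hx hy

lemma ι_mul_ι_odd_even {x y : 𝔤} (hx : x ∈ L.gr 1) (hy : y ∈ L.gr 0) :
    L.ι x * L.ι y = L.ι y * L.ι x + L.ι (L.bracket x y) := by
  simpa [koszulSign] using L.ι_mul_ι hx hy

lemma ι_mul_ι_odd_odd {x y : 𝔤} (hx : x ∈ L.gr 1) (hy : y ∈ L.gr 1) :
    L.ι x * L.ι y = -(L.ι y * L.ι x) + L.ι (L.bracket x y) := by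
  simpa [koszulSign] using L.ι_mul_ι hx hy

/-- Products of `n` odd elements and any number of even elements of `𝔤`. -/
inductive IsWord : ℕ → L.Env → Prop
  | one : IsWord 0 1
  | even {n : ℕ} {u : L.Env} (x : L.gr 0) : IsWord n u → IsWord n (L.ι x * u)
  | odd {n : ℕ} {u : L.Env} (x : L.gr 1) : IsWord n u → IsWord (n + 1) (L.ι x * u)

/-- The span of the products of elements of `𝔤` with fewer than `n` odd factors. -/
def filt (n : ℕ) : Submodule K L.Env := Submodule.span K {u | ∃ k < n, L.IsWord k u}

lemma IsWord.mem_filt {k n : ℕ} {u : L.Env} (h : L.IsWord k u) (hk : k < n) : u ∈ L.filt n :=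
  Submodule.subset_span ⟨k, hk, h⟩

lemma filt_le {n : ℕ} {M : Submodule K L.Env} (h : ∀ k < n, ∀ u, L.IsWord k u → u ∈ M) :
    L.filt n ≤ M := Submodule.span_le.2 fun u ⟨k, hk, hu⟩ => h k hk u hu

lemma filt_mono {m n : ℕ} (h : m ≤ n) : L.filt m ≤ L.filt n :=
  L.filt_le fun _ hk _ hu => hu.mem_filt L (hk.trans_le h)

lemma filt_zero : L.filt 0 = ⊥ :=
  le_bot_iff.1 (L.filt_le fun _ hk => (Nat.not_lt_zero _ hk).elim)

lemma one_mem_filt (n : ℕ) : (1 : L.Env) ∈ L.filt (n + 1) := IsWord.one.mem_filt L (Nat.succ_pos n)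

lemma even_mul_mem_filt {n : ℕ} (x : L.gr 0) {u : L.Env} (hu : u ∈ L.filt n) :
    L.ι x * u ∈ L.filt n := by
  have : L.filt n ≤ (L.filt n).comap (LinearMap.mulLeft K (L.ι x)) :=
    L.filt_le fun k hk u hu => (IsWord.even x hu).mem_filt L hk
  exact this hu

lemma odd_mul_mem_filt {n : ℕ} (x : L.gr 1) {u : L.Env} (hu : u ∈ L.filt n) :
    L.ι x * u ∈ L.filt (n + 1) := by
  have : L.filt n ≤ (L.filt (n + 1)).comap (LinearMap.mulLeft K (L.ι x)) :=
    L.filt_le fun k hk u hu => (IsWord.odd x hu).mem_filt L (Nat.succ_lt_succ hk)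
  exact this hu

/-- The index shift is due to the strict bound: `filt (m + 1)` allows `m` odd factors, which joined
to fewer than `n` give fewer than `m + n`. -/
lemma filt_mul {m n : ℕ} {u v : L.Env} (hu : u ∈ L.filt (m + 1)) (hv : v ∈ L.filt n) :
    u * v ∈ L.filt (m + n) := by
  have : L.filt (m + 1) ≤ (L.filt (m + n)).comap (LinearMap.mulRight K v) := by
    refine L.filt_le fun k hk u hu => ?_
    have key : u * v ∈ L.filt (k + n) := by
      clear hk
      induction hu with
      | one => simpa using hv
      | even x _ ih => rw [mul_assoc]; exact L.even_mul_mem_filt x ih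
      | odd x _ ih =>
        rw [mul_assoc, add_right_comm]
        exact L.odd_mul_mem_filt x ih
    exact L.filt_mono (by omega) key
  exact this hu

lemma ι_even_mem_filt (x : L.gr 0) (n : ℕ) : L.ι x ∈ L.filt (n + 1) := by
  simpa using L.even_mul_mem_filt x (L.one_mem_filt n)

lemma ι_odd_mem_filt (x : L.gr 1) : L.ι x ∈ L.filt 2 := by
  simpa using L.odd_mul_mem_filt x (L.one_mem_filt 0)

lemma exists_mem_filt (u : L.Env) : ∃ n, u ∈ L.filt n := by
  induction u using L.env_induction with
  | one => exact ⟨1, L.one_mem_filt 0⟩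
  | add u v hu hv =>
    obtain ⟨m, hu⟩ := hu
    obtain ⟨n, hv⟩ := hv
    exact ⟨max m n, add_mem (L.filt_mono (le_max_left _ _) hu) (L.filt_mono (le_max_right _ _) hv)⟩
  | smul c u hu => exact hu.imp fun n h => Submodule.smul_mem _ c h
  | mul x u hu =>
    obtain ⟨n, hu⟩ := hu
    refine ⟨n + 1, ?_⟩
    rw [← L.even_add_odd x, map_add, add_mul]
    exact add_mem (L.filt_mono n.le_succ (L.even_mul_mem_filt ⟨_, L.evenPart_mem x⟩ hu))
      (L.odd_mul_mem_filt ⟨_, L.oddPart_mem x⟩ hu)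

/-- The product in `U(𝔤)` of a list of odd elements. -/
def oddProd (l : List (L.gr 1)) : L.Env := (l.map fun x : L.gr 1 => L.ι x).prod

@[simp] lemma oddProd_nil : L.oddProd [] = 1 := rfl

@[simp] lemma oddProd_cons (x : L.gr 1) (l : List (L.gr 1)) :
    L.oddProd (x :: l) = L.ι x * L.oddProd l := by simp [oddProd]

lemma isWord_oddProd (l : List (L.gr 1)) : L.IsWord l.length (L.oddProd l) := by
  induction l with
  | nil => exact IsWord.one
  | cons x l ih => rw [oddProd_cons]; exact IsWord.odd x ih

lemma oddProd_mem_filt {l : List (L.gr 1)} {n : ℕ} (h : l.length < n) : L.oddProd l ∈ L.filt n :=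
  (L.isWord_oddProd l).mem_filt L h

lemma unit_smul_mem (M : Submodule K L.Env) (ε : ℤˣ) {u : L.Env} (hu : u ∈ M) : ε • u ∈ M := by
  rcases Int.units_eq_one_or ε with rfl | rfl
  · simpa using hu
  · simpa using neg_mem hu

/-- Exchanging two neighbouring factors costs a sign and their bracket, which is even and so
replaces two odd factors by none. -/
lemma oddProd_perm {l l' : List (L.gr 1)} (h : l.Perm l') :
    ∃ ε : ℤˣ, L.oddProd l - ε • L.oddProd l' ∈ L.filt l.length := by
  induction h with
  | nil => exact ⟨1, by simp⟩
  | cons x _ ih =>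
    obtain ⟨ε, h⟩ := ih
    refine ⟨ε, ?_⟩
    have := L.odd_mul_mem_filt x h
    rwa [mul_sub, mul_smul_comm, ← oddProd_cons, ← oddProd_cons] at this
  | swap x y l =>
    refine ⟨-1, ?_⟩
    have := L.filt_mono (Nat.le_succ _) (L.even_mul_mem_filt
      ⟨_, L.bracket_odd_odd y.2 x.2⟩ (L.oddProd_mem_filt (Nat.lt_succ_self l.length)))
    simp only [oddProd_cons, Units.neg_smul, one_smul, sub_neg_eq_add, List.length_cons]
    rw [← mul_assoc, L.ι_mul_ι_odd_odd y.2 x.2, add_mul, neg_mul, mul_assoc]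
    simpa using this
  | trans h₁ _ ih₁ ih₂ =>
    obtain ⟨ε₁, h₁'⟩ := ih₁
    obtain ⟨ε₂, h₂'⟩ := ih₂
    refine ⟨ε₁ * ε₂, ?_⟩
    rw [← h₁.length_eq] at h₂'
    have := add_mem h₁' (L.unit_smul_mem _ ε₁ h₂')
    rw [mul_smul]
    simpa [smul_sub] using this

/-- Two equal factors are brought to the front, up to sign and lower order, where `a a = ½ [a, a]`
is even. -/
lemma oddProd_mem_of_duplicate [CharZero K] {l : List (L.gr 1)} (h : ¬ l.Nodup) :
    L.oddProd l ∈ L.filt l.length := by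
  rw [List.nodup_iff_sublist] at h
  push Not at h
  obtain ⟨a, ha⟩ := h
  obtain ⟨r, hr⟩ := ha.exists_perm_append
  obtain ⟨ε, hε⟩ := L.oddProd_perm hr
  have h2 : L.oddProd ([a, a] ++ r) ∈ L.filt l.length := by
    rw [hr.length_eq]
    have h0 := L.ι_mul_ι_odd_odd a.2 a.2
    have h1 : L.ι a * L.ι a = (2⁻¹ : K) • L.ι (L.bracket a a) := by
      linear_combination (norm := module) (2⁻¹ : K) • h0
    have := L.filt_mono (Nat.le_succ _) (L.even_mul_mem_filt
      ⟨_, L.bracket_odd_odd a.2 a.2⟩ (L.oddProd_mem_filt (Nat.lt_succ_self r.length)))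
    simp only [List.cons_append, List.nil_append, oddProd_cons, List.length_cons]
    rw [← mul_assoc, h1, smul_mul_assoc]
    exact Submodule.smul_mem _ _ this
  simpa using add_mem hε (L.unit_smul_mem _ ε h2)

/-- The product of `n` odd elements, modulo products of fewer odd elements, is alternating. -/
def oddAlt [CharZero K] (n : ℕ) : L.gr 1 [⋀^Fin n]→ₗ[K] (L.Env ⧸ L.filt n) :=
  { (L.filt n).mkQ.compMultilinearMap ((MultilinearMap.mkPiAlgebraFin K n L.Env).compLinearMap
      fun _ => L.ι ∘ₗ (L.gr 1).subtype) with
    map_eq_zero_of_eq' := fun v i j hij hne => by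
      refine (Submodule.Quotient.mk_eq_zero _).2 ?_
      have := L.oddProd_mem_of_duplicate (l := List.ofFn v)
        fun h => hne (List.nodup_ofFn.1 h hij)
      rw [List.length_ofFn, oddProd, List.map_ofFn] at this
      exact this }

lemma oddAlt_apply [CharZero K] {n : ℕ} (v : Fin n → L.gr 1) :
    L.oddAlt n v = (L.filt n).mkQ (L.oddProd (List.ofFn v)) := by
  rw [oddProd, List.map_ofFn]
  rfl

/-- Even factors can be moved to the left: the commutator of an odd with an even element is odd, so
the number of odd factors does not change. The induction runs over all stable subspaces at once,
because splitting off a first odd letter replaces `M` by the stable space of all `u` with `v u ∈ M`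
for every odd `v`. -/
lemma mem_of_isWord {M : Submodule K L.Env} (hM : ∀ (x : L.gr 0), ∀ u ∈ M, L.ι x * u ∈ M) {n : ℕ}
    (h : ∀ l : List (L.gr 1), l.length = n → L.oddProd l ∈ M) {u : L.Env} (hu : L.IsWord n u) :
    u ∈ M := by
  induction hu generalizing M with
  | one => simpa using h [] rfl
  | even x _ ih => exact hM x _ (ih hM h)
  | odd x _ ih =>
    refine ih (M := ⨅ v : L.gr 1, M.comap (LinearMap.mulLeft K (L.ι v))) (fun y u hu => ?_)
      (fun l hl => ?_) |> fun h => (Submodule.mem_iInf _).1 h x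
    · rw [Submodule.mem_iInf] at hu ⊢
      intro v
      have h1 := hM y _ (hu v)
      have h2 := hu ⟨_, L.bracket_odd_even v.2 y.2⟩
      simp only [Submodule.mem_comap, LinearMap.mulLeft_apply] at *
      rw [← mul_assoc, L.ι_mul_ι_odd_even v.2 y.2, add_mul, mul_assoc]
      exact add_mem h1 h2
    · rw [Submodule.mem_iInf]
      intro v
      have := h (v :: l) (by simp [hl])
      rwa [oddProd_cons] at this

variable {ι : Type*} [LinearOrder ι] [Fintype ι] (b : Module.Basis ι K (L.gr 1))

/-- The ordered product of odd basis vectors with indices in `I`. -/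
def mono (I : Finset ι) : L.Env := L.basisWord b (I.sort (· ≤ ·))

lemma mono_eq_oddProd (I : Finset ι) : L.mono b I = L.oddProd ((I.sort (· ≤ ·)).map b) := by
  rw [mono, basisWord, oddProd, List.map_map]
  rfl

@[simp] lemma mono_empty : L.mono b ∅ = 1 := by simp [mono, basisWord]

lemma mono_insert {i : ι} {I : Finset ι} (h : ∀ j ∈ I, i < j) :
    L.mono b (insert i I) = L.ι (b i) * L.mono b I := by
  rw [mono, Finset.sort_insert _ (fun j hj => (h j hj).le) fun hi => lt_irrefl _ (h i hi)]
  simp [mono, basisWord]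

lemma mono_mem_filt {I : Finset ι} {n : ℕ} (h : I.card < n) : L.mono b I ∈ L.filt n := by
  rw [mono_eq_oddProd]
  exact L.oddProd_mem_filt (by simpa using h)

/-- Products of `n` odd elements are combinations of ordered products of basis vectors, up to
products of fewer elements. -/
lemma oddProd_mem_of_mono_mem [CharZero K] {M : Submodule K L.Env} (l : List (L.gr 1))
    (ih : L.filt l.length ≤ M) (h : ∀ I : Finset ι, I.card = l.length → L.mono b I ∈ M) :
    L.oddProd l ∈ M := by
  let g : L.gr 1 [⋀^Fin l.length]→ₗ[K] (L.Env ⧸ M) :=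
    (Submodule.mapQ _ M LinearMap.id ih).compAlternatingMap (L.oddAlt l.length)
  have hg : g = 0 := by
    refine Module.Basis.ext_alternating b fun v hv => ?_
    have e : g (fun i => b (v i)) = M.mkQ (L.oddProd (List.ofFn fun i => b (v i))) := by
      simp only [g, LinearMap.compAlternatingMap_apply, oddAlt_apply]
      rfl
    rw [e]
    refine (Submodule.Quotient.mk_eq_zero _).2 ?_
    have hp : ((List.ofFn v).map b).Perm ((((Finset.univ.map ⟨v, hv⟩).sort (· ≤ ·))).map b) := by
      refine List.Perm.map _ ?_
      refine (List.perm_ext_iff_of_nodup (List.nodup_ofFn.2 hv) (Finset.sort_nodup _ _)).2 ?_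
      intro a
      simp [List.mem_ofFn']
    obtain ⟨ε, hε⟩ := L.oddProd_perm hp
    rw [← mono_eq_oddProd] at hε
    have h3 := add_mem (ih (L.filt_mono (by simp) hε))
      (L.unit_smul_mem M ε (h (Finset.univ.map ⟨v, hv⟩) (by simp)))
    rw [List.map_ofFn, sub_add_cancel] at h3
    exact h3
  have := DFunLike.congr_fun hg l.get
  simp only [g, LinearMap.compAlternatingMap_apply, oddAlt_apply, List.ofFn_get] at this
  exact (Submodule.Quotient.mk_eq_zero _).1 this

/-- The filtration step `filt n` is generated under the even part of `𝔤` by the ordered products of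
fewer than `n` odd basis vectors. -/
theorem filt_le_of_mono_mem [CharZero K] {M : Submodule K L.Env}
    (hM : ∀ (x : L.gr 0), ∀ u ∈ M, L.ι x * u ∈ M) {n : ℕ}
    (h : ∀ I : Finset ι, I.card < n → L.mono b I ∈ M) : L.filt n ≤ M := by
  induction n with
  | zero => rw [filt_zero]; exact bot_le
  | succ n ih =>
    have ih := ih fun I hI => h I (hI.trans n.lt_succ_self)
    refine L.filt_le fun k hk u hu => ?_
    rcases (Nat.lt_succ_iff_lt_or_eq.1 hk) with hk | rfl
    · exact ih (hu.mem_filt L hk)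
    refine L.mem_of_isWord hM (fun l hl => ?_) hu
    subst hl
    exact L.oddProd_mem_of_mono_mem b l ih fun I hI => h I (by omega)

include b in
-- Each filtration step is generated by ordered products of distinct basis vectors, and these have
-- at most `card ι` factors.
theorem filt_card_eq_top [CharZero K] : L.filt (Fintype.card ι + 1) = ⊤ := by
  refine eq_top_iff.2 fun u _ => ?_
  obtain ⟨n, hu⟩ := L.exists_mem_filt u
  exact L.filt_le_of_mono_mem b (fun x u hu => L.even_mul_mem_filt x hu)
    (fun I _ => L.mono_mem_filt b (Nat.lt_succ_of_le (Finset.card_le_univ I))) hu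

/-- Submodules which are stable under the even part and contain the ordered products of odd basis
vectors are everything. -/
theorem eq_top_of_mono_mem [CharZero K] {M : Submodule K L.Env}
    (hM : ∀ (x : L.gr 0), ∀ u ∈ M, L.ι x * u ∈ M) (h : ∀ I : Finset ι, L.mono b I ∈ M) (u : L.Env) :
    u ∈ M := by
  obtain ⟨n, hu⟩ := L.exists_mem_filt u
  exact L.filt_le_of_mono_mem b hM (fun I _ => h I) hu

end Filtration

end LieSuperalgebra


namespace LieSuperalgebra

/-! ### The top coefficient functional on `U(𝔤)`. -/

section Berezin

variable {K 𝔤 : Type*} [Field K] [CharZero K] [AddCommGroup 𝔤] [Module K 𝔤]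
  (L : LieSuperalgebra K 𝔤)

lemma even_mul_oddProd (x : L.gr 0) {n : ℕ} (v : Fin n → L.gr 1) :
    L.ι x * L.oddProd (List.ofFn v) = L.oddProd (List.ofFn v) * L.ι x +
      ∑ i, L.oddProd (List.ofFn (Function.update v i
        ((L.bracket x).restrict (L.bracket_even_odd x) (v i)))) := by
  induction n with
  | zero => simp
  | succ n ih =>
    rw [List.ofFn_succ, oddProd_cons, ← mul_assoc, L.ι_mul_ι_even_odd x.2 (v 0).2, add_mul,
      mul_assoc, ih, Fin.sum_univ_succ, mul_add, mul_assoc, Finset.mul_sum, add_assoc]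
    congr 1
    rw [add_comm]
    congr 1
    · rw [List.ofFn_succ, oddProd_cons]
      simp [Function.update]
    · refine Finset.sum_congr rfl fun i _ => ?_
      rw [List.ofFn_succ, oddProd_cons]
      have e : (fun j : Fin n => Function.update v i.succ
          ((L.bracket x).restrict (L.bracket_even_odd x) (v i.succ)) j.succ) =
          Function.update (fun j : Fin n => v j.succ) i
            ((L.bracket x).restrict (L.bracket_even_odd x) (v i.succ)) := by
        ext j
        by_cases h : j = i
        · subst h; simp
        · simp [h]
      rw [e, Function.update_of_ne (Fin.succ_ne_zero i).symm]

variable {q : ℕ} (b : Module.Basis (Fin q) K (L.gr 1))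

lemma mono_univ : L.mono b Finset.univ = L.oddProd (List.ofFn b) := by
  rw [mono_eq_oddProd, Fin.sort_univ, List.ofFn_eq_map]

lemma alternating_eq_det {N : Type*} [AddCommGroup N] [Module K N] (g : L.gr 1 [⋀^Fin q]→ₗ[K] N)
    (v : Fin q → L.gr 1) : g v = b.det v • g b := by
  have : g = (LinearMap.toSpanSingleton K N (g b)).compAlternatingMap b.det := by
    refine Module.Basis.ext_alternating b fun v hv => ?_
    let σ : Equiv.Perm (Fin q) := Equiv.ofBijective v hv.bijective_of_finite
    have h1 := g.map_perm b σ
    have h2 := b.det.map_perm b σ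
    change g (fun i => b (v i)) = _ at h1
    change b.det (fun i => b (v i)) = _ at h2
    rw [LinearMap.compAlternatingMap_apply, h1, h2, Module.Basis.det_self]
    rcases Int.units_eq_one_or (Equiv.Perm.sign σ) with h | h <;> simp [h]
  conv_lhs => rw [this]
  rfl

lemma oddProd_sub_det_mem (v : Fin q → L.gr 1) :
    L.oddProd (List.ofFn v) - b.det v • L.mono b Finset.univ ∈ L.filt q := by
  have := L.alternating_eq_det b (L.oddAlt q) v
  rw [oddAlt_apply, oddAlt_apply, ← map_smul, ← sub_eq_zero, ← map_sub] at this
  rw [mono_univ]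
  exact (Submodule.Quotient.mk_eq_zero _).1 this

lemma det_update (i : Fin q) (w : L.gr 1) : b.det (Function.update b i w) = b.repr w i := by
  have : b.det.toMultilinearMap.toLinearMap b i = b.coord i := by
    refine b.ext fun j => ?_
    rw [MultilinearMap.toLinearMap_apply]
    by_cases h : j = i
    · subst h
      simp [Module.Basis.det_self]
    · have := b.det.map_update_self b (Ne.symm h)
      simpa [Finsupp.single_apply, h] using this
  exact DFunLike.congr_fun this w

/-- Here `δ` arises. Commuting `x` through `e_1 ⋯ e_q` replaces one factor at a time by its bracket
with `x`; modulo fewer odd factors only the diagonal coefficients survive, and they add up to the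
trace of `ad x` on the odd part, which is `-δ(x)`. -/
lemma mono_univ_mul_even (x : L.gr 0) :
    L.mono b Finset.univ * L.ι x - L.ι x * L.mono b Finset.univ
      - L.deltaOdd x • L.mono b Finset.univ ∈ L.filt q := by
  have h := L.even_mul_oddProd x b
  have ht : LinearMap.trace K (L.gr 1) ((L.bracket x).restrict (L.bracket_even_odd x)) =
      ∑ i, b.det (Function.update b i ((L.bracket x).restrict (L.bracket_even_odd x) (b i))) := by
    rw [LinearMap.trace_eq_matrix_trace K b, Matrix.trace]
    refine Finset.sum_congr rfl fun i _ => ?_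
    rw [det_update, Matrix.diag_apply, LinearMap.toMatrix_apply]
  have h2 := sum_mem (S := L.filt q) (t := Finset.univ) fun i _ => L.oddProd_sub_det_mem b
    (Function.update b i ((L.bracket x).restrict (L.bracket_even_odd x) (b i)))
  rw [Finset.sum_sub_distrib, ← Finset.sum_smul, ← ht] at h2
  have h3 := neg_mem h2
  rw [← mono_univ] at h
  rw [deltaOdd, h]
  convert h3 using 1
  module

/-- Relative Poincaré–Birkhoff–Witt for the trivial one-dimensional module. -/
theorem exists_berezin : ∃ ψ : L.Env →ₗ[K] K, (∀ (x : L.gr 0) (u : L.Env), ψ (L.ι x * u) = 0) ∧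
    ∀ I : Finset (Fin q), ψ (L.mono b I) = if I = Finset.univ then 1 else 0 :=
  L.exists_coind b (0 : L.gr 0 →ₗ[K] Module.End K K) (fun _ _ _ => by simp) _

/-- The functional on `U(𝔤)`, vanishing on left multiples of even elements, which picks the
coefficient of the product of all odd basis vectors. -/
def top : L.Env →ₗ[K] K := (L.exists_berezin b).choose

lemma top_even_mul (x : L.gr 0) (u : L.Env) : L.top b (L.ι x * u) = 0 :=
  (L.exists_berezin b).choose_spec.1 x u

lemma top_mono (I : Finset (Fin q)) : L.top b (L.mono b I) = if I = Finset.univ then 1 else 0 :=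
  (L.exists_berezin b).choose_spec.2 I

lemma top_filt {u : L.Env} (hu : u ∈ L.filt q) : L.top b u = 0 := by
  have : L.filt q ≤ LinearMap.ker (L.top b) := by
    refine L.filt_le_of_mono_mem b (fun x u _ => L.top_even_mul b x u) fun I hI => ?_
    rw [LinearMap.mem_ker, top_mono, if_neg]
    rintro rfl
    simp at hI
  exact this hu

/-- Both sides vanish on left multiples of even elements, so it suffices to compare them on the
products `e_I`. If `I` is not full, then `e_I x` has fewer than `q` odd factors; for full `I` the
commutator with `x` contributes `δ(x)` and the term `x e_I` is killed. -/
lemma top_mul_even (x : L.gr 0) (u : L.Env) : L.top b (u * L.ι x) = L.deltaOdd x * L.top b u := by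
  refine L.eq_top_of_mono_mem b (M := LinearMap.ker (L.top b ∘ₗ LinearMap.mulRight K (L.ι x)
    - L.deltaOdd x • L.top b)) (fun y u _ => ?_) (fun I => ?_) u |> sub_eq_zero.1
  · simp [mul_assoc, top_even_mul]
  · simp only [LinearMap.mem_ker, LinearMap.sub_apply, LinearMap.comp_apply, LinearMap.smul_apply,
      LinearMap.mulRight_apply, smul_eq_mul]
    by_cases hI : I = Finset.univ
    · subst hI
      have := L.top_filt b (L.mono_univ_mul_even b x)
      simpa [top_even_mul] using this
    · have hc : I.card < q := by
        simpa using Finset.card_lt_card (Finset.ssubset_univ_iff.2 hI)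
      have h1 := L.filt_mul (L.mono_mem_filt b (Nat.lt_succ_self I.card)) (L.ι_even_mem_filt x 0)
      rw [top_filt L b (L.filt_mono hc h1), top_mono, if_neg hI]
      simp

/-- The algebra endomorphism of `U(𝔤)` induced by an endomorphism of the Lie superalgebra `𝔤`. -/
def envMap (A : 𝔤 →ₗ[K] 𝔤) (hA : ∀ i, ∀ x ∈ L.gr i, A x ∈ L.gr i)
    (hb : ∀ x y, A (L.bracket x y) = L.bracket (A x) (A y)) : L.Env →ₐ[K] L.Env :=
  L.lift (L.ι ∘ₗ A) fun i j x hx y hy => by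
    simpa [hb] using L.ι_mul_ι (hA i x hx) (hA j y hy)

variable {A : 𝔤 →ₗ[K] 𝔤} {hA : ∀ i, ∀ x ∈ L.gr i, A x ∈ L.gr i}
  {hb : ∀ x y, A (L.bracket x y) = L.bracket (A x) (A y)}

lemma envMap_ι (x : 𝔤) : L.envMap A hA hb (L.ι x) = L.ι (A x) := L.lift_ι _ _ _

lemma envMap_oddProd (l : List (L.gr 1)) :
    L.envMap A hA hb (L.oddProd l) = L.oddProd (l.map (A.restrict (hA 1))) := by
  induction l with
  | nil => simp
  | cons x l ih =>
    rw [oddProd_cons, map_mul, ih, envMap_ι, List.map_cons, oddProd_cons]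
    rfl

lemma envMap_mem_filt {n : ℕ} {u : L.Env} (hu : u ∈ L.filt n) :
    L.envMap A hA hb u ∈ L.filt n := by
  have : L.filt n ≤ (L.filt n).comap (L.envMap A hA hb).toLinearMap := by
    refine L.filt_le fun k hk u hu => IsWord.mem_filt L ?_ hk
    clear hk
    induction hu with
    | one => simpa using IsWord.one
    | even x _ ih =>
      simp only [AlgHom.toLinearMap_apply, map_mul, envMap_ι] at ih ⊢
      exact IsWord.even ⟨_, hA 0 x x.2⟩ ih
    | odd x _ ih =>
      simp only [AlgHom.toLinearMap_apply, map_mul, envMap_ι] at ih ⊢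
      exact IsWord.odd ⟨_, hA 1 x x.2⟩ ih
  exact this hu

lemma envMap_mono_univ_sub_mem :
    L.envMap A hA hb (L.mono b Finset.univ)
      - LinearMap.det (A.restrict (hA 1)) • L.mono b Finset.univ ∈ L.filt q := by
  have := L.oddProd_sub_det_mem b (A.restrict (hA 1) ∘ b)
  rw [Module.Basis.det_comp, Module.Basis.det_self, mul_one, ← List.map_ofFn, ← envMap_oddProd,
    ← mono_univ] at this
  exact this

/-- The induced map preserves the filtration and acts on the top alternating degree by the
determinant on the odd part. -/
lemma top_envMap (u : L.Env) :
    L.top b (L.envMap A hA hb u) = LinearMap.det (A.restrict (hA 1)) * L.top b u := by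
  refine L.eq_top_of_mono_mem b (M := LinearMap.ker (L.top b ∘ₗ (L.envMap A hA hb).toLinearMap
    - LinearMap.det (A.restrict (hA 1)) • L.top b)) (fun y u _ => ?_) (fun I => ?_) u
      |> sub_eq_zero.1
  · have := L.top_even_mul b ⟨_, hA 0 y y.2⟩ (L.envMap A hA hb u)
    simpa [envMap_ι, top_even_mul] using this
  · simp only [LinearMap.mem_ker, LinearMap.sub_apply, LinearMap.comp_apply, LinearMap.smul_apply,
      AlgHom.toLinearMap_apply, smul_eq_mul]
    by_cases hI : I = Finset.univ
    · subst hI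
      have := L.top_filt b (L.envMap_mono_univ_sub_mem b (hA := hA) (hb := hb))
      simpa using this
    · have hc : I.card < q := by
        simpa using Finset.card_lt_card (Finset.ssubset_univ_iff.2 hI)
      rw [top_filt L b (L.envMap_mem_filt (L.mono_mem_filt b hc)), top_mono, if_neg hI]
      simp

end Berezin

/-! ### Duality between `U(𝔤)/I_δ` and the odd products, and the invariants. -/

section Invariants

variable {K 𝔤 : Type*} [Field K] [CharZero K] [AddCommGroup 𝔤] [Module K 𝔤]
  (L : LieSuperalgebra K 𝔤) {q : ℕ} (b : Module.Basis (Fin q) K (L.gr 1))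

lemma mono_mul_mono (I J : Finset (Fin q)) : L.mono b I * L.mono b J =
    L.oddProd ((I.sort (· ≤ ·) ++ J.sort (· ≤ ·)).map b) := by
  rw [mono_eq_oddProd, mono_eq_oddProd, oddProd, oddProd, oddProd, ← List.prod_append,
    List.map_append, List.map_append]

lemma top_mono_mul_mono_of_lt {I J : Finset (Fin q)} (h : I.card + J.card < q) :
    L.top b (L.mono b I * L.mono b J) = 0 := by
  rw [mono_mul_mono]
  exact L.top_filt b (L.oddProd_mem_filt (by simpa using h))

/-- A set `J ≠ I` of the same size meets the complement of `I`, so the product of `q` factors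
contains a repetition and drops in the filtration. -/
lemma top_mono_mul_mono_of_ne {I J : Finset (Fin q)} (h : J.card = I.card) (hne : J ≠ I) :
    L.top b (L.mono b Iᶜ * L.mono b J) = 0 := by
  rw [mono_mul_mono]
  have hd : ∃ a ∈ J, a ∉ I := by
    by_contra! hc
    exact hne (Finset.eq_of_subset_of_card_le hc h.ge)
  obtain ⟨a, haJ, haI⟩ := hd
  have := L.oddProd_mem_of_duplicate
    (l := (Iᶜ.sort (· ≤ ·) ++ J.sort (· ≤ ·)).map b) (fun hn => by
      have := List.Nodup.of_map _ hn
      exact (List.nodup_append.1 this).2.2 a (by simpa using haI) a (by simpa using haJ) rfl)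
  refine L.top_filt b (L.filt_mono ?_ this)
  have := Finset.card_add_card_compl I
  simp only [Fintype.card_fin] at this
  simp only [List.length_map, List.length_append, Finset.length_sort]
  omega

/-- The concatenation is a permutation of all basis vectors, hence `±` the full product modulo lower
order. -/
lemma top_mono_compl_mul_mono (I : Finset (Fin q)) :
    L.top b (L.mono b Iᶜ * L.mono b I) ≠ 0 := by
  have hp : ((Iᶜ.sort (· ≤ ·) ++ I.sort (· ≤ ·)).map b).Perm
      (((Finset.univ : Finset (Fin q)).sort (· ≤ ·)).map b) := by
    refine List.Perm.map _ ((List.perm_ext_iff_of_nodup ?_ (Finset.sort_nodup _ _)).2 ?_)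
    · refine List.nodup_append.2 ⟨Finset.sort_nodup _ _, Finset.sort_nodup _ _, ?_⟩
      rintro a ha c hc rfl
      simp_all
    · intro a
      simp only [List.mem_append, Finset.mem_sort, Finset.mem_univ, iff_true, Finset.mem_compl]
      tauto
  obtain ⟨ε, hε⟩ := L.oddProd_perm hp
  rw [← mono_mul_mono, ← mono_eq_oddProd] at hε
  have h1 := L.top_filt b (L.filt_mono (by rw [hp.length_eq]; simp) hε)
  rw [map_sub, sub_eq_zero] at h1
  rw [h1]
  rcases Int.units_eq_one_or ε with rfl | rfl <;> simp [top_mono]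

lemma even_sub_mem_idealDelta (u : L.Env) (x : L.gr 0) :
    u * L.ι x - L.deltaOdd x • u ∈ L.idealDelta := by
  have := L.idealDelta.mul_mem_left u (Ideal.subset_span ⟨x, rfl⟩ :
    L.ι x - algebraMap K L.Env (L.deltaOdd x) ∈ L.idealDelta)
  rwa [mul_sub, ← Algebra.commutes, ← Algebra.smul_def] at this

/-- The generators `x - δ(x)` are killed by `top_mul_even`. Thus the pairing `top(v u)` is well
defined for `u` in `U(𝔤)/I_δ`. -/
lemma top_mul_idealDelta (v : L.Env) {u : L.Env} (hu : u ∈ L.idealDelta) : L.top b (v * u) = 0 := by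
  induction hu using Submodule.span_induction generalizing v with
  | mem u hu =>
    obtain ⟨x, rfl⟩ := hu
    rw [mul_sub, ← Algebra.commutes, ← Algebra.smul_def, map_sub, map_smul, top_mul_even]
    simp
  | zero => simp
  | add x y _ _ hx hy => rw [mul_add, map_add, hx, hy, add_zero]
  | smul a x _ hx => rw [smul_eq_mul, ← mul_assoc, hx]

/-- The module `U(𝔤) / I_δ` is spanned by the ordered products of odd basis vectors. -/
lemma exists_sum_mono_sub_mem (u : L.Env) :
    ∃ c : Finset (Fin q) → K, u - ∑ I, c I • L.mono b I ∈ L.idealDelta := by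
  let D : Submodule K L.Env := L.idealDelta.restrictScalars K
  let M : ℕ → Submodule K L.Env := fun n => Submodule.span K (L.mono b '' {I | I.card < n}) ⊔ D
  have mono_M : ∀ n, M n ≤ M (n + 1) := fun n => by
    refine sup_le_sup_right (Submodule.span_mono (Set.image_mono ?_)) _
    intro I hI
    exact Nat.lt_succ_of_lt hI
  have hmem : ∀ n (I : Finset (Fin q)), I.card < n → L.mono b I ∈ M n := fun n I hI =>
    Submodule.mem_sup_left (Submodule.subset_span ⟨I, hI, rfl⟩)
  have key : ∀ n, L.filt n ≤ M n := by
    intro n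
    induction n with
    | zero => rw [filt_zero]; exact bot_le
    | succ n ih =>
      refine L.filt_le_of_mono_mem b (fun x u hu => ?_) fun I hI => hmem _ I hI
      have : M (n + 1) ≤ (M (n + 1)).comap (LinearMap.mulLeft K (L.ι x)) := by
        refine sup_le (Submodule.span_le.2 ?_) fun u hu =>
          Submodule.mem_sup_right (L.idealDelta.mul_mem_left (L.ι x) hu)
        rintro _ ⟨I, hI, rfl⟩
        change L.ι x * L.mono b I ∈ M (n + 1)
        rcases Nat.lt_succ_iff_lt_or_eq.1 hI with hI | hI
        · exact mono_M n (ih (L.even_mul_mem_filt x (L.mono_mem_filt b hI)))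
        · obtain ⟨l, hl, he⟩ : ∃ l : List (L.gr 1), l.length = n ∧ L.mono b I = L.oddProd l :=
            ⟨_, by simpa using hI, L.mono_eq_oddProd b I⟩
          -- The even letter is moved from the left of `e_I` to its right, where it becomes the
          -- scalar `δ(x)` modulo the ideal; the correction terms have as many odd factors as `e_I`.
          have h1 := L.even_mul_oddProd x l.get
          rw [List.ofFn_get, ← he] at h1
          rw [h1]
          refine add_mem ?_ (sum_mem fun i _ => L.oddProd_mem_of_mono_mem b _ ?_ fun J hJ => ?_)
          · have h2 := add_mem (Submodule.mem_sup_right (L.even_sub_mem_idealDelta (L.mono b I) x) :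
              _ ∈ M (n + 1)) (Submodule.smul_mem _ (L.deltaOdd x)
                (hmem (n + 1) I (by omega)))
            rwa [sub_add_cancel] at h2
          · rw [List.length_ofFn, hl]
            exact ih.trans (mono_M n)
          · rw [List.length_ofFn] at hJ
            exact hmem _ _ (by omega)
      exact this hu
  have hu : u ∈ M (q + 1) := key _ (by
    have := L.filt_card_eq_top b
    rw [Fintype.card_fin] at this
    rw [this]
    trivial)
  obtain ⟨y, hy, z, hz, rfl⟩ := Submodule.mem_sup.1 hu
  have hy' : y ∈ Submodule.span K (Set.range (L.mono b)) :=
    Submodule.span_mono (Set.image_subset_range _ _) hy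
  obtain ⟨c, rfl⟩ := (Submodule.mem_span_range_iff_exists_fun K).1 hy'
  have hz' : z ∈ L.idealDelta := hz
  exact ⟨c, by simpa using hz'⟩

/-- The Gram matrix `top(e_{Iᶜ} e_J)` is triangular for the cardinality, with non-zero diagonal.
Pairing with `e_{Iᶜ}`, for `I` of maximal size with `c I ≠ 0`, isolates `c I`. -/
lemma eq_zero_of_top_mul (c : Finset (Fin q) → K)
    (h : ∀ I, L.top b (L.mono b I * ∑ J, c J • L.mono b J) = 0) : c = 0 := by
  classical
  by_contra hc
  obtain ⟨I₀, hI₀⟩ := Function.ne_iff.1 hc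
  obtain ⟨I, hI, hmax⟩ := Finset.exists_max_image
    (Finset.univ.filter fun I => c I ≠ 0) Finset.card ⟨I₀, by simpa using hI₀⟩
  have := h Iᶜ
  rw [Finset.mul_sum, map_sum, Finset.sum_eq_single I] at this
  · rw [mul_smul_comm, map_smul, smul_eq_mul, mul_eq_zero] at this
    rcases this with h0 | h0
    · simp [h0] at hI
    · exact L.top_mono_compl_mul_mono b I h0
  · intro J _ hJ
    rw [mul_smul_comm, map_smul, smul_eq_mul]
    by_cases hcJ : c J = 0
    · rw [hcJ, zero_mul]
    have hle := hmax J (by simpa using hcJ)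
    rcases hle.lt_or_eq with hlt | heq
    · rw [top_mono_mul_mono_of_lt, mul_zero]
      have := Finset.card_add_card_compl I
      simp only [Fintype.card_fin] at this
      omega
    · rw [L.top_mono_mul_mono_of_ne b heq hJ, mul_zero]
  · simp

include b in
-- Nondegeneracy: modulo the ideal, `u` is a combination of the `e_I`, and the triangular Gram
-- matrix makes its coefficients vanish.
theorem mem_idealDelta_iff (u : L.Env) : u ∈ L.idealDelta ↔ ∀ v, L.top b (v * u) = 0 := by
  refine ⟨fun hu v => L.top_mul_idealDelta b v hu, fun h => ?_⟩
  obtain ⟨c, hc⟩ := L.exists_sum_mono_sub_mem b u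
  have h0 : c = 0 := L.eq_zero_of_top_mul b c fun I => by
    have := L.top_mul_idealDelta b (L.mono b I) hc
    rw [mul_sub, map_sub, h, zero_sub, neg_eq_zero] at this
    exact this
  simpa [h0] using hc

lemma counit_ι (x : 𝔤) : L.counit (L.ι x) = 0 := by simp [counit, lift_ι]

/-- The Gram matrix is square and injective, hence surjective, so some combination of the `e_J`
represents the counit on all `e_I`. Both sides vanish on left multiples of even elements, so this
suffices. -/
theorem exists_top_mul_eq_counit : ∃ γ : L.Env, ∀ u, L.top b (u * γ) = L.counit u := by
  let T : (Finset (Fin q) → K) →ₗ[K] (Finset (Fin q) → K) :=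
    LinearMap.pi fun I => L.top b ∘ₗ LinearMap.mulLeft K (L.mono b I) ∘ₗ
      Fintype.linearCombination K (L.mono b)
  have hT : ∀ c I, T c I = L.top b (L.mono b I * ∑ J, c J • L.mono b J) := fun c I => by
    simp [T, Fintype.linearCombination_apply, Finset.mul_sum, map_sum]
  have hinj : Function.Injective T := by
    rw [← LinearMap.ker_eq_bot, LinearMap.ker_eq_bot']
    intro c hc
    exact L.eq_zero_of_top_mul b c fun I => by rw [← hT, hc]; rfl
  obtain ⟨c, hc⟩ := LinearMap.injective_iff_surjective.1 hinj fun I => L.counit (L.mono b I)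
  refine ⟨∑ J, c J • L.mono b J, fun u => ?_⟩
  refine L.eq_top_of_mono_mem b (M := LinearMap.ker (L.top b ∘ₗ
    LinearMap.mulRight K (∑ J, c J • L.mono b J) - L.counit.toLinearMap)) (fun y u _ => ?_)
    (fun I => ?_) u |> sub_eq_zero.1
  · simp [mul_assoc, top_even_mul, counit_ι]
  · have := congrFun hc I
    rw [hT] at this
    simp [this]

/-- For an invariant class every letter to the left of `γ` acts by zero, also behind an arbitrary
prefix `v`; hence only the counit of a word survives under `top`. Conversely the formula gives
`top(v x γ) = 0` for all `v`, and nondegeneracy puts `x γ` into the ideal. -/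
lemma mkQ_mem_invariants_iff (γ : L.Env) : L.idealDelta.mkQ γ ∈ L.invariants ↔
    ∀ u, L.top b (u * γ) = L.counit u * L.top b γ := by
  have e : L.idealDelta.mkQ γ ∈ L.invariants ↔ ∀ x, L.ι x * γ ∈ L.idealDelta :=
    forall_congr' fun x => (Submodule.Quotient.mk_eq_zero _)
  rw [e]
  refine ⟨fun h u => ?_, fun h x => ?_⟩
  · have key : ∀ w v : L.Env, L.top b (v * w * γ) = L.counit w * L.top b (v * γ) := fun w => by
      induction w using L.env_induction with
      | one => simp
      | add u v hu hv => intro w; simp [mul_add, add_mul, hu, hv]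
      | smul c u hu => intro w; rw [mul_smul_comm, smul_mul_assoc, map_smul, map_smul, hu]; simp [mul_assoc]
      | mul x u hu =>
        intro w
        rw [← mul_assoc, hu, mul_assoc w, L.top_mul_idealDelta b w (h x)]
        simp [counit_ι]
    simpa using key u 1
  · rw [L.mem_idealDelta_iff b]
    intro v
    rw [← mul_assoc, h]
    simp [counit_ι]

include b in
-- On invariants the class is recovered from the number `top(γ)`, as `top(v γ) = ε(v) top(γ)` and
-- the pairing is nondegenerate. The element representing the counit has value `1`.
theorem finrank_invariants : Module.finrank K L.invariants = 1 := by
  obtain ⟨γ, hγ⟩ := L.exists_top_mul_eq_counit b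
  have h1 : L.top b γ = 1 := by simpa using hγ 1
  refine (finrank_eq_one_iff' (K := K) (V := L.invariants)).2 ⟨⟨L.idealDelta.mkQ γ,
    (L.mkQ_mem_invariants_iff b γ).2 fun u => by rw [hγ, h1, mul_one]⟩, fun h0 => ?_, ?_⟩
  · have h0 := (Submodule.Quotient.mk_eq_zero _).1 (congrArg Subtype.val h0)
    have := L.top_mul_idealDelta b 1 h0
    rw [one_mul, h1] at this
    exact one_ne_zero this
  · rintro ⟨m, hm⟩
    obtain ⟨w, rfl⟩ := L.idealDelta.mkQ_surjective m
    refine ⟨L.top b w, Subtype.ext ?_⟩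
    have hw := (L.mkQ_mem_invariants_iff b w).1 hm
    refine (Submodule.Quotient.eq (p := L.idealDelta) (x := L.top b w • γ) (y := w)).2 ?_
    rw [L.mem_idealDelta_iff b]
    intro v
    rw [mul_sub, mul_smul_comm, map_sub, map_smul, hγ, hw, smul_eq_mul, mul_comm, sub_self]

lemma top_ne_zero_of_invariant {γ : L.Env} (hγ : L.idealDelta.mkQ γ ∈ L.invariants)
    (h0 : L.idealDelta.mkQ γ ≠ 0) : L.top b γ ≠ 0 := fun h => h0 <| by
  refine (Submodule.Quotient.mk_eq_zero _).2 ((L.mem_idealDelta_iff b γ).2 fun v => ?_)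
  rw [(L.mkQ_mem_invariants_iff b γ).1 hγ, h, mul_zero]

include b in
/-- An automorphism of `𝔤` acts on the invariants in `U(𝔤) / I_δ` by its determinant on the odd
part. -/
lemma envMap_invariant {A : 𝔤 →ₗ[K] 𝔤} {hA : ∀ i, ∀ x ∈ L.gr i, A x ∈ L.gr i}
    {hb : ∀ x y, A (L.bracket x y) = L.bracket (A x) (A y)}
    (hs : Function.Surjective (L.envMap A hA hb)) {γ : L.Env}
    (hγ : L.idealDelta.mkQ γ ∈ L.invariants) :
    L.envMap A hA hb γ - LinearMap.det (A.restrict (hA 1)) • γ ∈ L.idealDelta := by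
  let c : L.Env →ₐ[K] K := L.counit.comp (L.envMap A hA hb)
  have hc : ∀ u, L.counit (L.envMap A hA hb u) = L.counit u := fun u => by
    have : c = L.counit := L.algHom_ext fun x => by simp [c, envMap_ι, counit_ι]
    exact DFunLike.congr_fun this u
  rw [L.mem_idealDelta_iff b]
  have h := (L.mkQ_mem_invariants_iff b γ).1 hγ
  intro v
  obtain ⟨w, rfl⟩ := hs v
  rw [mul_sub, ← map_mul, map_sub, top_envMap, mul_smul_comm, map_smul, h, h, hc, smul_eq_mul,
    sub_self]

end Invariants

end LieSuperalgebra


namespace LieSuperalgebra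

/-! ### Convolution of functionals on `U(𝔤)`, the pointwise form of the product of superfunctions.
-/

section Convolution

variable {K 𝔤 : Type*} [Field K] [CharZero K] [AddCommGroup 𝔤] [Module K 𝔤]
  (L : LieSuperalgebra K 𝔤)

/-- The convolution product of linear functionals on `U(𝔤)`. -/
def conv (f h : L.Env →ₗ[K] K) : L.Env →ₗ[K] K :=
  LinearMap.mul' K K ∘ₗ TensorProduct.map f h ∘ₗ L.signOp ∘ₗ L.comul

lemma conv_one (f h : L.Env →ₗ[K] K) : L.conv f h 1 = f 1 * h 1 := by
  have h2 : (2⁻¹ : K) * (f 1 * h 1 + f 1 * h 1) = f 1 * h 1 := by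
    rw [← two_mul, inv_mul_cancel_left₀ two_ne_zero]
  simpa [conv, comul_apply, signOp, mul_add] using h2

lemma signOp_tensorLie_even (x : L.gr 0) (w : L.Env ⊗[K] L.Env) :
    L.signOp (L.tensorLie x w) = (LinearMap.mulLeft K (L.ι x)).rTensor L.Env (L.signOp w)
      + (LinearMap.mulLeft K (L.ι x)).lTensor L.Env (L.signOp w) := by
  induction w using TensorProduct.induction_on with
  | zero => simp
  | tmul a c =>
    simp [signOp, tensorLie_tmul, L.evenPart_even x.2, L.oddPart_even x.2, L.parity_even x.2]
    module
  | add v w hv hw => simp only [map_add, hv, hw]; abel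

/-- The sign operator transfers the Koszul sign: where `x` acts on the second factor the sign of
passing the first one disappears, and where `x` acts on the first factor a parity appears on the
second. -/
lemma signOp_tensorLie_odd (x : L.gr 1) (w : L.Env ⊗[K] L.Env) :
    L.signOp (L.tensorLie x w) =
      TensorProduct.map (LinearMap.mulLeft K (L.ι x)) L.parity.toLinearMap (L.signOp w)
      + (LinearMap.mulLeft K (L.ι x)).lTensor L.Env (L.signOp w) := by
  induction w using TensorProduct.induction_on with
  | zero => simp
  | tmul a c =>
    simp [signOp, tensorLie_tmul, L.evenPart_odd x.2, L.oddPart_odd x.2, L.parity_odd x.2,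
      L.parity_parity, TensorProduct.neg_tmul, TensorProduct.tmul_neg]
    module
  | add v w hv hw => simp only [map_add, hv, hw]; abel

lemma conv_even_mul (f h : L.Env →ₗ[K] K) (x : L.gr 0) (u : L.Env) :
    L.conv f h (L.ι x * u) = L.conv (f ∘ₗ LinearMap.mulLeft K (L.ι x)) h u
      + L.conv f (h ∘ₗ LinearMap.mulLeft K (L.ι x)) u := by
  simp only [conv, LinearMap.comp_apply, comul_ι_mul, signOp_tensorLie_even, map_add]
  congr 2 <;> rw [← LinearMap.comp_apply] <;> congr 1 <;> ext a c <;> simp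

lemma conv_odd_mul (f h : L.Env →ₗ[K] K) (x : L.gr 1) (u : L.Env) :
    L.conv f h (L.ι x * u) =
      L.conv (f ∘ₗ LinearMap.mulLeft K (L.ι x)) (h ∘ₗ L.parity.toLinearMap) u
      + L.conv f (h ∘ₗ LinearMap.mulLeft K (L.ι x)) u := by
  simp only [conv, LinearMap.comp_apply, comul_ι_mul, signOp_tensorLie_odd, map_add]
  congr 2 <;> rw [← LinearMap.comp_apply] <;> congr 1 <;> ext a c <;> simp

lemma parity_mem_filt {n : ℕ} {u : L.Env} (hu : u ∈ L.filt n) : L.parity u ∈ L.filt n := by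
  have : L.filt n ≤ (L.filt n).comap L.parity.toLinearMap := by
    refine L.filt_le fun k hk u hu => ?_
    change L.parity u ∈ L.filt n
    suffices h : ∃ ε : ℤˣ, L.parity u = ε • u by
      obtain ⟨ε, h⟩ := h
      rw [h]
      exact L.unit_smul_mem _ ε (hu.mem_filt L hk)
    clear hk
    induction hu with
    | one => exact ⟨1, by simp⟩
    | even x _ ih =>
      obtain ⟨ε, h⟩ := ih
      exact ⟨ε, by rw [map_mul, L.parity_even x.2, h, mul_smul_comm]⟩
    | odd x _ ih =>
      obtain ⟨ε, h⟩ := ih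
      exact ⟨-ε, by rw [map_mul, L.parity_odd x.2, h, neg_mul, mul_smul_comm, Units.neg_smul]⟩
  exact this hu

/-- Orders of vanishing of functionals add up under convolution. -/
lemma conv_filt {m n : ℕ} {f h : L.Env →ₗ[K] K} (hf : ∀ u ∈ L.filt m, f u = 0)
    (hh : ∀ u ∈ L.filt n, h u = 0) {u : L.Env} (hu : u ∈ L.filt (m + n)) : L.conv f h u = 0 := by
  have key : ∀ (k : ℕ) (u : L.Env), L.IsWord k u → ∀ (m n : ℕ) (f h : L.Env →ₗ[K] K),
      (∀ u ∈ L.filt m, f u = 0) → (∀ u ∈ L.filt n, h u = 0) → k < m + n →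
      L.conv f h u = 0 := by
    intro k u hu
    induction hu with
    | one =>
      intro m n f h hf hh hk
      rw [conv_one]
      rcases Nat.eq_zero_or_pos m with rfl | hm
      · obtain ⟨n, rfl⟩ := Nat.exists_eq_succ_of_ne_zero (by omega : n ≠ 0)
        rw [hh 1 (L.one_mem_filt n), mul_zero]
      · obtain ⟨m, rfl⟩ := Nat.exists_eq_succ_of_ne_zero hm.ne'
        rw [hf 1 (L.one_mem_filt m), zero_mul]
    | even x _ ih =>
      intro m n f h hf hh hk
      rw [conv_even_mul, ih m n _ _ (fun u hu => hf (L.ι x * u) (L.even_mul_mem_filt x hu)) hh hk,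
        ih m n _ _ hf (fun u hu => hh (L.ι x * u) (L.even_mul_mem_filt x hu)) hk, add_zero]
    | odd x _ ih =>
      intro m n f h hf hh hk
      -- Precomposing with an odd letter lowers the order of vanishing by one. The truncated
      -- subtraction is harmless, because for order `0` the space `filt 0` is zero.
      rw [conv_odd_mul, ih (m - 1) n _ _ (fun u hu => ?_)
        (fun u hu => hh (L.parity u) (L.parity_mem_filt hu)) (by omega),
        ih m (n - 1) _ _ hf (fun u hu => ?_) (by omega), add_zero]
      · rcases Nat.eq_zero_or_pos n with rfl | hn
        · rw [show 0 - 1 = 0 from rfl, filt_zero, Submodule.mem_bot] at hu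
          simp [hu]
        · exact hh (L.ι x * u) (L.filt_mono (by omega) (L.odd_mul_mem_filt x hu))
      · rcases Nat.eq_zero_or_pos m with rfl | hm
        · rw [show 0 - 1 = 0 from rfl, filt_zero, Submodule.mem_bot] at hu
          simp [hu]
        · exact hf (L.ι x * u) (L.filt_mono (by omega) (L.odd_mul_mem_filt x hu))
  have : L.filt (m + n) ≤ LinearMap.ker (L.conv f h) :=
    L.filt_le fun k hk u hu => key k u hu m n f h hf hh hk
  exact this hu

variable {ι : Type*} [Fintype ι] [LinearOrder ι] (b : Module.Basis ι K (L.gr 1))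

lemma parity_mono (I : Finset ι) : L.parity (L.mono b I) = (-1 : ℤˣ) ^ I.card • L.mono b I := by
  induction I using Finset.induction_on_min with
  | empty => simp
  | insert i I hi ih =>
    rw [L.mono_insert b hi, map_mul, L.parity_odd (b i).2, ih,
      Finset.card_insert_of_notMem fun h => lt_irrefl _ (hi i h), pow_succ, mul_smul, neg_mul,
      mul_smul_comm, Units.neg_smul, one_smul, smul_neg]

/-- The coproduct of `e_I` distributes its factors over the two tensor factors in all ways. The
signs are chosen before the functionals, so that they do not vary with the point when the formula is
applied to superfunctions. -/
lemma exists_conv_mono (I : Finset ι) : ∃ ε : Finset ι → ℤˣ, ∀ f h : L.Env →ₗ[K] K,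
    L.conv f h (L.mono b I) =
      ∑ J ∈ I.powerset, ε J • (f (L.mono b J) * h (L.mono b (I \ J))) := by
  induction I using Finset.induction_on_min with
  | empty => exact ⟨fun _ => 1, fun f h => by simp [conv_one]⟩
  | insert i I hi ih =>
    obtain ⟨ε, hε⟩ := ih
    have hni : i ∉ I := fun h => lt_irrefl _ (hi i h)
    refine ⟨fun J => if i ∈ J then ε (J.erase i) * (-1) ^ (I \ J.erase i).card else ε J,
      fun f h => ?_⟩
    rw [L.mono_insert b hi, conv_odd_mul, hε, hε, Finset.sum_powerset_insert hni, add_comm]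
    congr 1 <;> refine Finset.sum_congr rfl fun J hJ => ?_
    · have hJ := Finset.mem_powerset.1 hJ
      have hiJ : i ∉ J := fun h => hni (hJ h)
      dsimp only
      rw [if_neg hiJ, Finset.insert_sdiff_of_notMem _ hiJ, L.mono_insert b
        (fun j hj => hi j (Finset.mem_sdiff.1 hj).1)]
      simp
    · have hJ := Finset.mem_powerset.1 hJ
      have hiJ : i ∉ J := fun h => hni (hJ h)
      dsimp only
      rw [if_pos (Finset.mem_insert_self _ _), Finset.erase_insert hiJ,
        Finset.insert_sdiff_insert, Finset.sdiff_insert_of_notMem hni,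
        L.mono_insert b (fun j hj => hi j (hJ hj)), mul_smul]
      simp [parity_mono, mul_smul_comm]

/-- The iterated convolution product. -/
def convProd (x : ι → L.Env →ₗ[K] K) (I : Finset ι) : L.Env →ₗ[K] K :=
  ((I.sort (· ≤ ·)).map x).foldr L.conv L.counit.toLinearMap

lemma convProd_empty (x : ι → L.Env →ₗ[K] K) : L.convProd x ∅ = L.counit.toLinearMap := by
  simp [convProd]

lemma convProd_insert (x : ι → L.Env →ₗ[K] K) {i : ι} {I : Finset ι} (h : ∀ j ∈ I, i < j) :
    L.convProd x (insert i I) = L.conv (x i) (L.convProd x I) := by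
  rw [convProd, Finset.sort_insert _ (fun j hj => (h j hj).le) fun hi => lt_irrefl _ (h i hi)]
  rfl

lemma convProd_filt {x : ι → L.Env →ₗ[K] K} (hx : ∀ i, ∀ u ∈ L.filt 1, x i u = 0)
    (I : Finset ι) : ∀ u ∈ L.filt I.card, L.convProd x I u = 0 := by
  induction I using Finset.induction_on_min with
  | empty =>
    intro u hu
    rw [Finset.card_empty, filt_zero, Submodule.mem_bot] at hu
    simp [hu]
  | insert i I hi ih =>
    intro u hu
    rw [convProd_insert L x hi]
    refine L.conv_filt (hx i) ih ?_
    rwa [Finset.card_insert_of_notMem (fun h => lt_irrefl _ (hi i h)), add_comm] at hu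

lemma counit_mono (I : Finset ι) : L.counit (L.mono b I) = if I = ∅ then 1 else 0 := by
  induction I using Finset.induction_on_min with
  | empty => simp
  | insert i I hi ih => simp [L.mono_insert b hi, counit_ι]

/-- Products of functionals which are dual to the basis of the odd part are dual to the ordered
products of basis vectors, up to sign. The hypothesis is required either in degree at most one, or,
if `H` holds, in all degrees. -/
lemma exists_convProd_mono (H : Prop) (I : Finset ι) : ∃ ε : ℤˣ, ∀ x : ι → L.Env →ₗ[K] K,
    (∀ (i : ι) (J : Finset ι), J.card ≤ 1 ∨ H → x i (L.mono b J) = if J = {i} then 1 else 0) →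
    ∀ J : Finset ι, J.card ≤ I.card ∨ H →
      L.convProd x I (L.mono b J) = if J = I then ε • 1 else 0 := by
  induction I using Finset.induction_on_min with
  | empty =>
    refine ⟨1, fun x _ J _ => ?_⟩
    rw [convProd_empty, one_smul]
    exact L.counit_mono b J
  | insert i I hi ih =>
    obtain ⟨ε, hε⟩ := ih
    obtain ⟨η, hη⟩ := L.exists_conv_mono b (insert i I)
    have hni : i ∉ I := fun h => lt_irrefl _ (hi i h)
    refine ⟨η {i} * ε, fun x hx J hJ => ?_⟩
    have hε := hε x hx
    rw [convProd_insert L x hi]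
    obtain ⟨θ, hθ⟩ := L.exists_conv_mono b J
    -- Only the splitting of `J` into `{i}` and `I` contributes: if `J'` falls outside the range
    -- where `x i` is known, it has at least two elements, and then `J \ J'` is too small for the
    -- remaining product to be non-zero.
    have hz : ∀ J' ⊆ J, ¬ (J' = {i} ∧ J \ J' = I) →
        x i (L.mono b J') * L.convProd x I (L.mono b (J \ J')) = 0 := by
      intro J' hJ' hne
      have hc := Finset.card_sdiff_add_card_eq_card hJ'
      rw [Finset.card_insert_of_notMem hni] at hJ
      by_cases h1 : J'.card ≤ 1 ∨ H
      · rw [hx i J' h1]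
        by_cases h2 : J' = {i}
        · have h3 : J'.card = 1 := by simp [h2]
          have h4 : J \ J' ≠ I := fun h => hne ⟨h2, h⟩
          rw [hε _ (hJ.imp_left fun h => by omega), if_neg h4, mul_zero]
        · rw [if_neg h2, zero_mul]
      · rw [not_or] at h1
        have hJ := hJ.resolve_right h1.2
        rw [hε _ (Or.inl (by omega)), if_neg, mul_zero]
        rintro rfl
        omega
    by_cases hJI : J = insert i I
    · subst hJI
      rw [hη, Finset.sum_eq_single {i}, hx i _ (Or.inl (by simp)), if_pos rfl, if_pos rfl]
      · have : insert i I \ {i} = I := by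
          rw [Finset.sdiff_singleton_eq_erase, Finset.erase_insert hni]
        rw [this, hε I (Or.inl le_rfl), if_pos rfl, one_mul, mul_smul]
      · intro J' hJ' hne
        rw [hz J' (Finset.mem_powerset.1 hJ') fun h => hne h.1, smul_zero]
      · intro h
        simp at h
    · rw [hθ, if_neg hJI]
      refine Finset.sum_eq_zero fun J' hJ' => ?_
      have hJ' := Finset.mem_powerset.1 hJ'
      rw [hz J' hJ' ?_, smul_zero]
      rintro ⟨rfl, rfl⟩
      refine hJI ?_
      rw [Finset.insert_eq, Finset.union_sdiff_of_subset hJ']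

end Convolution

end LieSuperalgebra


/-! ### Left-invariant and right-invariant differential operators on `G`. -/

section Calculus

/-- Mixed partial derivatives commute. -/
lemma deriv_deriv_comm {F : Type*} [NormedAddCommGroup F] [NormedSpace ℝ F] {H : ℝ × ℝ → F}
    (hH : ContDiffAt ℝ 2 H (0, 0)) :
    deriv (fun s => deriv (fun t => H (s, t)) 0) 0 =
      deriv (fun t => deriv (fun s => H (s, t)) 0) 0 := by
  have hev : ∀ᶠ z in nhds ((0 : ℝ), (0 : ℝ)), ContDiffAt ℝ 2 H z :=
    hH.eventually (by simp)
  have hd : DifferentiableAt ℝ (fderiv ℝ H) (0, 0) :=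
    (hH.fderiv_right (m := 1) (by norm_num)).differentiableAt (by simp)
  have hs : HasDerivAt (fun s : ℝ => (s, (0 : ℝ))) (1, 0) 0 :=
    (hasDerivAt_id _).prodMk (hasDerivAt_const _ _)
  have ht : HasDerivAt (fun t : ℝ => ((0 : ℝ), t)) (0, 1) 0 :=
    (hasDerivAt_const _ _).prodMk (hasDerivAt_id _)
  have e1 : (fun s => deriv (fun t => H (s, t)) 0) =ᶠ[nhds 0]
      fun s => fderiv ℝ H (s, 0) (0, 1) := by
    have := hs.continuousAt.eventually hev
    filter_upwards [this] with s hs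
    have h1 : HasDerivAt (fun t : ℝ => (s, t)) (0, 1) 0 :=
      (hasDerivAt_const _ _).prodMk (hasDerivAt_id _)
    exact ((hs.differentiableAt (by simp)).hasFDerivAt.comp_hasDerivAt (0 : ℝ) h1).deriv
  have e2 : (fun t => deriv (fun s => H (s, t)) 0) =ᶠ[nhds 0]
      fun t => fderiv ℝ H (0, t) (1, 0) := by
    have := ht.continuousAt.eventually hev
    filter_upwards [this] with t ht
    have h1 : HasDerivAt (fun s : ℝ => (s, t)) (1, 0) 0 :=
      (hasDerivAt_id _).prodMk (hasDerivAt_const _ _)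
    exact ((ht.differentiableAt (by simp)).hasFDerivAt.comp_hasDerivAt (0 : ℝ) h1).deriv
  rw [e1.deriv_eq, e2.deriv_eq]
  have h1 := ((HasFDerivAt.comp_hasDerivAt (f := fun s : ℝ => (s, (0 : ℝ))) (0 : ℝ) hd.hasFDerivAt hs).clm_apply
    (hasDerivAt_const (0 : ℝ) ((0 : ℝ), (1 : ℝ)))).deriv
  have h2 := ((HasFDerivAt.comp_hasDerivAt (f := fun t : ℝ => ((0 : ℝ), t)) (0 : ℝ) hd.hasFDerivAt ht).clm_apply
    (hasDerivAt_const (0 : ℝ) ((1 : ℝ), (0 : ℝ)))).deriv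
  refine h1.trans (Eq.trans ?_ h2.symm)
  simpa using hH.isSymmSndFDerivAt (by simp) (1, 0) (0, 1)

variable {K : Type*} [RCLike K] {p : ℕ}
  {G : Type*} [TopologicalSpace G] [ChartedSpace (EuclideanSpace ℝ (Fin p)) G] [Group G]

/-- The right-invariant differential operator attached to `x ∈ Lie(G)`. -/
def leftDeriv (x : GroupLieAlgebra (𝓡 p) G) (f : G → K) (g : G) : K :=
  mfderiv (𝓡 p) 𝓘(ℝ, K) (fun h : G => f (h * g)) 1 x

/-- A curve through `1` with derivative `x`. -/
def unitCurve (x : EuclideanSpace ℝ (Fin p)) (t : ℝ) : G :=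
  (extChartAt (𝓡 p) (1 : G)).symm (extChartAt (𝓡 p) (1 : G) 1 + t • x)

lemma unitCurve_zero (x : EuclideanSpace ℝ (Fin p)) : (unitCurve x 0 : G) = 1 := by
  simp [unitCurve]

/-- Straight lines in the chart at `1` reduce invariant operators to derivatives in one real
variable; neither one-parameter groups nor the exponential map are needed. -/
lemma mfderiv_eq_deriv_unitCurve {f : G → K} (hf : MDifferentiableAt (𝓡 p) 𝓘(ℝ, K) f 1)
    (x : GroupLieAlgebra (𝓡 p) G) :
    mfderiv (𝓡 p) 𝓘(ℝ, K) f 1 x = deriv (fun t => f (unitCurve x t)) 0 := by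
  let v : EuclideanSpace ℝ (Fin p) := x
  let A : EuclideanSpace ℝ (Fin p) →L[ℝ] K := mfderiv (𝓡 p) 𝓘(ℝ, K) f 1
  have h1 : HasFDerivWithinAt (fun t => f ((extChartAt (𝓡 p) (1 : G)).symm t)) A
    (Set.range (𝓡 p)) (extChartAt (𝓡 p) (1 : G) 1) := hf.hasMFDerivAt.2
  have h1' := h1.hasFDerivAt (by simp)
  have h2 : HasDerivAt (fun t : ℝ => extChartAt (𝓡 p) (1 : G) 1 + t • v) v 0 := by
    have := ((hasDerivAt_id (0 : ℝ)).smul_const v).const_add (extChartAt (𝓡 p) (1 : G) 1)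
    rwa [one_smul] at this
  have h3 := HasFDerivAt.comp_hasDerivAt (0 : ℝ) (by simpa using h1') h2
  exact h3.deriv.symm

variable [LieGroup (𝓡 p) ∞ G]

lemma eventually_contMDiffAt_unitCurve (x : EuclideanSpace ℝ (Fin p)) :
    ∀ᶠ t in nhds (0 : ℝ), ContMDiffAt 𝓘(ℝ, ℝ) (𝓡 p) ∞ (unitCurve x : ℝ → G) t := by
  have hc : Continuous fun t : ℝ => extChartAt (𝓡 p) (1 : G) 1 + t • x := by fun_prop
  have ht : (extChartAt (𝓡 p) (1 : G)).target ∈ nhds (extChartAt (𝓡 p) (1 : G) 1 +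
      (0 : ℝ) • x) := by
    simpa using extChartAt_target_mem_nhds (I := 𝓡 p) (1 : G)
  filter_upwards [hc.continuousAt.eventually_mem
    ((isOpen_extChartAt_target (I := 𝓡 p) (1 : G)).mem_nhds (mem_of_mem_nhds ht))] with t h
  have h1 := (contMDiffOn_extChartAt_symm (I := 𝓡 p) (n := ∞) (1 : G)).contMDiffAt
    ((isOpen_extChartAt_target (I := 𝓡 p) (1 : G)).mem_nhds h)
  refine ContMDiffAt.comp t h1 (ContDiff.contMDiff ?_).contMDiffAt
  fun_prop

lemma contMDiffAt_unitCurve (x : EuclideanSpace ℝ (Fin p)) :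
    ContMDiffAt 𝓘(ℝ, ℝ) (𝓡 p) ∞ (unitCurve x : ℝ → G) 0 := (eventually_contMDiffAt_unitCurve x).self_of_nhds

lemma mdifferentiableAt_right_translate {f : G → K} {g : G}
    (hf : ContMDiffAt (𝓡 p) 𝓘(ℝ, K) ∞ f g) :
    MDifferentiableAt (𝓡 p) 𝓘(ℝ, K) (fun h : G => f (h * g)) 1 := by
  have h2 : ContMDiffAt (𝓡 p) (𝓡 p) ∞ (fun h : G => h * g) 1 :=
    (contMDiff_mul_right (I := 𝓡 p) (n := ∞) (a := g)).contMDiffAt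
  exact (ContMDiffAt.comp (1 : G) (by rwa [one_mul]) h2).mdifferentiableAt (by simp)

lemma mdifferentiableAt_left_translate {f : G → K} {g : G}
    (hf : ContMDiffAt (𝓡 p) 𝓘(ℝ, K) ∞ f g) :
    MDifferentiableAt (𝓡 p) 𝓘(ℝ, K) (fun h : G => f (g * h)) 1 := by
  have h2 : ContMDiffAt (𝓡 p) (𝓡 p) ∞ (fun h : G => g * h) 1 :=
    (contMDiff_mul_left (I := 𝓡 p) (n := ∞) (a := g)).contMDiffAt
  exact (ContMDiffAt.comp (1 : G) (by rwa [mul_one]) h2).mdifferentiableAt (by simp)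

lemma rightDeriv_eq_deriv {f : G → K} {g : G} (hf : ContMDiffAt (𝓡 p) 𝓘(ℝ, K) ∞ f g)
    (x : GroupLieAlgebra (𝓡 p) G) :
    rightDeriv x f g = deriv (fun t => f (g * unitCurve x t)) 0 :=
  mfderiv_eq_deriv_unitCurve (mdifferentiableAt_left_translate hf) x

lemma leftDeriv_eq_deriv {f : G → K} {g : G} (hf : ContMDiffAt (𝓡 p) 𝓘(ℝ, K) ∞ f g)
    (x : GroupLieAlgebra (𝓡 p) G) :
    leftDeriv x f g = deriv (fun t => f (unitCurve x t * g)) 0 :=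
  mfderiv_eq_deriv_unitCurve (mdifferentiableAt_right_translate hf) x

/-- Smooth dependence on parameters, by which the smoothness of the multiplication passes to
`leftDeriv` and `rightDeriv`. -/
lemma contMDiffAt_deriv_zero {N : Type*} [TopologicalSpace N]
    [ChartedSpace (EuclideanSpace ℝ (Fin p)) N] [IsManifold (𝓡 p) ∞ N] {F : N → ℝ → K} {g : N}
    (hF : ContMDiffAt ((𝓡 p).prod 𝓘(ℝ, ℝ)) 𝓘(ℝ, K) ∞ (Function.uncurry F) (g, 0)) :
    ContMDiffAt (𝓡 p) 𝓘(ℝ, K) ∞ (fun h => deriv (F h) 0) g := by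
  have h1 := ContMDiffAt.mfderiv (I := 𝓘(ℝ, ℝ)) (I' := 𝓘(ℝ, K)) (J := 𝓡 p) (m := ∞) (n := ∞)
    F (fun _ => 0) hF contMDiffAt_const (by simp)
  have h0 := inTangentCoordinates_model_space (I := 𝓘(ℝ, ℝ)) (I' := 𝓘(ℝ, K))
    (fun _ : N => (0 : ℝ)) (fun x => F x 0) (fun x => mfderiv 𝓘(ℝ, ℝ) 𝓘(ℝ, K) (F x) 0) g
  have h3 : ContMDiffAt (𝓡 p) 𝓘(ℝ, ℝ →L[ℝ] K) ∞ (fun h => fderiv ℝ (F h) 0) g := by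
    simp only [← mfderiv_eq_fderiv]
    exact h0 ▸ h1
  have h2 : ContMDiffAt (𝓡 p) 𝓘(ℝ, K) ∞ (fun h => fderiv ℝ (F h) 0 (1 : ℝ)) g :=
    h3.clm_apply contMDiffAt_const
  simpa only [fderiv_apply_one_eq_deriv] using h2

lemma contMDiffAt_rightDeriv {f : G → K} {g : G} {U : TopologicalSpace.Opens G}
    (hf : ContMDiffOn (𝓡 p) 𝓘(ℝ, K) ∞ f U) (hg : g ∈ U) (x : GroupLieAlgebra (𝓡 p) G) :
    ContMDiffAt (𝓡 p) 𝓘(ℝ, K) ∞ (rightDeriv x f) g := by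
  have h1 : ∀ h ∈ U, ContMDiffAt (𝓡 p) 𝓘(ℝ, K) ∞ f h := fun h hh =>
    hf.contMDiffAt (U.isOpen.mem_nhds hh)
  have e : rightDeriv x f =ᶠ[nhds g] fun h => deriv (fun t => f (h * unitCurve x t)) 0 := by
    filter_upwards [U.isOpen.mem_nhds hg] with h hh using rightDeriv_eq_deriv (h1 h hh) x
  refine ContMDiffAt.congr_of_eventuallyEq ?_ e
  refine contMDiffAt_deriv_zero (F := fun h t => f (h * unitCurve x t)) ?_
  have h2 : ContMDiffAt ((𝓡 p).prod 𝓘(ℝ, ℝ)) (𝓡 p) ∞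
      (fun z : G × ℝ => z.1 * unitCurve x z.2) (g, 0) :=
    contMDiffAt_fst.mul (ContMDiffAt.comp (g, (0 : ℝ)) (g := unitCurve x) (f := Prod.snd) (contMDiffAt_unitCurve x)
      contMDiffAt_snd)
  exact ContMDiffAt.comp (g, (0 : ℝ)) (by simpa [show (unitCurve x 0 : G) = 1 from unitCurve_zero _] using h1 g hg) h2

lemma contMDiffAt_leftDeriv {f : G → K} {g : G} {U : TopologicalSpace.Opens G}
    (hf : ContMDiffOn (𝓡 p) 𝓘(ℝ, K) ∞ f U) (hg : g ∈ U) (x : GroupLieAlgebra (𝓡 p) G) :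
    ContMDiffAt (𝓡 p) 𝓘(ℝ, K) ∞ (leftDeriv x f) g := by
  have h1 : ∀ h ∈ U, ContMDiffAt (𝓡 p) 𝓘(ℝ, K) ∞ f h := fun h hh =>
    hf.contMDiffAt (U.isOpen.mem_nhds hh)
  have e : leftDeriv x f =ᶠ[nhds g] fun h => deriv (fun t => f (unitCurve x t * h)) 0 := by
    filter_upwards [U.isOpen.mem_nhds hg] with h hh using leftDeriv_eq_deriv (h1 h hh) x
  refine ContMDiffAt.congr_of_eventuallyEq ?_ e
  refine contMDiffAt_deriv_zero (F := fun h t => f (unitCurve x t * h)) ?_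
  have h2 : ContMDiffAt ((𝓡 p).prod 𝓘(ℝ, ℝ)) (𝓡 p) ∞
      (fun z : G × ℝ => unitCurve x z.2 * z.1) (g, 0) :=
    (ContMDiffAt.comp (g, (0 : ℝ)) (g := unitCurve x) (f := Prod.snd) (contMDiffAt_unitCurve x)
      contMDiffAt_snd).mul contMDiffAt_fst
  exact ContMDiffAt.comp (g, (0 : ℝ)) (by simpa [show (unitCurve x 0 : G) = 1 from unitCurve_zero _] using h1 g hg) h2

/-- Left-invariant and right-invariant differential operators commute. -/
lemma leftDeriv_rightDeriv_comm {f : G → K} {g : G} {U : TopologicalSpace.Opens G}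
    (hf : ContMDiffOn (𝓡 p) 𝓘(ℝ, K) ∞ f U) (hg : g ∈ U) (x y : GroupLieAlgebra (𝓡 p) G) :
    leftDeriv x (rightDeriv y f) g = rightDeriv y (leftDeriv x f) g := by
  have h1 : ∀ h ∈ U, ContMDiffAt (𝓡 p) 𝓘(ℝ, K) ∞ f h := fun h hh =>
    hf.contMDiffAt (U.isOpen.mem_nhds hh)
  have hx0 : (unitCurve x 0 : G) = 1 := unitCurve_zero _
  have hy0 : (unitCurve y 0 : G) = 1 := unitCurve_zero _
  have hx := (contMDiffAt_unitCurve (G := G) x)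
  have hy := (contMDiffAt_unitCurve (G := G) y)
  rw [leftDeriv_eq_deriv (contMDiffAt_rightDeriv hf hg y),
    rightDeriv_eq_deriv (contMDiffAt_leftDeriv hf hg x)]
  have e1 : (fun s => rightDeriv y f (unitCurve x s * g)) =ᶠ[nhds 0]
      fun s => deriv (fun t => f (unitCurve x s * g * unitCurve y t)) 0 := by
    have hc : ContinuousAt (fun s => unitCurve x s * g) 0 :=
      (hx.mul contMDiffAt_const).continuousAt
    filter_upwards [hc.eventually_mem (U.isOpen.mem_nhds (by simpa [hx0, hy0] using hg))]
      with s hs using rightDeriv_eq_deriv (h1 _ hs) y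
  have e2 : (fun t => leftDeriv x f (g * unitCurve y t)) =ᶠ[nhds 0]
      fun t => deriv (fun s => f (unitCurve x s * g * unitCurve y t)) 0 := by
    have hc : ContinuousAt (fun s => g * unitCurve y s) 0 :=
      (contMDiffAt_const.mul hy).continuousAt
    filter_upwards [hc.eventually_mem (U.isOpen.mem_nhds (by simpa [hx0, hy0] using hg))]
      with s hs
    rw [leftDeriv_eq_deriv (h1 _ hs) x]
    simp only [mul_assoc]
  rw [e1.deriv_eq, e2.deriv_eq]
  -- By associativity both iterated derivatives are mixed partial derivatives of the same function
  -- `f(x(s) g y(t))`.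
  refine deriv_deriv_comm (H := fun z => f (unitCurve x z.1 * g * unitCurve y z.2)) ?_
  have h2 : ContMDiffAt 𝓘(ℝ, ℝ × ℝ) (𝓡 p) ∞
      (fun z : ℝ × ℝ => unitCurve x z.1 * g * unitCurve y z.2) (0, 0) := by
    refine (ContMDiffAt.mul ?_ contMDiffAt_const).mul ?_
    · exact ContMDiffAt.comp ((0 : ℝ), (0 : ℝ)) (f := fun z : ℝ × ℝ => z.1) hx
        contDiffAt_fst.contMDiffAt
    · exact ContMDiffAt.comp ((0 : ℝ), (0 : ℝ)) (f := fun z : ℝ × ℝ => z.2) hy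
        contDiffAt_snd.contMDiffAt
  have h3 := ContMDiffAt.comp ((0 : ℝ), (0 : ℝ)) (g := f) (by simpa [hx0, hy0] using h1 g hg) h2
  exact h3.contDiffAt.of_le (by norm_cast)

lemma leftDeriv_congr_nhds {f f' : G → K} {g : G} (h : f =ᶠ[nhds g] f')
    (x : GroupLieAlgebra (𝓡 p) G) : leftDeriv x f g = leftDeriv x f' g := by
  have hc : ContinuousAt (fun h : G => h * g) 1 :=
    (contMDiff_mul_right (I := 𝓡 p) (n := ∞) (a := g)).continuous.continuousAt
  have : (fun h : G => f (h * g)) =ᶠ[nhds 1] fun h => f' (h * g) :=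
    hc.eventually (p := fun z => f z = f' z) (by simp only [one_mul]; exact h)
  rw [leftDeriv, leftDeriv, this.mfderiv_eq]
  rfl

lemma rightDeriv_congr_nhds {f f' : G → K} {g : G} (h : f =ᶠ[nhds g] f')
    (x : GroupLieAlgebra (𝓡 p) G) : rightDeriv x f g = rightDeriv x f' g := by
  have hc : ContinuousAt (fun h : G => g * h) 1 :=
    (contMDiff_mul_left (I := 𝓡 p) (n := ∞) (a := g)).continuous.continuousAt
  have : (fun h : G => f (g * h)) =ᶠ[nhds 1] fun h => f' (g * h) :=
    hc.eventually (p := fun z => f z = f' z) (by simp only [mul_one]; exact h)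
  rw [rightDeriv, rightDeriv, this.mfderiv_eq]
  rfl

lemma leftDeriv_mul {f₁ f₂ : G → K} {g : G} (h₁ : ContMDiffAt (𝓡 p) 𝓘(ℝ, K) ∞ f₁ g)
    (h₂ : ContMDiffAt (𝓡 p) 𝓘(ℝ, K) ∞ f₂ g) (x : GroupLieAlgebra (𝓡 p) G) :
    leftDeriv x (f₁ * f₂) g = leftDeriv x f₁ g * f₂ g + f₁ g * leftDeriv x f₂ g := by
  have := ((mdifferentiableAt_right_translate h₁).hasMFDerivAt.mul
    (mdifferentiableAt_right_translate h₂).hasMFDerivAt).mfderiv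
  refine (DFunLike.congr_fun this x).trans ?_
  simp only [one_mul]
  change f₁ g * leftDeriv x f₂ g + f₂ g * leftDeriv x f₁ g = _
  ring

lemma rightDeriv_add_vec {f : G → K} {g : G} (x y : GroupLieAlgebra (𝓡 p) G) :
    rightDeriv (x + y) f g = rightDeriv x f g + rightDeriv y f g := map_add _ _ _

lemma rightDeriv_smul_vec {f : G → K} {g : G} (c : ℝ) (x : GroupLieAlgebra (𝓡 p) G) :
    rightDeriv (c • x) f g = c • rightDeriv x f g := map_smul _ _ _

/-- The adjoint action of `G` on its Lie algebra. -/
def adVec (g : G) (x : GroupLieAlgebra (𝓡 p) G) : GroupLieAlgebra (𝓡 p) G :=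
  (mfderiv (𝓡 p) (𝓡 p) (fun h : G => g * h * g⁻¹) 1 x : EuclideanSpace ℝ (Fin p))

/-- The derivative of left translation is given by left-invariant operators in the directions
`Ad(g⁻¹) x`. -/
lemma leftDeriv_eq_rightDeriv {f : G → K} {g : G} (hf : ContMDiffAt (𝓡 p) 𝓘(ℝ, K) ∞ f g)
    (x : GroupLieAlgebra (𝓡 p) G) :
    rightDeriv (adVec g⁻¹ x) f g = leftDeriv x f g := by
  have h1 := (mdifferentiableAt_left_translate hf)
  have h2 : MDifferentiableAt (𝓡 p) (𝓡 p) (fun h : G => g⁻¹ * h * g⁻¹⁻¹) 1 :=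
    ((contMDiff_const.mul contMDiff_id).mul contMDiff_const).contMDiffAt.mdifferentiableAt
      (n := ∞) (by simp)
  have h0 : g⁻¹ * 1 * g⁻¹⁻¹ = 1 := by group
  have h3 : HasMFDerivAt (𝓡 p) 𝓘(ℝ, K) (fun h : G => f (g * h)) (g⁻¹ * 1 * g⁻¹⁻¹)
      (mfderiv (𝓡 p) 𝓘(ℝ, K) (fun h : G => f (g * h)) 1) := by
    rw [h0]
    exact h1.hasMFDerivAt
  have h4 := (h3.comp (1 : G) h2.hasMFDerivAt).mfderiv
  have e : (fun h : G => f (g * h)) ∘ (fun h : G => g⁻¹ * h * g⁻¹⁻¹) = fun h => f (h * g) := by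
    ext h
    simp only [Function.comp_apply]
    congr 1
    group
  rw [e] at h4
  exact (DFunLike.congr_fun h4 x).symm

end Calculus


namespace SupergroupPair

variable {K : Type*} [RCLike K] {p : ℕ}
  {G : Type*} [TopologicalSpace G] [ChartedSpace (EuclideanSpace ℝ (Fin p)) G] [Group G]
  [LieGroup (𝓡 p) ∞ G]
  {𝔤 : Type*} [AddCommGroup 𝔤] [Module K 𝔤] (P : SupergroupPair K p G 𝔤)

/-! ### Smooth functions as a module over the even part of `𝔤`. -/

section EvenRep

/-- The left-invariant differential operator attached to `x` on `C^∞(U, K)`. -/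
def rightOp (U : TopologicalSpace.Opens G) (x : GroupLieAlgebra (𝓡 p) G) :
    smoothFun K p U →ₗ[K] smoothFun K p U where
  toFun f := ⟨(U : Set G).indicator (rightDeriv x f.1),
    fun g hg => ((contMDiffAt_rightDeriv f.2.1 hg x).congr_of_eventuallyEq
      (Filter.eventuallyEq_of_mem (U.isOpen.mem_nhds hg)
        fun _ h => Set.indicator_of_mem h _)).contMDiffWithinAt,
    fun g hg => Set.indicator_of_notMem hg _⟩
  map_add' f f' := Subtype.ext <| funext fun g => by
    by_cases hg : g ∈ (U : Set G)
    · simpa [hg] using rightDeriv_add f.2.1 f'.2.1 hg x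
    · simp [hg]
  map_smul' c f := Subtype.ext <| funext fun g => by
    by_cases hg : g ∈ (U : Set G)
    · simpa [hg] using rightDeriv_smul c f.2.1 hg x
    · simp [hg]

lemma rightOp_apply {U : TopologicalSpace.Opens G} (x : GroupLieAlgebra (𝓡 p) G)
    (f : smoothFun K p U) {g : G} (hg : g ∈ U) : (rightOp U x f).1 g = rightDeriv x f.1 g :=
  Set.indicator_of_mem (s := (U : Set G)) hg _

lemma smoothFun_ext {U : TopologicalSpace.Opens G} {f f' : smoothFun K p U}
    (h : ∀ g ∈ U, f.1 g = f'.1 g) : f = f' := Subtype.ext <| funext fun g => by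
  by_cases hg : g ∈ U
  · exact h g hg
  · rw [f.2.2 g hg, f'.2.2 g hg]

/-- The operators `rightOp` depend linearly on `x`. -/
def rightRep (U : TopologicalSpace.Opens G) :
    GroupLieAlgebra (𝓡 p) G →ₗ[ℝ] Module.End K (smoothFun K p U) where
  toFun := rightOp U
  map_add' x y := LinearMap.ext fun f => smoothFun_ext fun g hg => by
    simp [rightOp_apply, hg, rightDeriv_add_vec]
  map_smul' c x := LinearMap.ext fun f => smoothFun_ext fun g hg => by
    simp [rightOp_apply, hg, rightDeriv_smul_vec]

/-- The action of the even part of `𝔤` on `C^∞(U, K)`. -/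
def evenRep (U : TopologicalSpace.Opens G) : P.L.gr 0 →ₗ[K] Module.End K (smoothFun K p U) :=
  LinearMap.liftBaseChange K (rightRep U) ∘ₗ P.evenEquiv.symm.toLinearMap

lemma evenRep_incl (U : TopologicalSpace.Opens G) (x : GroupLieAlgebra (𝓡 p) G) :
    P.evenRep U ⟨P.incl x, P.incl_mem x⟩ = rightOp U x := by
  simp [evenRep, incl, rightRep]

lemma even_induction {motive : P.L.gr 0 → Prop}
    (incl : ∀ x, motive ⟨P.incl x, P.incl_mem x⟩) (add : ∀ x y, motive x → motive y → motive (x + y))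
    (smul : ∀ (c : K) x, motive x → motive (c • x)) (x : P.L.gr 0) : motive x := by
  obtain ⟨w, rfl⟩ := P.evenEquiv.surjective x
  induction w using TensorProduct.induction_on with
  | zero =>
    rw [map_zero]
    simpa using smul 0 _ (incl 0)
  | tmul c x =>
    have := smul c _ (incl x)
    convert this using 1
    have h : c ⊗ₜ[ℝ] x = c • ((1 : K) ⊗ₜ[ℝ] x) := by simp [TensorProduct.smul_tmul']
    rw [h, map_smul]
    rfl
  | add v w hv hw => rw [map_add]; exact add _ _ hv hw

lemma incl_Ad (g : G) (x : GroupLieAlgebra (𝓡 p) G) : P.Ad g (P.incl x) =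
    P.incl (adVec g x) :=
  P.Ad_even g x

lemma evenRep_Ad_inv {U : TopologicalSpace.Opens G} (f : smoothFun K p U)
    (x : GroupLieAlgebra (𝓡 p) G) {g : G} (hg : g ∈ U) :
    (P.evenRep U (P.L.toEven (P.Ad g⁻¹ (P.incl x))) f).1 g = leftDeriv x f.1 g := by
  rw [incl_Ad, P.L.toEven_even (P.incl_mem _), evenRep_incl, rightOp_apply _ _ hg]
  exact leftDeriv_eq_rightDeriv (f.2.1.contMDiffAt (U.isOpen.mem_nhds hg)) x

variable [FiniteDimensional K 𝔤]

/-- By bilinearity `x` and `y` come from elements `y'`, `z` of the real Lie algebra. With `x0 =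
Ad(g) z`, the function `h ↦ (Ad(h⁻¹) x0 · f)(h)` is the derivative of `f` along left translations by
`x0`. Differentiating it at `g` in the direction `y'` by the product rule gives `-[y', z] f + y' z
f`; commuting left and right derivatives gives `z y' f`. Equating the two is the claim. -/
lemma evenRep_bracket (U : TopologicalSpace.Opens G) (x y : P.L.gr 0) (f : smoothFun K p U) :
    P.evenRep U ⟨P.L.bracket x y, P.L.bracket_even_even x.2 y.2⟩ f =
      P.evenRep U x (P.evenRep U y f) - P.evenRep U y (P.evenRep U x f) := by
  have e : ∀ x y : P.L.gr 0, (⟨P.L.bracket x y, P.L.bracket_even_even x.2 y.2⟩ : P.L.gr 0) =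
      P.L.toEven (P.L.bracket x y) := fun x y =>
    (P.L.toEven_even (P.L.bracket_even_even x.2 y.2)).symm
  rw [e]
  induction x using P.even_induction generalizing f with
  | add x x' hx hx' => simp [hx, hx']; abel
  | smul c x hx => simp [hx, smul_sub]
  | incl y' =>
    induction y using P.even_induction generalizing f with
    | add x x' hx hx' => simp [hx, hx']; abel
    | smul c x hx => simp [hx, smul_sub]
    | incl z =>
      refine smoothFun_ext fun g hg => ?_
      let T : 𝔤 →ₗ[K] (G → K) := (smoothFun K p U).subtype ∘ₗ LinearMap.applyₗ f ∘ₗ P.evenRep U ∘ₗ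
        P.L.toEven
      have hT : ∀ v, T v = (P.evenRep U (P.L.toEven v) f).1 := fun v => rfl
      set x0 : GroupLieAlgebra (𝓡 p) G := adVec g z with hx0
      have hz : P.Ad g⁻¹ (P.incl x0) = P.incl z := by
        rw [hx0, ← incl_Ad, ← LinearEquiv.mul_apply, ← map_mul]; simp
      have h1 := (P.frozen T (U := U) (fun v => (P.evenRep U (P.L.toEven v) f).2.1) (P.incl x0)).2
        y' g hg
      have h2 : (fun h => T (P.Ad h⁻¹ (P.incl x0)) h) =ᶠ[nhds g] leftDeriv x0 f.1 :=
        Filter.eventuallyEq_of_mem (U.isOpen.mem_nhds hg) fun h hh => P.evenRep_Ad_inv f x0 hh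
      rw [rightDeriv_congr_nhds h2, ← leftDeriv_rightDeriv_comm f.2.1 hg] at h1
      have h3 : rightDeriv y' f.1 =ᶠ[nhds g] (rightOp U y' f).1 :=
        Filter.eventuallyEq_of_mem (U.isOpen.mem_nhds hg) fun h hh => (rightOp_apply y' f hh).symm
      rw [leftDeriv_congr_nhds h3, ← P.evenRep_Ad_inv _ _ hg, hz, hT, hT,
        P.L.toEven_even (P.incl_mem z), ← rightOp_apply _ _ hg] at h1
      rw [evenRep_incl P U y']
      change (P.evenRep U (P.L.toEven (P.L.bracket (P.incl y') (P.incl z))) f).1 g =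
        (rightOp U y' (P.evenRep U ⟨P.incl z, P.incl_mem z⟩ f)).1 g -
        (P.evenRep U ⟨P.incl z, P.incl_mem z⟩ (rightOp U y' f)).1 g
      rw [h1]
      ring

end EvenRep

/-! ### Superfunctions as families of smooth components. -/

section Values

lemma superFun_even_mul {U : TopologicalSpace.Opens G} {φ : P.L.Env →ₗ[K] (G → K)}
    (hφ : φ ∈ P.superFun U) (x : P.L.gr 0) (u : P.L.Env) :
    φ (P.L.ι x * u) = (P.evenRep U x ⟨φ u, hφ.1 u⟩).1 := by
  induction x using P.even_induction with
  | add x x' hx hx' => simp [add_mul, hx, hx']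
  | smul c x hx => simp [hx]
  | incl y =>
    rw [evenRep_incl]
    funext g
    by_cases hg : g ∈ U
    · rw [rightOp_apply _ _ hg]
      exact hφ.2 y u g hg
    · rw [(hφ.1 _).2 g hg, (rightOp U y _).2.2 g hg]

variable {ι : Type*} [Fintype ι] [LinearOrder ι] (b : Module.Basis ι K (P.L.gr 1))

/-- As `C` is closed, vanishing outside `C` is a local property; it is inherited by derivatives and
hence by left multiples with even elements. -/
lemma superFun_eq_zero_of_notMem {U : TopologicalSpace.Opens G} {φ : P.L.Env →ₗ[K] (G → K)}
    (hφ : φ ∈ P.superFun U) {C : Set G} (hC : IsClosed C)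
    (h : ∀ I, ∀ g ∉ C, φ (P.L.mono b I) g = 0) (u : P.L.Env) : ∀ g ∉ C, φ u g = 0 := by
  let M : Submodule K P.L.Env :=
    { carrier := {u | ∀ g ∉ C, φ u g = 0}
      add_mem' := fun hu hv g hg => by simp [hu g hg, hv g hg]
      zero_mem' := fun g _ => by simp
      smul_mem' := fun c u hu g hg => by simp [hu g hg] }
  refine P.L.eq_top_of_mono_mem b (M := M) (fun x u hu => ?_) h u
  intro g hg
  induction x using P.even_induction with
  | add x x' hx hx' => simp [add_mul, hx, hx']
  | smul c x hx => simp [hx]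
  | incl y =>
    by_cases hgU : g ∈ U
    · have h0 : φ u =ᶠ[nhds g] fun _ => 0 :=
        Filter.eventuallyEq_of_mem (hC.isOpen_compl.mem_nhds hg) fun h hh => hu h hh
      rw [hφ.2 y u g hgU, rightDeriv_congr_nhds h0, rightDeriv_const]
    · exact (hφ.1 _).2 g hgU

lemma superFun_filt {U : TopologicalSpace.Opens G} {φ : P.L.Env →ₗ[K] (G → K)}
    (hφ : φ ∈ P.superFun U) {n : ℕ} (h : ∀ I : Finset ι, I.card < n → φ (P.L.mono b I) = 0)
    {u : P.L.Env} (hu : u ∈ P.L.filt n) : φ u = 0 := by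
  refine P.L.filt_le_of_mono_mem b (M := LinearMap.ker φ) (fun x u hu => ?_) h hu
  have h0 : (⟨φ u, hφ.1 u⟩ : smoothFun K p U) = 0 := Subtype.ext hu
  rw [LinearMap.mem_ker, P.superFun_even_mul hφ, h0, map_zero]
  rfl

lemma superFun_ext {U : TopologicalSpace.Opens G} {φ ψ : P.L.Env →ₗ[K] (G → K)}
    (hφ : φ ∈ P.superFun U) (hψ : ψ ∈ P.superFun U)
    (h : ∀ I : Finset ι, φ (P.L.mono b I) = ψ (P.L.mono b I)) : φ = ψ := by
  refine LinearMap.ext fun u => sub_eq_zero.1 ?_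
  obtain ⟨n, hn⟩ := P.L.exists_mem_filt u
  exact P.superFun_filt b (sub_mem hφ hψ) (fun I _ => by simp [h]) hn

variable [FiniteDimensional K 𝔤]

/-- Relative Poincaré–Birkhoff–Witt with coefficients in `C^∞(U, K)`. -/
theorem exists_superFun {U : TopologicalSpace.Opens G} (a : Finset ι → smoothFun K p U) :
    ∃ φ ∈ P.superFun U, ∀ I, φ (P.L.mono b I) = (a I).1 := by
  obtain ⟨φ, h1, h2⟩ := P.L.exists_coind b (P.evenRep U) (P.evenRep_bracket U) a
  refine ⟨(smoothFun K p U).subtype ∘ₗ φ, ⟨fun u => (φ u).2, fun x u g hg => ?_⟩,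
    fun I => congrArg Subtype.val (h2 I)⟩
  have := h1 ⟨P.incl x, P.incl_mem x⟩ u
  rw [evenRep_incl] at this
  exact (congrArg (fun f : smoothFun K p U => f.1 g) this).trans (rightOp_apply x _ hg)

/-- A superfunction is determined by its values on the ordered products of odd basis vectors, and
these can be prescribed. -/
def superEquiv (U : TopologicalSpace.Opens G) :
    P.superFun U ≃ₗ[K] (Finset ι → smoothFun K p U) :=
  LinearEquiv.ofBijective
    { toFun := fun φ I => ⟨φ.1 (P.L.mono b I), φ.2.1 _⟩
      map_add' := fun _ _ => rfl
      map_smul' := fun _ _ => rfl }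
    ⟨fun φ ψ h => Subtype.ext (P.superFun_ext b φ.2 ψ.2 fun I =>
      congrArg Subtype.val (congrFun h I)), fun a => by
        obtain ⟨φ, hφ, h⟩ := P.exists_superFun b a
        exact ⟨⟨φ, hφ⟩, funext fun I => Subtype.ext (h I)⟩⟩

lemma superEquiv_symm_mono {U : TopologicalSpace.Opens G} (a : Finset ι → smoothFun K p U)
    (I : Finset ι) : ((P.superEquiv b U).symm a).1 (P.L.mono b I) = (a I).1 :=
  congrArg Subtype.val (congrFun ((P.superEquiv b U).apply_symm_apply a) I)

theorem exists_testFun [T2Space G] (a : Finset ι → G → K)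
    (ha : ∀ I, ContMDiff (𝓡 p) 𝓘(ℝ, K) ∞ (a I)) {C : Set G} (hC : IsCompact C)
    (h : ∀ I, ∀ g ∉ C, a I g = 0) :
    ∃ φ : P.TestFun, (∀ I, φ.val (P.L.mono b I) = a I) ∧ ∀ u, ∀ g ∉ C, φ.val u g = 0 := by
  obtain ⟨φ, hφ, hI⟩ := P.exists_superFun (U := ⊤) b fun I =>
    ⟨a I, (ha I).contMDiffOn, fun g hg => (hg trivial).elim⟩
  have h0 := P.superFun_eq_zero_of_notMem b hφ hC.isClosed fun I g hg => by rw [hI]; exact h I g hg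
  exact ⟨TestFun.mk φ ⟨hφ, C, hC, Set.subset_univ _, h0⟩, hI, h0⟩

end Values

end SupergroupPair


namespace SupergroupPair

variable {K : Type*} [RCLike K] {p : ℕ}
  {G : Type*} [TopologicalSpace G] [ChartedSpace (EuclideanSpace ℝ (Fin p)) G] [Group G]
  {𝔤 : Type*} [AddCommGroup 𝔤] [Module K 𝔤] (P : SupergroupPair K p G 𝔤)

/-! ### Evaluation of superfunctions at a point. -/

section Evaluation

/-- The functional `u ↦ φ(u; g)` on `U(𝔤)`. -/
def evalAt (g : G) : (P.L.Env →ₗ[K] (G → K)) →ₗ[K] (P.L.Env →ₗ[K] K) :=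
  LinearMap.compRight K (LinearMap.proj g)

lemma evalAt_apply (g : G) (φ : P.L.Env →ₗ[K] (G → K)) (u : P.L.Env) :
    P.evalAt g φ u = φ u g := rfl

/-- Evaluation at `g` is multiplicative on functions, so it carries the product of superfunctions to
convolution, where the algebra of signs has been settled. -/
lemma evalAt_mul (g : G) (φ ψ : P.L.Env →ₗ[K] (G → K)) :
    P.evalAt g (P.mul φ ψ) = P.L.conv (P.evalAt g φ) (P.evalAt g ψ) := by
  have : LinearMap.proj g ∘ₗ LinearMap.mul' K (G → K) ∘ₗ TensorProduct.map φ ψ =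
      LinearMap.mul' K K ∘ₗ TensorProduct.map (P.evalAt g φ) (P.evalAt g ψ) := by
    ext u v
    simp [evalAt_apply]
  ext u
  exact DFunLike.congr_fun this (P.L.signOp (P.L.comul u))

lemma mul_apply (φ ψ : P.L.Env →ₗ[K] (G → K)) (u : P.L.Env) (g : G) :
    P.mul φ ψ u g = P.L.conv (P.evalAt g φ) (P.evalAt g ψ) u :=
  DFunLike.congr_fun (P.evalAt_mul g φ ψ) u

lemma evalAt_one {U : Set G} {g : G} (hg : g ∈ U) :
    P.evalAt g (P.one U) = P.L.counit.toLinearMap := by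
  ext u
  simp [evalAt_apply, one, hg]

variable [LieGroup (𝓡 p) ∞ G]

lemma evalAt_monomial {U : TopologicalSpace.Opens G} {q : ℕ} (ξ : Fin q → P.superFun U)
    (I : Finset (Fin q)) {g : G} (hg : g ∈ U) :
    P.evalAt g (P.monomial U ξ I) = P.L.convProd (fun i => P.evalAt g (ξ i).1) I := by
  rw [monomial, LieSuperalgebra.convProd]
  induction I.sort (· ≤ ·) with
  | nil => exact P.evalAt_one hg
  | cons i l ih =>
    rw [List.map_cons, List.foldr_cons, evalAt_mul, ih]
    rfl

lemma monomial_mem {U : TopologicalSpace.Opens G} {q : ℕ} (ξ : Fin q → P.superFun U)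
    (I : Finset (Fin q)) : P.monomial U ξ I ∈ P.superFun U := by
  rw [monomial]
  induction I.sort (· ≤ ·) with
  | nil => exact P.one_mem U
  | cons i l ih => exact P.mul_mem (ξ i).2 ih

end Evaluation

/-! ### Coordinates dual to a basis of the odd part. -/

section StandardCoordinates

variable [LieGroup (𝓡 p) ∞ G] [FiniteDimensional K 𝔤]

/-- The standard basis of the odd part. -/
abbrev oddBasis : Module.Basis (Fin (Module.finrank K (P.L.gr 1))) K (P.L.gr 1) :=
  Module.finBasis K (P.L.gr 1)

/-- The superfunction on `U` with value `f` on the product `e_I` of odd basis vectors, and value `0`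
on `e_J` for `J ≠ I`. -/
def singleFun (U : TopologicalSpace.Opens G) (I : Finset (Fin (Module.finrank K (P.L.gr 1)))) :
    smoothFun K p U →ₗ[K] P.superFun U :=
  (P.superEquiv P.oddBasis U).symm.toLinearMap ∘ₗ LinearMap.single K (fun _ => smoothFun K p U) I

lemma singleFun_mono {U : TopologicalSpace.Opens G}
    (I J : Finset (Fin (Module.finrank K (P.L.gr 1)))) (f : smoothFun K p U) :
    (P.singleFun U I f).1 (P.L.mono P.oddBasis J) = if J = I then f.1 else 0 := by
  rw [singleFun, LinearMap.comp_apply, LinearEquiv.coe_coe, superEquiv_symm_mono]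
  by_cases h : J = I
  · subst h; simp
  · simp [h]

lemma singleFun_parity {U : TopologicalSpace.Opens G}
    (I : Finset (Fin (Module.finrank K (P.L.gr 1)))) (f : smoothFun K p U) (u : P.L.Env) :
    (P.singleFun U I f).1 (P.L.parity u) = (-1 : ℤˣ) ^ I.card • (P.singleFun U I f).1 u := by
  have hmem : ((-1 : ℤˣ) ^ I.card • (P.singleFun U I f)).1 ∈ P.superFun U := Subtype.prop _
  have hpar : (P.singleFun U I f).1 ∘ₗ P.L.parity.toLinearMap ∈ P.superFun U := by
    refine ⟨fun u => (P.singleFun U I f).2.1 _, fun x u g hg => ?_⟩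
    have := (P.singleFun U I f).2.2 x (P.L.parity u) g hg
    rw [← P.L.parity_even (P.incl_mem x), ← map_mul] at this
    exact this
  have := P.superFun_ext P.oddBasis hpar hmem fun J => by
    change (P.singleFun U I f).1 (P.L.parity (P.L.mono P.oddBasis J)) =
      (-1 : ℤˣ) ^ I.card • (P.singleFun U I f).1 (P.L.mono P.oddBasis J)
    rw [P.L.parity_mono]
    have h : ∀ ε : ℤˣ, (P.singleFun U I f).1 (ε • P.L.mono P.oddBasis J) =
        ε • (P.singleFun U I f).1 (P.L.mono P.oddBasis J) := fun ε => by
      rcases Int.units_eq_one_or ε with rfl | rfl <;> simp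
    rw [h, singleFun_mono]
    by_cases hJ : J = I
    · rw [hJ]
    · simp [hJ]
  exact DFunLike.congr_fun this u

/-- The constant function `1` on `U`. -/
def unitFun (U : TopologicalSpace.Opens G) : smoothFun K p U := ⟨_, smoothFun_one_mem p U⟩

lemma unitFun_apply {U : TopologicalSpace.Opens G} {g : G} (hg : g ∈ U) :
    (unitFun (K := K) (p := p) U).1 g = 1 :=
  Set.indicator_of_mem (s := (U : Set G)) hg (fun _ => (1 : K))

lemma exists_mul_singleFun_empty (J : Finset (Fin (Module.finrank K (P.L.gr 1)))) :
    ∃ ε : ℤˣ, ∀ {U : TopologicalSpace.Opens G} (f : smoothFun K p U) (ψ : P.L.Env →ₗ[K] (G → K))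
      (g : G), P.mul (P.singleFun U ∅ f).1 ψ (P.L.mono P.oddBasis J) g =
        ε • (f.1 g * ψ (P.L.mono P.oddBasis J) g) := by
  obtain ⟨ε, hε⟩ := P.L.exists_conv_mono P.oddBasis J
  refine ⟨ε ∅, fun {U} f ψ g => ?_⟩
  rw [mul_apply, hε, Finset.sum_eq_single ∅]
  · simp only [evalAt_apply, singleFun_mono, if_true, Finset.sdiff_empty]
  · intro J' _ hJ'
    simp only [evalAt_apply, singleFun_mono, if_neg hJ', Pi.zero_apply, zero_mul, smul_zero]
  · simp

lemma exists_monomial_singleFun (I : Finset (Fin (Module.finrank K (P.L.gr 1)))) :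
    ∃ ε : ℤˣ, ∀ {U : TopologicalSpace.Opens G} (J : Finset (Fin (Module.finrank K (P.L.gr 1))))
      {g : G} (_ : g ∈ U),
      P.monomial U (fun i => P.singleFun U {i} (unitFun U)) I (P.L.mono P.oddBasis J) g =
        if J = I then ε • 1 else 0 := by
  obtain ⟨ε, hε⟩ := P.L.exists_convProd_mono P.oddBasis True I
  refine ⟨ε, fun {U} J g hg => ?_⟩
  rw [← evalAt_apply, evalAt_monomial P _ _ hg]
  refine hε _ (fun i J _ => ?_) J (Or.inr trivial)
  rw [evalAt_apply, singleFun_mono]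
  by_cases h : J = {i}
  · rw [if_pos h, if_pos h, unitFun_apply hg]
  · rw [if_neg h, if_neg h, Pi.zero_apply]

/-- For these coordinates the coefficient of `ξ^J` is the value on `e_J`, up to a sign independent
of the superfunction and of `U`. This gives existence and uniqueness of expansions and makes the
Berezin integral explicit. -/
lemma exists_expansion_sign : ∃ η : Finset (Fin (Module.finrank K (P.L.gr 1))) → ℤˣ,
    ∀ {U : TopologicalSpace.Opens G} (a : Finset (Fin (Module.finrank K (P.L.gr 1))) →
      smoothFun K p U) (J : Finset (Fin (Module.finrank K (P.L.gr 1)))),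
      (∑ I, P.mul (P.singleFun U ∅ (a I)).1
        (P.monomial U (fun i => P.singleFun U {i} (unitFun U)) I)) (P.L.mono P.oddBasis J) =
        η J • (a J).1 := by
  choose ε hε using P.exists_mul_singleFun_empty
  choose θ hθ using P.exists_monomial_singleFun
  refine ⟨fun J => ε J * θ J, fun {U} a J => ?_⟩
  have hmem : (∑ I, P.mul (P.singleFun U ∅ (a I)).1
      (P.monomial U (fun i => P.singleFun U {i} (unitFun U)) I)) ∈ P.superFun U :=
    sum_mem fun I _ => P.mul_mem (P.singleFun U ∅ (a I)).2 (P.monomial_mem _ I)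
  funext g
  by_cases hg : g ∈ U
  · rw [LinearMap.sum_apply, Finset.sum_apply, Finset.sum_eq_single J]
    · rw [hε, hθ J J hg, if_pos rfl, Pi.smul_apply, mul_smul, mul_smul_comm, mul_one]
    · intro I _ hI
      rw [hε, hθ I J hg, if_neg hI.symm, mul_zero, smul_zero]
    · simp
  · rw [(hmem.1 _).2 g hg, Pi.smul_apply, (a J).2.2 g hg, smul_zero]

/-- The coordinates on the domain of a chart of `G` given by the standard basis of the odd part. -/
def stdCoordinates (e : OpenPartialHomeomorph G (EuclideanSpace ℝ (Fin p)))
    (he : e ∈ IsManifold.maximalAtlas (𝓡 p) ∞ G) : P.Coordinates ⟨e.source, e.open_source⟩ where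
  chart := e
  chart_mem := he
  chart_source := rfl
  pull := P.singleFun _ ∅
  pull_one := by
    refine P.superFun_ext P.oddBasis (Subtype.prop _) (P.one_mem _) fun J => ?_
    rw [singleFun_mono]
    funext g
    simp only [one, LinearMap.smulRight_apply, AlgHom.toLinearMap_apply, P.L.counit_mono]
    by_cases h : J = ∅ <;> simp [h]
  pull_mul f f' := by
    refine P.superFun_ext P.oddBasis (Subtype.prop _)
      (P.mul_mem (Subtype.prop _) (Subtype.prop _)) fun J => ?_
    funext g
    rw [singleFun_mono]
    obtain ⟨ε, hε⟩ := P.exists_mul_singleFun_empty J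
    rw [hε, singleFun_mono]
    by_cases h : J = ∅
    · subst h
      -- The abstract sign for the empty set is eliminated by computing the value at `1` directly,
      -- where convolution is plain multiplication.
      have h1 := hε f (P.singleFun _ ∅ f').1 g
      rw [P.L.mono_empty, mul_apply, P.L.conv_one, ← P.L.mono_empty P.oddBasis] at h1
      simp only [evalAt_apply, singleFun_mono, if_true] at h1 ⊢
      exact h1
    · simp [h]
  pull_even f u := by simpa using P.singleFun_parity ∅ f u
  pull_body f := by
    have := P.singleFun_mono ∅ ∅ f
    rwa [P.L.mono_empty, if_pos rfl] at this
  ξ i := P.singleFun _ {i} (unitFun _)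
  ξ_odd i u := by simpa using P.singleFun_parity {i} (unitFun _) u
  expand φ := by
    obtain ⟨η, hη⟩ := P.exists_expansion_sign
    refine ⟨fun J => (η J : ℤ) • ⟨φ.1 (P.L.mono P.oddBasis J), φ.2.1 _⟩, ?_, ?_⟩
    · refine P.superFun_ext P.oddBasis φ.2 (sum_mem fun I _ =>
        P.mul_mem (Subtype.prop _) (P.monomial_mem _ I)) fun J => ?_
      rw [hη]
      rcases Int.units_eq_one_or (η J) with h | h <;> simp [h]
    · intro a ha
      funext J
      refine Subtype.ext ?_
      have h := hη a J
      rw [← ha] at h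
      rcases Int.units_eq_one_or (η J) with h' | h' <;> simp [h', h]

lemma exists_berezinIntegral_stdCoordinates : ∃ η : ℤˣ,
    ∀ (e : OpenPartialHomeomorph G (EuclideanSpace ℝ (Fin p)))
      (he : e ∈ IsManifold.maximalAtlas (𝓡 p) ∞ G) (φ : P.superFun ⟨e.source, e.open_source⟩),
      (P.stdCoordinates e he).berezinIntegral φ =
        ∫ t in e.target, η • φ.1 (P.L.mono P.oddBasis Finset.univ) (e.symm t) := by
  obtain ⟨η, hη⟩ := P.exists_expansion_sign
  refine ⟨η Finset.univ, fun e he φ => ?_⟩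
  have h := hη ((P.stdCoordinates e he).expand φ).choose Finset.univ
  have h2 := ((P.stdCoordinates e he).expand φ).choose_spec.1
  dsimp only at h2
  have h3 : φ.1 (P.L.mono P.oddBasis Finset.univ) =
    η Finset.univ • (((P.stdCoordinates e he).expand φ).choose Finset.univ).1 :=
    (DFunLike.congr_fun h2 _).trans h
  rw [Coordinates.berezinIntegral, h3]
  change ∫ t in e.target, _ = _
  congr 1
  funext t
  rw [Pi.smul_apply, smul_smul, Int.units_mul_self, one_smul]
  rfl

end StandardCoordinates

end SupergroupPair


/-! ### Jacobians of left translations in charts. -/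

section HaarDensity

lemma continuous_of_continuousOn_of_eq_zero {X Y : Type*} [TopologicalSpace X] [TopologicalSpace Y]
    [Zero Y] {f : X → Y} {U C : Set X} (hU : IsOpen U) (hC : IsClosed C) (hCU : C ⊆ U)
    (hf : ContinuousOn f U) (h0 : ∀ x ∉ C, f x = 0) : Continuous f := by
  refine continuous_iff_continuousAt.2 fun x => ?_
  by_cases hx : x ∈ C
  · exact hf.continuousAt (hU.mem_nhds (hCU hx))
  · have : f =ᶠ[nhds x] fun _ => 0 :=
      Filter.eventuallyEq_of_mem (hC.isOpen_compl.mem_nhds hx) h0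
    exact this.continuousAt

lemma contDiff_det {E : Type*} [NormedAddCommGroup E] [NormedSpace ℝ E] [FiniteDimensional ℝ E] :
    ContDiff ℝ ∞ fun A : E →L[ℝ] E => A.det := by
  let b := Module.finBasis ℝ E
  have h : (fun A : E →L[ℝ] E => A.det) = fun A => ∑ σ : Equiv.Perm (Fin (Module.finrank ℝ E)),
      ((Equiv.Perm.sign σ : ℤ) : ℝ) * ∏ i, b.coord (σ i) (A (b i)) := by
    funext A
    rw [ContinuousLinearMap.det, ← LinearMap.det_toMatrix b, Matrix.det_apply']
    simp [LinearMap.toMatrix_apply]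
  rw [h]
  refine ContDiff.sum fun σ _ => contDiff_const.mul (contDiff_prod fun i _ => ?_)
  have h1 : ContDiff ℝ ∞ fun A : E →L[ℝ] E => A (b i) := contDiff_id.clm_apply contDiff_const
  exact (LinearMap.toContinuousLinearMap (b.coord (σ i))).contDiff.comp h1

variable {p : ℕ}
  {G : Type*} [TopologicalSpace G] [ChartedSpace (EuclideanSpace ℝ (Fin p)) G] [Group G]
  [LieGroup (𝓡 p) ∞ G]

/-- The chart of `G` at `1`. -/
abbrev unitChart (p : ℕ) (G : Type*) [TopologicalSpace G]
    [ChartedSpace (EuclideanSpace ℝ (Fin p)) G] [Group G] :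
    OpenPartialHomeomorph G (EuclideanSpace ℝ (Fin p)) := chartAt (EuclideanSpace ℝ (Fin p)) (1 : G)

/-- Left translation by `g⁻¹` in a chart `e` and the chart at `1`. -/
def transl (e : OpenPartialHomeomorph G (EuclideanSpace ℝ (Fin p))) (g : G)
    (s : EuclideanSpace ℝ (Fin p)) : EuclideanSpace ℝ (Fin p) :=
  unitChart p G (g⁻¹ * e.symm s)

/-- The Jacobian of left translation by `g⁻¹` in a chart `e` and the chart at `1`. -/
def translJac (e : OpenPartialHomeomorph G (EuclideanSpace ℝ (Fin p))) (g : G)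
    (s : EuclideanSpace ℝ (Fin p)) : ℝ := (fderiv ℝ (transl e g) s).det

variable {e : OpenPartialHomeomorph G (EuclideanSpace ℝ (Fin p))}

lemma contMDiffAt_transl (he : e ∈ IsManifold.maximalAtlas (𝓡 p) ∞ G) {g : G}
    {s : EuclideanSpace ℝ (Fin p)} (hs : s ∈ e.target)
    (hg : g⁻¹ * e.symm s ∈ (unitChart p G).source) :
    ContMDiffAt ((𝓡 p).prod (𝓡 p)) (𝓡 p) ∞ (Function.uncurry (transl e)) (g, s) := by
  have h0 : ContMDiffAt (𝓡 p) (𝓡 p) ∞ (unitChart p G) (g⁻¹ * e.symm s) :=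
    contMDiffAt_of_mem_maximalAtlas (IsManifold.chart_mem_maximalAtlas _) hg
  have h1 : ContMDiffAt ((𝓡 p).prod (𝓡 p)) (𝓡 p) ∞
      (fun z : G × EuclideanSpace ℝ (Fin p) => z.1⁻¹ * e.symm z.2) (g, s) :=
    contMDiffAt_fst.inv.mul (ContMDiffAt.comp (g, s) (g := e.symm) (f := Prod.snd)
      (contMDiffAt_symm_of_mem_maximalAtlas he hs) contMDiffAt_snd)
  exact ContMDiffAt.comp (g, s) h0 h1

lemma contDiffAt_transl (he : e ∈ IsManifold.maximalAtlas (𝓡 p) ∞ G) {g : G}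
    {s : EuclideanSpace ℝ (Fin p)} (hs : s ∈ e.target)
    (hg : g⁻¹ * e.symm s ∈ (unitChart p G).source) : ContDiffAt ℝ ∞ (transl e g) s := by
  have h := contMDiffAt_transl he hs hg
  have h1 : ContMDiffAt (𝓡 p) ((𝓡 p).prod (𝓡 p)) ∞
      (fun s : EuclideanSpace ℝ (Fin p) => (g, s)) s := contMDiffAt_const.prodMk contMDiffAt_id
  exact (ContMDiffAt.comp s h h1).contDiffAt

/-- Translation by `g⁻¹` is translation by `y⁻¹` to the identity, for `y = e.symm s`, followed by
translation by `(y⁻¹ g)⁻¹`. The Jacobian thus separates into a factor depending only on `y⁻¹ g` and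
one depending only on `s`. -/
lemma translJac_chain (he : e ∈ IsManifold.maximalAtlas (𝓡 p) ∞ G) {g : G}
    {s : EuclideanSpace ℝ (Fin p)} (hs : s ∈ e.target)
    (hg : g⁻¹ * e.symm s ∈ (unitChart p G).source) :
    translJac e g s = translJac (unitChart p G) ((e.symm s)⁻¹ * g) (unitChart p G 1) *
      translJac e (e.symm s) s := by
  set y := e.symm s with hy
  have h1 : transl e y s = unitChart p G 1 := by simp [transl, hy]
  have hs1 : y⁻¹ * e.symm s ∈ (unitChart p G).source := by
    rw [← hy, inv_mul_cancel]; exact mem_chart_source _ _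
  have hd1 := (contDiffAt_transl he hs hs1).differentiableAt (by simp)
  have ht : unitChart p G 1 ∈ (unitChart p G).target := mem_chart_target _ _
  have hd2 := (contDiffAt_transl (e := unitChart p G) (g := y⁻¹ * g)
    (IsManifold.chart_mem_maximalAtlas _) ht
    (by rw [(unitChart p G).left_inv (mem_chart_source _ _)]; simpa using hg)).differentiableAt
    (by simp)
  have hev : transl e g =ᶠ[nhds s] transl (unitChart p G) (y⁻¹ * g) ∘ transl e y := by
    have hc : ContinuousAt (fun s => y⁻¹ * e.symm s) s := by
      have : IsTopologicalGroup G := topologicalGroup_of_lieGroup (𝓡 p) ∞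
      exact continuousAt_const.mul (e.symm.continuousAt hs)
    filter_upwards [hc.eventually_mem ((unitChart p G).open_source.mem_nhds hs1)] with s' hs'
    simp only [transl, Function.comp_apply]
    rw [(unitChart p G).left_inv hs']
    congr 1
    group
  have h2 : HasFDerivAt (transl e g) ((fderiv ℝ (transl (unitChart p G) (y⁻¹ * g))
      (unitChart p G 1)).comp (fderiv ℝ (transl e y) s)) s := by
    refine HasFDerivAt.congr_of_eventuallyEq ?_ hev
    refine HasFDerivAt.comp s ?_ hd1.hasFDerivAt
    rw [h1]
    exact hd2.hasFDerivAt
  rw [translJac, h2.fderiv, translJac, translJac]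
  exact LinearMap.det_comp _ _

lemma contMDiffAt_translJac {e' : G → EuclideanSpace ℝ (Fin p)} {g : G}
    (he : e ∈ IsManifold.maximalAtlas (𝓡 p) ∞ G) (he' : ContMDiffAt (𝓡 p) (𝓡 p) ∞ e' g)
    (hs : e' g ∈ e.target) (hg : g⁻¹ * e.symm (e' g) ∈ (unitChart p G).source) :
    ContMDiffAt (𝓡 p) 𝓘(ℝ, ℝ) ∞ (fun g => translJac e g (e' g)) g := by
  have h1 := ContMDiffAt.mfderiv (I := 𝓡 p) (I' := 𝓡 p) (J := 𝓡 p) (m := ∞) (n := ∞)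
    (transl e) e' (contMDiffAt_transl he hs hg) he' (by simp)
  have h0 := inTangentCoordinates_model_space (I := 𝓡 p) (I' := 𝓡 p)
    e' (fun x => transl e x (e' x)) (fun x => mfderiv (𝓡 p) (𝓡 p) (transl e x) (e' x)) g
  have h3 : ContMDiffAt (𝓡 p)
      𝓘(ℝ, EuclideanSpace ℝ (Fin p) →L[ℝ] EuclideanSpace ℝ (Fin p)) ∞
      (fun h => fderiv ℝ (transl e h) (e' h)) g := by
    simp only [← mfderiv_eq_fderiv]
    exact h0 ▸ h1
  exact ContMDiffAt.comp g contDiff_det.contMDiff.contMDiffAt h3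

lemma contMDiffAt_translJac_self (he : e ∈ IsManifold.maximalAtlas (𝓡 p) ∞ G) {g : G}
    (hg : g ∈ e.source) : ContMDiffAt (𝓡 p) 𝓘(ℝ, ℝ) ∞ (fun g => translJac e g (e g)) g :=
  contMDiffAt_translJac he (contMDiffAt_of_mem_maximalAtlas he hg) (e.map_source hg) (by
    rw [e.left_inv hg, inv_mul_cancel]; exact mem_chart_source _ _)

/-- Translation by `g` is a smooth local inverse, so the chain rule makes the determinant
invertible. -/
lemma translJac_self_ne_zero (he : e ∈ IsManifold.maximalAtlas (𝓡 p) ∞ G) {g : G}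
    (hg : g ∈ e.source) : translJac e g (e g) ≠ 0 := by
  have h1 : g⁻¹ * e.symm (e g) ∈ (unitChart p G).source := by
    rw [e.left_inv hg, inv_mul_cancel]; exact mem_chart_source _ _
  have hd1 := (contDiffAt_transl he (e.map_source hg) h1).differentiableAt (by simp)
  have e1 : transl e g (e g) = unitChart p G 1 := by simp [transl, hg]
  have h0 : ContMDiffAt (𝓡 p) (𝓡 p) ∞ (fun t => e (g * (unitChart p G).symm t))
      (unitChart p G 1) := by
    have h2 : ContMDiffAt (𝓡 p) (𝓡 p) ∞ (unitChart p G).symm (unitChart p G 1) :=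
      contMDiffAt_symm_of_mem_maximalAtlas (IsManifold.chart_mem_maximalAtlas _)
        (mem_chart_target _ _)
    have h3 : ContMDiffAt (𝓡 p) (𝓡 p) ∞ e (g * (unitChart p G).symm (unitChart p G 1)) := by
      rw [(unitChart p G).left_inv (mem_chart_source _ _), mul_one]
      exact contMDiffAt_of_mem_maximalAtlas he hg
    exact ContMDiffAt.comp (unitChart p G 1) h3 (contMDiffAt_const.mul h2)
  have hd2 := h0.contDiffAt.differentiableAt (by simp)
  have hev : (fun t => e (g * (unitChart p G).symm t)) ∘ transl e g =ᶠ[nhds (e g)] id := by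
    have hc : ContinuousAt (fun s => g⁻¹ * e.symm s) (e g) := by
      have : IsTopologicalGroup G := topologicalGroup_of_lieGroup (𝓡 p) ∞
      exact continuousAt_const.mul (e.symm.continuousAt (e.map_source hg))
    filter_upwards [hc.eventually_mem ((unitChart p G).open_source.mem_nhds h1),
      e.open_target.mem_nhds (e.map_source hg)] with s' hs' ht
    simp only [transl, Function.comp_apply, id]
    rw [(unitChart p G).left_inv hs', mul_inv_cancel_left, e.right_inv ht]
  have h2 : HasFDerivAt ((fun t => e (g * (unitChart p G).symm t)) ∘ transl e g)
      ((fderiv ℝ (fun t => e (g * (unitChart p G).symm t)) (unitChart p G 1)).comp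
        (fderiv ℝ (transl e g) (e g))) (e g) := by
    refine HasFDerivAt.comp (e g) ?_ hd1.hasFDerivAt
    rw [e1]
    exact hd2.hasFDerivAt
  have h3 := h2.unique ((hasFDerivAt_id (e g)).congr_of_eventuallyEq hev)
  intro h4
  have h5 := congrArg ContinuousLinearMap.det h3
  have h6 : ((fderiv ℝ (fun t => e (g * (unitChart p G).symm t)) (unitChart p G 1)).comp
      (fderiv ℝ (transl e g) (e g))).det = _ * translJac e g (e g) := LinearMap.det_comp _ _
  rw [h6, h4, mul_zero, ContinuousLinearMap.det, ContinuousLinearMap.coe_id, LinearMap.det_id] at h5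
  exact zero_ne_one h5

end HaarDensity


/-! ### Haar measure has a smooth density in charts. -/

section HaarDensity

open Measure
open scoped Pointwise

variable {p : ℕ}
  {G : Type*} [TopologicalSpace G] [ChartedSpace (EuclideanSpace ℝ (Fin p)) G] [Group G]
  [LieGroup (𝓡 p) ∞ G]

variable {e : OpenPartialHomeomorph G (EuclideanSpace ℝ (Fin p))}

/-- The pullback of a bump function around the identity, times the Jacobian at the identity of left
translation. -/
def bumpJac (k : EuclideanSpace ℝ (Fin p) → ℝ) (z : G) : ℝ :=
  open Classical in
  if z⁻¹ ∈ (unitChart p G).source then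
    k (unitChart p G z⁻¹) * |translJac (unitChart p G) z (unitChart p G 1)| else 0

/-- The density of the Haar measure in a chart, times a function. -/
def chartDensity (e : OpenPartialHomeomorph G (EuclideanSpace ℝ (Fin p))) (F : G → ℝ)
    (s : EuclideanSpace ℝ (Fin p)) : ℝ :=
  open Classical in
  if s ∈ e.target then |translJac e (e.symm s) s| * F (e.symm s) else 0

lemma exists_chart_bump (p : ℕ) (G : Type*) [TopologicalSpace G]
    [ChartedSpace (EuclideanSpace ℝ (Fin p)) G] [Group G] :
    ∃ k : EuclideanSpace ℝ (Fin p) → ℝ, Continuous k ∧ (∀ t, 0 ≤ k t) ∧ k (unitChart p G 1) = 1 ∧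
      ∃ B, IsCompact B ∧ B ⊆ (unitChart p G).target ∧ ∀ t ∉ B, k t = 0 := by
  obtain ⟨ε, hε, h⟩ := Metric.isOpen_iff.1 (unitChart p G).open_target _ (mem_chart_target _ (1 : G))
  let f : ContDiffBump (unitChart p G 1) := ⟨ε / 4, ε / 2, by linarith, by linarith⟩
  refine ⟨f, f.continuous, fun t => f.nonneg, f.one_of_mem_closedBall (Metric.mem_closedBall_self f.rIn_pos.le),
    Metric.closedBall (unitChart p G 1) (ε / 2), isCompact_closedBall _ _,
    (Metric.closedBall_subset_ball (by linarith)).trans h, fun t ht => ?_⟩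
  exact f.zero_of_le_dist (by simpa using (not_le.1 ht).le)

variable {k : EuclideanSpace ℝ (Fin p) → ℝ} {B : Set (EuclideanSpace ℝ (Fin p))}

lemma bumpJac_eq_zero (hk0 : ∀ t ∉ B, k t = 0) {z : G}
    (hz : z ∉ ((unitChart p G).symm '' B)⁻¹) : bumpJac k z = 0 := by
  rw [bumpJac]
  split_ifs with h
  · rw [hk0, zero_mul]
    exact fun hB => hz ⟨_, hB, (unitChart p G).left_inv h⟩
  · rfl

lemma isCompact_symm_image {X : Type*} [TopologicalSpace X] {E : Type*} [TopologicalSpace E]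
    {e : OpenPartialHomeomorph X E} {B : Set E} (hB : IsCompact B) (hBt : B ⊆ e.target) :
    IsCompact (e.symm '' B) := hB.image_of_continuousOn (e.continuousOn_symm.mono hBt)

variable [T2Space G]

lemma continuous_bumpJac (hk : Continuous k) (hB : IsCompact B) (hBt : B ⊆ (unitChart p G).target)
    (hk0 : ∀ t ∉ B, k t = 0) : Continuous (bumpJac k : G → ℝ) := by
  have : IsTopologicalGroup G := topologicalGroup_of_lieGroup (𝓡 p) ∞
  refine continuous_of_continuousOn_of_eq_zero (U := (unitChart p G).source⁻¹)
    (C := ((unitChart p G).symm '' B)⁻¹) (unitChart p G).open_source.inv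
    (isCompact_symm_image hB hBt).inv.isClosed ?_ ?_ fun z hz => bumpJac_eq_zero hk0 hz
  · rintro z ⟨t, ht, hz⟩
    change z⁻¹ ∈ (unitChart p G).source
    rw [← hz]
    exact (unitChart p G).map_target (hBt ht)
  · have h1 : ContinuousOn (fun z : G => k (unitChart p G z⁻¹) *
        |translJac (unitChart p G) z (unitChart p G 1)|) (unitChart p G).source⁻¹ := by
      intro z hz
      refine ContinuousAt.continuousWithinAt (ContinuousAt.mul (hk.continuousAt.comp ?_) ?_)
      · exact ContinuousAt.comp (g := unitChart p G) (f := fun z => z⁻¹)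
          ((unitChart p G).continuousAt hz) continuous_inv.continuousAt
      · refine (contMDiffAt_translJac (IsManifold.chart_mem_maximalAtlas _) contMDiffAt_const
          (mem_chart_target _ _) ?_).continuousAt.abs
        rw [(unitChart p G).left_inv (mem_chart_source _ _), mul_one]
        exact hz
    exact h1.congr fun z hz => if_pos hz

lemma continuousOn_chartDensity (he : e ∈ IsManifold.maximalAtlas (𝓡 p) ∞ G) {F : G → ℝ}
    (hF : Continuous F) : ContinuousOn (chartDensity e F) e.target := by
  have h1 : ContinuousOn (fun s => |translJac e (e.symm s) s| * F (e.symm s)) e.target := by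
    intro s hs
    refine ContinuousAt.continuousWithinAt (ContinuousAt.mul ?_
      (hF.continuousAt.comp (e.symm.continuousAt hs)))
    have h2 := (contMDiffAt_translJac_self he (e.map_target hs)).continuousAt.abs
    refine (ContinuousAt.comp (f := e.symm) h2 (e.symm.continuousAt hs)).congr ?_
    filter_upwards [e.open_target.mem_nhds hs] with s hs
    simp [e.right_inv hs]
  exact h1.congr fun s hs => if_pos hs

lemma chartDensity_eq_zero {F : G → ℝ} {C : Set G} (hF0 : ∀ g ∉ C, F g = 0)
    {s : EuclideanSpace ℝ (Fin p)} (hs : s ∉ e '' C) : chartDensity e F s = 0 := by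
  rw [chartDensity]
  split_ifs with h
  · rw [hF0 _ fun hC => hs ⟨_, hC, e.right_inv h⟩, mul_zero]
  · rfl

/-- Change of variables in the integral over a right translate of a chart at `1`. -/
lemma integral_right_translate (he : e ∈ IsManifold.maximalAtlas (𝓡 p) ∞ G) {F : G → ℝ} {C : Set G}
    (hC : C ⊆ e.source) (hF0 : ∀ g ∉ C, F g = 0) (hBt : B ⊆ (unitChart p G).target)
    (hk0 : ∀ t ∉ B, k t = 0) (x : G) :
    ∫ t, k t * F (x * (unitChart p G).symm t) =
      ∫ s, bumpJac k ((e.symm s)⁻¹ * x) * chartDensity e F s := by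
  have : IsTopologicalGroup G := topologicalGroup_of_lieGroup (𝓡 p) ∞
  -- The part of the chart `e` that is translated by `x⁻¹` into the chart at `1`. The right
  -- integrand vanishes off `S`, and the left one off the image of `S`.
  let S : Set (EuclideanSpace ℝ (Fin p)) :=
    e.target ∩ e.symm ⁻¹' ((fun y => x⁻¹ * y) ⁻¹' (unitChart p G).source)
  have hS : IsOpen S := e.isOpen_inter_preimage_symm
    ((unitChart p G).open_source.preimage (continuous_const_mul x⁻¹))
  have hinj : Set.InjOn (transl e x) S := by
    intro s hs s' hs' h
    have h1 := (unitChart p G).injOn hs.2 hs'.2 h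
    exact e.symm.injOn hs.1 hs'.1 (mul_left_cancel h1)
  have hd : ∀ s ∈ S, HasFDerivWithinAt (𝕜 := ℝ) (transl e x) (fderiv ℝ (transl e x) s) S s := fun s hs =>
    ((contDiffAt_transl he hs.1 hs.2).differentiableAt (by simp)).hasFDerivAt.hasFDerivWithinAt
  have h1 := integral_image_eq_integral_abs_det_fderiv_smul volume hS.measurableSet hd hinj
    (fun t => (k t * F (x * (unitChart p G).symm t) : ℝ))
  rw [setIntegral_eq_integral_of_forall_compl_eq_zero] at h1
  · refine h1.trans (Eq.trans ?_ (setIntegral_eq_integral_of_forall_compl_eq_zero (s := S) ?_))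
    · refine setIntegral_congr_fun hS.measurableSet fun s hs => ?_
      have hs2 : x⁻¹ * e.symm s ∈ (unitChart p G).source := hs.2
      have h2 : x * (unitChart p G).symm (transl e x s) = e.symm s := by
        rw [transl, (unitChart p G).left_inv hs2, mul_inv_cancel_left]
      have h3 : ((e.symm s)⁻¹ * x)⁻¹ = x⁻¹ * e.symm s := by group
      rw [h2, bumpJac, chartDensity, if_pos hs.1, h3, if_pos hs2]
      have h4 := translJac_chain he hs.1 hs2
      rw [translJac] at h4
      -- The chain rule splits the Jacobian of the substitution into the factor built into `bumpJac`
      -- and the one built into `chartDensity`.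
      rw [h4, abs_mul, smul_eq_mul, transl]
      ring
    · intro s hs
      by_cases hst : s ∈ e.target
      · have : ((e.symm s)⁻¹ * x)⁻¹ ∉ (unitChart p G).source := fun h => hs ⟨hst, by
          have h3 : ((e.symm s)⁻¹ * x)⁻¹ = x⁻¹ * e.symm s := by group
          rwa [h3] at h⟩
        rw [bumpJac, if_neg this, zero_mul]
      · rw [chartDensity, if_neg hst, mul_zero]
  · intro t ht
    by_contra hne
    refine ht ?_
    have htB : t ∈ B := by
      by_contra h
      exact hne (by rw [hk0 t h, zero_mul])
    have hxC : x * (unitChart p G).symm t ∈ C := by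
      by_contra h
      exact hne (by rw [hF0 _ h, mul_zero])
    refine ⟨e (x * (unitChart p G).symm t), ⟨e.map_source (hC hxC), ?_⟩, ?_⟩
    · change x⁻¹ * e.symm (e (x * (unitChart p G).symm t)) ∈ (unitChart p G).source
      rw [e.left_inv (hC hxC), inv_mul_cancel_left]
      exact (unitChart p G).map_target (hBt htB)
    · rw [transl, e.left_inv (hC hxC), inv_mul_cancel_left, (unitChart p G).right_inv (hBt htB)]

variable [MeasurableSpace G] [BorelSpace G] (ν : Measure G) [ν.IsHaarMeasure]

/-- Uniqueness of Haar measure by a double integral. The function `k(t) F(x t)` is integrated over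
`t` near the identity and over `x` in `G`. Integration over `x` first gives `c1 ∫ F`, as a right
translate of `ν` is a multiple of `ν`. Substituting `x t = e.symm s` and then integrating over `x`
by left invariance gives `c2 ∫ chartDensity`. Both constants are non-zero and independent of `e` and
`F`. -/
lemma exists_haar_const : ∃ c : ℝ, c ≠ 0 ∧
    ∀ (e : OpenPartialHomeomorph G (EuclideanSpace ℝ (Fin p))),
      e ∈ IsManifold.maximalAtlas (𝓡 p) ∞ G → ∀ (F : G → ℝ) (C : Set G), Continuous F → IsCompact C →
      C ⊆ e.source → (∀ g ∉ C, F g = 0) → ∫ g, F g ∂ν = c * ∫ s, chartDensity e F s := by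
  have hG : IsTopologicalGroup G := topologicalGroup_of_lieGroup (𝓡 p) ∞
  have hLC : LocallyCompactSpace G := ChartedSpace.locallyCompactSpace (EuclideanSpace ℝ (Fin p)) G
  obtain ⟨k, hk, hkn, hk1, B, hB, hBt, hk0⟩ := exists_chart_bump p G
  have hBi := isCompact_symm_image hB hBt
  set c2 : ℝ := ∫ z, bumpJac k z ∂ν with hc2
  have hbc : Continuous (bumpJac k : G → ℝ) := continuous_bumpJac hk hB hBt hk0
  have hbs : HasCompactSupport (bumpJac k : G → ℝ) :=
    HasCompactSupport.intro hBi.inv fun z hz => bumpJac_eq_zero hk0 hz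
  have hc2' : 0 < c2 := by
    refine hbc.integral_pos_of_hasCompactSupport_nonneg_nonzero hbs (fun z => ?_) (x := 1) ?_
    · rw [bumpJac]
      split_ifs
      · exact mul_nonneg (hkn _) (abs_nonneg _)
      · exact le_rfl
    · rw [bumpJac, inv_one, if_pos (mem_chart_source _ _), hk1, one_mul]
      exact abs_ne_zero.2 (translJac_self_ne_zero (IsManifold.chart_mem_maximalAtlas _)
        (mem_chart_source _ _))
  -- No regularity of the scalar factor in `t` is required: the constant `∫ F` leaves the integral
  -- in any case, and `c1 ≠ 0` is proved afterwards.
  set c1 : ℝ := ∫ t, k t * (haarScalarFactor (map (· * (unitChart p G).symm t) ν) ν : ℝ) with hc1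
  have key : ∀ (e : OpenPartialHomeomorph G (EuclideanSpace ℝ (Fin p))),
      e ∈ IsManifold.maximalAtlas (𝓡 p) ∞ G → ∀ (F : G → ℝ) (C : Set G), Continuous F → IsCompact C →
      C ⊆ e.source → (∀ g ∉ C, F g = 0) →
      c1 * ∫ g, F g ∂ν = c2 * ∫ s, chartDensity e F s := by
    intro e he F C hF hC hCs hF0
    have hFs : HasCompactSupport F := HasCompactSupport.intro hC hF0
    have hr : ∀ y : G, ∫ x, F (x * y) ∂ν =
        (haarScalarFactor (map (· * y) ν) ν : ℝ) * ∫ g, F g ∂ν := by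
      intro y
      have h1 := integral_isMulLeftInvariant_eq_smul_of_hasCompactSupport (map (· * y) ν) ν hF hFs
      rw [integral_smul_nnreal_measure, integral_map (continuous_mul_const y).aemeasurable
        hF.aestronglyMeasurable] at h1
      exact h1
    have hs1 : ∫ t, ∫ x, k t * F (x * (unitChart p G).symm t) ∂ν = c1 * ∫ g, F g ∂ν := by
      rw [hc1, ← integral_mul_const]
      refine integral_congr_ae (.of_forall fun t => ?_)
      dsimp only
      rw [integral_const_mul, hr, mul_assoc]
    have hs2 : ∫ s, ∫ x, bumpJac k ((e.symm s)⁻¹ * x) * chartDensity e F s ∂ν =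
        c2 * ∫ s, chartDensity e F s := by
      rw [← integral_const_mul]
      refine integral_congr_ae (.of_forall fun s => ?_)
      dsimp only
      rw [integral_mul_const, integral_mul_left_eq_self (bumpJac k) (e.symm s)⁻¹]
    have hsw2 : ∫ s, ∫ x, bumpJac k ((e.symm s)⁻¹ * x) * chartDensity e F s ∂ν =
        ∫ x, (∫ s, bumpJac k ((e.symm s)⁻¹ * x) * chartDensity e F s) ∂ν := by
      refine integral_integral_swap_of_hasCompactSupport
        (f := fun s x => bumpJac k ((e.symm s)⁻¹ * x) * chartDensity e F s) ?_ ?_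
      · have hCi : IsCompact (e '' C) := hC.image_of_continuousOn (e.continuousOn.mono hCs)
        refine continuous_of_continuousOn_of_eq_zero (U := e.target ×ˢ Set.univ)
          (C := (e '' C) ×ˢ Set.univ) (e.open_target.prod isOpen_univ)
          (hCi.isClosed.prod isClosed_univ) ?_ ?_ ?_
        · rintro ⟨s, x⟩ ⟨⟨y, hy, rfl⟩, -⟩
          exact ⟨e.map_source (hCs hy), trivial⟩
        · refine ContinuousOn.mul (hbc.comp_continuousOn ?_) ?_
          · refine ContinuousOn.mul (ContinuousOn.inv ?_) continuousOn_snd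
            exact e.continuousOn_symm.comp continuousOn_fst fun z hz => hz.1
          · exact (continuousOn_chartDensity he hF).comp continuousOn_fst fun z hz => hz.1
        · rintro ⟨s, x⟩ hsx
          simp only [Function.uncurry]
          rw [chartDensity_eq_zero hF0 fun h => hsx ⟨h, trivial⟩, mul_zero]
      · have hCi : IsCompact (e '' C) := hC.image_of_continuousOn (e.continuousOn.mono hCs)
        refine HasCompactSupport.intro (K := (e '' C) ×ˢ (C * ((unitChart p G).symm '' B)⁻¹))
          (hCi.prod (hC.mul hBi.inv)) ?_
        rintro ⟨s, x⟩ hsx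
        simp only [Function.uncurry]
        by_cases hs : s ∈ e '' C
        · rw [bumpJac_eq_zero hk0 fun hx => ?_, zero_mul]
          refine hsx ⟨hs, ?_⟩
          obtain ⟨y, hy, rfl⟩ := hs
          rw [e.left_inv (hCs hy)] at hx
          exact ⟨y, hy, _, hx, mul_inv_cancel_left _ _⟩
        · rw [chartDensity_eq_zero hF0 hs, mul_zero]
    have hsw1 : ∫ t, ∫ x, k t * F (x * (unitChart p G).symm t) ∂ν =
        ∫ x, (∫ t, k t * F (x * (unitChart p G).symm t)) ∂ν := by
      refine integral_integral_swap_of_hasCompactSupport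
        (f := fun t x => k t * F (x * (unitChart p G).symm t)) ?_ ?_
      · refine continuous_of_continuousOn_of_eq_zero (U := (unitChart p G).target ×ˢ Set.univ)
          (C := B ×ˢ Set.univ) ((unitChart p G).open_target.prod isOpen_univ)
          (hB.isClosed.prod isClosed_univ) (Set.prod_mono hBt le_rfl) ?_ ?_
        · refine ContinuousOn.mul (hk.comp_continuousOn continuousOn_fst) (hF.comp_continuousOn ?_)
          refine ContinuousOn.mul continuousOn_snd ?_
          exact (unitChart p G).continuousOn_symm.comp continuousOn_fst fun z hz => hz.1
        · rintro ⟨t, x⟩ htx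
          simp only [Function.uncurry]
          rw [hk0 t fun h => htx ⟨h, trivial⟩, zero_mul]
      · refine HasCompactSupport.intro (K := B ×ˢ (C * ((unitChart p G).symm '' B)⁻¹))
          (hB.prod (hC.mul hBi.inv)) ?_
        rintro ⟨t, x⟩ htx
        simp only [Function.uncurry]
        by_cases ht : t ∈ B
        · rw [hF0, mul_zero]
          intro hx
          refine htx ⟨ht, ?_⟩
          exact ⟨_, hx, ((unitChart p G).symm t)⁻¹, by simpa using ⟨t, ht, rfl⟩,
            mul_inv_cancel_right _ _⟩
        · rw [hk0 t ht, zero_mul]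
    rw [← hs1, ← hs2, hsw1, hsw2]
    refine integral_congr_ae (.of_forall fun x => ?_)
    exact integral_right_translate he hCs hF0 hBt hk0 x
  -- If `c1` were zero, every density integral would vanish, contrary to the non-negative function
  -- `bumpJac k g⁻¹`, which is positive at the identity.
  have hc1' : c1 ≠ 0 := by
    intro h0
    have hFc : Continuous (fun g : G => bumpJac k g⁻¹) := hbc.comp continuous_inv
    have h1 := key (unitChart p G) (IsManifold.chart_mem_maximalAtlas _)
      (fun g => bumpJac k g⁻¹) ((unitChart p G).symm '' B) hFc hBi (by
        rintro _ ⟨t, ht, rfl⟩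
        exact (unitChart p G).map_target (hBt ht)) (fun g hg => bumpJac_eq_zero hk0 (by simpa using hg))
    rw [h0, zero_mul, zero_eq_mul] at h1
    have hcont : Continuous (chartDensity (unitChart p G) fun g => bumpJac k g⁻¹) := by
      refine continuous_of_continuousOn_of_eq_zero (unitChart p G).open_target hB.isClosed hBt
        (continuousOn_chartDensity (IsManifold.chart_mem_maximalAtlas _) hFc) fun t ht => ?_
      refine chartDensity_eq_zero (C := (unitChart p G).symm '' B)
        (fun g hg => bumpJac_eq_zero hk0 (by simpa using hg)) ?_
      rintro ⟨_, ⟨t', ht', rfl⟩, rfl⟩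
      rw [(unitChart p G).right_inv (hBt ht')] at ht
      exact ht ht'
    have hpos : 0 < ∫ s, chartDensity (unitChart p G) (fun g => bumpJac k g⁻¹) s := by
      refine hcont.integral_pos_of_hasCompactSupport_nonneg_nonzero
        (HasCompactSupport.intro hB fun t ht => ?_) (fun s => ?_) (x := unitChart p G 1) ?_
      · refine chartDensity_eq_zero (C := (unitChart p G).symm '' B)
          (fun g hg => bumpJac_eq_zero hk0 (by simpa using hg)) ?_
        rintro ⟨_, ⟨t', ht', rfl⟩, rfl⟩
        rw [(unitChart p G).right_inv (hBt ht')] at ht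
        exact ht ht'
      · rw [chartDensity]
        split_ifs
        · refine mul_nonneg (abs_nonneg _) ?_
          rw [bumpJac]
          split_ifs
          · exact mul_nonneg (hkn _) (abs_nonneg _)
          · exact le_rfl
        · exact le_rfl
      · have h1 := translJac_self_ne_zero (G := G) (e := unitChart p G)
          (IsManifold.chart_mem_maximalAtlas _) (mem_chart_source _ 1)
        rw [chartDensity, if_pos (mem_chart_target _ _),
          (unitChart p G).left_inv (mem_chart_source _ _), bumpJac, inv_inv,
          if_pos (mem_chart_source _ _), hk1, inv_one]
        simpa using h1
    rcases h1 with h1 | h1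
    · exact hc2'.ne' h1
    · exact hpos.ne' h1
  refine ⟨c1⁻¹ * c2, mul_ne_zero (inv_ne_zero hc1') hc2'.ne', fun e he F C hF hC hCs hF0 => ?_⟩
  rw [mul_assoc, ← key e he F C hF hC hCs hF0, inv_mul_cancel_left₀ hc1']

/-- A left Haar measure on a Lie group is given by a smooth nowhere vanishing density in any
chart. -/
theorem exists_haar_density {K : Type*} [RCLike K]
    (he : e ∈ IsManifold.maximalAtlas (𝓡 p) ∞ G) :
    ∃ ρ : G → ℝ, ContMDiffOn (𝓡 p) 𝓘(ℝ, ℝ) ∞ ρ e.source ∧ (∀ g ∈ e.source, ρ g ≠ 0) ∧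
      ∀ (F : G → K) (C : Set G), Continuous F → IsCompact C → C ⊆ e.source → (∀ g ∉ C, F g = 0) →
        ∫ g, F g ∂ν = ∫ s in e.target, (ρ (e.symm s) : K) * F (e.symm s) := by
  obtain ⟨c, hc, h⟩ := exists_haar_const (p := p) ν
  -- The absolute value preserves smoothness because the Jacobian has no zeros.
  refine ⟨fun g => c * |translJac e g (e g)|, fun g hg => ?_, fun g hg =>
    mul_ne_zero hc (abs_ne_zero.2 (translJac_self_ne_zero he hg)), fun F C hF hC hCs hF0 => ?_⟩
  · refine ContMDiffAt.contMDiffWithinAt (contMDiffAt_const.mul ?_)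
    exact ContMDiffAt.comp g (contDiffAt_abs (translJac_self_ne_zero he hg)).contMDiffAt
      (contMDiffAt_translJac_self he hg)
  have hr : ∀ F : G → ℝ, Continuous F → (∀ g ∉ C, F g = 0) →
      ∫ g, F g ∂ν = ∫ s in e.target, c * |translJac e (e.symm s) (e (e.symm s))| * F (e.symm s) := by
    intro F hF hF0
    rw [h e he F C hF hC hCs hF0, ← integral_const_mul,
      ← setIntegral_eq_integral_of_forall_compl_eq_zero (s := e.target)]
    · refine setIntegral_congr_fun e.open_target.measurableSet fun s hs => ?_
      simp only [chartDensity, if_pos hs, e.right_inv hs]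
      ring
    · intro s hs
      rw [chartDensity, if_neg hs, mul_zero]
  have hG : IsTopologicalGroup G := topologicalGroup_of_lieGroup (𝓡 p) ∞
  have hint : Integrable F ν := hF.integrable_of_hasCompactSupport (HasCompactSupport.intro hC hF0)
  have hint2 : IntegrableOn
      (fun s => ((c * |translJac e (e.symm s) (e (e.symm s))| : ℝ) : K) * F (e.symm s)) e.target := by
    have hCi : IsCompact (e '' C) := hC.image_of_continuousOn (e.continuousOn.mono hCs)
    have hsub : e '' C ⊆ e.target := by
      rintro _ ⟨y, hy, rfl⟩
      exact e.map_source (hCs hy)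
    have h1 : ContinuousOn (fun s => ((c * |translJac e (e.symm s) (e (e.symm s))| : ℝ) : K) *
        F (e.symm s)) (e '' C) := by
      refine ContinuousOn.mul (RCLike.continuous_ofReal.comp_continuousOn
        (continuousOn_const.mul ?_)) (hF.comp_continuousOn (e.continuousOn_symm.mono hsub))
      intro s hs
      exact (ContinuousAt.comp (f := e.symm) (contMDiffAt_translJac_self he
        (e.map_target (hsub hs))).continuousAt.abs
        (e.symm.continuousAt (hsub hs))).continuousWithinAt
    refine IntegrableOn.of_forall_sdiff_eq_zero (h1.integrableOn_compact hCi)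
      e.open_target.measurableSet fun s hs => ?_
    rw [hF0 _ fun h => hs.2 ⟨_, h, e.right_inv hs.1⟩, mul_zero]
  rw [← integral_re_add_im hint, ← integral_re_add_im hint2]
  rw [hr (fun g => RCLike.re (F g)) (RCLike.continuous_re.comp hF) (fun g hg => by simp [hF0 g hg]),
    hr (fun g => RCLike.im (F g)) (RCLike.continuous_im.comp hF) (fun g hg => by simp [hF0 g hg])]
  simp only [RCLike.re_ofReal_mul, RCLike.im_ofReal_mul]

end HaarDensity


/-! ### Integration by parts against Haar measure. -/

section IntegrationByParts

variable {K : Type*} [RCLike K] {p : ℕ}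
  {G : Type*} [TopologicalSpace G] [ChartedSpace (EuclideanSpace ℝ (Fin p)) G] [Group G]
  [LieGroup (𝓡 p) ∞ G]

/-- Joint continuity in time and point bounds the derivative on compact sets, which permits
differentiation under the integral. -/
lemma continuousAt_deriv_unitCurve_mul {F : G → K} (hF : ContMDiff (𝓡 p) 𝓘(ℝ, K) ∞ F)
    (x : EuclideanSpace ℝ (Fin p)) {t : ℝ} (ht : ContMDiffAt 𝓘(ℝ, ℝ) (𝓡 p) ∞ (unitCurve x : ℝ → G) t)
    (g : G) : ContinuousAt (fun z : ℝ × G => deriv (fun s => F (unitCurve x s * z.2)) z.1) (t, g) := by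
  have h2 : ContMDiffAt ((𝓘(ℝ, ℝ).prod (𝓡 p)).prod 𝓘(ℝ, ℝ)) (𝓡 p) ∞
      (fun z : (ℝ × G) × ℝ => unitCurve x z.2 * z.1.2) ((t, g), t) :=
    (ContMDiffAt.comp ((t, g), t) (g := unitCurve x) (f := Prod.snd) ht contMDiffAt_snd).mul
      (contMDiffAt_snd.comp _ contMDiffAt_fst)
  have h1 := ContMDiffAt.mfderiv (I := 𝓘(ℝ, ℝ)) (I' := 𝓘(ℝ, K)) (J := 𝓘(ℝ, ℝ).prod (𝓡 p))
    (m := ∞) (n := ∞) (x₀ := (t, g)) (fun z s => F (unitCurve x s * z.2)) (fun z => z.1)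
    (hF.contMDiffAt.comp _ h2) contMDiffAt_fst (by simp)
  have h0 := inTangentCoordinates_model_space (I := 𝓘(ℝ, ℝ)) (I' := 𝓘(ℝ, K))
    (fun z : ℝ × G => z.1) (fun z => F (unitCurve x z.1 * z.2))
    (fun z => mfderiv 𝓘(ℝ, ℝ) 𝓘(ℝ, K) (fun s => F (unitCurve x s * z.2)) z.1) (t, g)
  have h3 : ContMDiffAt (𝓘(ℝ, ℝ).prod (𝓡 p)) 𝓘(ℝ, ℝ →L[ℝ] K) ∞
      (fun z : ℝ × G => fderiv ℝ (fun s => F (unitCurve x s * z.2)) z.1) (t, g) := by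
    simp only [← mfderiv_eq_fderiv]
    exact h0 ▸ h1
  have h4 : ContMDiffAt (𝓘(ℝ, ℝ).prod (𝓡 p)) 𝓘(ℝ, K) ∞
      (fun z : ℝ × G => fderiv ℝ (fun s => F (unitCurve x s * z.2)) z.1 (1 : ℝ)) (t, g) :=
    h3.clm_apply contMDiffAt_const
  simpa only [fderiv_apply_one_eq_deriv] using h4.continuousAt

lemma leftDeriv_eq_zero_of_notMem {f : G → K} {C : Set G} (hC : IsClosed C)
    (h0 : ∀ g ∉ C, f g = 0) {g : G} (hg : g ∉ C) {x : GroupLieAlgebra (𝓡 p) G} :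
    leftDeriv x f g = 0 := by
  have : f =ᶠ[nhds g] fun _ => 0 := Filter.eventuallyEq_of_mem (hC.isOpen_compl.mem_nhds hg) h0
  rw [leftDeriv_congr_nhds this, leftDeriv, mfderiv_const]
  rfl

variable [T2Space G] [MeasurableSpace G] [BorelSpace G] (ν : Measure G) [ν.IsHaarMeasure]

open scoped Pointwise in
/-- The integral of a derivative along left translations vanishes. -/
lemma integral_leftDeriv_eq_zero {F : G → K} (hF : ContMDiff (𝓡 p) 𝓘(ℝ, K) ∞ F) {C : Set G}
    (hC : IsCompact C) (h0 : ∀ g ∉ C, F g = 0) (x : GroupLieAlgebra (𝓡 p) G) :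
    ∫ g, leftDeriv x F g ∂ν = 0 := by
  have hG : IsTopologicalGroup G := topologicalGroup_of_lieGroup (𝓡 p) ∞
  let v : EuclideanSpace ℝ (Fin p) := x
  obtain ⟨r, hr, hsm⟩ := Metric.eventually_nhds_iff_ball.1
    (eventually_contMDiffAt_unitCurve (G := G) v)
  let A : Set ℝ := Metric.closedBall 0 (r / 2)
  have hA : IsCompact A := isCompact_closedBall _ _
  have hsmA : ∀ t ∈ A, ContMDiffAt 𝓘(ℝ, ℝ) (𝓡 p) ∞ (unitCurve v : ℝ → G) t := fun t ht =>
    hsm t (Metric.closedBall_subset_ball (by linarith) ht)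
  -- A compact set containing the supports of all the translates `g ↦ F(x(t) g)` for `t` in `A`.
  let D : Set G := (unitCurve v '' A)⁻¹ * C
  have hD : IsCompact D := (hA.image_of_continuousOn fun t ht =>
    (hsmA t ht).continuousAt.continuousWithinAt).inv.mul hC
  have hFD : ∀ t ∈ A, ∀ g ∉ D, F (unitCurve v t * g) = 0 := fun t ht g hg => h0 _ fun h =>
    hg ⟨_, Set.inv_mem_inv.2 ⟨t, ht, rfl⟩, _, h, inv_mul_cancel_left _ _⟩
  let H : ℝ → G → K := fun t g => deriv (fun s => F (unitCurve v s * g)) t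
  have hH : ∀ t ∈ A, ∀ g, ContinuousAt (fun z : ℝ × G => H z.1 z.2) (t, g) := fun t ht g =>
    continuousAt_deriv_unitCurve_mul hF v (hsmA t ht) g
  obtain ⟨M, hM⟩ := (hA.prod hD).exists_bound_of_continuousOn (f := fun z : ℝ × G => H z.1 z.2)
    fun z hz => (hH z.1 hz.1 z.2).continuousWithinAt
  have h0A : Metric.ball (0 : ℝ) (r / 2) ∈ nhds (0 : ℝ) := Metric.ball_mem_nhds _ (by linarith)
  have hHD : ∀ t ∈ Metric.ball (0 : ℝ) (r / 2), ∀ g ∉ D, H t g = 0 := fun t ht g hg => by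
    have : (fun s => F (unitCurve v s * g)) =ᶠ[nhds t] fun _ => 0 := by
      filter_upwards [Metric.isOpen_ball.mem_nhds ht] with s hs
      exact hFD s (Metric.ball_subset_closedBall hs) g hg
    simp only [H, this.deriv_eq, deriv_const]
  have hFc : ∀ t, Continuous fun g => F (unitCurve v t * g) := fun t =>
    hF.continuous.comp (continuous_const_mul _)
  have h00 : (0 : ℝ) ∈ A := Metric.mem_closedBall_self (by linarith)
  have hH0 : Continuous (H 0) := continuous_iff_continuousAt.2 fun g =>
    ContinuousAt.comp (f := fun g : G => ((0 : ℝ), g)) (hH 0 h00 g) (by fun_prop)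
  have key := hasDerivAt_integral_of_dominated_loc_of_deriv_le (μ := ν) (x₀ := (0 : ℝ))
    (F := fun t g => F (unitCurve v t * g)) (F' := H) (bound := D.indicator fun _ => M) h0A
    (.of_forall fun t => (hFc t).aestronglyMeasurable)
    ((hFc 0).integrable_of_hasCompactSupport (HasCompactSupport.intro hD (hFD 0 h00)))
    hH0.aestronglyMeasurable
    (.of_forall fun g t ht => by
      by_cases hg : g ∈ D
      · rw [Set.indicator_of_mem hg]
        exact hM (t, g) ⟨Metric.ball_subset_closedBall ht, hg⟩
      · rw [Set.indicator_of_notMem hg, hHD t ht g hg, norm_zero])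
    ((integrable_indicator_iff hD.measurableSet).2 (integrableOn_const hD.measure_lt_top.ne))
    (.of_forall fun g t ht => by
      have h1 : ContMDiffAt 𝓘(ℝ, ℝ) 𝓘(ℝ, K) ∞ (fun s => F (unitCurve v s * g)) t :=
        hF.contMDiffAt.comp t ((hsmA t (Metric.ball_subset_closedBall ht)).mul contMDiffAt_const)
      exact (h1.contDiffAt.differentiableAt (by simp)).hasDerivAt)
  -- By left invariance the integral of the translates does not depend on `t`, so its derivative,
  -- the integral sought, is zero.
  have hconst : (fun t => ∫ g, F (unitCurve v t * g) ∂ν) = fun _ => ∫ g, F g ∂ν := by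
    funext t
    exact integral_mul_left_eq_self F _
  rw [hconst] at key
  refine Eq.trans (integral_congr_ae (.of_forall fun g => ?_)) (key.2.unique (hasDerivAt_const _ _))
  exact leftDeriv_eq_deriv hF.contMDiffAt x

lemma integral_mul_leftDeriv {k f : G → K} (hk : ContMDiff (𝓡 p) 𝓘(ℝ, K) ∞ k)
    (hf : ContMDiff (𝓡 p) 𝓘(ℝ, K) ∞ f) {C : Set G}
    (hC : IsCompact C) (h0 : ∀ g ∉ C, f g = 0) (x : GroupLieAlgebra (𝓡 p) G) :
    ∫ g, k g * leftDeriv x f g ∂ν = -∫ g, leftDeriv x k g * f g ∂ν := by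
  have hkf : ContMDiff (𝓡 p) 𝓘(ℝ, K) ∞ (k * f) :=
    contMDiffOn_univ.1 (contMDiffOn_mul hk.contMDiffOn hf.contMDiffOn)
  have h1 := integral_leftDeriv_eq_zero ν hkf hC (fun g hg => by simp [h0 g hg]) x
  have hd : ∀ {f : G → K}, ContMDiff (𝓡 p) 𝓘(ℝ, K) ∞ f → Continuous (leftDeriv x f) :=
    fun hf => continuous_iff_continuousAt.2 fun g => (contMDiffAt_leftDeriv (U := ⊤)
      hf.contMDiffOn trivial x).continuousAt
  have h2 : ∀ g ∉ C, leftDeriv x f g = 0 := fun g hg =>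
    leftDeriv_eq_zero_of_notMem hC.isClosed h0 hg
  have hi1 : Integrable (fun g => leftDeriv x k g * f g) ν :=
    ((hd hk).mul hf.continuous).integrable_of_hasCompactSupport
      (HasCompactSupport.intro hC fun g hg => by simp [h0 g hg])
  have hi2 : Integrable (fun g => k g * leftDeriv x f g) ν :=
    (hk.continuous.mul (hd hf)).integrable_of_hasCompactSupport
      (HasCompactSupport.intro hC fun g hg => by simp [h2 g hg])
  rw [eq_neg_iff_add_eq_zero, add_comm, ← integral_add hi1 hi2, ← h1]
  exact integral_congr_ae (.of_forall fun g =>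
    (leftDeriv_mul hk.contMDiffAt hf.contMDiffAt x).symm)

end IntegrationByParts

/-! ### The derivative of the determinant. -/

section Determinant

variable {K : Type*} [RCLike K] {ι : Type*} [Fintype ι] [DecidableEq ι]

lemma contDiff_matrix_det : ContDiff ℝ ∞ fun M : ι → ι → K => (Matrix.of M).det := by
  simp only [Matrix.det_apply', Matrix.of_apply]
  exact ContDiff.sum fun σ _ => contDiff_const.mul (contDiff_prod fun i _ => by fun_prop)

/-- A permutation other than the identity moves at least two indices, so after one factor is
differentiated an off-diagonal entry of the identity matrix remains. Only the trace survives. -/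
lemma hasDerivAt_matrix_det_one {M : ℝ → ι → ι → K} {M' : ι → ι → K} {t : ℝ}
    (hM : ∀ i j, HasDerivAt (fun s => M s i j) (M' i j) t) (h1 : Matrix.of (M t) = 1) :
    HasDerivAt (fun s => (Matrix.of (M s)).det) (∑ i, M' i i) t := by
  simp only [Matrix.det_apply', Matrix.of_apply]
  have key : ∀ σ : Equiv.Perm ι, HasDerivAt (fun s => ((Equiv.Perm.sign σ : ℤ) : K) *
      ∏ i, M s (σ i) i) (((Equiv.Perm.sign σ : ℤ) : K) *
      ∑ i, (∏ j ∈ Finset.univ.erase i, M t (σ j) j) • M' (σ i) i) t := fun σ =>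
    (HasDerivAt.fun_finsetProd fun i _ => hM (σ i) i).const_mul _
  have h2 : ∀ i j, M t i j = if i = j then 1 else 0 := fun i j => by
    rw [← Matrix.of_apply (M t) i j, h1, Matrix.one_apply]
  refine (HasDerivAt.fun_sum (u := Finset.univ) fun σ _ => key σ).congr_deriv ?_
  rw [Finset.sum_eq_single 1]
  · simp [h2]
  · intro σ _ hσ
    rw [Finset.sum_eq_zero, mul_zero]
    intro i _
    rw [Finset.prod_eq_zero_iff.2, zero_smul]
    by_contra! h
    refine hσ (Equiv.ext fun j => ?_)
    have hj : ∀ j ≠ i, σ j = j := fun j hj => by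
      by_contra hne
      exact h j (by simpa using hj) (by rw [h2, if_neg hne])
    by_cases hji : j = i
    · subst hji
      by_contra hne
      exact hne (σ.injective (hj _ hne))
    · exact hj j hji
  · simp

end Determinant

/-! ### The odd modular character and its derivative. -/

namespace SupergroupPair

variable {K : Type*} [RCLike K] {p : ℕ}
  {G : Type*} [TopologicalSpace G] [ChartedSpace (EuclideanSpace ℝ (Fin p)) G] [Group G]
  {𝔤 : Type*} [AddCommGroup 𝔤] [Module K 𝔤] (P : SupergroupPair K p G 𝔤)

lemma DeltaOdd_mul (g h : G) : P.DeltaOdd (g * h) = P.DeltaOdd g * P.DeltaOdd h := by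
  rw [DeltaOdd, DeltaOdd, DeltaOdd, ← LinearMap.det_comp]
  congr 1
  ext x
  simp

lemma DeltaOdd_one : P.DeltaOdd 1 = 1 := by
  refine Eq.trans ?_ (LinearMap.det_id (M := P.L.gr 1))
  rw [DeltaOdd]
  congr 1
  ext x
  simp

lemma DeltaOdd_inv_mul (g : G) : P.DeltaOdd g⁻¹ * P.DeltaOdd g = 1 := by
  rw [← DeltaOdd_mul, inv_mul_cancel, DeltaOdd_one]

variable [LieGroup (𝓡 p) ∞ G] [FiniteDimensional K 𝔤]

/-- The matrix coefficients of `Ad` on the odd part. -/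
def oddCoord (i : Fin (Module.finrank K (P.L.gr 1))) : Module.Dual K 𝔤 :=
  (Module.finBasis K (P.L.gr 1)).coord i ∘ₗ
    (P.L.gr 1).projectionOnto (P.L.gr 0) P.L.isCompl.symm

lemma oddCoord_of_mem (i : Fin (Module.finrank K (P.L.gr 1))) {x : 𝔤} (hx : x ∈ P.L.gr 1) :
    P.oddCoord i x = P.oddBasis.coord i ⟨x, hx⟩ := by
  rw [oddCoord, LinearMap.comp_apply, Submodule.projectionOnto_apply_of_mem_left _ hx]

lemma DeltaOdd_eq_det (g : G) : P.DeltaOdd g =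
    (Matrix.of fun i j => P.oddCoord i (P.Ad g (P.oddBasis j))).det := by
  rw [DeltaOdd, ← LinearMap.det_toMatrix P.oddBasis]
  congr 1
  ext i j
  rw [LinearMap.toMatrix_apply, Matrix.of_apply, oddCoord_of_mem P i (P.Ad_mem g 1 _ (P.oddBasis j).2)]
  rfl

lemma contMDiff_DeltaOdd : ContMDiff (𝓡 p) 𝓘(ℝ, K) ∞ P.DeltaOdd := by
  have h : P.DeltaOdd = fun g =>
    (Matrix.of fun i j => P.oddCoord i (P.Ad g (P.oddBasis j))).det := funext P.DeltaOdd_eq_det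
  rw [h]
  have h1 : ContMDiff (𝓡 p) 𝓘(ℝ, Fin (Module.finrank K (P.L.gr 1)) →
      Fin (Module.finrank K (P.L.gr 1)) → K) ∞
      (fun g : G => fun i j => P.oddCoord i (P.Ad g (P.oddBasis j))) :=
    contMDiff_pi_space.2 fun i => contMDiff_pi_space.2 fun j => P.Ad_smooth _ _
  exact contDiff_matrix_det.contMDiff.comp h1

/-- Multiplicativity reduces the claim to the derivative at the identity, which is the trace of `ad
x` on the odd part, that is `-δ(x)`. -/
lemma leftDeriv_DeltaOdd (x : GroupLieAlgebra (𝓡 p) G) (g : G) :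
    leftDeriv x P.DeltaOdd g =
      -P.L.deltaOdd ⟨P.incl x, P.incl_mem x⟩ * P.DeltaOdd g := by
  let v : EuclideanSpace ℝ (Fin p) := x
  rw [leftDeriv_eq_deriv P.contMDiff_DeltaOdd.contMDiffAt]
  change deriv (fun t => P.DeltaOdd (unitCurve v t * g)) 0 = _
  simp only [DeltaOdd_mul]
  have h1 : HasDerivAt (fun t => P.DeltaOdd (unitCurve v t))
      (∑ i, P.oddCoord i (P.L.bracket (P.incl x) (P.oddBasis i))) 0 := by
    simp only [DeltaOdd_eq_det]
    refine hasDerivAt_matrix_det_one (M := fun t i j =>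
      P.oddCoord i (P.Ad (unitCurve v t) (P.oddBasis j)))
      (M' := fun i j => P.oddCoord i (P.L.bracket (P.incl x) (P.oddBasis j))) (fun i j => ?_) ?_
    · have h2 : ContMDiffAt 𝓘(ℝ, ℝ) 𝓘(ℝ, K) ∞ (fun t => P.oddCoord i
          (P.Ad (unitCurve v t) (P.oddBasis j))) 0 := ContMDiffAt.comp (0 : ℝ)
        (g := fun g => P.oddCoord i (P.Ad g (P.oddBasis j)))
        (P.Ad_smooth _ _).contMDiffAt (contMDiffAt_unitCurve v)
      have h3 := (h2.contDiffAt.differentiableAt (by simp)).hasDerivAt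
      exact h3.congr_deriv ((mfderiv_eq_deriv_unitCurve ((P.Ad_smooth (P.oddCoord i)
        (P.oddBasis j)).contMDiffAt.mdifferentiableAt (by simp)) x).symm.trans (P.Ad_deriv x _ _))
    · ext i j
      rw [Matrix.of_apply, unitCurve_zero, map_one]
      simp only [LinearEquiv.coe_one, id_eq]
      rw [oddCoord_of_mem P i (P.oddBasis j).2]
      simp [Matrix.one_apply, Finsupp.single_apply, eq_comm]
  rw [(h1.mul_const _).deriv, LieSuperalgebra.deltaOdd, neg_neg,
    LinearMap.trace_eq_matrix_trace K P.oddBasis, Matrix.trace]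
  congr 1
  refine Finset.sum_congr rfl fun i _ => ?_
  rw [Matrix.diag_apply, LinearMap.toMatrix_apply,
    oddCoord_of_mem P i (P.L.bracket_even_odd ⟨P.incl x, P.incl_mem x⟩ _ (P.oddBasis i).2)]
  rfl

end SupergroupPair


/-! ### Invariance of `L_γ(|dg| Δ)`. -/

namespace SupergroupPair

variable {K : Type*} [RCLike K] {p : ℕ}
  {G : Type*} [TopologicalSpace G] [ChartedSpace (EuclideanSpace ℝ (Fin p)) G] [Group G]
  {𝔤 : Type*} [AddCommGroup 𝔤] [Module K 𝔤] (P : SupergroupPair K p G 𝔤)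

/-- The action of `g ∈ G` on `U(𝔤)` by automorphisms. -/
def AdEnv (g : G) : P.L.Env →ₐ[K] P.L.Env :=
  P.L.envMap (P.Ad g).toLinearMap (P.Ad_mem g) (P.Ad_bracket g)

lemma AdEnv_ι (g : G) (x : 𝔤) : P.AdEnv g (P.L.ι x) = P.L.ι (P.Ad g x) := P.L.envMap_ι x

lemma AdEnv_mul_apply (g h : G) (u : P.L.Env) : P.AdEnv (g * h) u = P.AdEnv g (P.AdEnv h u) := by
  have : P.AdEnv (g * h) = (P.AdEnv g).comp (P.AdEnv h) := P.L.algHom_ext fun x => by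
    simp [AdEnv_ι]
  exact DFunLike.congr_fun this u

lemma AdEnv_one_apply (u : P.L.Env) : P.AdEnv 1 u = u := by
  have : P.AdEnv 1 = AlgHom.id K _ := P.L.algHom_ext fun x => by simp [AdEnv_ι]
  exact DFunLike.congr_fun this u

lemma AdEnv_surjective (g : G) : Function.Surjective (P.AdEnv g) := fun u =>
  ⟨P.AdEnv g⁻¹ u, by rw [← AdEnv_mul_apply, mul_inv_cancel, AdEnv_one_apply]⟩

lemma Ad_inv_Ad (g : G) (x : 𝔤) : P.Ad g⁻¹ (P.Ad g x) = x := by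
  rw [← LinearEquiv.mul_apply, ← map_mul]; simp

lemma Ad_even_sub_odd (g : G) (x : 𝔤) :
    P.L.evenPart (P.Ad g x) - P.L.oddPart (P.Ad g x) =
      P.Ad g (P.L.evenPart x - P.L.oddPart x) := by
  conv_lhs => rw [← P.L.even_add_odd x]
  have h0 := P.Ad_mem g 0 _ (P.L.evenPart_mem x)
  have h1 := P.Ad_mem g 1 _ (P.L.oddPart_mem x)
  simp only [map_add, map_sub, P.L.evenPart_even h0, P.L.evenPart_odd h1, P.L.oddPart_even h0,
    P.L.oddPart_odd h1]
  abel

variable [LieGroup (𝓡 p) ∞ G] [FiniteDimensional K 𝔤]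

lemma TestFun.contMDiff_val {P : SupergroupPair K p G 𝔤} (φ : P.TestFun) (u : P.L.Env) :
    ContMDiff (𝓡 p) 𝓘(ℝ, K) ∞ (φ.val u) := contMDiffOn_univ.1 (φ.mem.1.1 u).1

lemma TestFun.exists_isCompact {P : SupergroupPair K p G 𝔤} (φ : P.TestFun) :
    ∃ C : Set G, IsCompact C ∧ ∀ u, ∀ g ∉ C, φ.val u g = 0 := by
  obtain ⟨-, C, hC, -, h⟩ := φ.mem
  exact ⟨C, hC, h⟩

/-- The left-invariant operator in direction `Ad(h⁻¹) x` at `h` is differentiation along left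
translations by `x`, for which integration by parts against left Haar measure is available. -/
lemma TestFun.val_Ad_inv_incl_mul {P : SupergroupPair K p G 𝔤} (φ : P.TestFun)
    (x : GroupLieAlgebra (𝓡 p) G) (u : P.L.Env) (h : G) :
    φ.val (P.L.ι (P.Ad h⁻¹ (P.incl x)) * u) h = leftDeriv x (φ.val u) h := by
  rw [incl_Ad]
  exact (φ.mem.1.2 _ u h trivial).trans (leftDeriv_eq_rightDeriv (φ.contMDiff_val u).contMDiffAt x)

lemma dualAct_ι (x : 𝔤) : P.dualAct (P.L.ι x) = P.dualLie x := P.L.lift_ι _ _ x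

lemma dualAct_ι_mul (x : 𝔤) (u : P.L.Env) (μ : P.Functional) :
    P.dualAct (P.L.ι x * u) μ = P.dualLie x (P.dualAct u μ) := by
  rw [map_mul, dualAct_ι, Module.End.mul_apply]

lemma dualTranslate_dualLie (a : G) (x : 𝔤) (μ : P.Functional) :
    P.dualTranslate a (P.dualLie x μ) = P.dualLie (P.Ad a x) (P.dualTranslate a μ) := by
  refine LinearMap.ext fun φ : P.TestFun => ?_
  change μ (P.signedLie x (P.translate a⁻¹ φ)) = μ (P.translate a⁻¹ (P.signedLie (P.Ad a x) φ))
  congr 1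
  refine TestFun.ext fun u h => ?_
  rw [signedLie_apply, translate_apply, translate_apply, signedLie_apply, inv_inv, mul_inv_rev,
    Ad_even_sub_odd, map_mul P.Ad, LinearEquiv.mul_apply, Ad_inv_Ad]

lemma dualTranslate_dualAct (a : G) (u : P.L.Env) (μ : P.Functional) :
    P.dualTranslate a (P.dualAct u μ) = P.dualAct (P.AdEnv a u) (P.dualTranslate a μ) := by
  have hadd : ∀ μ₁ μ₂ : P.Functional, P.dualTranslate a (μ₁ + μ₂) =
    P.dualTranslate a μ₁ + P.dualTranslate a μ₂ := fun _ _ => rfl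
  have hsmul : ∀ (c : K) (μ : P.Functional), P.dualTranslate a (c • μ) =
    c • P.dualTranslate a μ := fun _ _ => rfl
  induction u using P.L.env_induction with
  | one => simp
  | add u v hu hv => rw [map_add, map_add, map_add, LinearMap.add_apply, hadd, hu, hv]; rfl
  | smul c u hu => rw [map_smul, map_smul, map_smul, LinearMap.smul_apply, hsmul, hu]; rfl
  | mul x u hu => rw [dualAct_ι_mul, dualTranslate_dualLie, hu, map_mul, AdEnv_ι, dualAct_ι_mul]

/-- This expression makes the linearity of `δ` evident. -/
lemma deltaOdd_eq (x : P.L.gr 0) : P.L.deltaOdd x = P.L.top P.oddBasis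
    (P.L.mono P.oddBasis Finset.univ * P.L.ι x) := by
  rw [P.L.top_mul_even, P.L.top_mono, if_pos rfl, mul_one]

variable [MeasurableSpace G] [BorelSpace G] (ν : Measure G) [ν.IsHaarMeasure]

lemma haarDelta_apply (φ : P.TestFun) :
    P.haarDelta ν φ = ∫ g, P.DeltaOdd g * φ.val 1 g ∂ν := rfl

/-- After a left translation of the variable only the multiplicative character `Δ` changes. -/
lemma dualTranslate_haarDelta (a : G) :
    P.dualTranslate a (P.haarDelta ν) = P.DeltaOdd a⁻¹ • P.haarDelta ν := by
  have : IsTopologicalGroup G := topologicalGroup_of_lieGroup (𝓡 p) ∞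
  refine LinearMap.ext fun φ : P.TestFun => ?_
  change P.haarDelta ν (P.translate a⁻¹ φ) = P.DeltaOdd a⁻¹ * P.haarDelta ν φ
  rw [haarDelta_apply, haarDelta_apply, ← integral_const_mul,
    ← integral_mul_left_eq_self (fun g => P.DeltaOdd a⁻¹ * (P.DeltaOdd g * φ.val 1 g)) a]
  refine integral_congr_ae (.of_forall fun g => ?_)
  dsimp only
  rw [translate_apply, inv_inv, DeltaOdd_mul, ← mul_assoc, ← mul_assoc, DeltaOdd_inv_mul, one_mul]

variable [T2Space G]

/-- Integration by parts moves the derivative onto `Δ`, whose logarithmic derivative is `-δ`. This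
is why `Δ` has to accompany the ideal `I_δ`. -/
lemma dualLie_haarDelta (x : P.L.gr 0) :
    P.dualLie (x : 𝔤) (P.haarDelta ν) = P.L.deltaOdd x • P.haarDelta ν := by
  induction x using P.even_induction with
  | add x y hx hy =>
    have h : P.L.deltaOdd (x + y) = P.L.deltaOdd x + P.L.deltaOdd y := by
      simp only [deltaOdd_eq, Submodule.coe_add, map_add, mul_add]
    rw [h, add_smul, ← hx, ← hy, Submodule.coe_add, map_add, LinearMap.add_apply]
  | smul c x hx =>
    have h : P.L.deltaOdd (c • x) = c * P.L.deltaOdd x := by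
      simp only [deltaOdd_eq, Submodule.coe_smul, map_smul, mul_smul_comm, smul_eq_mul]
    rw [h, mul_smul, ← hx, Submodule.coe_smul, map_smul, LinearMap.smul_apply]
  | incl y =>
    refine LinearMap.ext fun φ : P.TestFun => ?_
    change P.haarDelta ν (P.signedLie (P.incl y) φ) = _ * P.haarDelta ν φ
    obtain ⟨C, hC, h0⟩ := φ.exists_isCompact
    have h1 : ∀ h, (P.signedLie (P.incl y) φ).val 1 h = leftDeriv y (φ.val 1) h := fun h => by
      rw [signedLie_apply, P.L.evenPart_even (P.incl_mem y), P.L.oddPart_even (P.incl_mem y),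
        sub_zero, TestFun.val_Ad_inv_incl_mul]
    simp only [haarDelta_apply, h1]
    rw [integral_mul_leftDeriv ν P.contMDiff_DeltaOdd (φ.contMDiff_val 1) hC (h0 1),
      ← integral_const_mul, ← integral_neg]
    refine integral_congr_ae (.of_forall fun g => ?_)
    dsimp only
    rw [leftDeriv_DeltaOdd]
    ring

lemma dualAct_haarDelta_of_mem {w : P.L.Env} (hw : w ∈ P.L.idealDelta) :
    P.dualAct w (P.haarDelta ν) = 0 := by
  induction hw using Submodule.span_induction with
  | mem u hu =>
    obtain ⟨x, rfl⟩ := hu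
    rw [map_sub, LinearMap.sub_apply, dualAct_ι, dualLie_haarDelta, AlgHom.commutes,
      Module.algebraMap_end_apply, sub_self]
  | zero => simp
  | add x y _ _ hx hy => rw [map_add, LinearMap.add_apply, hx, hy, add_zero]
  | smul a x _ hx => rw [smul_eq_mul, map_mul, Module.End.mul_apply, hx, map_zero]

variable {γ : P.L.Env} (hγ : P.L.idealDelta.mkQ γ ∈ P.L.invariants)

include hγ

lemma dualLie_dualAct_haarDelta (x : 𝔤) : P.dualLie x (P.dualAct γ (P.haarDelta ν)) = 0 := by
  rw [← dualAct_ι_mul]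
  exact P.dualAct_haarDelta_of_mem ν ((Submodule.Quotient.mk_eq_zero _).1 (hγ x))

/-- `Ad(a)` multiplies the class of `γ` by `Δ(a)`, and translation multiplies `|dg| Δ` by `Δ(a⁻¹)`;
since `I_δ` annihilates `|dg| Δ`, the two factors cancel. -/
lemma dualTranslate_dualAct_haarDelta (a : G) :
    P.dualTranslate a (P.dualAct γ (P.haarDelta ν)) = P.dualAct γ (P.haarDelta ν) := by
  have h := P.dualAct_haarDelta_of_mem ν (P.L.envMap_invariant P.oddBasis (P.AdEnv_surjective a) hγ)
  rw [map_sub, LinearMap.sub_apply, sub_eq_zero, map_smul, LinearMap.smul_apply] at h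
  rw [dualTranslate_dualAct, dualTranslate_haarDelta, map_smul, AdEnv, h, smul_smul]
  exact (congrArg (· • P.dualAct γ (P.haarDelta ν)) (P.DeltaOdd_inv_mul a)).trans (one_smul _ _)

end SupergroupPair


/-! ### Normal form and top coefficient of `L_γ(|dg| Δ)`. -/

namespace LieSuperalgebra

variable {K 𝔤 : Type*} [Field K] [AddCommGroup 𝔤] [Module K 𝔤] (L : LieSuperalgebra K 𝔤)

lemma parity_ι (x : 𝔤) : L.parity (L.ι x) = L.ι (L.evenPart x - L.oddPart x) := by
  conv_lhs => rw [← L.even_add_odd x, map_add, map_add, L.parity_even (L.evenPart_mem x),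
    L.parity_odd (L.oddPart_mem x), ← sub_eq_add_neg, ← map_sub]

end LieSuperalgebra

section LieAlgebraBasis

variable (p : ℕ) (G : Type*) [TopologicalSpace G] [ChartedSpace (EuclideanSpace ℝ (Fin p)) G]
  [Group G]

/-- The standard basis of the Lie algebra of `G`. -/
def lieBasis : Module.Basis (Fin p) ℝ (GroupLieAlgebra (𝓡 p) G) :=
  (EuclideanSpace.basisFun (Fin p) ℝ).toBasis

end LieAlgebraBasis

namespace SupergroupPair

variable {K : Type*} [RCLike K] {p : ℕ}
  {G : Type*} [TopologicalSpace G] [ChartedSpace (EuclideanSpace ℝ (Fin p)) G] [Group G]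
  {𝔤 : Type*} [AddCommGroup 𝔤] [Module K 𝔤] (P : SupergroupPair K p G 𝔤)

/-- The basis of the even part of `𝔤` given by a basis of the Lie algebra of `G`. -/
def evenBasis : Module.Basis (Fin p) K (P.L.gr 0) :=
  ((lieBasis p G).baseChange K).map P.evenEquiv

lemma coe_evenBasis (j : Fin p) : (P.evenBasis j : 𝔤) = P.incl (lieBasis p G j) := by
  simp [evenBasis, incl]

/-- The coordinates of the even part with respect to `evenBasis`. -/
def evenCoord (j : Fin p) : Module.Dual K 𝔤 := P.evenBasis.coord j ∘ₗ P.L.toEven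

lemma ι_eq_sum_evenCoord {x : 𝔤} (hx : x ∈ P.L.gr 0) :
    x = ∑ j, P.evenCoord j x • P.incl (lieBasis p G j) := by
  have h := congrArg (Subtype.val) (P.evenBasis.sum_repr ⟨x, hx⟩)
  rw [Submodule.coe_sum] at h
  refine h.symm.trans (Finset.sum_congr rfl fun j _ => ?_)
  rw [Submodule.coe_smul, coe_evenBasis, evenCoord, LinearMap.comp_apply, P.L.toEven_even hx]
  rfl

variable [LieGroup (𝓡 p) ∞ G]

/-- The span of the maps `h ↦ c(h) w` from `G` to `U(𝔤)` with `c` smooth. -/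
def smoothEnv : Submodule K (G → P.L.Env) :=
  Submodule.span K {F | ∃ c : G → K, ContMDiff (𝓡 p) 𝓘(ℝ, K) ∞ c ∧ ∃ w, F = fun h => c h • w}

variable [FiniteDimensional K 𝔤]

/-- A fixed even left factor becomes a combination, with smooth coefficients, of derivatives along
left translations, which can be integrated by parts. -/
lemma TestFun.val_even_mul {P : SupergroupPair K p G 𝔤} (φ : P.TestFun) (x : P.L.gr 0)
    (u : P.L.Env) (h : G) : φ.val (P.L.ι x * u) h =
      ∑ j, P.evenCoord j (P.Ad h x) * leftDeriv (lieBasis p G j) (φ.val u) h := by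
  have h1 := P.ι_eq_sum_evenCoord (P.Ad_mem h 0 x x.2)
  conv_lhs => rw [← P.Ad_inv_Ad h x, h1]
  simp only [map_sum, map_smul, Finset.sum_mul, smul_mul_assoc, Finset.sum_apply, Pi.smul_apply,
    smul_eq_mul, TestFun.val_Ad_inv_incl_mul]

/-- `L_γ` is the adjoint of the operator `φ(v; h) ↦ φ(Ad(h⁻¹)(γ) v; h)`, up to the parity of
`γ`. -/
lemma exists_dualAct_eq (γ : P.L.Env) (φ : P.TestFun) : ∃ S : P.TestFun,
    (∀ v h, S.val v h = φ.val (P.AdEnv h⁻¹ (P.L.parity γ) * v) h) ∧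
      ∀ μ : P.Functional, P.dualAct γ μ φ = μ S := by
  induction γ using P.L.env_induction generalizing φ with
  | one => exact ⟨φ, fun v h => by simp, fun μ => by simp⟩
  | add u v hu hv =>
    obtain ⟨S, h1, h2⟩ := hu φ
    obtain ⟨T, h3, h4⟩ := hv φ
    refine ⟨S + T, fun w h => ?_, fun μ => ?_⟩
    · simp only [TestFun.val_add, h1, h3, map_add, add_mul, Pi.add_apply]
    · rw [map_add, LinearMap.add_apply, map_add, ← h2, ← h4]
      rfl
  | smul c u hu =>
    obtain ⟨S, h1, h2⟩ := hu φ
    refine ⟨c • S, fun w h => ?_, fun μ => ?_⟩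
    · simp only [TestFun.val_smul, h1, map_smul, smul_mul_assoc, Pi.smul_apply, smul_eq_mul]
    · rw [map_smul, LinearMap.smul_apply, map_smul, ← h2]
      rfl
  | mul x u hu =>
    obtain ⟨S, h1, h2⟩ := hu (P.signedLie x φ)
    refine ⟨S, fun w h => ?_, fun μ => ?_⟩
    · rw [h1, signedLie_apply, map_mul P.L.parity, map_mul (P.AdEnv h⁻¹), P.L.parity_ι, AdEnv_ι, mul_assoc]
    · rw [dualAct_ι_mul, dualLie_apply, h2]

/-- Letter by letter, `Ad(h⁻¹) x` is expanded in a fixed basis of `𝔤`, with coefficients smooth in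
`h`. -/
lemma AdEnv_mem_smoothEnv (u : P.L.Env) : (fun h : G => P.AdEnv h⁻¹ u) ∈ P.smoothEnv := by
  induction u using P.L.env_induction with
  | one =>
    refine Submodule.subset_span ⟨fun _ => 1, contMDiff_const, 1, ?_⟩
    funext h
    rw [map_one, one_smul]
  | add u v hu hv =>
    simp only [map_add]
    exact add_mem hu hv
  | smul c u hu =>
    simp only [map_smul]
    exact Submodule.smul_mem _ c hu
  | mul x u hu =>
    simp only [map_mul, AdEnv_ι]
    have key : ∀ F ∈ P.smoothEnv, (fun h : G => P.L.ι (P.Ad h⁻¹ x) * F h) ∈ P.smoothEnv := by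
      intro F hF
      induction hF using Submodule.span_induction with
      | mem F hF =>
        obtain ⟨c, hc, w, rfl⟩ := hF
        have h1 : (fun h : G => P.L.ι (P.Ad h⁻¹ x) * c h • w) = ∑ i, fun h : G =>
            ((fun h : G => (Module.finBasis K 𝔤).coord i (P.Ad h⁻¹ x)) * c) h •
              (P.L.ι (Module.finBasis K 𝔤 i) * w) := by
          funext h
          rw [map_expand P.L.ι (P.Ad h⁻¹ x)]
          simp only [Finset.sum_mul, Finset.sum_apply, Pi.mul_apply, smul_mul_assoc,
            mul_smul_comm, mul_smul, Finset.smul_sum]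
          exact Finset.sum_congr rfl fun i _ => by rw [smul_comm]
        rw [h1]
        exact sum_mem fun i _ => Submodule.subset_span ⟨_, contMDiffOn_univ.1
          (contMDiffOn_mul (P.Ad_inv_smooth _ _).contMDiffOn hc.contMDiffOn), _, rfl⟩
      | zero => simp only [Pi.zero_apply, mul_zero]; exact zero_mem _
      | add F F' _ _ h h' => simp only [Pi.add_apply, mul_add]; exact add_mem h h'
      | smul a F _ h => simp only [Pi.smul_apply, mul_smul_comm]; exact Submodule.smul_mem _ a h
    exact key _ hu

variable [T2Space G] [MeasurableSpace G] [BorelSpace G] (ν : Measure G) [ν.IsHaarMeasure]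

lemma TestFun.integrable_mul_val {P : SupergroupPair K p G 𝔤} (φ : P.TestFun) {k : G → K}
    (hk : Continuous k) (u : P.L.Env) : Integrable (fun h => k h * φ.val u h) ν := by
  have : IsTopologicalGroup G := topologicalGroup_of_lieGroup (𝓡 p) ∞
  obtain ⟨C, hC, h0⟩ := φ.exists_isCompact
  exact (hk.mul (φ.contMDiff_val u).continuous).integrable_of_hasCompactSupport
    (HasCompactSupport.intro hC fun g hg => by simp [h0 u g hg])

lemma contMDiff_leftDeriv {k : G → K} (hk : ContMDiff (𝓡 p) 𝓘(ℝ, K) ∞ k)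
    (x : GroupLieAlgebra (𝓡 p) G) : ContMDiff (𝓡 p) 𝓘(ℝ, K) ∞ (leftDeriv x k) := fun _ =>
  contMDiffAt_leftDeriv (U := ⊤) hk.contMDiffOn trivial x

/-- The superdistribution `φ ↦ ∑_I ∫ k_I(h) φ(e_I; h) dh`. -/
lemma exists_normalForm (w : P.L.Env) {k : G → K} (hk : ContMDiff (𝓡 p) 𝓘(ℝ, K) ∞ k) :
    ∃ l : Finset (Fin (Module.finrank K (P.L.gr 1))) → G → K,
      (∀ I, ContMDiff (𝓡 p) 𝓘(ℝ, K) ∞ (l I)) ∧ ∀ φ : P.TestFun, ∫ h, k h * φ.val w h ∂ν =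
        ∑ I, ∫ h, l I h * φ.val (P.L.mono P.oddBasis I) h ∂ν := by
  let M : Submodule K P.L.Env :=
    { carrier := {w | ∀ k : G → K, ContMDiff (𝓡 p) 𝓘(ℝ, K) ∞ k →
        ∃ l : Finset (Fin (Module.finrank K (P.L.gr 1))) → G → K,
          (∀ I, ContMDiff (𝓡 p) 𝓘(ℝ, K) ∞ (l I)) ∧ ∀ φ : P.TestFun, ∫ h, k h * φ.val w h ∂ν =
            ∑ I, ∫ h, l I h * φ.val (P.L.mono P.oddBasis I) h ∂ν}
      add_mem' := fun {u v} hu hv k hk => by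
        obtain ⟨l, hl, h1⟩ := hu k hk
        obtain ⟨m, hm, h2⟩ := hv k hk
        refine ⟨l + m, fun I => (hl I).add (hm I), fun φ => ?_⟩
        simp only [map_add, Pi.add_apply, mul_add, add_mul]
        rw [integral_add (φ.integrable_mul_val ν hk.continuous u)
          (φ.integrable_mul_val ν hk.continuous v), h1, h2, ← Finset.sum_add_distrib]
        exact Finset.sum_congr rfl fun I _ => (integral_add
          (φ.integrable_mul_val ν (hl I).continuous _)
          (φ.integrable_mul_val ν (hm I).continuous _)).symm
      zero_mem' := fun k hk => ⟨0, fun I => contMDiff_const, fun φ => by simp⟩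
      smul_mem' := fun c u hu k hk => by
        obtain ⟨l, hl, h1⟩ := hu k hk
        refine ⟨fun I h => c * l I h, fun I => contMDiffOn_univ.1
          (contMDiffOn_mul contMDiffOn_const (hl I).contMDiffOn), fun φ => ?_⟩
        simp only [map_smul, Pi.smul_apply, smul_eq_mul, mul_left_comm _ c, mul_assoc,
          integral_const_mul, h1, Finset.mul_sum] }
  refine P.L.eq_top_of_mono_mem P.oddBasis (M := M) (fun x u hu k hk => ?_) (fun I k hk => ?_) w k hk
  -- An even left factor is removed from the argument: its smooth coefficients join `k`, and its
  -- derivatives move onto this product with a minus sign.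
  · let c : Fin p → G → K := fun j => k * fun h => P.evenCoord j (P.Ad h x)
    have hc : ∀ j, ContMDiff (𝓡 p) 𝓘(ℝ, K) ∞ (c j) := fun j => contMDiffOn_univ.1
      (contMDiffOn_mul hk.contMDiffOn (P.Ad_smooth _ _).contMDiffOn)
    have hd := fun j => contMDiff_leftDeriv (hc j) (lieBasis p G j)
    obtain ⟨l, hl, h1⟩ := hu (fun h => -∑ j, leftDeriv (lieBasis p G j) (c j) h)
      (ContMDiff.neg (contMDiff_finsetSum fun j _ => hd j))
    refine ⟨l, hl, fun φ => ?_⟩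
    obtain ⟨C, hC, h0⟩ := φ.exists_isCompact
    rw [← h1]
    have hint : ∀ j, Integrable (fun h => c j h * leftDeriv (lieBasis p G j) (φ.val u) h) ν :=
      fun j => by
        have hG : IsTopologicalGroup G := topologicalGroup_of_lieGroup (𝓡 p) ∞
        refine ((hc j).continuous.mul (contMDiff_leftDeriv (φ.contMDiff_val u)
          (lieBasis p G j)).continuous).integrable_of_hasCompactSupport
          (HasCompactSupport.intro hC fun g hg => ?_)
        rw [Pi.mul_apply, leftDeriv_eq_zero_of_notMem hC.isClosed (h0 u) hg, mul_zero]
    have e1 : ∀ h, k h * φ.val (P.L.ι x * u) h =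
        ∑ j, c j h * leftDeriv (lieBasis p G j) (φ.val u) h := fun h => by
      rw [TestFun.val_even_mul, Finset.mul_sum]
      exact Finset.sum_congr rfl fun j _ => (mul_assoc _ _ _).symm
    simp only [e1, neg_mul, Finset.sum_mul]
    rw [integral_finsetSum _ fun j _ => hint j, integral_neg, integral_finsetSum _ fun j _ =>
      φ.integrable_mul_val ν (hd j).continuous u, ← Finset.sum_neg_distrib]
    exact Finset.sum_congr rfl fun j _ =>
      integral_mul_leftDeriv ν (hc j) (φ.contMDiff_val u) hC (h0 u) _
  · refine ⟨Pi.single I k, fun J => ?_, fun φ => ?_⟩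
    · by_cases h : J = I
      · subst h; simpa using hk
      · rw [Pi.single_eq_of_ne h]; exact contMDiff_const
    · rw [Finset.sum_eq_single I]
      · simp
      · intro J _ hJ
        simp [Pi.single_eq_of_ne hJ]
      · simp

lemma exists_normalForm_smoothEnv {F : G → P.L.Env} (hF : F ∈ P.smoothEnv) {k : G → K}
    (hk : ContMDiff (𝓡 p) 𝓘(ℝ, K) ∞ k) :
    (∀ φ : P.TestFun, Integrable (fun h => k h * φ.val (F h) h) ν) ∧
    ∃ l : Finset (Fin (Module.finrank K (P.L.gr 1))) → G → K,
      (∀ I, ContMDiff (𝓡 p) 𝓘(ℝ, K) ∞ (l I)) ∧ ∀ φ : P.TestFun, ∫ h, k h * φ.val (F h) h ∂ν =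
        ∑ I, ∫ h, l I h * φ.val (P.L.mono P.oddBasis I) h ∂ν := by
  induction hF using Submodule.span_induction with
  | mem F hF =>
    obtain ⟨c, hc, w, rfl⟩ := hF
    have hkc : ContMDiff (𝓡 p) 𝓘(ℝ, K) ∞ (k * c) :=
      contMDiffOn_univ.1 (contMDiffOn_mul hk.contMDiffOn hc.contMDiffOn)
    have e : ∀ (φ : P.TestFun) h, k h * φ.val (c h • w) h = (k * c) h * φ.val w h := fun φ h => by
      simp only [map_smul, Pi.smul_apply, smul_eq_mul, Pi.mul_apply, mul_assoc]
    simp only [e]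
    exact ⟨fun φ => φ.integrable_mul_val ν hkc.continuous w, P.exists_normalForm ν w hkc⟩
  | zero =>
    simp only [Pi.zero_apply, map_zero, mul_zero, integral_zero]
    exact ⟨fun φ => integrable_zero _ _ _, 0, fun I => contMDiff_const, fun φ => by simp⟩
  | add F F' _ _ h h' =>
    obtain ⟨hi, l, hl, h1⟩ := h
    obtain ⟨hi', m, hm, h2⟩ := h'
    simp only [Pi.add_apply, map_add, mul_add]
    refine ⟨fun φ => (hi φ).add (hi' φ), l + m, fun I => (hl I).add (hm I), fun φ => ?_⟩
    simp only [Pi.add_apply, add_mul]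
    rw [integral_add (hi φ) (hi' φ), h1, h2, ← Finset.sum_add_distrib]
    exact Finset.sum_congr rfl fun I _ => (integral_add
      (φ.integrable_mul_val ν (hl I).continuous _)
      (φ.integrable_mul_val ν (hm I).continuous _)).symm
  | smul a F _ h =>
    obtain ⟨hi, l, hl, h1⟩ := h
    simp only [Pi.smul_apply, map_smul, smul_eq_mul, mul_left_comm _ a]
    refine ⟨fun φ => (hi φ).const_mul a, fun I h => a * l I h, fun I => contMDiffOn_univ.1
      (contMDiffOn_mul contMDiffOn_const (hl I).contMDiffOn), fun φ => ?_⟩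
    simp only [integral_const_mul, h1, Finset.mul_sum, mul_assoc]

/-- The superdistribution `L_γ(|dg| Δ)` is given by smooth densities. -/
lemma exists_dualAct_haarDelta_eq (γ : P.L.Env) :
    ∃ l : Finset (Fin (Module.finrank K (P.L.gr 1))) → G → K,
      (∀ I, ContMDiff (𝓡 p) 𝓘(ℝ, K) ∞ (l I)) ∧ ∀ φ : P.TestFun, P.dualAct γ (P.haarDelta ν) φ =
        ∑ I, ∫ h, l I h * φ.val (P.L.mono P.oddBasis I) h ∂ν := by
  obtain ⟨-, l, hl, h⟩ := P.exists_normalForm_smoothEnv ν (P.AdEnv_mem_smoothEnv (P.L.parity γ))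
    P.contMDiff_DeltaOdd
  refine ⟨l, hl, fun φ => ?_⟩
  obtain ⟨S, h1, h2⟩ := P.exists_dualAct_eq γ φ
  rw [h2, haarDelta_apply, ← h]
  simp only [h1, mul_one]

/-- The value of `L_γ(|dg| Δ)` on superfunctions with vanishing lower order components. -/
lemma exists_dualAct_haarDelta_top : ∃ ε : ℤˣ, ∀ (γ : P.L.Env) (φ : P.TestFun),
    (∀ I, I ≠ Finset.univ → φ.val (P.L.mono P.oddBasis I) = 0) →
      P.dualAct γ (P.haarDelta ν) φ =
        ε • (P.L.top P.oddBasis γ * ∫ h, φ.val (P.L.mono P.oddBasis Finset.univ) h ∂ν) := by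
  -- The sign is the parity of the full odd product, which enters through the signs in the action on
  -- functionals.
  refine ⟨(-1) ^ (Finset.univ : Finset (Fin (Module.finrank K (P.L.gr 1)))).card, fun γ φ hφ => ?_⟩
  have hφ0 : ∀ u ∈ P.L.filt (Module.finrank K (P.L.gr 1)), φ.val u = 0 := fun u hu =>
    P.superFun_filt P.oddBasis φ.mem.1 (fun I hI => hφ I (by rintro rfl; simp at hI)) hu
  obtain ⟨c, hc⟩ := P.L.exists_sum_mono_sub_mem P.oddBasis γ
  have h1 := P.dualAct_haarDelta_of_mem ν hc
  rw [map_sub, LinearMap.sub_apply, sub_eq_zero] at h1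
  have h2 := P.L.top_mul_idealDelta P.oddBasis 1 hc
  rw [one_mul, map_sub, sub_eq_zero] at h2
  have hsm : ∀ (n : ℕ) (u : P.L.Env), φ.val (((-1 : ℤˣ) ^ n) • u) = ((-1 : ℤˣ) ^ n) • φ.val u :=
    fun n u => by rcases neg_one_pow_eq_or ℤˣ n with h | h <;> simp [h]
  have hsm' : ∀ (n : ℕ) (h : G) (u : P.L.Env), P.AdEnv h (((-1 : ℤˣ) ^ n) • u) =
      ((-1 : ℤˣ) ^ n) • P.AdEnv h u :=
    fun n g u => by rcases neg_one_pow_eq_or ℤˣ n with h | h <;> simp [h]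
  have h3 : ∀ I, P.dualAct (P.L.mono P.oddBasis I) (P.haarDelta ν) φ =
      if I = Finset.univ then (-1 : ℤˣ) ^ I.card •
        ∫ h, φ.val (P.L.mono P.oddBasis Finset.univ) h ∂ν else 0 := by
    intro I
    obtain ⟨S, hS1, hS2⟩ := P.exists_dualAct_eq (P.L.mono P.oddBasis I) φ
    rw [hS2, haarDelta_apply]
    simp only [hS1, mul_one, P.L.parity_mono, hsm, hsm']
    split_ifs with hI
    · subst hI
      -- Modulo lower order, where `φ` vanishes, `Ad(h⁻¹)` scales the full product by `Δ(h⁻¹)`; this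
      -- cancels the density `Δ(h)` and leaves the plain Haar integral.
      have e : ∀ h, φ.val (P.AdEnv h⁻¹ (P.L.mono P.oddBasis Finset.univ)) =
          P.DeltaOdd h⁻¹ • φ.val (P.L.mono P.oddBasis Finset.univ) := fun h => by
        have := hφ0 _ (P.L.envMap_mono_univ_sub_mem P.oddBasis (A := (P.Ad h⁻¹).toLinearMap)
          (hA := P.Ad_mem h⁻¹) (hb := P.Ad_bracket h⁻¹))
        rwa [map_sub, sub_eq_zero, map_smul] at this
      have e2 : ∀ h, P.DeltaOdd h * φ.val (P.AdEnv h⁻¹ (P.L.mono P.oddBasis Finset.univ)) h =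
          φ.val (P.L.mono P.oddBasis Finset.univ) h := fun h => by
        rw [e, Pi.smul_apply, smul_eq_mul, ← mul_assoc, mul_comm (P.DeltaOdd h), DeltaOdd_inv_mul,
          one_mul]
      rcases neg_one_pow_eq_or ℤˣ (Finset.univ : Finset (Fin (Module.finrank K (P.L.gr 1)))).card
        with hε | hε
      · simp only [hε, one_smul, e2]
      · simp only [hε, Units.neg_smul, one_smul, Pi.neg_apply, mul_neg, e2, integral_neg]
    · have hlt : I.card < Module.finrank K (P.L.gr 1) := by
        simpa using Finset.card_lt_card (Finset.ssubset_univ_iff.2 hI)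
      have e : ∀ h, φ.val (P.AdEnv h⁻¹ (P.L.mono P.oddBasis I)) = 0 := fun h =>
        hφ0 _ (P.L.envMap_mem_filt (P.L.mono_mem_filt P.oddBasis hlt))
      simp [e]
  rw [h1, h2]
  have e1 : P.dualAct (∑ I, c I • P.L.mono P.oddBasis I) (P.haarDelta ν) φ =
      ∑ I, c I * P.dualAct (P.L.mono P.oddBasis I) (P.haarDelta ν) φ := by
    rw [map_sum, LinearMap.sum_apply, LinearMap.sum_apply]
    exact Finset.sum_congr rfl fun I _ => by rw [map_smul]; rfl
  rw [e1]
  simp only [h3, map_sum, map_smul, P.L.top_mono]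
  simp [mul_smul_comm]

end SupergroupPair


/-! ### Bump functions and the fundamental lemma. -/

section TestFunctions

variable {K : Type*} [RCLike K] {p : ℕ}
  {G : Type*} [TopologicalSpace G] [ChartedSpace (EuclideanSpace ℝ (Fin p)) G]
  [IsManifold (𝓡 p) ∞ G] [T2Space G] [MeasurableSpace G] [BorelSpace G]
  (ν : Measure G) [ν.IsOpenPosMeasure] [IsFiniteMeasureOnCompacts ν]

/-- A bump function at `g`. -/
lemma exists_smooth_bump {U : Set G} (hU : IsOpen U) {g : G} (hg : g ∈ U) :
    ∃ b : G → ℝ, ContMDiff (𝓡 p) 𝓘(ℝ, ℝ) ∞ b ∧ (∀ h, 0 ≤ b h) ∧ b g = 1 ∧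
      ∃ C, IsCompact C ∧ C ⊆ U ∧ ∀ h ∉ C, b h = 0 := by
  obtain ⟨f, -, hf⟩ := (SmoothBumpFunction.nhds_basis_tsupport (I := 𝓡 p) g).mem_iff.1
    (hU.mem_nhds hg)
  exact ⟨f, f.contMDiff, fun _ => f.nonneg, f.eq_one, tsupport f, f.hasCompactSupport, hf,
    fun h hh => image_eq_zero_of_notMem_tsupport hh⟩

lemma contMDiff_ofReal {b : G → ℝ} (hb : ContMDiff (𝓡 p) 𝓘(ℝ, ℝ) ∞ b) :
    ContMDiff (𝓡 p) 𝓘(ℝ, K) ∞ fun g => (b g : K) :=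
  (RCLike.ofRealCLM (K := K)).contDiff.contMDiff.comp hb

/-- The fundamental lemma of the calculus of variations for continuous functions. -/
lemma eq_zero_of_integral_mul_eq_zero {U : Set G} (hU : IsOpen U) {f : G → K}
    (hf : ContinuousOn f U)
    (h : ∀ (b : G → ℝ) (C : Set G), ContMDiff (𝓡 p) 𝓘(ℝ, ℝ) ∞ b → IsCompact C → C ⊆ U →
      (∀ g ∉ C, b g = 0) → ∫ g, (b g : K) * f g ∂ν = 0) : ∀ g ∈ U, f g = 0 := by
  intro g hg
  by_contra hne
  -- Multiplying by the conjugate of `f g` makes the real part positive near `g`, so that a bump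
  -- function there contradicts the vanishing integral.
  let r : G → ℝ := fun h => RCLike.re (starRingEnd K (f g) * f h)
  have hr : ContinuousOn r U :=
    RCLike.continuous_re.comp_continuousOn (continuousOn_const.mul hf)
  have hrg : 0 < r g := by
    simp only [r, RCLike.conj_mul]
    have : 0 < ‖f g‖ ^ 2 := by positivity
    exact_mod_cast this
  have hV : IsOpen (U ∩ r ⁻¹' Set.Ioi 0) := hr.isOpen_inter_preimage hU isOpen_Ioi
  obtain ⟨b, hb, hb0, hb1, C, hC, hCV, hbC⟩ := exists_smooth_bump (p := p) hV ⟨hg, hrg⟩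
  have hCU : C ⊆ U := hCV.trans Set.inter_subset_left
  have h0 := h b C hb hC hCU hbC
  have hFc : Continuous fun g => (b g : K) * f g :=
    continuous_of_continuousOn_of_eq_zero hU hC.isClosed hCU
      ((RCLike.continuous_ofReal.comp hb.continuous).continuousOn.mul hf)
      fun g hg => by simp [hbC g hg]
  have hFi : Integrable (fun g => (b g : K) * f g) ν :=
    hFc.integrable_of_hasCompactSupport (HasCompactSupport.intro hC fun g hg => by simp [hbC g hg])
  have e : ∀ h, RCLike.re (starRingEnd K (f g) * ((b h : K) * f h)) = b h * r h := fun h => by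
    rw [mul_left_comm, RCLike.re_ofReal_mul]
  have hpos : 0 < ∫ h, b h * r h ∂ν := by
    refine Continuous.integral_pos_of_hasCompactSupport_nonneg_nonzero ?_
      (HasCompactSupport.intro hC fun g hg => by simp [hbC g hg]) (fun h => ?_) (x := g) ?_
    · simp only [← e]
      exact RCLike.continuous_re.comp (continuous_const.mul hFc)
    · by_cases hh : h ∈ C
      · exact mul_nonneg (hb0 h) (le_of_lt (hCV hh).2)
      · simp [hbC h hh]
    · rw [hb1, one_mul]
      exact hrg.ne'
  have e2 := integral_re (hFi.const_mul (starRingEnd K (f g)))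
  rw [integral_const_mul, h0, mul_zero, map_zero] at e2
  simp only [e] at e2
  exact hpos.ne' e2

end TestFunctions

/-! ### `L_γ(|dg| Δ)` is a nowhere vanishing Berezinian density. -/

namespace SupergroupPair

variable {K : Type*} [RCLike K] {p : ℕ}
  {G : Type*} [TopologicalSpace G] [ChartedSpace (EuclideanSpace ℝ (Fin p)) G] [Group G]
  {𝔤 : Type*} [AddCommGroup 𝔤] [Module K 𝔤] (P : SupergroupPair K p G 𝔤)
  [LieGroup (𝓡 p) ∞ G] [FiniteDimensional K 𝔤] [T2Space G]

/-- Superfunctions concentrated in the highest order component. -/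
lemma exists_topFun {b : G → K} (hb : ContMDiff (𝓡 p) 𝓘(ℝ, K) ∞ b) {C : Set G} (hC : IsCompact C)
    (h0 : ∀ g ∉ C, b g = 0) : ∃ φ : P.TestFun, φ.val (P.L.mono P.oddBasis Finset.univ) = b ∧
      (∀ I, I ≠ Finset.univ → φ.val (P.L.mono P.oddBasis I) = 0) ∧
      ∀ u, ∀ g ∉ C, φ.val u g = 0 := by
  obtain ⟨φ, h1, h2⟩ := P.exists_testFun P.oddBasis (Pi.single Finset.univ b) (fun I => by
    by_cases h : I = Finset.univ
    · subst h; simpa using hb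
    · rw [Pi.single_eq_of_ne h]; exact contMDiff_const) hC (fun I g hg => by
    by_cases h : I = Finset.univ
    · subst h; simpa using h0 g hg
    · rw [Pi.single_eq_of_ne h]; rfl)
  exact ⟨φ, by simp [h1], fun I hI => by rw [h1, Pi.single_eq_of_ne hI], h2⟩

variable [MeasurableSpace G] [BorelSpace G] (ν : Measure G) [ν.IsHaarMeasure]

/-- Functionals given by smooth densities are Berezinian densities. -/
lemma exists_represents {D : P.Functional}
    {l : Finset (Fin (Module.finrank K (P.L.gr 1))) → G → K}
    (hl : ∀ I, ContMDiff (𝓡 p) 𝓘(ℝ, K) ∞ (l I))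
    (hD : ∀ φ : P.TestFun, D φ = ∑ I, ∫ h, l I h * φ.val (P.L.mono P.oddBasis I) h ∂ν)
    {e : OpenPartialHomeomorph G (EuclideanSpace ℝ (Fin p))}
    (he : e ∈ IsManifold.maximalAtlas (𝓡 p) ∞ G) :
    ∃ f : P.superFun ⟨e.source, e.open_source⟩, P.Represents D (P.stdCoordinates e he) f ∧
      ∀ g ∈ e.source, l Finset.univ g ≠ 0 → f.1 1 g ≠ 0 := by
  obtain ⟨η, hη⟩ := P.exists_berezinIntegral_stdCoordinates
  obtain ⟨ε, hε⟩ := P.L.exists_conv_mono P.oddBasis Finset.univ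
  obtain ⟨ρ, hρ, hρ0, hν⟩ := exists_haar_density (K := K) ν he
  let U : TopologicalSpace.Opens G := ⟨e.source, e.open_source⟩
  have hsm : ∀ J, ContMDiffOn (𝓡 p) 𝓘(ℝ, K) ∞
      (fun g => (((η * ε J : ℤˣ) : ℤ) : K) * ((ρ g : K) * l Jᶜ g)) U := fun J =>
    contMDiffOn_mul contMDiffOn_const (contMDiffOn_mul
      ((RCLike.ofRealCLM (K := K)).contDiff.contMDiff.comp_contMDiffOn hρ) (hl _).contMDiffOn)
  -- The top component of `f φ` pairs `f(e_J)` with `φ(e_{Jᶜ})` up to the sign `ε J`, and `η` is the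
  -- sign in the Berezin integral. The components of `f` are therefore the complementary
  -- coefficients of `D` times the Haar density; in particular `f(1)` is `±` the density times
  -- `l_univ`.
  let a : Finset (Fin (Module.finrank K (P.L.gr 1))) → smoothFun K p U := fun J =>
    ⟨(U : Set G).indicator fun g => (((η * ε J : ℤˣ) : ℤ) : K) * ((ρ g : K) * l Jᶜ g),
      (hsm J).congr fun g hg => Set.indicator_of_mem hg _, fun g hg => Set.indicator_of_notMem hg _⟩
  have ha : ∀ J, ∀ g ∈ U, (a J).1 g = (((η * ε J : ℤˣ) : ℤ) : K) * ((ρ g : K) * l Jᶜ g) :=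
    fun J g hg => Set.indicator_of_mem (s := (U : Set G)) hg
      fun g => (((η * ε J : ℤˣ) : ℤ) : K) * ((ρ g : K) * l Jᶜ g)
  refine ⟨(P.superEquiv P.oddBasis U).symm a, fun φ h => ?_, fun g hg hne => ?_⟩
  · obtain ⟨C, hC, hCU, h0⟩ := id h
    have h1 := hν (fun g => ∑ I, l I g * φ.val (P.L.mono P.oddBasis I) g) C
      (continuous_finsetSum _ fun I _ => (hl I).continuous.mul (φ.contMDiff_val _).continuous)
        hC hCU fun g hg => by simp [h0 _ g hg]
    rw [integral_finsetSum _ fun I _ => φ.integrable_mul_val ν (hl I).continuous _] at h1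
    refine ((hD φ).trans h1).trans (Eq.trans ?_ (hη e he _).symm)
    refine setIntegral_congr_fun e.open_target.measurableSet fun t ht => ?_
    have hg : e.symm t ∈ U := e.map_target ht
    dsimp only
    rw [mul_apply, hε, Finset.powerset_univ, Finset.mul_sum, Finset.smul_sum]
    refine Fintype.sum_equiv (Function.Involutive.toPerm _ compl_involutive) _ _ fun I => ?_
    rw [← Finset.compl_eq_univ_sdiff, Function.Involutive.coe_toPerm, compl_compl, evalAt_apply, evalAt_apply,
      superEquiv_symm_mono, ha _ _ hg, compl_compl]
    rcases Int.units_eq_one_or η with h | h <;> rcases Int.units_eq_one_or (ε Iᶜ) with h' | h' <;>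
      simp [h, h', mul_assoc]
  · rw [← P.L.mono_empty P.oddBasis, superEquiv_symm_mono, ha _ _ hg, Finset.compl_empty]
    refine mul_ne_zero ?_ (mul_ne_zero (by exact_mod_cast hρ0 g hg) hne)
    rcases Int.units_eq_one_or (η * ε ∅) with h | h <;> simp [h]

variable {γ : P.L.Env} (hγ : P.L.idealDelta.mkQ γ ∈ P.L.invariants)
  (h0 : P.L.idealDelta.mkQ γ ≠ 0)

include hγ h0

/-- Only the top coefficient decides about vanishing. Comparing the two formulas on superfunctions
with only a top component identifies it with the constant `± top(γ)`, which is non-zero for a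
non-zero invariant class. -/
theorem isInvariantBerezinDensity_dualAct_haarDelta :
    P.IsInvariantBerezinDensity (P.dualAct γ (P.haarDelta ν)) := by
  obtain ⟨l, hl, h⟩ := P.exists_dualAct_haarDelta_eq ν γ
  obtain ⟨ε, hε⟩ := P.exists_dualAct_haarDelta_top ν
  have key : ∀ g ∈ Set.univ, l Finset.univ g - ((ε : ℤ) : K) * P.L.top P.oddBasis γ = 0 := by
    refine eq_zero_of_integral_mul_eq_zero (p := p) ν isOpen_univ
      ((hl _).continuous.sub continuous_const).continuousOn fun b C hb hC _ hbC => ?_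
    obtain ⟨φ, h1, h2, h3⟩ := P.exists_topFun (contMDiff_ofReal (K := K) hb) hC
      fun g hg => by simp [hbC g hg]
    have e1 := h φ
    rw [hε γ φ h2, Finset.sum_eq_single Finset.univ (fun I _ hI => by simp [h2 I hI]) (by simp)] at e1
    have hi1 := φ.integrable_mul_val ν (hl Finset.univ).continuous (P.L.mono P.oddBasis Finset.univ)
    have hi2 := φ.integrable_mul_val ν (continuous_const (y := ((ε : ℤ) : K) * P.L.top P.oddBasis γ))
      (P.L.mono P.oddBasis Finset.univ)
    have e2 : ∫ g, ((b g : K) * (l Finset.univ g - ((ε : ℤ) : K) * P.L.top P.oddBasis γ)) ∂ν =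
        (∫ g, l Finset.univ g * φ.val (P.L.mono P.oddBasis Finset.univ) g ∂ν) -
        ∫ g, (((ε : ℤ) : K) * P.L.top P.oddBasis γ) *
          φ.val (P.L.mono P.oddBasis Finset.univ) g ∂ν := by
      rw [← integral_sub hi1 hi2]
      refine integral_congr_ae (.of_forall fun g => ?_)
      dsimp only
      rw [h1]
      ring
    rw [e2, ← e1, integral_const_mul, Units.smul_def, zsmul_eq_mul, mul_assoc, sub_self]
  have hne : ∀ g, l Finset.univ g ≠ 0 := fun g => by
    rw [sub_eq_zero.1 (key g trivial)]
    refine mul_ne_zero ?_ (P.L.top_ne_zero_of_invariant P.oddBasis hγ h0)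
    rcases Int.units_eq_one_or ε with h | h <;> simp [h]
  have hV : P.IsNowhereVanishing (P.dualAct γ (P.haarDelta ν)) := fun g => by
    obtain ⟨f, hf, hf0⟩ := P.exists_represents ν hl h
      (IsManifold.chart_mem_maximalAtlas (I := 𝓡 p) (n := ∞) g)
    exact ⟨_, _, f, mem_chart_source _ g, hf, hf0 g (mem_chart_source _ g) (hne g)⟩
  refine ⟨fun g => ?_, hV, P.dualTranslate_dualAct_haarDelta ν hγ, P.dualLie_dualAct_haarDelta ν hγ⟩
  obtain ⟨U, c, f, hg, hf, -⟩ := hV g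
  exact ⟨U, c, f, hg, hf⟩

end SupergroupPair


/-! ### Functionals killed by `𝔤` are determined in top degree. -/

namespace LieSuperalgebra

variable {K 𝔤 : Type*} [Field K] [CharZero K] [AddCommGroup 𝔤] [Module K 𝔤]
  (L : LieSuperalgebra K 𝔤) {ι : Type*} [Fintype ι] [LinearOrder ι] (b : Module.Basis ι K (L.gr 1))

lemma odd_mul_mono_eq_oddProd (j : ι) (J : Finset ι) : L.ι (b j) * L.mono b J =
    L.oddProd ((j :: J.sort (· ≤ ·)).map b) := by
  rw [mono_eq_oddProd, List.map_cons, oddProd_cons]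

lemma odd_mul_mono_of_mem {j : ι} {J : Finset ι} (h : j ∈ J) :
    L.ι (b j) * L.mono b J ∈ L.filt (J.card + 1) := by
  rw [odd_mul_mono_eq_oddProd]
  have := L.oddProd_mem_of_duplicate (l := (j :: J.sort (· ≤ ·)).map b)
    (fun hn => by simpa [h] using hn.of_map)
  simpa using this

lemma exists_odd_mul_mono_of_notMem {j : ι} {J : Finset ι} (h : j ∉ J) : ∃ ε : ℤˣ,
    L.ι (b j) * L.mono b J - ε • L.mono b (insert j J) ∈ L.filt (J.card + 1) := by
  have hp : (j :: J.sort (· ≤ ·)).Perm ((insert j J).sort (· ≤ ·)) := by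
    refine (List.perm_ext_iff_of_nodup ?_ (Finset.sort_nodup _ _)).2 fun a => by simp
    simp [h]
  obtain ⟨ε, hε⟩ := L.oddProd_perm (hp.map b)
  rw [odd_mul_mono_eq_oddProd, mono_eq_oddProd]
  exact ⟨ε, by simpa using hε⟩

end LieSuperalgebra

namespace SupergroupPair

variable {K : Type*} [RCLike K] {p : ℕ}
  {G : Type*} [TopologicalSpace G] [ChartedSpace (EuclideanSpace ℝ (Fin p)) G] [Group G]
  {𝔤 : Type*} [AddCommGroup 𝔤] [Module K 𝔤] (P : SupergroupPair K p G 𝔤)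
  [LieGroup (𝓡 p) ∞ G] [FiniteDimensional K 𝔤]

lemma eq_sum_oddCoord {x : 𝔤} (hx : x ∈ P.L.gr 1) :
    x = ∑ j, P.oddCoord j x • (P.oddBasis j : 𝔤) := by
  have h := congrArg Subtype.val (P.oddBasis.sum_repr ⟨x, hx⟩)
  rw [Submodule.coe_sum] at h
  refine h.symm.trans (Finset.sum_congr rfl fun j _ => ?_)
  rw [Submodule.coe_smul, P.oddCoord_of_mem j hx]
  rfl

/-- The matrices of `Ad(h⁻¹)` and `Ad(h)` are inverse to each other. -/
lemma sum_oddCoord_Ad_inv (h : G) (i j : Fin (Module.finrank K (P.L.gr 1))) :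
    ∑ k, P.oddCoord j (P.Ad h⁻¹ (P.oddBasis k)) * P.oddCoord k (P.Ad h (P.oddBasis i)) =
      if j = i then 1 else 0 := by
  have h1 := P.eq_sum_oddCoord (P.Ad_mem h 1 _ (P.oddBasis i).2)
  have h2 := congrArg (fun x => P.oddCoord j (P.Ad h⁻¹ x)) h1
  simp only [Ad_inv_Ad, map_sum, map_smul, smul_eq_mul] at h2
  rw [P.oddCoord_of_mem j (P.oddBasis i).2] at h2
  simp only [mul_comm (P.oddCoord j _)]
  rw [← h2]
  simp [Finsupp.single_apply, eq_comm]

/-- The value of a superfunction with a single non-zero component on a product of odd basis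
vectors. -/
lemma exists_superFun_odd_mul_mono (j : Fin (Module.finrank K (P.L.gr 1)))
    (J T : Finset (Fin (Module.finrank K (P.L.gr 1)))) (hT : J.card + 1 ≤ T.card) : ∃ c : K,
      (c ≠ 0 ↔ j ∉ J ∧ insert j J = T) ∧
      ∀ {U : TopologicalSpace.Opens G} {φ : P.L.Env →ₗ[K] (G → K)}, φ ∈ P.superFun U →
        (∀ I, I ≠ T → φ (P.L.mono P.oddBasis I) = 0) →
        φ (P.L.ι (P.oddBasis j) * P.L.mono P.oddBasis J) = c • φ (P.L.mono P.oddBasis T) := by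
  have hf : ∀ {U : TopologicalSpace.Opens G} {φ : P.L.Env →ₗ[K] (G → K)}, φ ∈ P.superFun U →
      (∀ I, I ≠ T → φ (P.L.mono P.oddBasis I) = 0) → ∀ u ∈ P.L.filt (J.card + 1), φ u = 0 :=
    fun hφ h u hu => P.superFun_filt P.oddBasis hφ
      (fun I hI => h I (by rintro rfl; omega)) hu
  by_cases hj : j ∈ J
  · refine ⟨0, by simp [hj], fun hφ h => ?_⟩
    rw [zero_smul, hf hφ h _ (P.L.odd_mul_mono_of_mem P.oddBasis hj)]
  · obtain ⟨ε, hε⟩ := P.L.exists_odd_mul_mono_of_notMem P.oddBasis hj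
    have e : ∀ {U : TopologicalSpace.Opens G} {φ : P.L.Env →ₗ[K] (G → K)}, φ ∈ P.superFun U →
      (∀ I, I ≠ T → φ (P.L.mono P.oddBasis I) = 0) →
        φ (P.L.ι (P.oddBasis j) * P.L.mono P.oddBasis J) =
          ε • φ (P.L.mono P.oddBasis (insert j J)) := fun {U φ} hφ h => by
      have := hf hφ h _ hε
      rw [map_sub, sub_eq_zero] at this
      rw [this]
      rcases Int.units_eq_one_or ε with rfl | rfl <;> simp
    by_cases hJ : insert j J = T
    · refine ⟨((ε : ℤ) : K), ?_, fun hφ h => ?_⟩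
      · simp only [hj, hJ, not_false_eq_true, and_self, iff_true]
        rcases Int.units_eq_one_or ε with rfl | rfl <;> simp
      · rw [e hφ h, hJ]
        rcases Int.units_eq_one_or ε with rfl | rfl <;> simp
    · refine ⟨0, by simp [hJ], fun hφ h => ?_⟩
      rw [e hφ h, h _ hJ, smul_zero, zero_smul]

lemma signedLie_oddBasis (i : Fin (Module.finrank K (P.L.gr 1))) (φ : P.TestFun) (u : P.L.Env)
    (h : G) : (P.signedLie (P.oddBasis i : 𝔤) φ).val u h =
      -∑ j, P.oddCoord j (P.Ad h⁻¹ (P.oddBasis i)) * φ.val (P.L.ι (P.oddBasis j) * u) h := by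
  rw [signedLie_apply, P.L.evenPart_odd (P.oddBasis i).2, P.L.oddPart_odd (P.oddBasis i).2, zero_sub,
    map_neg, map_neg, neg_mul, map_neg, Pi.neg_apply]
  conv_lhs => rw [P.eq_sum_oddCoord (P.Ad_mem h⁻¹ 1 _ (P.oddBasis i).2)]
  simp only [map_sum, map_smul, Finset.sum_mul, smul_mul_assoc, Finset.sum_apply, Pi.smul_apply,
    smul_eq_mul]

variable [T2Space G]

/-- Superfunctions with a single non-zero component below the top degree are, up to components of
higher order, infinitesimal translates. -/
lemma exists_sum_signedLie (I : Finset (Fin (Module.finrank K (P.L.gr 1)))) (hI : I ≠ Finset.univ)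
    {a : G → K} (ha : ContMDiff (𝓡 p) 𝓘(ℝ, K) ∞ a) {C : Set G} (hC : IsCompact C)
    (h0 : ∀ g ∉ C, a g = 0) :
    ∃ ψ : Fin (Module.finrank K (P.L.gr 1)) → P.TestFun, ∀ J, J.card ≤ I.card →
      (∑ i, P.signedLie (P.oddBasis i : 𝔤) (ψ i)).val (P.L.mono P.oddBasis J) =
        if J = I then a else 0 := by
  obtain ⟨i₀, hi₀⟩ : ∃ i, i ∉ I := by
    by_contra! h
    exact hI (Finset.eq_univ_iff_forall.2 h)
  let T := insert i₀ I
  have hTc : T.card = I.card + 1 := Finset.card_insert_of_notMem hi₀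
  obtain ⟨d, hd, -⟩ := P.exists_superFun_odd_mul_mono i₀ I T hTc.ge
  have hd0 : d ≠ 0 := hd.2 ⟨hi₀, rfl⟩
  have key : ∃ c : K, c ≠ 0 ∧ ∃ ψ : Fin (Module.finrank K (P.L.gr 1)) → P.TestFun,
      ∀ J, J.card ≤ I.card →
      (∑ i, P.signedLie (P.oddBasis i : 𝔤) (ψ i)).val (P.L.mono P.oddBasis J) =
        if J = I then c • a else 0 := by
    -- The factor `a` is placed one degree higher, at `T`, and weighted by matrix coefficients of
    -- `Ad(h)`. Summing the translates by all `e_i` then undoes the `Ad(h⁻¹)` in the left action and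
    -- leaves the single letter `e_{i₀}`.
    have hψ : ∀ i, ∃ ψ : P.TestFun, ∀ J, ψ.val (P.L.mono P.oddBasis J) =
        if J = T then (fun h => P.oddCoord i (P.Ad h (P.oddBasis i₀)) * a h) else 0 := by
      intro i
      obtain ⟨ψ, hψ, -⟩ := P.exists_testFun P.oddBasis (fun J =>
        if J = T then (fun h => P.oddCoord i (P.Ad h (P.oddBasis i₀)) * a h) else 0)
        (fun J => by
          split_ifs
          · exact contMDiffOn_univ.1 (contMDiffOn_mul (P.Ad_smooth _ _).contMDiffOn ha.contMDiffOn)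
          · exact contMDiff_const) hC (fun J g hg => by
          split_ifs
          · simp [h0 g hg]
          · rfl)
      exact ⟨ψ, hψ⟩
    choose ψ hψ using hψ
    have hval : ∀ (J : Finset (Fin (Module.finrank K (P.L.gr 1)))), J.card ≤ I.card → ∀ j,
        ∃ c : K, (c ≠ 0 ↔ j ∉ J ∧ insert j J = T) ∧ ∀ i h,
          (ψ i).val (P.L.ι (P.oddBasis j) * P.L.mono P.oddBasis J) h =
            c * (P.oddCoord i (P.Ad h (P.oddBasis i₀)) * a h) := by
      intro J hJ j
      obtain ⟨c, hc, h⟩ := P.exists_superFun_odd_mul_mono j J T (by omega)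
      refine ⟨c, hc, fun i g => ?_⟩
      rw [h (ψ i).mem.1 fun I' hI' => by rw [hψ, if_neg hI'], hψ, if_pos rfl]
      rfl
    choose! c hc hcv using hval
    refine ⟨-c I i₀, neg_ne_zero.2 ((hc I le_rfl i₀).2 ⟨hi₀, rfl⟩), ψ, fun J hJ => ?_⟩
    funext h
    have e1 : (∑ i, P.signedLie (P.oddBasis i : 𝔤) (ψ i)).val (P.L.mono P.oddBasis J) h =
        ∑ i, (P.signedLie (P.oddBasis i : 𝔤) (ψ i)).val (P.L.mono P.oddBasis J) h := by
      let ev : P.TestFun →ₗ[K] K :=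
        { toFun := fun φ => φ.val (P.L.mono P.oddBasis J) h
          map_add' := fun _ _ => rfl
          map_smul' := fun _ _ => rfl }
      exact map_sum ev _ _
    rw [e1]
    simp only [signedLie_oddBasis, hcv J hJ, Finset.sum_neg_distrib]
    rw [Finset.sum_comm]
    have e2 : ∀ j, ∑ i, P.oddCoord j (P.Ad h⁻¹ (P.oddBasis i)) *
        (c J j * (P.oddCoord i (P.Ad h (P.oddBasis i₀)) * a h)) =
        if j = i₀ then c J j * a h else 0 := by
      intro j
      have := P.sum_oddCoord_Ad_inv h i₀ j
      rw [show (if j = i₀ then c J j * a h else 0) = c J j * a h * (if j = i₀ then 1 else 0) by simp,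
        ← this, Finset.mul_sum]
      exact Finset.sum_congr rfl fun i _ => by ring
    simp only [e2, Finset.sum_ite_eq', Finset.mem_univ, if_true]
    by_cases hJI : J = I
    · subst hJI
      simp
    · rw [if_neg hJI]
      have : c J i₀ = 0 := by
        by_contra hne
        obtain ⟨h1, h2⟩ := (hc J hJ i₀).1 hne
        refine hJI ?_
        rw [← Finset.erase_insert h1, h2, Finset.erase_insert hi₀]
      simp [this]
  obtain ⟨c, hc, ψ, hψ⟩ := key
  refine ⟨fun i => c⁻¹ • ψ i, fun J hJ => ?_⟩
  have e : ∑ i, P.signedLie (P.oddBasis i : 𝔤) (c⁻¹ • ψ i) =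
      c⁻¹ • ∑ i, P.signedLie (P.oddBasis i : 𝔤) (ψ i) := by
    simp only [map_smul, Finset.smul_sum]
  have e2 : (c⁻¹ • ∑ i, P.signedLie (P.oddBasis i : 𝔤) (ψ i)).val (P.L.mono P.oddBasis J) =
      c⁻¹ • (∑ i, P.signedLie (P.oddBasis i : 𝔤) (ψ i)).val (P.L.mono P.oddBasis J) := rfl
  rw [e, e2, hψ J hJ]
  split_ifs
  · rw [smul_smul, inv_mul_cancel₀ hc, one_smul]
  · rw [smul_zero]

/-- A functional which is annihilated by `𝔤` is determined by its values on superfunctions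
concentrated in the highest order component. -/
theorem eq_zero_of_dualLie_eq_zero {D : P.Functional} (hD : ∀ x, P.dualLie x D = 0)
    (h : ∀ φ : P.TestFun, (∀ I, I ≠ Finset.univ → φ.val (P.L.mono P.oddBasis I) = 0) → D φ = 0) :
    D = 0 := by
  -- Induction on the codegree: `φ` is assumed to vanish in degrees below `q - k`, and the case `k =
  -- q` is no condition.
  have key : ∀ k : ℕ, ∀ φ : P.TestFun, (∀ I : Finset (Fin (Module.finrank K (P.L.gr 1))),
      I.card + k < Module.finrank K (P.L.gr 1) → φ.val (P.L.mono P.oddBasis I) = 0) → D φ = 0 := by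
    intro k
    induction k with
    | zero =>
      intro φ hφ
      refine h φ fun I hI => hφ I ?_
      simpa using Finset.card_lt_card (Finset.ssubset_univ_iff.2 hI)
    | succ k ih =>
      intro φ hφ
      obtain ⟨C, hC, h0⟩ := φ.exists_isCompact
      have hψ := fun (I : Finset (Fin (Module.finrank K (P.L.gr 1)))) (hI : I ≠ Finset.univ) =>
        P.exists_sum_signedLie I hI (φ.contMDiff_val (P.L.mono P.oddBasis I)) hC (h0 _)
      choose! ψ hψ using hψ
      let s : Finset (Finset (Fin (Module.finrank K (P.L.gr 1)))) :=
        Finset.univ.filter fun I => I.card + (k + 1) = Module.finrank K (P.L.gr 1)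
      have hs : ∀ I ∈ s, I ≠ Finset.univ := by
        rintro _ hI rfl
        simp [s] at hI
      -- A sum of infinitesimal translates, killed by `D`, which reproduces the lowest components of
      -- `φ`; subtracting it raises the order of vanishing by one.
      let χ : P.TestFun := ∑ I ∈ s, ∑ i, P.signedLie (P.oddBasis i : 𝔤) (ψ I i)
      have hχ : D χ = 0 := by
        simp only [χ, map_sum, ← dualLie_apply, hD]
        simp
      have hval : ∀ J : Finset (Fin (Module.finrank K (P.L.gr 1))),
          J.card + k < Module.finrank K (P.L.gr 1) →
          χ.val (P.L.mono P.oddBasis J) = φ.val (P.L.mono P.oddBasis J) := by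
        intro J hJ
        have e1 : χ.val (P.L.mono P.oddBasis J) = ∑ I ∈ s,
            (∑ i, P.signedLie (P.oddBasis i : 𝔤) (ψ I i)).val (P.L.mono P.oddBasis J) := by
          let ev : P.TestFun →ₗ[K] (G → K) :=
            { toFun := fun φ => φ.val (P.L.mono P.oddBasis J)
              map_add' := fun _ _ => rfl
              map_smul' := fun _ _ => rfl }
          exact map_sum ev _ _
        rw [e1, Finset.sum_congr rfl fun I hI => hψ I (hs I hI) J
          (by have := (Finset.mem_filter.1 hI).2; omega)]
        simp only [Finset.sum_ite_eq]
        split_ifs with hJs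
        · rfl
        · refine (hφ J ?_).symm
          simp only [s, Finset.mem_filter, Finset.mem_univ, true_and] at hJs
          omega
      have hsub := ih (φ - χ) fun I hI => by
        have : (φ - χ).val (P.L.mono P.oddBasis I) =
          φ.val (P.L.mono P.oddBasis I) - χ.val (P.L.mono P.oddBasis I) := rfl
        rw [this, hval I hI, sub_self]
      rw [map_sub, hχ, sub_zero] at hsub
      exact hsub
  exact LinearMap.ext fun φ : P.TestFun => key (Module.finrank K (P.L.gr 1)) φ fun I hI => by omega

end SupergroupPair


/-! ### The Berezin integral of top components in arbitrary coordinates. -/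

namespace LieSuperalgebra

variable {K 𝔤 : Type*} [Field K] [CharZero K] [AddCommGroup 𝔤] [Module K 𝔤]
  (L : LieSuperalgebra K 𝔤)

lemma conv_ι_odd (f h : L.Env →ₗ[K] K) (x : L.gr 1) :
    L.conv f h (L.ι x) = f (L.ι x) * h 1 + f 1 * h (L.ι x) := by
  have := L.conv_odd_mul f h x 1
  simpa [conv_one] using this

variable {q : ℕ} (b : Module.Basis (Fin q) K (L.gr 1))

/-- The product of all functionals `x_i` vanishing in order zero is nonzero on the top component if
the matrix of the values of `x_i` on basis vectors is invertible. -/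
lemma convProd_mono_univ_ne_zero {x : Fin q → L.Env →ₗ[K] K} (hx : ∀ i, x i 1 = 0)
    (hx1 : ∀ i, ∀ u ∈ L.filt 1, x i u = 0)
    (hM : IsUnit (Matrix.of fun i j => x i (L.ι (b j))).det) :
    L.convProd x Finset.univ (L.mono b Finset.univ) ≠ 0 := by
  set M : Matrix (Fin q) (Fin q) K := Matrix.of fun i j => x i (L.ι (b j)) with hMdef
  have hN : IsUnit (M⁻¹).det := Matrix.isUnit_nonsing_inv_det M hM
  -- In the basis changed by the inverse matrix the functionals are dual in degree one. The two full
  -- products differ by a determinant modulo lower order, which does not contribute.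
  let b' : Module.Basis (Fin q) K (L.gr 1) := b.map (Matrix.toLinearEquiv b M⁻¹ hN)
  have hb' : ∀ j, b' j = ∑ k, M⁻¹ k j • b k := fun j => by
    rw [Module.Basis.map_apply]
    exact Matrix.toLin_self b b _ j
  obtain ⟨ε, hε⟩ := L.exists_convProd_mono b' False Finset.univ
  have h1 := hε x (fun i J hJ => by
    simp only [or_false] at hJ
    rcases Nat.lt_or_ge J.card 1 with h | h
    · obtain rfl : J = ∅ := by simpa using h
      rw [mono_empty, hx, if_neg (Finset.singleton_ne_empty i).symm]
    · obtain ⟨j, rfl⟩ := Finset.card_eq_one.1 (le_antisymm hJ h)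
      have hm : L.mono b' {j} = L.ι (b' j) := by
        have := L.mono_insert b' (i := j) (I := ∅) (by simp)
        simpa using this
      have h2 : x i (L.ι (b' j)) = (M * M⁻¹) i j := by
        rw [hb', Matrix.mul_apply, Submodule.coe_sum, map_sum, map_sum]
        refine Finset.sum_congr rfl fun k _ => ?_
        rw [Submodule.coe_smul, map_smul, map_smul, smul_eq_mul, mul_comm]
        rfl
      rw [hm, h2, Matrix.mul_nonsing_inv M hM, Matrix.one_apply]
      simp [eq_comm]) Finset.univ (Or.inl le_rfl)
  rw [if_pos rfl] at h1
  have h3 := L.convProd_filt hx1 Finset.univ _ (by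
    rw [Finset.card_univ, Fintype.card_fin]
    exact L.oddProd_sub_det_mem b b')
  rw [← mono_univ, map_sub, map_smul, h1, sub_eq_zero] at h3
  intro h0
  rw [h0, smul_zero] at h3
  rcases Int.units_eq_one_or ε with rfl | rfl <;> simp at h3

end LieSuperalgebra

namespace SupergroupPair

variable {K : Type*} [RCLike K] {p : ℕ}
  {G : Type*} [TopologicalSpace G] [ChartedSpace (EuclideanSpace ℝ (Fin p)) G] [Group G]
  {𝔤 : Type*} [AddCommGroup 𝔤] [Module K 𝔤] {P : SupergroupPair K p G 𝔤}
  [LieGroup (𝓡 p) ∞ G] [FiniteDimensional K 𝔤] {U : TopologicalSpace.Opens G}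

namespace Coordinates

lemma ξ_one (c : P.Coordinates U) (i : Fin (Module.finrank K (P.L.gr 1))) : (c.ξ i).1 1 = 0 := by
  have h := c.ξ_odd i 1
  rw [map_one] at h
  exact self_eq_neg.1 h

lemma ξ_filt (c : P.Coordinates U) (i : Fin (Module.finrank K (P.L.gr 1))) {u : P.L.Env}
    (hu : u ∈ P.L.filt 1) : (c.ξ i).1 u = 0 :=
  P.superFun_filt P.oddBasis (c.ξ i).2 (fun I hI => by
    obtain rfl : I = ∅ := by simpa using hI
    rw [P.L.mono_empty, ξ_one]) hu

lemma pull_odd (c : P.Coordinates U) (f : smoothFun K p U) (x : P.L.gr 1) :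
    (c.pull f).1 (P.L.ι x) = 0 := by
  have h := c.pull_even f (P.L.ι x)
  rw [P.L.parity_odd x.2, map_neg] at h
  exact self_eq_neg.1 h.symm

/-- The Jacobian of the odd coordinates. -/
def theta (c : P.Coordinates U) : G → K :=
  P.monomial U c.ξ Finset.univ (P.L.mono P.oddBasis Finset.univ)

/-- In degree one only `I = {i}` contributes: even pullbacks vanish on odd elements, and products of
two or more `ξ` vanish to second order. -/
lemma mul_monomial_ι (c : P.Coordinates U) (f : smoothFun K p U)
    (I : Finset (Fin (Module.finrank K (P.L.gr 1)))) (x : P.L.gr 1) {g : G} (hg : g ∈ U) :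
    P.mul (c.pull f).1 (P.monomial U c.ξ I) (P.L.ι x) g =
      ∑ i, if I = {i} then f.1 g * (c.ξ i).1 (P.L.ι x) g else 0 := by
  have hpx : P.evalAt g (c.pull f).1 (P.L.ι x) = 0 := by
    rw [evalAt_apply, c.pull_odd]
    rfl
  have hp1 : P.evalAt g (c.pull f).1 1 = f.1 g := by rw [evalAt_apply, c.pull_body]
  have hξ1 : ∀ i, P.evalAt g (c.ξ i).1 1 = 0 := fun i => by rw [evalAt_apply, c.ξ_one]; rfl
  rw [mul_apply, evalAt_monomial P _ _ hg]
  rcases Nat.lt_trichotomy I.card 1 with h | h | h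
  · obtain rfl : I = ∅ := by simpa using h
    rw [P.L.convProd_empty, P.L.conv_ι_odd, hpx, AlgHom.toLinearMap_apply, AlgHom.toLinearMap_apply,
      P.L.counit_ι]
    simp [(Finset.singleton_ne_empty _).symm]
  · obtain ⟨i, rfl⟩ := Finset.card_eq_one.1 h
    have e := P.L.convProd_insert (fun i => P.evalAt g (c.ξ i).1) (i := i) (I := ∅) (by simp)
    rw [insert_empty_eq, P.L.convProd_empty] at e
    rw [e, P.L.conv_ι_odd, hpx, hp1, P.L.conv_ι_odd]
    simp only [AlgHom.toLinearMap_apply, map_one, P.L.counit_ι, mul_zero, mul_one, add_zero,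
      zero_mul, zero_add, evalAt_apply, Finset.singleton_inj, Finset.sum_ite_eq, Finset.mem_univ,
      if_true]
  · rw [P.L.conv_filt (m := 0) (n := I.card) (fun u hu => by
        rw [P.L.filt_zero, Submodule.mem_bot] at hu
        rw [hu, map_zero])
      (P.L.convProd_filt (fun i u hu => by
        rw [evalAt_apply, c.ξ_filt i hu]
        rfl) I) (by
        rw [zero_add]
        exact P.L.filt_mono h (P.L.ι_odd_mem_filt x))]
    rw [Finset.sum_eq_zero]
    intro i _
    rw [if_neg]
    rintro rfl
    simp at h

/-- Expanding the standard odd coordinates in terms of the `ξ_i` yields, in degree one, a left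
inverse of the matrix of values `ξ_i(e_j)`. -/
lemma theta_ne_zero (c : P.Coordinates U) {g : G} (hg : g ∈ U) : c.theta g ≠ 0 := by
  rw [theta, ← evalAt_apply, evalAt_monomial P _ _ hg]
  refine P.L.convProd_mono_univ_ne_zero P.oddBasis (fun i => ?_) (fun i u hu => ?_) ?_
  · rw [evalAt_apply, c.ξ_one]
    rfl
  · rw [evalAt_apply, c.ξ_filt i hu]
    rfl
  · let A : Matrix (Fin (Module.finrank K (P.L.gr 1))) (Fin (Module.finrank K (P.L.gr 1))) K :=
      Matrix.of fun k i => ((c.expand (P.singleFun U {k} (unitFun U))).choose {i}).1 g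
    refine Matrix.isUnit_det_of_left_inverse (B := A) ?_
    ext k j
    have h1 := (c.expand (P.singleFun U {k} (unitFun U))).choose_spec.1
    dsimp only at h1
    have h2 := congrFun (DFunLike.congr_fun h1 (P.L.ι (P.oddBasis j))) g
    have hm : P.L.mono P.oddBasis {j} = P.L.ι (P.oddBasis j) := by
      have := P.L.mono_insert P.oddBasis (i := j) (I := ∅) (by simp)
      simpa using this
    rw [LinearMap.sum_apply, Finset.sum_apply] at h2
    simp only [c.mul_monomial_ι _ _ _ hg] at h2
    rw [Finset.sum_comm] at h2
    simp only [Finset.sum_ite_eq', Finset.mem_univ, if_true] at h2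
    rw [← hm, P.singleFun_mono] at h2
    rw [Matrix.mul_apply, Matrix.one_apply]
    simp only [A, Matrix.of_apply, evalAt_apply]
    rw [← hm, ← h2]
    by_cases hkj : k = j
    · subst hkj
      rw [if_pos rfl, if_pos rfl, unitFun_apply hg]
    · rw [if_neg hkj, if_neg fun h => hkj (Finset.singleton_injective h).symm]
      rfl

lemma contMDiffOn_theta (c : P.Coordinates U) : ContMDiffOn (𝓡 p) 𝓘(ℝ, K) ∞ c.theta U :=
  ((P.monomial_mem c.ξ Finset.univ).1 _).1

lemma mul_filt {f φ : P.L.Env →ₗ[K] (G → K)} {n : ℕ} {u : P.L.Env}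
    (hφ : ∀ u ∈ P.L.filt n, φ u = 0) (hu : u ∈ P.L.filt n) : P.mul f φ u = 0 := by
  funext g
  rw [mul_apply]
  refine P.L.conv_filt (m := 0) (n := n) (fun u hu => ?_) (fun u hu => ?_) (by rwa [zero_add])
  · rw [P.L.filt_zero, Submodule.mem_bot] at hu
    rw [hu, map_zero]
  · rw [evalAt_apply, hφ u hu]
    rfl

/-- The Berezin integral of `f φ` for `φ` concentrated in the highest order component. -/
lemma berezinIntegral_mul (c : P.Coordinates U) (f φ : P.superFun U)
    (hφ : ∀ I, I ≠ Finset.univ → φ.1 (P.L.mono P.oddBasis I) = 0) :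
    c.berezinIntegral ⟨P.mul f.1 φ.1, P.mul_mem f.2 φ.2⟩ = ∫ t in c.chart.target,
      f.1 1 (c.chart.symm t) * (c.theta (c.chart.symm t))⁻¹ *
        φ.1 (P.L.mono P.oddBasis Finset.univ) (c.chart.symm t) := by
  have hφ0 : ∀ u ∈ P.L.filt (Module.finrank K (P.L.gr 1)), φ.1 u = 0 := fun u hu =>
    P.superFun_filt P.oddBasis φ.2 (fun I hI => hφ I (by rintro rfl; simp at hI)) hu
  have hξ0 : ∀ u ∈ P.L.filt (Module.finrank K (P.L.gr 1)), P.monomial U c.ξ Finset.univ u = 0 := by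
    intro u hu
    funext g
    by_cases hg : g ∈ U
    · rw [← evalAt_apply, evalAt_monomial P _ _ hg]
      refine P.L.convProd_filt (fun i u hu => ?_) Finset.univ u (by simpa using hu)
      rw [evalAt_apply, c.ξ_filt i hu]
      rfl
    · exact ((P.monomial_mem c.ξ Finset.univ).1 _).2 g hg
  have hmono : ∀ I : Finset (Fin (Module.finrank K (P.L.gr 1))), I ≠ Finset.univ →
      P.L.mono P.oddBasis I ∈ P.L.filt (Module.finrank K (P.L.gr 1)) := fun I hI =>
    P.L.mono_mem_filt _ (by simpa using Finset.card_lt_card (Finset.ssubset_univ_iff.2 hI))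
  have hsm : ContMDiffOn (𝓡 p) 𝓘(ℝ, K) ∞ (f.1 1 * (fun g => (c.theta g)⁻¹) *
      φ.1 (P.L.mono P.oddBasis Finset.univ)) U := by
    refine contMDiffOn_mul (contMDiffOn_mul (f.2.1 1).1 fun g hg => ?_) (φ.2.1 _).1
    exact ContMDiffAt.comp_contMDiffWithinAt g
      (contDiffAt_inv ℝ (c.theta_ne_zero hg)).contMDiffAt (c.contMDiffOn_theta g hg)
  -- Dividing by `theta` converts the value on the full odd product into the coefficient of `ξ_1 ⋯
  -- ξ_q`.
  let a₀ : smoothFun K p U := ⟨_, hsm, fun g hg => by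
    rw [Pi.mul_apply, (φ.2.1 _).2 g hg, mul_zero]⟩
  let a : Finset (Fin (Module.finrank K (P.L.gr 1))) → smoothFun K p U := Pi.single Finset.univ a₀
  obtain ⟨ε, hε⟩ := P.L.exists_conv_mono P.oddBasis Finset.univ
  have hone : ∀ (f h : P.L.Env →ₗ[K] (G → K)) (g : G),
      (∀ u ∈ P.L.filt (Module.finrank K (P.L.gr 1)), h u = 0) →
      P.mul f h (P.L.mono P.oddBasis Finset.univ) g =
        ε ∅ • (f 1 g * h (P.L.mono P.oddBasis Finset.univ) g) := by
    intro f h g hh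
    rw [mul_apply, hε, Finset.sum_eq_single ∅]
    · rw [P.L.mono_empty, Finset.sdiff_empty]
      rfl
    · intro J _ hJ
      have hne : Finset.univ \ J ≠ Finset.univ := by
        rwa [← Finset.compl_eq_univ_sdiff, Ne, Finset.compl_eq_univ_iff]
      rw [P.evalAt_apply g h, hh _ (hmono _ hne), Pi.zero_apply, mul_zero, smul_zero]
    · simp
  -- Both sides have only a top component, computed with the same sign `ε ∅`. Uniqueness of the
  -- expansion then identifies the coefficient integrated by the Berezin integral.
  have hexp : P.mul f.1 φ.1 = ∑ I, P.mul (c.pull (a I)).1 (P.monomial U c.ξ I) := by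
    have hz : ∀ ψ, P.mul 0 ψ = 0 := fun ψ => by simp [mul]
    rw [Finset.sum_eq_single Finset.univ (fun I _ hI => by simp [a, Pi.single_eq_of_ne hI, hz])
      (by simp)]
    refine P.superFun_ext P.oddBasis (P.mul_mem f.2 φ.2)
      (P.mul_mem (Subtype.prop _) (P.monomial_mem _ _)) fun J => ?_
    by_cases hJ : J = Finset.univ
    · subst hJ
      funext g
      rw [hone _ _ _ hφ0, hone _ _ _ hξ0, c.pull_body]
      congr 1
      by_cases hg : g ∈ U
      · have h1 := c.theta_ne_zero hg
        change _ = (a Finset.univ).1 g * c.theta g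
        simp only [a, Pi.single_eq_same]
        change _ = f.1 1 g * (c.theta g)⁻¹ * φ.1 (P.L.mono P.oddBasis Finset.univ) g * c.theta g
        field_simp
      · rw [(φ.2.1 _).2 g hg, (a _).2.2 g hg, mul_zero, zero_mul]
    · rw [mul_filt hφ0 (hmono J hJ), mul_filt hξ0 (hmono J hJ)]
  have huniq := (c.expand ⟨P.mul f.1 φ.1, P.mul_mem f.2 φ.2⟩).unique
    (c.expand ⟨P.mul f.1 φ.1, P.mul_mem f.2 φ.2⟩).choose_spec.1 hexp
  rw [berezinIntegral, huniq]
  simp only [a, Pi.single_eq_same]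
  rfl

end Coordinates

end SupergroupPair


/-! ### The top density of an invariant Berezinian density. -/

namespace SupergroupPair

variable {K : Type*} [RCLike K] {p : ℕ}
  {G : Type*} [TopologicalSpace G] [ChartedSpace (EuclideanSpace ℝ (Fin p)) G] [Group G]
  {𝔤 : Type*} [AddCommGroup 𝔤] [Module K 𝔤] (P : SupergroupPair K p G 𝔤)
  [LieGroup (𝓡 p) ∞ G] [FiniteDimensional K 𝔤]

/-- Superfunctions concentrated in the highest order component. -/
def topFuns : Submodule K P.TestFun where
  carrier := {φ | ∀ I, I ≠ Finset.univ → φ.val (P.L.mono P.oddBasis I) = 0}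
  add_mem' := fun {φ ψ} hφ hψ I hI => by
    have : (φ + ψ).val (P.L.mono P.oddBasis I) = φ.val (P.L.mono P.oddBasis I) +
      ψ.val (P.L.mono P.oddBasis I) := rfl
    rw [this, hφ I hI, hψ I hI, add_zero]
  zero_mem' := fun _ _ => rfl
  smul_mem' := fun c φ hφ I hI => by
    have : (c • φ).val (P.L.mono P.oddBasis I) = c • φ.val (P.L.mono P.oddBasis I) := rfl
    rw [this, hφ I hI, smul_zero]

/-- The highest order component of a superfunction. -/
def topPart : P.TestFun →ₗ[K] (G → K) where
  toFun φ := φ.val (P.L.mono P.oddBasis Finset.univ)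
  map_add' _ _ := rfl
  map_smul' _ _ := rfl

variable {P}

lemma topPart_apply (φ : P.TestFun) : P.topPart φ = φ.val (P.L.mono P.oddBasis Finset.univ) := rfl

lemma eq_of_topPart_eq {φ ψ : P.TestFun} (hφ : φ ∈ P.topFuns) (hψ : ψ ∈ P.topFuns)
    (h : P.topPart φ = P.topPart ψ) : φ = ψ := by
  refine Subtype.ext (P.superFun_ext P.oddBasis φ.mem.1 ψ.mem.1 fun I => ?_)
  by_cases hI : I = Finset.univ
  · subst hI
    exact h
  · exact (hφ I hI).trans (hψ I hI).symm

lemma val_eq_zero_of_topPart [T2Space G] {φ : P.TestFun} (hφ : φ ∈ P.topFuns) {C : Set G}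
    (hC : IsClosed C) (h : ∀ g ∉ C, P.topPart φ g = 0) (u : P.L.Env) : ∀ g ∉ C, φ.val u g = 0 := by
  refine P.superFun_eq_zero_of_notMem P.oddBasis φ.mem.1 hC (fun I g hg => ?_) u
  by_cases hI : I = Finset.univ
  · subst hI
    exact h g hg
  · rw [hφ I hI]
    rfl

variable (P)

variable [T2Space G]

lemma exists_topFuns {b : G → K} (hb : ContMDiff (𝓡 p) 𝓘(ℝ, K) ∞ b) {C : Set G} (hC : IsCompact C)
    (h0 : ∀ g ∉ C, b g = 0) : ∃ φ ∈ P.topFuns, P.topPart φ = b := by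
  obtain ⟨φ, h1, h2, -⟩ := P.exists_topFun hb hC h0
  exact ⟨φ, h2, h1⟩

lemma translate_mem_topFuns (a : G) {φ : P.TestFun} (hφ : φ ∈ P.topFuns) :
    P.translate a φ ∈ P.topFuns := fun I hI => by
  funext h
  rw [translate_apply, hφ I hI]
  rfl

variable [MeasurableSpace G] [BorelSpace G] (ν : Measure G) [ν.IsHaarMeasure]

/-- The functional `D` on superfunctions concentrated in the highest order component, with support
in `U`, is given by the density `κ`. -/
def HasTopDensity (D : P.Functional) (U : Set G) (κ : G → K) : Prop :=
  ∀ φ ∈ P.topFuns, ∀ C, IsCompact C → C ⊆ U → (∀ g ∉ C, P.topPart φ g = 0) →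
    D φ = ∫ g, P.topPart φ g * κ g ∂ν

variable {P ν}

/-- The density is the value `f(1)` divided by the odd Jacobian `theta` and by the density of Haar
measure, both without zeros on the chart. -/
lemma exists_hasTopDensity {D : P.Functional} (hD : P.IsNowhereVanishing D) (g : G) :
    ∃ (U : Set G) (κ : G → K), IsOpen U ∧ g ∈ U ∧ ContinuousOn κ U ∧ κ g ≠ 0 ∧
      P.HasTopDensity ν D U κ := by
  obtain ⟨U, c, f, hg, hf, hne⟩ := hD g
  obtain ⟨ρ, hρ, hρ0, hν⟩ := exists_haar_density (K := K) ν c.chart_mem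
  rw [c.chart_source] at hρ hρ0 hν
  have hκ : ContinuousOn (fun h => f.1 1 h * (c.theta h)⁻¹ * (ρ h : K)⁻¹) U :=
    ((f.2.1 1).1.continuousOn.mul (c.contMDiffOn_theta.continuousOn.inv₀
      fun h hh => c.theta_ne_zero hh)).mul
      ((RCLike.continuous_ofReal.comp_continuousOn hρ.continuousOn).inv₀
        fun h hh => RCLike.ofReal_ne_zero.2 (hρ0 h hh))
  refine ⟨U, fun h => f.1 1 h * (c.theta h)⁻¹ * (ρ h : K)⁻¹, U.isOpen, hg, hκ, ?_, ?_⟩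
  · exact mul_ne_zero (mul_ne_zero hne (inv_ne_zero (c.theta_ne_zero hg)))
      (inv_ne_zero (by exact_mod_cast hρ0 g hg))
  · intro φ hφ C hC hCU h0
    have hs : P.SuppIn φ.val U := ⟨C, hC, hCU, val_eq_zero_of_topPart hφ hC.isClosed h0⟩
    have hcont : Continuous fun h => P.topPart φ h * (f.1 1 h * (c.theta h)⁻¹ * (ρ h : K)⁻¹) :=
      continuous_of_continuousOn_of_eq_zero U.isOpen hC.isClosed hCU
        ((φ.contMDiff_val _).continuous.continuousOn.mul hκ) fun h hh => mul_eq_zero_of_left (h0 h hh) _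
    rw [hf φ hs, c.berezinIntegral_mul f ⟨φ.val, P.mem_superFun_of_suppIn φ hs⟩ hφ, hν _ C hcont hC hCU fun h hh => by
      rw [h0 h hh, zero_mul]]
    refine setIntegral_congr_fun c.chart.open_target.measurableSet fun t ht => ?_
    have hρt : (ρ (c.chart.symm t) : K) ≠ 0 := by
      exact_mod_cast hρ0 _ (c.chart_source ▸ c.chart.map_target ht)
    simp only [topPart_apply]
    field_simp

lemma HasTopDensity.translate {D : P.Functional} {U : Set G} {κ : G → K}
    (h : P.HasTopDensity ν D U κ) (a : G) (hD : P.dualTranslate a D = D) :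
    P.HasTopDensity ν D ((fun g => a⁻¹ * g) ⁻¹' U) fun g => κ (a⁻¹ * g) := by
  have hG : IsTopologicalGroup G := topologicalGroup_of_lieGroup (𝓡 p) ∞
  intro φ hφ C hC hCU h0
  have h1 : D φ = D (P.translate a⁻¹ φ) := by
    conv_lhs => rw [← hD]
    rfl
  rw [h1, h _ (P.translate_mem_topFuns a⁻¹ hφ) ((fun g => a⁻¹ * g) '' C)
    (hC.image (continuous_const_mul a⁻¹)) (by rintro _ ⟨g, hg, rfl⟩; exact hCU hg) (fun g hg => ?_),
    ← integral_mul_left_eq_self (fun g => P.topPart φ g * κ (a⁻¹ * g)) a]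
  · simp only [topPart_apply, translate_apply, inv_inv, inv_mul_cancel_left]
  · rw [topPart_apply, translate_apply, inv_inv]
    exact h0 _ fun hC => hg ⟨_, hC, by simp⟩

/-- Arbitrary bump functions occur as top components, so two continuous densities agree where their
domains overlap. -/
lemma HasTopDensity.eq {D : P.Functional} {U V : Set G} {κ κ' : G → K}
    (h : P.HasTopDensity ν D U κ) (h' : P.HasTopDensity ν D V κ') (hU : IsOpen U) (hV : IsOpen V)
    (hκ : ContinuousOn κ U) (hκ' : ContinuousOn κ' V) {g : G} (hgU : g ∈ U) (hgV : g ∈ V) :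
    κ g = κ' g := by
  refine sub_eq_zero.1 (eq_zero_of_integral_mul_eq_zero (p := p) ν (hU.inter hV)
    ((hκ.mono Set.inter_subset_left).sub (hκ'.mono Set.inter_subset_right))
    (fun b C hb hC hCU hb0 => ?_) g ⟨hgU, hgV⟩)
  obtain ⟨φ, hφ, hφb⟩ := P.exists_topFuns (contMDiff_ofReal (K := K) hb) hC
    fun g hg => by simp [hb0 g hg]
  have h0 : ∀ g ∉ C, P.topPart φ g = 0 := fun g hg => by rw [hφb]; simp [hb0 g hg]
  have hi : ∀ {W : Set G} {κ : G → K}, IsOpen W → ContinuousOn κ W → C ⊆ W →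
      Integrable (fun g => P.topPart φ g * κ g) ν := fun hW hκ hCW =>
    (continuous_of_continuousOn_of_eq_zero hW hC.isClosed hCW
      ((φ.contMDiff_val _).continuous.continuousOn.mul hκ)
      fun h hh => mul_eq_zero_of_left (h0 h hh) _).integrable_of_hasCompactSupport
      (HasCompactSupport.intro hC fun g hg => mul_eq_zero_of_left (h0 g hg) _)
  have hCU' := hCU.trans Set.inter_subset_left
  have hCV' := hCU.trans Set.inter_subset_right
  have e : ∀ g, (b g : K) * (κ g - κ' g) = P.topPart φ g * κ g - P.topPart φ g * κ' g := fun g => by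
    rw [hφb, mul_sub]
  refine (integral_congr_ae (.of_forall e)).trans ?_
  rw [integral_sub (hi hU hκ hCU') (hi hV hκ' hCV'), ← h φ hφ C hC hCU' h0,
    ← h' φ hφ C hC hCV' h0, sub_self]

/-- An invariant Berezinian density is given by a multiple of the Haar measure in the highest order
component. -/
theorem exists_topDensity_const [SigmaCompactSpace G] {D : P.Functional}
    (hD : P.IsNowhereVanishing D) (hinv : ∀ a, P.dualTranslate a D = D) :
    ∃ c : K, c ≠ 0 ∧ ∀ φ ∈ P.topFuns, D φ = c * ∫ g, P.topPart φ g ∂ν := by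
  have hG : IsTopologicalGroup G := topologicalGroup_of_lieGroup (𝓡 p) ∞
  obtain ⟨U, κ, hU, h1U, hκ, hκ1, h⟩ := exists_hasTopDensity (ν := ν) hD 1
  have hpre : ∀ a : G, IsOpen ((fun g => a⁻¹ * g) ⁻¹' U) := fun a =>
    hU.preimage (continuous_const_mul a⁻¹)
  -- Translation by `g` turns `κ` into another density of the same functional near `g`, whose value
  -- at `g` is `κ 1`.
  have hconst : ∀ g ∈ U, κ g = κ 1 := fun g hg => by
    have := h.eq (h.translate g (hinv g)) hU (hpre g) hκ
      (hκ.comp (continuous_const_mul g⁻¹).continuousOn fun _ h => h) hg (by simpa using h1U)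
    rwa [inv_mul_cancel] at this
  have hloc : ∀ a : G, ∀ φ ∈ P.topFuns, ∀ C, IsCompact C → C ⊆ (fun g => a⁻¹ * g) ⁻¹' U →
      (∀ g ∉ C, P.topPart φ g = 0) → D φ = κ 1 * ∫ g, P.topPart φ g ∂ν := by
    intro a φ hφ C hC hCU h0
    rw [h.translate a (hinv a) φ hφ C hC hCU h0, ← integral_const_mul]
    refine integral_congr_ae (.of_forall fun g => ?_)
    dsimp only
    by_cases hg : g ∈ C
    · rw [hconst _ (hCU hg), mul_comm]
    · rw [h0 g hg, zero_mul, mul_zero]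
  refine ⟨κ 1, hκ1, fun φ hφ => ?_⟩
  obtain ⟨C, hC, h0⟩ := φ.exists_isCompact
  -- The translates of `U` cover `G` and all carry the same constant density, so a partition of
  -- unity globalizes the formula.
  obtain ⟨f, hf⟩ := SmoothPartitionOfUnity.exists_isSubordinate (𝓡 p) hC.isClosed
    (fun a : G => (fun g => a⁻¹ * g) ⁻¹' U) hpre fun g _ => Set.mem_iUnion.2 ⟨g, by simpa using h1U⟩
  have hfin := f.locallyFinite.finite_nonempty_inter_compact hC
  have hpart : ∀ a, ∃ ψ ∈ P.topFuns, P.topPart ψ = (fun g => (f a g : K)) * P.topPart φ := fun a =>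
    P.exists_topFuns (contMDiffOn_univ.1 (contMDiffOn_mul
      (contMDiff_ofReal (K := K) (f a).contMDiff).contMDiffOn (φ.contMDiff_val _).contMDiffOn)) hC
      fun g hg => by rw [Pi.mul_apply, topPart_apply, h0 _ g hg, mul_zero]
  choose ψ hψ hψp using hpart
  have hsum : φ = ∑ a ∈ hfin.toFinset, ψ a := by
    refine eq_of_topPart_eq hφ (sum_mem fun a _ => hψ a) ?_
    rw [map_sum]
    funext g
    simp only [Finset.sum_apply, hψp, Pi.mul_apply, ← Finset.sum_mul]
    by_cases hg : g ∈ C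
    · have h1 := f.sum_eq_one hg
      rw [finsum_eq_sum_of_support_subset (s := hfin.toFinset) _ fun a ha => by
        simpa using ⟨g, ha, hg⟩] at h1
      rw [← RCLike.ofReal_sum, h1, RCLike.ofReal_one, one_mul]
    · rw [topPart_apply, h0 _ g hg, mul_zero]
  have hDψ : ∀ a, D (ψ a) = κ 1 * ∫ g, P.topPart (ψ a) g ∂ν := fun a => by
    refine hloc a (ψ a) (hψ a) (C ∩ tsupport (f a)) (hC.inter_right (isClosed_tsupport _))
      (Set.inter_subset_right.trans (hf a)) fun g hg => ?_
    rw [hψp, Pi.mul_apply]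
    by_cases hgC : g ∈ C
    · rw [image_eq_zero_of_notMem_tsupport fun h => hg ⟨hgC, h⟩, RCLike.ofReal_zero, zero_mul]
    · rw [topPart_apply, h0 _ g hgC, mul_zero]
  have hi : ∀ a, Integrable (P.topPart (ψ a)) ν := fun a => by
    have := (ψ a).integrable_mul_val ν (continuous_const (y := (1 : K)))
      (P.L.mono P.oddBasis Finset.univ)
    simp only [one_mul] at this
    exact this
  rw [hsum, map_sum, map_sum]
  simp only [hDψ, Finset.sum_apply]
  rw [integral_finsetSum _ fun a _ => hi a, Finset.mul_sum]

end SupergroupPair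

end

/-! ### Conclusion. -/

theorem mainTheorem5 {K : Type*} [RCLike K] {p : ℕ}
    {G : Type*} [TopologicalSpace G] [ChartedSpace (EuclideanSpace ℝ (Fin p)) G] [Group G]
    [LieGroup (𝓡 p) ∞ G] [T2Space G] [SigmaCompactSpace G] [MeasurableSpace G] [BorelSpace G]
    {𝔤 : Type*} [AddCommGroup 𝔤] [Module K 𝔤] [FiniteDimensional K 𝔤]
    (P : SupergroupPair K p G 𝔤) :
    Module.finrank K P.L.invariants = 1 ∧
    ∀ γ : P.L.Env,
      P.L.idealDelta.mkQ γ ∈ P.L.invariants → P.L.idealDelta.mkQ γ ≠ 0 →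
      ∀ (ν : Measure G) [ν.IsHaarMeasure],
        P.IsInvariantBerezinDensity (P.dualAct γ (P.haarDelta ν)) ∧
        ∀ D : P.Functional, P.IsInvariantBerezinDensity D →
          ∃ c : K, c ≠ 0 ∧ c • D = P.dualAct γ (P.haarDelta ν) := by
  refine ⟨P.L.finrank_invariants P.oddBasis, fun γ hγ h0 ν _ =>
    ⟨P.isInvariantBerezinDensity_dualAct_haarDelta ν hγ h0, fun D hD => ?_⟩⟩
  obtain ⟨c, hc, hDc⟩ := SupergroupPair.exists_topDensity_const (ν := ν) hD.isNowhereVanishing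
    hD.translate_eq
  obtain ⟨ε, hε⟩ := P.exists_dualAct_haarDelta_top ν
  have hε0 : ((ε : ℤ) : K) ≠ 0 := by
    rcases Int.units_eq_one_or ε with h | h <;> simp [h]
  -- The quotient of the constants by which the two functionals multiply the Haar integral of the
  -- top component.
  refine ⟨((ε : ℤ) : K) * P.L.top P.oddBasis γ * c⁻¹, mul_ne_zero (mul_ne_zero hε0
    (P.L.top_ne_zero_of_invariant P.oddBasis hγ h0)) (inv_ne_zero hc), sub_eq_zero.1 ?_⟩
  -- The difference is killed by `𝔤` and vanishes in top degree by the choice of the constant.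
  refine P.eq_zero_of_dualLie_eq_zero (fun x => ?_) fun φ hφ => ?_
  · rw [map_sub, map_smul, hD.lie_eq_zero, P.dualLie_dualAct_haarDelta ν hγ, smul_zero, sub_zero]
  · have h1 := hDc φ hφ
    rw [LinearMap.sub_apply, LinearMap.smul_apply, hε γ φ hφ, h1, smul_eq_mul, Units.smul_def,
      zsmul_eq_mul, sub_eq_zero]
    simp only [SupergroupPair.topPart_apply]
    field_simp
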